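/- Work over $\mathbb{C}$ in the complex analytic category. Let $T$ be a complex superspace (possibly non-reduced, with odd functions) and let $\pi\colon X\to T$ be a family of super Riemann surfaces with $2r$ Ramond punctures: $\pi$ is smooth and proper of relative dimension $(1|1)$ with connected fibres; $R\subset X$ (the Ramond divisor) is an unramified relative effective Cartier divisor (locally $R=\{z=0\}$ for the even member $z$ of a system of relative coordinates) with components $R_1,\dots,R_{2r}$, each meeting every fibre in one point; and $\mathcal{D}\subset\mathcal{T}_{X/T}$ is a subbundle of rank $0|1$ such that the supercommutator induces an isomorphism $\mathcal{D}\otimes\mathcal{D}\cong(\mathcal{T}_{X/T}/\mathcal{D})(-R)$. Superconformal coordinates are local relative coordinates $(z,\theta)$ such that $R=\{z=0\}$ and $\mathcal{D}$ is generated by $\partial_\theta+z\theta\,\partial_z$; then $x=\theta|_R$ is called a superconformal coordinate on $R$ and $dx\in\Omega^1_{R/T}$ a superconformal differential. Let $\mathcal{Z}^1_{R/T}$ be the sheaf of relative closed one-forms on $R$, write $\pi$ also for $\pi|_R$, and let $\Lambda_1\subset\pi_*\mathcal{Z}^1_{R/T}$ be the subsheaf of abelian groups consisting of the sections that are, locally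 on $R$, integral combinations of superconformal differentials. Then: 1. $\pi_*\mathcal{Z}^1_{R/T}$ is a vector bundle of rank $0|2r$ on $T$. 2. $\Lambda_1$ is a local system of free abelian groups of rank $0|2r$ on $T$, and the natural map $\Lambda_1\otimes_{\mathbb{Z}}\mathcal{O}_T\to\pi_*\mathcal{Z}^1_{R/T}$ is an isomorphism. 3. There is a unique bilinear pairing $J_1\colon\Lambda_1\times\Lambda_1\to\mathbb{Z}$ such that, for sections which near the point of $R_i$ over $t$ are $a_i\,dx^i$ and $b_i\,dx^i$ with $x^i$ a superconformal coordinate on $R_i$ and $a_i,b_i\in\mathbb{Z}$ $(i=1,\dots,2r)$, its value at $t$ is $\sum_i a_ib_i$. It is symmetric and non-degenerate; locally on $T$ it is isometric to the constant sheaf $\mathbb{Z}^{2r}$ with its standard form. It extends uniquely to an $\mathcal{O}_T$-bilinear pairing $J_1\otimes\mathcal{O}_T$ on $\pi_*\mathcal{Z}^1_{R/T}$, with $(\lambda a,\mu b)\mapsto J_1(\lambda,\mu)\,ab$ for $\lambda,\mu\in\Lambda_1$ and $a,b\in\mathcal{O}_T$, and this pairing is symmetric (in the graded sense, a form $\lambda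 a$ counting with the parity of $a$). 4. Suppose that the Ramond divisor is oriented, that is, a class of superconformal coordinates covering $R$ is given any two of which differ, locally, by translation by an odd function on $T$. Then $\Lambda_1$ is isomorphic to the constant sheaf with fibre $V=\mathbb{Z}^{0|2r}$, with $J_1$ corresponding to the standard form $\sum_i a_ib_i$; the $i$-th basis vector corresponds to the section which is $dx$ along $R_i$ for the coordinates $x$ of the orientation, and $0$ along $R_j$ for $j\neq i$. -/

import Mathlib

noncomputable section

open TopologicalSpace Topology
open scoped TensorProduct

namespace SuperGeom

/-- The sign `(-1)^(i j)` of the sign rule. -/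
def sgn (i j : ZMod 2) : ℂ := if i = 1 ∧ j = 1 then -1 else 1

theorem zmod_cases (a : ZMod 2) : a = 0 ∨ a = 1 := by
  revert a; decide

/-! ### Superspaces and their morphisms -/

/-- A topological space with a sheaf `Γ` of supercommutative `ℂ`-superalgebras;
`part U 0` and `part U 1` are the even and the odd sections over `U`. -/
structure SuperSpace where
  space : Type
  [top : TopologicalSpace space]
  Γ : Opens space → Type
  [ring : ∀ U, Ring (Γ U)]
  [algebra : ∀ U, Algebra ℂ (Γ U)]
  res : ∀ {U V : Opens space}, V ≤ U → (Γ U →ₐ[ℂ] Γ V)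
  res_self : ∀ {U : Opens space} (h : U ≤ U) (a : Γ U), res h a = a
  res_res : ∀ {U V W : Opens space} (h : V ≤ U) (h' : W ≤ V) (a : Γ U),
    res h' (res h a) = res (h'.trans h) a
  existsUnique_gluing : ∀ {ι : Type} (U : ι → Opens space) (V : Opens space)
    (hU : ∀ i, U i ≤ V), (∀ x ∈ V, ∃ i, x ∈ U i) → ∀ s : ∀ i, Γ (U i),
    (∀ i j, res (inf_le_left : U i ⊓ U j ≤ U i) (s i) =
      res (inf_le_right : U i ⊓ U j ≤ U j) (s j)) →
    ∃! a : Γ V, ∀ i, res (hU i) a = s i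
  part : ∀ U : Opens space, ZMod 2 → Submodule ℂ (Γ U)
  isCompl : ∀ U, IsCompl (part U 0) (part U 1)
  one_mem : ∀ U, (1 : Γ U) ∈ part U 0
  mul_mem : ∀ {U i j} {a b : Γ U}, a ∈ part U i → b ∈ part U j → a * b ∈ part U (i + j)
  super_comm : ∀ {U i j} {a b : Γ U}, a ∈ part U i → b ∈ part U j → a * b = sgn i j • (b * a)
  res_mem : ∀ {U V : Opens space} (h : V ≤ U) {i} {a : Γ U}, a ∈ part U i → res h a ∈ part V i

attribute [instance] SuperSpace.top SuperSpace.ring SuperSpace.algebra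

/-- A morphism of superspaces over `ℂ`. -/
structure Hom (X Y : SuperSpace) where
  base : C(X.space, Y.space)
  pull : ∀ V : Opens Y.space, Y.Γ V →ₐ[ℂ] X.Γ (Opens.comap base V)
  pull_mem : ∀ {V i} {a : Y.Γ V}, a ∈ Y.part V i → pull V a ∈ X.part _ i
  pull_res : ∀ {V V' : Opens Y.space} (h : V' ≤ V) (a : Y.Γ V),
    pull V' (Y.res h a) = X.res (Opens.comap_mono base h) (pull V a)

/-- Composition of morphisms: first `f`, then `g`. -/
def Hom.comp {X Y Z : SuperSpace} (g : Hom Y Z) (f : Hom X Y) : Hom X Z where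
  base := g.base.comp f.base
  pull V := (X.res (U := Opens.comap f.base (Opens.comap g.base V))
    (V := Opens.comap (g.base.comp f.base) V) (fun _ h => h)).comp
    ((f.pull (Opens.comap g.base V)).comp (g.pull V))
  pull_mem h := X.res_mem _ (f.pull_mem (g.pull_mem h))
  pull_res h a := by
    simp only [AlgHom.comp_apply, g.pull_res h a,
      f.pull_res (Opens.comap_mono g.base h) (g.pull _ a)]
    exact (X.res_res _ _ _).trans (X.res_res _ _ _).symm

/-! ### Holomorphic functions, charts, complex superspaces -/

section Hol

variable {E : Type} [NormedAddCommGroup E] [NormedSpace ℂ E]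

/-- The algebra of holomorphic functions on an open set. -/
def Hol (W : Opens E) : Subalgebra ℂ (W → ℂ) where
  carrier := {f | ∃ F : E → ℂ, DifferentiableOn ℂ F W ∧ ∀ x : W, f x = F x}
  mul_mem' := by
    rintro f g ⟨F, hF, hf⟩ ⟨G, hG, hg⟩
    exact ⟨fun x => F x * G x, hF.mul hG, fun x => by simp [hf, hg]⟩
  add_mem' := by
    rintro f g ⟨F, hF, hf⟩ ⟨G, hG, hg⟩
    exact ⟨fun x => F x + G x, hF.add hG, fun x => by simp [hf, hg]⟩
  algebraMap_mem' := fun c => ⟨fun _ => c, differentiableOn_const c, fun _ => rfl⟩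

/-- Restriction of holomorphic functions. -/
def Hol.res {W W' : Opens E} (h : W' ≤ W) (f : Hol W) : Hol W' :=
  ⟨fun x => f.1 ⟨x.1, h x.2⟩, by
    obtain ⟨F, hF, hf⟩ := f.2
    exact ⟨F, hF.mono h, fun x => hf _⟩⟩

/-- A holomorphic function on `W`, seen as a function on an open set of `E × ℂ` lying over `W`. -/
def Hol.ofFst {W : Opens E} {W' : Opens (E × ℂ)} (h : ∀ p ∈ W', p.1 ∈ W) (f : Hol W) : Hol W' :=
  ⟨fun p => f.1 ⟨p.1.1, h _ p.2⟩, by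
    obtain ⟨F, hF, hf⟩ := f.2
    exact ⟨fun p => F p.1, hF.comp differentiableOn_fst h, fun x => hf _⟩⟩

/-- The last coordinate on `E × ℂ`. -/
def Hol.snd : Hol (⊤ : Opens (E × ℂ)) :=
  ⟨fun p => p.1.2, fun p => p.2, differentiableOn_snd, fun _ => rfl⟩

/-- Even coordinates on `U ⊆ X` with values in `E`: a morphism from `U` to the complex
manifold `E`, given by a continuous map `fn` and the pullback `ev` of holomorphic functions. -/
structure HolCoord (X : SuperSpace) (E : Type) [NormedAddCommGroup E] [NormedSpace ℂ E]
    (U : Opens X.space) where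
  fn : X.space → E
  continuousOn : ContinuousOn fn U
  ev : ∀ {U' : Opens X.space} (_ : U' ≤ U) {W : Opens E} (_ : Set.MapsTo fn U' W),
    Hol W →ₐ[ℂ] X.Γ U'
  ev_even : ∀ {U' : Opens X.space} (h : U' ≤ U) {W : Opens E} (hW : Set.MapsTo fn U' W)
    (f : Hol W), ev h hW f ∈ X.part U' 0
  ev_res : ∀ {U' U'' : Opens X.space} (h : U' ≤ U) (h' : U'' ≤ U') {W W' : Opens E}
    (hW : Set.MapsTo fn U' W) (hW' : Set.MapsTo fn U'' W') (i : W' ≤ W) (f : Hol W),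
    ev (h'.trans h) hW' (Hol.res i f) = X.res h' (ev h hW f)

/-- The section `∑_I f_I η^I`, where `η^I` is the product of the `η k`, `k ∈ I`, in increasing
order: the pullback of the superfunction with coefficients `f_I` under the morphism to
`E × ℂ^{0|n}` with even coordinates `C` and odd coordinates `η`. -/
def HolCoord.expand {X : SuperSpace} {U : Opens X.space} (C : HolCoord X E U) {n : ℕ}
    (η : Fin n → X.Γ U) {U' : Opens X.space} (h : U' ≤ U) {W : Opens E}
    (hW : Set.MapsTo C.fn U' W) (f : Finset (Fin n) → Hol W) : X.Γ U' :=
  ∑ I : Finset (Fin n), C.ev h hW (f I) * ((I.sort (· ≤ ·)).map fun k => X.res h (η k)).prod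

end Hol

/-- A chart of `T`: an isomorphism of the open subspace `source` with a closed subspace of the
superdomain `target × ℂ^{0|n}`, `target ⊆ ℂ^m`, that is defined by a locally finitely generated
ideal sheaf. (The ideal is finitely generated if and only if it is so as a module over the
holomorphic functions, and it is treated as such a module here.) -/
structure SuperChart (T : SuperSpace) (m n : ℕ) where
  source : Opens T.space
  coord : HolCoord T (Fin m → ℂ) source
  odd : Fin n → T.Γ source
  odd_mem : ∀ k, odd k ∈ T.part source 1
  target : Opens (Fin m → ℂ)
  mapsTo : ∀ x : source, coord.fn x ∈ target
  isClosedEmbedding : IsClosedEmbedding fun x : source => (⟨coord.fn x, mapsTo x⟩ : target)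
  /-- The pullback of superfunctions is surjective on stalks. -/
  generates : ∀ (U : Opens T.space) (h : U ≤ source) (s : T.Γ U), ∀ x ∈ U,
    ∃ (U' : Opens T.space) (h' : U' ≤ U) (W : Opens (Fin m → ℂ))
      (hW : Set.MapsTo coord.fn U' W) (f : Finset (Fin n) → Hol W),
      x ∈ U' ∧ T.res h' s = coord.expand odd (h'.trans h) hW f
  /-- The kernel is locally finitely generated. -/
  kernel_fg : ∀ x ∈ source, ∃ (W₀ : Opens (Fin m → ℂ)) (k : ℕ)
    (g : Fin k → Finset (Fin n) → Hol W₀), coord.fn x ∈ W₀ ∧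
    (∀ (l : Fin k) (U : Opens T.space) (h : U ≤ source) (hW : Set.MapsTo coord.fn U W₀),
      coord.expand odd h hW (g l) = 0) ∧
    ∀ (W : Opens (Fin m → ℂ)) (i : W ≤ W₀) (f : Finset (Fin n) → Hol W)
      (U : Opens T.space) (h : U ≤ source) (hW : Set.MapsTo coord.fn U W),
      coord.expand odd h hW f = 0 → ∀ y ∈ U,
      ∃ (W' : Opens (Fin m → ℂ)) (i' : W' ≤ W) (a : Fin k → Hol W'), coord.fn y ∈ W' ∧
        ∀ I, Hol.res i' (f I) = ∑ l, a l * Hol.res (i'.trans i) (g l I)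

/-- Complex superspaces: nowhere vanishing structure sheaf, charts at every point. -/
structure SuperSpace.IsComplex (T : SuperSpace) : Prop where
  nontrivial : ∀ U : Opens T.space, (U : Set T.space).Nonempty → Nontrivial (T.Γ U)
  exists_chart : ∀ t : T.space, ∃ (m n : ℕ) (c : SuperChart T m n), t ∈ c.source

/-- A relative chart of `π : X ⟶ T` of relative dimension `(1|1)`: an isomorphism over `T` of the
open subspace `source` with an open subspace of `T × ℂ^{1|1}`. Over the chart `base` of `T`, with
coordinates in `E = ℂ^m` and odd coordinates `η`, the coordinates on `source` are those of the
base together with an even one, the second component of `coord`, and an odd one, `θ`; the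
relations among the superfunctions of these coordinates are generated by those of the base. -/
structure RelChart {X T : SuperSpace} (π : Hom X T) where
  m : ℕ
  n : ℕ
  base : SuperChart T m n
  source : Opens X.space
  source_le : source ≤ Opens.comap π.base base.source
  coord : HolCoord X ((Fin m → ℂ) × ℂ) source
  θ : X.Γ source
  θ_odd : θ ∈ X.part source 1
  fst_eq : ∀ x ∈ source, (coord.fn x).1 = base.coord.fn (π.base x)
  ev_fst : ∀ (U : Opens X.space) (h : U ≤ source) (V : Opens T.space) (hV : V ≤ base.source)
    (hUV : U ≤ Opens.comap π.base V) (W : Opens (Fin m → ℂ)) (hW : Set.MapsTo base.coord.fn V W)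
    (W' : Opens ((Fin m → ℂ) × ℂ)) (hW' : Set.MapsTo coord.fn U W') (i : ∀ p ∈ W', p.1 ∈ W)
    (f : Hol W),
    coord.ev h hW' (Hol.ofFst i f) = X.res hUV (π.pull V (base.coord.ev hV hW f))
  isOpenEmbedding : IsOpenEmbedding fun x : source => (π.base x, (coord.fn x).2)
  generates : ∀ (U : Opens X.space) (h : U ≤ source) (s : X.Γ U), ∀ x ∈ U,
    ∃ (U' : Opens X.space) (h' : U' ≤ U) (W : Opens ((Fin m → ℂ) × ℂ))
      (hW : Set.MapsTo coord.fn U' W) (f g : Finset (Fin n) → Hol W), x ∈ U' ∧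
      X.res h' s =
        coord.expand (fun k => X.res source_le (π.pull _ (base.odd k))) (h'.trans h) hW f +
        coord.expand (fun k => X.res source_le (π.pull _ (base.odd k))) (h'.trans h) hW g *
          X.res (h'.trans h) θ
  kernel_eq : ∀ (U : Opens X.space) (h : U ≤ source) (W : Opens ((Fin m → ℂ) × ℂ))
    (hW : Set.MapsTo coord.fn U W) (f g : Finset (Fin n) → Hol W),
    coord.expand (fun k => X.res source_le (π.pull _ (base.odd k))) h hW f +
      coord.expand (fun k => X.res source_le (π.pull _ (base.odd k))) h hW g * X.res h θ = 0 →
    ∀ x ∈ U, ∃ (W' : Opens ((Fin m → ℂ) × ℂ)) (i : W' ≤ W) (V : Opens T.space)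
      (hV : V ≤ base.source) (W₀ : Opens (Fin m → ℂ)) (hW₀ : Set.MapsTo base.coord.fn V W₀)
      (i₀ : ∀ p ∈ W', p.1 ∈ W₀) (k : ℕ) (ρ : Fin k → Finset (Fin n) → Hol W₀)
      (a b : Fin k → Hol W'), coord.fn x ∈ W' ∧ π.base x ∈ V ∧
      (∀ l, base.coord.expand base.odd hV hW₀ (ρ l) = 0) ∧
      ∀ I, Hol.res i (f I) = ∑ l, a l * Hol.ofFst i₀ (ρ l I) ∧
        Hol.res i (g I) = ∑ l, b l * Hol.ofFst i₀ (ρ l I)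

/-- The even relative coordinate `z` of a relative chart. -/
def RelChart.z {X T : SuperSpace} {π : Hom X T} (c : RelChart π) : X.Γ c.source :=
  c.coord.ev le_rfl (W := ⊤) (fun _ _ => trivial) Hol.snd

/-! ### Relative vector fields -/

/-- Relative vector fields of parity `p` on `U ⊆ X`, for `π : X ⟶ T`: the `𝒪_T`-linear
superderivations of the sheaf `𝒪_X` restricted to `U`. -/
@[ext]
structure RelVF {X T : SuperSpace} (π : Hom X T) (p : ZMod 2) (U : Opens X.space) where
  app : ∀ U' : Opens X.space, U' ≤ U → (X.Γ U' →ₗ[ℂ] X.Γ U')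
  app_res : ∀ {U' U'' : Opens X.space} (h : U' ≤ U) (h' : U'' ≤ U') (s : X.Γ U'),
    app U'' (h'.trans h) (X.res h' s) = X.res h' (app U' h s)
  app_mem : ∀ {U' : Opens X.space} (h : U' ≤ U) {i : ZMod 2} {s : X.Γ U'},
    s ∈ X.part U' i → app U' h s ∈ X.part U' (p + i)
  leibniz : ∀ {U' : Opens X.space} (h : U' ≤ U) {i : ZMod 2} {s : X.Γ U'},
    s ∈ X.part U' i → ∀ s' : X.Γ U',
    app U' h (s * s') = app U' h s * s' + sgn p i • (s * app U' h s')
  app_pull : ∀ {U' : Opens X.space} (h : U' ≤ U) {V : Opens T.space}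
    (hV : U' ≤ Opens.comap π.base V) (f : T.Γ V), app U' h (X.res hV (π.pull V f)) = 0

section VF

variable {X T : SuperSpace} {π : Hom X T}

/-- Restriction of vector fields. -/
def RelVF.res {p : ZMod 2} {U U' : Opens X.space} (h : U' ≤ U) (ξ : RelVF π p U) :
    RelVF π p U' where
  app V hV := ξ.app V (hV.trans h)
  app_res hV h' s := ξ.app_res (hV.trans h) h' s
  app_mem hV _ _ hs := ξ.app_mem (hV.trans h) hs
  leibniz hV _ _ hs s' := ξ.leibniz (hV.trans h) hs s'
  app_pull hV _ hf f := ξ.app_pull (hV.trans h) hf f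

/-- The supercommutator `[ξ, ζ] = ξ ζ - (-1)^(a b) ζ ξ`. -/
def RelVF.bracket {a b : ZMod 2} {U : Opens X.space} (ξ : RelVF π a U) (ζ : RelVF π b U) :
    RelVF π (a + b) U where
  app V hV := ξ.app V hV ∘ₗ ζ.app V hV - sgn a b • (ζ.app V hV ∘ₗ ξ.app V hV)
  app_res hV h' s := by
    simp [ξ.app_res hV h', ζ.app_res hV h', map_sub]
  app_mem {V} hV i s hs := by
    refine Submodule.sub_mem _ ?_ (Submodule.smul_mem _ _ ?_)
    · rw [add_assoc]; exact ξ.app_mem hV (ζ.app_mem hV hs)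
    · rw [add_comm a b, add_assoc]; exact ζ.app_mem hV (ξ.app_mem hV hs)
  leibniz {V} hV i s hs s' := by
    simp only [LinearMap.sub_apply, LinearMap.comp_apply, LinearMap.smul_apply,
      ζ.leibniz hV hs, ξ.leibniz hV hs, map_add, map_smul,
      ζ.leibniz hV (ξ.app_mem hV hs), ξ.leibniz hV (ζ.app_mem hV hs), sub_mul, mul_sub,
      smul_mul_assoc, mul_smul_comm]
    have h11 : (1 : ZMod 2) + 1 = 0 := rfl
    rcases zmod_cases a with rfl | rfl <;> rcases zmod_cases b with rfl | rfl <;>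
      rcases zmod_cases i with rfl | rfl <;>
      simp only [sgn, h11, add_zero, zero_add, and_self, and_true, and_false, 
        zero_ne_one, if_true, if_false, one_smul, neg_smul, smul_add, smul_neg, smul_sub] <;> abel
  app_pull hV _ hf f := by
    simp [ξ.app_pull hV hf, ζ.app_pull hV hf]

/-- `ξ = f ζ + g ζ'` on the open set `U` where `ξ` is defined. -/
def RelVF.IsComb {p a b : ZMod 2} {U : Opens X.space} (ξ : RelVF π p U) (f : X.Γ U)
    (ζ : RelVF π a U) (g : X.Γ U) (ζ' : RelVF π b U) : Prop :=
  ∀ (U' : Opens X.space) (h : U' ≤ U) (s : X.Γ U'),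
    ξ.app U' h s = X.res h f * ζ.app U' h s + X.res h g * ζ'.app U' h s

/-- `ξ = f ζ`. -/
def RelVF.IsMul {p a : ZMod 2} {U : Opens X.space} (ξ : RelVF π p U) (f : X.Γ U)
    (ζ : RelVF π a U) : Prop :=
  ∀ (U' : Opens X.space) (h : U' ≤ U) (s : X.Γ U'),
    ξ.app U' h s = X.res h f * ζ.app U' h s

/-- `(w | v)` is a basis of the relative tangent sheaf on `U`, of rank `(1|1)`. -/
def IsFrame {U : Opens X.space} (w : RelVF π 0 U) (v : RelVF π 1 U) : Prop :=
  ∀ (p : ZMod 2) (U' : Opens X.space) (h : U' ≤ U) (ξ : RelVF π p U'),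
    ∃! fg : X.Γ U' × X.Γ U', ξ.IsComb fg.1 (w.res h) fg.2 (v.res h)

/-! ### Relative one-forms -/

/-- Relative one-forms on `U ⊆ X`: the morphisms of sheaves of left `𝒪_X`-modules from the
relative tangent sheaf to `𝒪_X` over `U`. -/
def formSubgroup (π : Hom X T) (U : Opens X.space) : AddSubgroup
    (∀ (U' : {V : Opens X.space // V ≤ U}) (p : ZMod 2), RelVF π p U'.1 → X.Γ U'.1) where
  carrier := {ω |
    (∀ (U' U'' : Opens X.space) (h : U' ≤ U) (h' : U'' ≤ U') (p : ZMod 2) (ξ : RelVF π p U'),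
      ω ⟨U'', h'.trans h⟩ p (ξ.res h') = X.res h' (ω ⟨U', h⟩ p ξ)) ∧
    ∀ (U' : Opens X.space) (h : U' ≤ U) (p a b : ZMod 2) (ξ : RelVF π p U') (f g : X.Γ U')
      (ζ : RelVF π a U') (ζ' : RelVF π b U'), ξ.IsComb f ζ g ζ' →
      ω ⟨U', h⟩ p ξ = f * ω ⟨U', h⟩ a ζ + g * ω ⟨U', h⟩ b ζ'}
  zero_mem' := by simp
  add_mem' := by
    rintro ω ω' ⟨h1, h2⟩ ⟨h1', h2'⟩
    refine ⟨fun U' U'' h h' p ξ => ?_, fun U' h p a b ξ f g ζ ζ' H => ?_⟩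
    · simp [h1 U' U'' h h' p ξ, h1' U' U'' h h' p ξ]
    · simp only [Pi.add_apply, h2 U' h p a b ξ f g ζ ζ' H, h2' U' h p a b ξ f g ζ ζ' H, mul_add]
      abel
  neg_mem' := by
    rintro ω ⟨h1, h2⟩
    refine ⟨fun U' U'' h h' p ξ => ?_, fun U' h p a b ξ f g ζ ζ' H => ?_⟩
    · simp [h1 U' U'' h h' p ξ]
    · simp only [Pi.neg_apply, h2 U' h p a b ξ f g ζ ζ' H, mul_neg]
      abel

/-- The group of relative one-forms on `U`. -/
abbrev RelForm (π : Hom X T) (U : Opens X.space) : Type := formSubgroup π U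

/-- Restriction of one-forms. -/
def RelForm.res {U V : Opens X.space} (h : V ≤ U) : RelForm π U →+ RelForm π V where
  toFun ω := ⟨fun U' => ω.1 ⟨U'.1, U'.2.trans h⟩,
    fun U' U'' k k' => ω.2.1 U' U'' (k.trans h) k', fun U' k => ω.2.2 U' (k.trans h)⟩
  map_zero' := rfl
  map_add' _ _ := rfl

/-- The form `ω` has parity `p`. -/
def RelForm.HasParity {U : Opens X.space} (ω : RelForm π U) (p : ZMod 2) : Prop :=
  ∀ (U' : Opens X.space) (h : U' ≤ U) (a : ZMod 2) (ξ : RelVF π a U'),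
    ω.1 ⟨U', h⟩ a ξ ∈ X.part U' (a + p)

/-- The differential `dx` of a function: `⟨ξ, dx⟩ = ξ x`. -/
def RelForm.d {U : Opens X.space} (x : X.Γ U) : RelForm π U :=
  ⟨fun U' _ ξ => ξ.app U'.1 le_rfl (X.res U'.2 x), by
    refine ⟨fun U' U'' h h' p ξ => ?_, fun U' h p a b ξ f g ζ ζ' H => ?_⟩
    · dsimp only
      rw [← ξ.app_res le_rfl h', X.res_res]; rfl
    · dsimp only
      rw [H U' le_rfl, X.res_self, X.res_self]⟩

/-- The closed forms: `dω = 0`, where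
`⟨ξ ⊗ ζ, dω⟩ = ξ ⟨ζ, ω⟩ - (-1)^(a b) ζ ⟨ξ, ω⟩ - ⟨[ξ, ζ], ω⟩`. -/
def RelForm.closed (π : Hom X T) (U : Opens X.space) : AddSubgroup (RelForm π U) where
  carrier := {ω | ∀ (U' : Opens X.space) (h : U' ≤ U) (a b : ZMod 2) (ξ : RelVF π a U')
    (ζ : RelVF π b U'),
    ξ.app U' le_rfl (ω.1 ⟨U', h⟩ b ζ) - sgn a b • ζ.app U' le_rfl (ω.1 ⟨U', h⟩ a ξ) -
      ω.1 ⟨U', h⟩ (a + b) (ξ.bracket ζ) = 0}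
  zero_mem' := by simp
  add_mem' := by
    intro ω ω' H H' U' h a b ξ ζ
    have h1 := H U' h a b ξ ζ
    have h2 := H' U' h a b ξ ζ
    simp only [AddSubgroup.coe_add, Pi.add_apply, map_add, smul_add]
    rw [← add_zero (0 : X.Γ U')]
    nth_rewrite 1 [← h1]
    rw [← h2]
    abel
  neg_mem' := by
    intro ω H U' h a b ξ ζ
    have h1 := H U' h a b ξ ζ
    simp only [AddSubgroup.coe_neg, Pi.neg_apply, map_neg, smul_neg]
    rw [← neg_zero (G := X.Γ U'), ← h1]
    abel

/-- Multiplication of a form from the right by a function on the base. (The pairing of vector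
fields with forms is left linear in the vector field, hence right linear in the form.) -/
def RelForm.mulRight {U : Opens X.space} (ω : RelForm π U) {V : Opens T.space}
    (hV : U ≤ Opens.comap π.base V) (c : T.Γ V) : RelForm π U :=
  ⟨fun U' p ξ => ω.1 U' p ξ * X.res (U'.2.trans hV) (π.pull V c), by
    refine ⟨fun U' U'' h h' p ξ => ?_, fun U' h p a b ξ f g ζ ζ' H => ?_⟩
    · dsimp only
      rw [map_mul, ← ω.2.1 U' U'' h h' p ξ, X.res_res]
    · dsimp only
      rw [ω.2.2 U' h p a b ξ f g ζ ζ' H, add_mul, mul_assoc, mul_assoc]⟩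

theorem RelVF.app_mul_pull {p : ZMod 2} {U U' : Opens X.space} (ξ : RelVF π p U) (h : U' ≤ U)
    {V : Opens T.space} (hV : U' ≤ Opens.comap π.base V) (s : X.Γ U') (c : T.Γ V) :
    ξ.app U' h (s * X.res hV (π.pull V c)) = ξ.app U' h s * X.res hV (π.pull V c) := by
  have hs : s ∈ X.part U' 0 ⊔ X.part U' 1 := by
    rw [(X.isCompl U').sup_eq_top]; trivial
  obtain ⟨s₀, h₀, s₁, h₁, rfl⟩ := Submodule.mem_sup.1 hs
  rw [add_mul, map_add, map_add, ξ.leibniz h h₀, ξ.leibniz h h₁, ξ.app_pull h hV, add_mul]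
  simp

theorem RelForm.mulRight_closed {U : Opens X.space} {ω : RelForm π U} (hω : ω ∈ closed π U)
    {V : Opens T.space} (hV : U ≤ Opens.comap π.base V) (c : T.Γ V) :
    ω.mulRight hV c ∈ closed π U := by
  intro U' h a b ξ ζ
  simp only [mulRight, RelVF.app_mul_pull]
  rw [← smul_mul_assoc, ← sub_mul, ← sub_mul, hω U' h a b ξ ζ, zero_mul]

theorem RelForm.res_closed {U V : Opens X.space} (h : V ≤ U) {ω : RelForm π U}
    (hω : ω ∈ closed π U) : RelForm.res h ω ∈ closed π V :=
  fun U' hU' => hω U' (hU'.trans h)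

end VF

/-! ### Closed subspaces, families of super Riemann surfaces -/

/-- The ideal sheaf of `j : R ⟶ X` (the kernel of `𝒪_X → j_* 𝒪_R`) is generated by `h` on `U`. -/
def IsCutOutBy {R X : SuperSpace} (j : Hom R X) (U : Opens X.space) (h : X.Γ U) : Prop :=
  ∀ (U' : Opens X.space) (i : U' ≤ U) (s : X.Γ U'), j.pull U' s = 0 ↔
    ∀ x ∈ U', ∃ (U'' : Opens X.space) (i' : U'' ≤ U') (a : X.Γ U''), x ∈ U'' ∧
      X.res i' s = X.res (i'.trans i) h * a

/-- `j` is a closed embedding of superspaces: a closed embedding of the underlying spaces such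
that `𝒪_X → j_* 𝒪_R` is surjective on stalks. -/
structure IsClosedSubspace {R X : SuperSpace} (j : Hom R X) : Prop where
  isClosedEmbedding : IsClosedEmbedding j.base
  surjective : ∀ (W : Opens R.space) (s : R.Γ W), ∀ y ∈ W,
    ∃ (U : Opens X.space) (h : Opens.comap j.base U ≤ W) (a : X.Γ U),
      j.base y ∈ U ∧ j.pull U a = R.res h s

/-- A family over `T` of super Riemann surfaces with `2r` labelled Ramond punctures. -/
structure SRSFamily (T : SuperSpace) (r : ℕ) where
  X : SuperSpace
  /-- The family; smooth of relative dimension `(1|1)` and proper, with connected fibres. -/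
  π : Hom X T
  smooth : ∀ x : X.space, ∃ c : RelChart π, x ∈ c.source
  proper : IsProperMap π.base
  connected : ∀ t : T.space, IsConnected (π.base ⁻¹' {t})
  /-- The Ramond divisor, an unramified relative effective Cartier divisor: a closed subspace,
  locally defined by `z = 0` for the even coordinate `z` of a relative chart. -/
  R : SuperSpace
  R_nontrivial : ∀ W : Opens R.space, (W : Set R.space).Nonempty → Nontrivial (R.Γ W)
  j : Hom R X
  closedSubspace : IsClosedSubspace j
  divisor : ∀ y : R.space, ∃ c : RelChart π, j.base y ∈ c.source ∧ IsCutOutBy j c.source c.z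
  /-- The labelling of the punctures; there is one puncture of each label in every fibre. -/
  label : R.space → Fin (2 * r)
  label_locallyConstant : IsLocallyConstant label
  label_bijective : ∀ (t : T.space) (i : Fin (2 * r)),
    ∃! y : R.space, π.base (j.base y) = t ∧ label y = i
  /-- The distribution, a subsheaf of the relative tangent sheaf. -/
  D : ∀ (p : ZMod 2) (U : Opens X.space), Set (RelVF π p U)
  D_res : ∀ (p : ZMod 2) (U U' : Opens X.space) (h : U' ≤ U), ∀ ξ ∈ D p U, ξ.res h ∈ D p U'
  D_local : ∀ (p : ZMod 2) (U : Opens X.space) (ξ : RelVF π p U),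
    (∀ x ∈ U, ∃ (U' : Opens X.space) (h : U' ≤ U), x ∈ U' ∧ ξ.res h ∈ D p U') → ξ ∈ D p U
  /-- Locally `D` is generated by the odd member `v` of a frame `(w | v)` of the relative tangent
  sheaf, and the supercommutator `[v, v] = 2 v²` is `2 h w` modulo `D`, where `h` generates the
  ideal of the Ramond divisor: the supercommutator identifies `D ⊗ D` with `(𝒯/D)(-R)`. -/
  D_superconformal : ∀ x : X.space, ∃ (U : Opens X.space) (w : RelVF π 0 U) (v : RelVF π 1 U)
    (h k : X.Γ U), x ∈ U ∧ IsFrame w v ∧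
    (∀ (p : ZMod 2) (U' : Opens X.space) (i : U' ≤ U) (ξ : RelVF π p U'),
      ξ ∈ D p U' ↔ ∃ f : X.Γ U', ξ.IsMul f (v.res i)) ∧
    IsCutOutBy j U h ∧ (v.bracket v).IsComb (2 * h) w k v

namespace SRSFamily

variable {T : SuperSpace} {r : ℕ} (F : SRSFamily T r)

/-- The projection `R ⟶ T`. -/
def q : Hom F.R T := F.π.comp F.j

/-- The open set of `R` lying over `V ⊆ T`. -/
def above (V : Opens T.space) : Opens F.R.space := Opens.comap F.q.base V

theorem above_mono {V V' : Opens T.space} (h : V' ≤ V) : F.above V' ≤ F.above V :=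
  Opens.comap_mono _ h

/-! ### The pushforward of the sheaf of relative closed one-forms on `R` -/

/-- Sections over `V` of the pushforward to `T` of the sheaf of relative closed one-forms. -/
abbrev Z (V : Opens T.space) : AddSubgroup (RelForm F.q (F.above V)) :=
  RelForm.closed F.q (F.above V)

/-- Restriction of closed forms. -/
def resZ {V V' : Opens T.space} (h : V' ≤ V) : F.Z V →+ F.Z V' where
  toFun ω := ⟨RelForm.res (F.above_mono h) ω.1, RelForm.res_closed _ ω.2⟩
  map_zero' := rfl
  map_add' _ _ := rfl

/-- The (right) module structure over the functions on the base. -/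
def mulZ {V : Opens T.space} : F.Z V →+ T.Γ V →+ F.Z V :=
  AddMonoidHom.mk' (fun ω => AddMonoidHom.mk'
    (fun c => ⟨ω.1.mulRight le_rfl c, RelForm.mulRight_closed ω.2 _ c⟩)
    (fun c c' => by
      ext U' p ξ
      simp [RelForm.mulRight, mul_add]))
    (fun ω ω' => by
      ext c U' p ξ
      simp [RelForm.mulRight, add_mul])

/-! ### Superconformal coordinates and the lattice `Λ₁` -/

/-- Superconformal coordinates `(z, θ)` on an open set of `X`: the Ramond divisor is `z = 0` and
the distribution is generated by the vector field `∂_θ + z θ ∂_z`, that is, by a `v` with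
`v θ = 1` and `v z = z θ`. -/
structure SCChart where
  chart : RelChart F.π
  divisor : IsCutOutBy F.j chart.source chart.z
  v : RelVF F.π 1 chart.source
  v_θ : v.app _ le_rfl chart.θ = 1
  v_z : v.app _ le_rfl chart.z = chart.z * chart.θ
  generates : ∀ (p : ZMod 2) (U : Opens F.X.space) (i : U ≤ chart.source) (ξ : RelVF F.π p U),
    ξ ∈ F.D p U ↔ ∃ f : F.X.Γ U, ξ.IsMul f (v.res i)

/-- `x` is a superconformal coordinate on the open set `W` of the Ramond divisor: the restriction
of the odd one of two superconformal coordinates on `X`. -/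
def IsSCCoord (W : Opens F.R.space) (x : F.R.Γ W) : Prop :=
  ∃ (c : F.SCChart) (h : W ≤ Opens.comap F.j.base c.chart.source),
    x = F.R.res h (F.j.pull _ c.chart.θ)

/-- `γ` is a superconformal differential: locally `γ = dx` for a superconformal coordinate. -/
def IsSCDiff (W : Opens F.R.space) (γ : RelForm F.q W) : Prop :=
  ∀ y ∈ W, ∃ (W' : Opens F.R.space) (h : W' ≤ W) (x : F.R.Γ W'), y ∈ W' ∧ F.IsSCCoord W' x ∧
    RelForm.res h γ = RelForm.d x

theorem IsSCDiff.res {W W' : Opens F.R.space} (h : W' ≤ W) {γ : RelForm F.q W}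
    (hγ : F.IsSCDiff W γ) : F.IsSCDiff W' (RelForm.res h γ) := by
  intro y hy
  obtain ⟨W₁, h₁, x, hy₁, ⟨c, hc, rfl⟩, hx⟩ := hγ y (h hy)
  refine ⟨W₁ ⊓ W', inf_le_right, F.R.res inf_le_left (F.R.res hc (F.j.pull _ c.chart.θ)),
    ⟨hy₁, hy⟩, ⟨c, inf_le_left.trans hc, F.R.res_res _ _ _⟩, ?_⟩
  have := congrArg (RelForm.res (inf_le_left : W₁ ⊓ W' ≤ W₁)) hx
  ext U' p ξ
  have := congrFun (congrFun (congrFun (congrArg Subtype.val this) U') p) ξ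
  refine this.trans ?_
  simp only [RelForm.res, RelForm.d, F.R.res_res]
  rfl

theorem res_closure {W W' : Opens F.R.space} (k : W' ≤ W) {α : RelForm F.q W}
    (hα : α ∈ AddSubgroup.closure {γ | F.IsSCDiff W γ}) :
    RelForm.res k α ∈ AddSubgroup.closure {γ | F.IsSCDiff W' γ} := by
  induction hα using AddSubgroup.closure_induction with
  | mem γ hγ => exact AddSubgroup.subset_closure (IsSCDiff.res F k hγ)
  | zero => simp
  | add a b _ _ ha hb => rw [map_add]; exact add_mem ha hb
  | neg a _ ha => rw [map_neg]; exact neg_mem ha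

/-- Sections over `V` of the sheaf `Λ₁` on `T`: the closed forms that are locally on `R`
integral combinations of superconformal differentials. -/
def Lam (V : Opens T.space) : AddSubgroup (F.Z V) where
  carrier := {ω | ∀ y ∈ F.above V, ∃ (W : Opens F.R.space) (h : W ≤ F.above V), y ∈ W ∧
    RelForm.res h ω.1 ∈ AddSubgroup.closure {γ | F.IsSCDiff W γ}}
  zero_mem' := fun y hy => ⟨F.above V, le_rfl, hy, by simp⟩
  add_mem' := by
    intro ω ω' H H' y hy
    obtain ⟨W, h, hyW, hW⟩ := H y hy
    obtain ⟨W', h', hyW', hW'⟩ := H' y hy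
    refine ⟨W ⊓ W', inf_le_left.trans h, ⟨hyW, hyW'⟩, ?_⟩
    exact add_mem (F.res_closure inf_le_left hW) (F.res_closure inf_le_right hW')
  neg_mem' := by
    intro ω H y hy
    obtain ⟨W, h, hyW, hW⟩ := H y hy
    exact ⟨W, h, hyW, neg_mem hW⟩

/-- Restriction of sections of `Λ₁`. -/
def resLam {V V' : Opens T.space} (h : V' ≤ V) : F.Lam V →+ F.Lam V' where
  toFun ω := ⟨F.resZ h ω.1, by
    intro y hy
    obtain ⟨W, k, hyW, hW⟩ := ω.2 y (F.above_mono h hy)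
    exact ⟨W ⊓ F.above V', inf_le_right, ⟨hyW, hy⟩, F.res_closure inf_le_left hW⟩⟩
  map_zero' := rfl
  map_add' _ _ := rfl

/-! ### Vector bundles, local systems -/

end SRSFamily

/-- The sheaf condition for a presheaf of sets on `T`. -/
def IsSheaf {T : SuperSpace} (G : Opens T.space → Type)
    (res : ∀ {V V' : Opens T.space}, V' ≤ V → G V → G V') : Prop :=
  ∀ {ι : Type} (U : ι → Opens T.space) (V : Opens T.space) (hU : ∀ i, U i ≤ V),
    (∀ x ∈ V, ∃ i, x ∈ U i) → ∀ s : ∀ i, G (U i),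
    (∀ i j, res (inf_le_left : U i ⊓ U j ≤ U i) (s i) =
      res (inf_le_right : U i ⊓ U j ≤ U j) (s j)) →
    ∃! a : G V, ∀ i, res (hU i) a = s i

namespace SRSFamily

variable {T : SuperSpace} {r : ℕ} (F : SRSFamily T r)

/-- The forms `e i` are a basis over `V₀` of the pushforward of the closed one-forms. -/
def IsBasis {V₀ : Opens T.space} (e : Fin (2 * r) → F.Z V₀) : Prop :=
  ∀ (V : Opens T.space) (h : V ≤ V₀) (ω : F.Z V),
    ∃! c : Fin (2 * r) → T.Γ V, ω = ∑ i, F.mulZ (F.resZ h (e i)) (c i)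

/-- The pushforward of the closed one-forms is a vector bundle of rank `0|2r`: a sheaf which
locally has a basis of `2r` odd sections. -/
def IsVectorBundle : Prop :=
  IsSheaf (fun V => F.Z V) (fun h ω => F.resZ h ω) ∧
  ∀ t : T.space, ∃ (V₀ : Opens T.space) (e : Fin (2 * r) → F.Z V₀), t ∈ V₀ ∧
    (∀ i, (e i).1.HasParity 1) ∧ F.IsBasis e

/-- An isomorphism over `V₀` of the constant sheaf `ℤ^{2r}` with `Λ₁`. -/
structure Trivialization (V₀ : Opens T.space) where
  equiv : ∀ V : Opens T.space, V ≤ V₀ → (LocallyConstant V (Fin (2 * r) → ℤ) ≃+ F.Lam V)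
  equiv_res : ∀ {V V' : Opens T.space} (h : V ≤ V₀) (h' : V' ≤ V)
    (n : LocallyConstant V (Fin (2 * r) → ℤ)),
    F.resLam h' (equiv V h n) =
      equiv V' (h'.trans h) (n.comap ⟨Set.inclusion h', continuous_inclusion h'⟩)

/-- The section of `Λ₁` corresponding to the `i`-th standard basis vector. -/
def Trivialization.frame {F : SRSFamily T r} {V₀ : Opens T.space} (e : F.Trivialization V₀)
    (i : Fin (2 * r)) : F.Lam V₀ :=
  e.equiv V₀ le_rfl (LocallyConstant.const _ (Pi.single i 1))

/-- `Λ₁` is a local system of free abelian groups of rank `0|2r`: a sheaf which is locally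
isomorphic to the constant sheaf `ℤ^{2r}`, and all of whose sections are odd. -/
def IsLocalSystem : Prop :=
  IsSheaf (fun V => F.Lam V) (fun h ω => F.resLam h ω) ∧
  (∀ t : T.space, ∃ V₀ : Opens T.space, t ∈ V₀ ∧ Nonempty (F.Trivialization V₀)) ∧
  ∀ (V : Opens T.space) (ω : F.Lam V), ω.1.1.HasParity 1

/-- The map `Λ₁(V) ⊗ 𝒪_T(V) → π_* 𝒵¹(V)`. -/
def tensorMap (V : Opens T.space) : F.Lam V ⊗[ℤ] T.Γ V →+ F.Z V :=
  TensorProduct.liftAddHom (F.mulZ.comp (F.Lam V).subtype) (fun n ω c => by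
    rw [AddMonoidHom.map_zsmul, AddMonoidHom.map_zsmul]; rfl)

/-- The map `Λ₁ ⊗ 𝒪_T → π_* 𝒵¹` is an isomorphism: where `Λ₁` is trivial, it is an isomorphism
on sections over connected open sets, and a `ℤ`-basis of `Λ₁` is an `𝒪_T`-basis of `π_* 𝒵¹`. -/
def IsAssociated : Prop :=
  ∀ (V₀ : Opens T.space) (e : F.Trivialization V₀),
    (∀ V ≤ V₀, IsConnected (V : Set T.space) → Function.Bijective (F.tensorMap V)) ∧
    F.IsBasis fun i => (e.frame i).1

/-! ### The pairings -/

/-- A `ℤ`-bilinear pairing of `Λ₁` with itself, with values in the constant sheaf `ℤ`. -/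
@[ext]
structure LatticePairing where
  form : ∀ V : Opens T.space, F.Lam V →+ F.Lam V →+ LocallyConstant V ℤ
  form_res : ∀ {V V' : Opens T.space} (h : V' ≤ V) (a b : F.Lam V),
    form V' (F.resLam h a) (F.resLam h b) =
      (form V a b).comap ⟨Set.inclusion h, continuous_inclusion h⟩

namespace LatticePairing

variable {F : SRSFamily T r} (J : F.LatticePairing)

/-- `J = ∑ i, dxⁱ ⊗ dxⁱ`, where `dxⁱ` is a superconformal differential at the `i`-th puncture: the
sections that are `aᵢ dxⁱ` and `bᵢ dxⁱ` near the `i`-th puncture `y i` of the fibre over `t`, for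
all `i`, have the pairing `∑ i, aᵢ bᵢ` at `t`. -/
def IsStandard : Prop :=
  ∀ (V : Opens T.space) (l l' : F.Lam V) (t : V) (y : Fin (2 * r) → F.R.space),
    (∀ i, F.q.base (y i) = t ∧ F.label (y i) = i) →
    ∀ (W : Fin (2 * r) → Opens F.R.space) (hW : ∀ i, W i ≤ F.above V)
      (γ : ∀ i, RelForm F.q (W i)) (a b : Fin (2 * r) → ℤ),
      (∀ i, y i ∈ W i ∧ F.IsSCDiff (W i) (γ i) ∧
        RelForm.res (hW i) l.1.1 = a i • γ i ∧ RelForm.res (hW i) l'.1.1 = b i • γ i) →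
      J.form V l l' t = ∑ i, a i * b i

/-- Symmetry. -/
def IsSymmetric : Prop := ∀ (V : Opens T.space) (l l' : F.Lam V), J.form V l l' = J.form V l' l

/-- Non-degeneracy of the pairing of sheaves. -/
def IsNondegenerate : Prop :=
  ∀ (V : Opens T.space) (l : F.Lam V),
    (∀ (V' : Opens T.space) (h : V' ≤ V) (l' : F.Lam V'), J.form V' (F.resLam h l) l' = 0) → l = 0

/-- The trivialization turns `J` into the standard form `∑ i, aᵢ bᵢ` on `ℤ^{2r}`. -/
def IsIsometry {V₀ : Opens T.space} (e : F.Trivialization V₀) : Prop :=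
  ∀ (V : Opens T.space) (h : V ≤ V₀) (a b : LocallyConstant V (Fin (2 * r) → ℤ)) (t : V),
    J.form V (e.equiv V h a) (e.equiv V h b) t = ∑ i, a t i * b t i

end LatticePairing

/-- A biadditive pairing of the sheaf `π_* 𝒵¹` with itself, with values in `𝒪_T`. -/
@[ext]
structure FormPairing where
  form : ∀ V : Opens T.space, F.Z V →+ F.Z V →+ T.Γ V
  form_res : ∀ {V V' : Opens T.space} (h : V' ≤ V) (a b : F.Z V),
    form V' (F.resZ h a) (F.resZ h b) = T.res h (form V a b)

namespace FormPairing

variable {F : SRSFamily T r} (K : F.FormPairing)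

/-- `K = J ⊗ 𝒪_T`: if `J(l, l')` is the constant `n`, then `K(l a, l' b) = n a b`. -/
def Extends (J : F.LatticePairing) : Prop :=
  ∀ (V : Opens T.space) (l l' : F.Lam V) (n : ℤ), (∀ t : V, J.form V l l' t = n) →
    ∀ a b : T.Γ V, K.form V (F.mulZ l.1 a) (F.mulZ l'.1 b) = n • (a * b)

/-- `𝒪_T`-bilinearity. The sections of `Λ₁` are taken out without a sign (that is, they count as
even here, and a form of parity `p` as a coefficient of parity `p + 1`). -/
def IsBilinear : Prop :=
  (∀ (V : Opens T.space) (ω ω' : F.Z V) (c : T.Γ V),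
    K.form V ω (F.mulZ ω' c) = K.form V ω ω' * c) ∧
  ∀ (V : Opens T.space) (ω ω' : F.Z V) (p k : ZMod 2) (c : T.Γ V), ω'.1.HasParity p →
    c ∈ T.part V k → K.form V (F.mulZ ω c) ω' = sgn k (p + 1) • (K.form V ω ω' * c)

/-- Symmetry, with the same convention for the signs. -/
def IsSymmetric : Prop :=
  ∀ (V : Opens T.space) (ω ω' : F.Z V) (p p' : ZMod 2), ω.1.HasParity p → ω'.1.HasParity p' →
    K.form V ω' ω = sgn (p + 1) (p' + 1) • K.form V ω ω'

end FormPairing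

/-! ### Orientations -/

/-- An orientation of the Ramond divisor: a class of superconformal coordinates on open sets of
`R`, covering `R`, any two of which differ on overlaps only by translations by odd functions on
the base (while two superconformal coordinates in general are related by `x' = ±(x + τ)`). -/
structure Orientation where
  coords : ∀ W : Opens F.R.space, Set (F.R.Γ W)
  isSCCoord : ∀ (W : Opens F.R.space), ∀ x ∈ coords W, F.IsSCCoord W x
  covers : ∀ y : F.R.space, ∃ W : Opens F.R.space, y ∈ W ∧ (coords W).Nonempty
  translation : ∀ (W W' : Opens F.R.space), ∀ x ∈ coords W, ∀ x' ∈ coords W', ∀ y ∈ W ⊓ W',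
    ∃ (W'' : Opens F.R.space) (h : W'' ≤ W) (h' : W'' ≤ W') (V : Opens T.space)
      (hV : W'' ≤ F.above V) (τ : T.Γ V), y ∈ W'' ∧ τ ∈ T.part V 1 ∧
      F.R.res h' x' = F.R.res h x + F.R.res hV (F.q.pull V τ)

/-- The `i`-th basis section is `dx` along the `i`-th puncture, for the coordinates `x` of the
orientation, and it vanishes along the other punctures. -/
def Trivialization.IsAdapted {F : SRSFamily T r} (e : F.Trivialization ⊤)
    (σ : F.Orientation) : Prop :=
  ∀ (i i' : Fin (2 * r)) (W : Opens F.R.space), (∀ y ∈ W, F.label y = i') →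
    ∀ x ∈ σ.coords W,
      RelForm.res (le_top : W ≤ F.above ⊤) (e.frame i).1.1 = if i = i' then RelForm.d x else 0

end SRSFamily

end SuperGeom

end

/-! Near a puncture the Ramond divisor is a product of T with ℂ^{0|1}, and the theorem rests on
making this explicit. In superconformal coordinates R is z = 0, so the functions on R are a + b x
with x = θ|_R and with a, b from the base, determined locally on T (`exists_eq_add_mul`,
`exists_res_eq_zero`). Vector fields on R are multiples of ∂_x, so a form ω is determined by s =
⟨∂_x, ω⟩. Since [∂_x, ∂_x] = 0, closedness says 2 ∂_x s = 0, that is, s comes from the base: closed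
forms are locally dx · a (`exists_hasCoeff`). Each fibre has one puncture of every label and R → T
is open, so the differentials dx^i at the punctures of one fibre, extended by zero to the other
components, form a basis of the closed forms over a neighbourhood (`IsSCFrame.isBasis`).

The integral structure exists because dx is unique up to sign (`SCChart.exists_oddCoord_eq`). Two
superconformal systems satisfy z' = z γ, and their vector fields v, v' are proportional, which gives
v(z') = v(θ') z' θ'. Cancel z, restrict to R and write θ' = a + b x with a odd, b even and γ = g₀ +
g₁ x with g₀ invertible: comparison of coefficients gives b² = 1, and as even germs form a local
ring, b = ±1. So x' = a ± x and dx' = ±dx. Consequently Λ₁ consists of the sections with integral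
coefficients in a frame (dx^i). The expression ∑ aᵢ bᵢ in these coefficients does not see the signs,
so it glues to a pairing of closed forms; J₁ is its restriction to Λ₁, where the values are
integers. An orientation removes the sign ambiguity, and translations do not change dx, so the frame
is then global.

Superconformal coordinates have to be constructed (`exists_SCChart`). A generator v of the
distribution is normalised to v θ = 1, and then v² = H ∂_z, where H generates the ideal of R. One
finds v z = z γ with v γ invertible. The odd coordinate θ' = γ / √(v γ) satisfies θ' v(θ') = γ, so
that v / v(θ') has the required form for (z, θ'). The square root is a branch of a holomorphic root
corrected by Newton's method in the nilpotent directions.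

The analytic input is holomorphic division f(t, z) = f(t, 0) + z g(t, z), by a Cauchy integral, and
holomorphy of ∂f/∂z. Together with the fact that the relations on a relative chart come from the
base, it gives the fields ∂_z, ∂_θ, ∂_x and the uniqueness of a and b in a + b x. -/

noncomputable section

open TopologicalSpace Topology
open scoped TensorProduct

namespace SuperGeom

/-! ### Cauchy integrals with parameters -/

section Analysis

variable {E : Type} [NormedAddCommGroup E] [NormedSpace ℂ E]

/-- Cauchy's estimate for the Fréchet derivative of a holomorphic function of several variables. -/
theorem norm_fderiv_le_of_forall_mem_closedBall {f : E → ℂ} {p : E} {r M : ℝ} (hr : 0 < r)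
    {s : Set E} (hs : IsOpen s) (hps : Metric.closedBall p r ⊆ s) (hf : DifferentiableOn ℂ f s)
    (hM : ∀ x ∈ Metric.closedBall p r, ‖f x‖ ≤ M) : ‖fderiv ℂ f p‖ ≤ M / r := by
  have hM0 : 0 ≤ M := (norm_nonneg _).trans (hM p (Metric.mem_closedBall_self hr.le))
  refine ContinuousLinearMap.opNorm_le_bound _ (by positivity) fun u => ?_
  rcases eq_or_ne u 0 with rfl | hu
  · simp
  have hu' : 0 < ‖u‖ := norm_pos_iff.2 hu
  -- On the complex line through p in the direction u, the ball of radius r is the disc of radius r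
  -- / ‖u‖; the one-variable estimate there gives M ‖u‖ / r.
  have hmem : ∀ c ∈ Metric.closedBall (0 : ℂ) (r / ‖u‖), p + c • u ∈ Metric.closedBall p r := by
    intro c hc
    rw [mem_closedBall_zero_iff, le_div_iff₀ hu'] at hc
    simpa [norm_smul] using hc
  have hd : ∀ c ∈ Metric.closedBall (0 : ℂ) (r / ‖u‖),
      HasDerivAt (fun c : ℂ => f (p + c • u)) (fderiv ℂ f (p + c • u) u) c := by
    intro c hc
    have h1 : HasFDerivAt f (fderiv ℂ f (p + c • u)) (p + c • u) :=
      ((hf _ (hps (hmem c hc))).differentiableAt (hs.mem_nhds (hps (hmem c hc)))).hasFDerivAt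
    have h2 : HasDerivAt (fun c : ℂ => p + c • u) u c := by
      simpa using ((hasDerivAt_id c).smul_const u).const_add p
    exact h1.comp_hasDerivAt c h2
  have h0 := hd 0 (Metric.mem_closedBall_self (by positivity))
  have := Complex.norm_deriv_le_of_forall_mem_sphere_norm_le (c := 0) (R := r / ‖u‖) (C := M)
    (f := fun c : ℂ => f (p + c • u)) (by positivity)
    (DifferentiableOn.diffContOnCl (s := Metric.ball 0 (r / ‖u‖))
      fun c hc => (hd c (Metric.closure_ball_subset_closedBall hc)).differentiableAt.differentiableWithinAt)
    fun c hc => hM _ (hmem c (Metric.sphere_subset_closedBall hc))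
  rw [h0.deriv, zero_smul, add_zero, div_div_eq_mul_div] at this
  rwa [div_mul_eq_mul_div]

/-- A circle integral depending holomorphically on parameters. -/
theorem differentiableOn_circleIntegral [ProperSpace E] {s : Set E} (hs : IsOpen s)
    {K : E → ℂ → ℂ} {c : ℂ} {R : ℝ} (hR : 0 ≤ R)
    (hK : ContinuousOn (Function.uncurry K) (s ×ˢ Metric.sphere c R))
    (hd : ∀ ζ ∈ Metric.sphere c R, DifferentiableOn ℂ (fun p => K p ζ) s) :
    DifferentiableOn ℂ (fun p => ∮ ζ in C(c, R), K p ζ) s := by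
  intro p hp
  -- Twice the radius, so that Cauchy's estimate with radius r applies at every point within
  -- distance r of p.
  obtain ⟨r, hr, hrs⟩ : ∃ r > 0, Metric.closedBall p (r + r) ⊆ s := by
    obtain ⟨ε, hε, h⟩ := Metric.isOpen_iff.1 hs p hp
    exact ⟨ε / 4, by positivity, (Metric.closedBall_subset_ball (by linarith)).trans h⟩
  have hcpt : IsCompact (Metric.closedBall p (r + r) ×ˢ Metric.sphere c R) :=
    (isCompact_closedBall _ _).prod (isCompact_sphere _ _)
  have hcont := hK.mono (Set.prod_mono_left (t := Metric.sphere c R) hrs)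
  obtain ⟨M, hM⟩ := hcpt.exists_bound_of_continuousOn hcont
  have hζ : ∀ φ, circleMap c R φ ∈ Metric.sphere c R := circleMap_mem_sphere c hR
  have hsub : ∀ x ∈ Metric.closedBall p r,
      Metric.closedBall x r ⊆ Metric.closedBall p (r + r) := fun x hx =>
    Metric.closedBall_subset_closedBall' (by have := Metric.mem_closedBall.1 hx; linarith)
  have hKφ : ∀ x ∈ s, Continuous fun φ => K x (circleMap c R φ) := fun x hx =>
    hK.comp_continuous (f := fun φ => (x, circleMap c R φ)) (by fun_prop) fun φ => ⟨hx, hζ φ⟩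
  have hDφ : ∀ φ, ∀ x ∈ s, HasFDerivAt (fun p => K p (circleMap c R φ))
      (fderiv ℂ (fun p => K p (circleMap c R φ)) x) x := fun φ x hx =>
    ((hd _ (hζ φ) x hx).differentiableAt (hs.mem_nhds hx)).hasFDerivAt
  have hps : Metric.closedBall p r ⊆ s := (Metric.closedBall_subset_closedBall (by linarith)).trans hrs
  -- Needed for the measurability of the differentiated integrand. K is uniformly continuous on the
  -- compact product, so K(·, ζ) - K(·, ζ₀) is uniformly small for ζ near ζ₀, and Cauchy's estimate
  -- passes this on to the derivatives at p.
  have hF'cont : Continuous fun φ => fderiv ℂ (fun p => K p (circleMap c R φ)) p := by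
    have huc := hcpt.uniformContinuousOn_of_continuous hcont
    rw [Metric.uniformContinuousOn_iff] at huc
    rw [continuous_iff_continuousAt]
    intro φ₀
    rw [Metric.continuousAt_iff]
    intro ε hε
    obtain ⟨δ, hδ, H⟩ := huc (ε * r / 2) (by positivity)
    obtain ⟨δ', hδ', H'⟩ := Metric.continuousAt_iff.1
      ((continuous_circleMap c R).continuousAt (x := φ₀)) δ hδ
    refine ⟨δ', hδ', fun {φ} hφ => ?_⟩
    rw [dist_eq_norm, ← fderiv_fun_sub (hDφ φ p hp).differentiableAt (hDφ φ₀ p hp).differentiableAt]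
    refine (norm_fderiv_le_of_forall_mem_closedBall hr hs hps
      ((hd _ (hζ φ)).sub (hd _ (hζ φ₀))) (M := ε * r / 2) fun x hx => ?_).trans_lt ?_
    · have hx' : x ∈ Metric.closedBall p (r + r) :=
        Metric.closedBall_subset_closedBall (by linarith) hx
      have := H (x, circleMap c R φ) ⟨hx', hζ φ⟩ (x, circleMap c R φ₀) ⟨hx', hζ φ₀⟩ (by
        simpa [Prod.dist_eq] using H' hφ)
      rw [dist_eq_norm] at this
      exact this.le
    · rw [div_lt_iff₀ hr]; nlinarith [mul_pos hε hr]
  refine HasFDerivAt.differentiableAt (𝕜 := ℂ) (f' := ∫ φ in (0 : ℝ)..2 * Real.pi,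
    deriv (circleMap c R) φ • fderiv ℂ (fun p => K p (circleMap c R φ)) p) ?_
    |>.differentiableWithinAt
  have hdc : Continuous (deriv (circleMap c R)) := by
    simp only [funext (deriv_circleMap c R)]
    fun_prop
  refine intervalIntegral.hasFDerivAt_integral_of_dominated_of_fderiv_le
    (F := fun p φ => deriv (circleMap c R) φ • K p (circleMap c R φ))
    (F' := fun p φ => deriv (circleMap c R) φ • fderiv ℂ (fun p => K p (circleMap c R φ)) p)
    (bound := fun _ => R * (M / r)) (Metric.closedBall_mem_nhds p hr) ?_ ?_ ?_ ?_ ?_ ?_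
  · filter_upwards [hs.mem_nhds hp] with x hx
    exact (hdc.smul (hKφ x hx)).aestronglyMeasurable
  · exact (hdc.smul (hKφ p hp)).intervalIntegrable _ _
  · exact (hdc.smul hF'cont).aestronglyMeasurable
  · refine Filter.Eventually.of_forall fun φ _ x hx => ?_
    rw [norm_smul]
    have h1 : ‖deriv (circleMap c R) φ‖ = R := by simp [deriv_circleMap, abs_of_nonneg hR]
    rw [h1]
    refine mul_le_mul_of_nonneg_left ?_ hR
    exact norm_fderiv_le_of_forall_mem_closedBall hr hs ((hsub x hx).trans hrs) (hd _ (hζ φ))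
      fun y hy => hM (y, _) ⟨hsub x hx hy, hζ φ⟩
  · exact continuous_const.intervalIntegrable _ _
  · exact Filter.Eventually.of_forall fun φ _ x hx => (hDφ φ x (hps hx)).fun_const_smul _

/-- Division by the last coordinate. -/
theorem exists_eq_add_mul [ProperSpace E] {s : Set (E × ℂ)} (hs : IsOpen s) {f : E × ℂ → ℂ}
    (hf : DifferentiableOn ℂ f s) {t₀ : E} {z₀ : ℂ} (h0 : (t₀, z₀) ∈ s) :
    ∃ ε > 0, Metric.ball t₀ ε ×ˢ Metric.ball z₀ ε ⊆ s ∧ ∃ g : E × ℂ → ℂ,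
      DifferentiableOn ℂ g (Metric.ball t₀ ε ×ˢ Metric.ball z₀ ε) ∧
      ∀ p ∈ Metric.ball t₀ ε ×ˢ Metric.ball z₀ ε, f p = f (p.1, z₀) + (p.2 - z₀) * g p := by
  obtain ⟨ε, hε, h⟩ := Metric.isOpen_iff.1 hs _ h0
  have hsub : ∀ t ∈ Metric.ball t₀ (ε / 2), ∀ ζ ∈ Metric.closedBall z₀ (ε / 2), (t, ζ) ∈ s := by
    intro t ht ζ hζ
    apply h
    rw [Metric.mem_ball, Prod.dist_eq, max_lt_iff]
    exact ⟨lt_trans ht (by linarith), lt_of_le_of_lt hζ (by linarith)⟩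
  have hB : Metric.ball t₀ (ε / 2) ×ˢ Metric.ball z₀ (ε / 2) ⊆ s := fun p hp =>
    hsub p.1 hp.1 p.2 (Metric.ball_subset_closedBall hp.2)
  have hne : ∀ ζ ∈ Metric.sphere z₀ (ε / 2), ∀ w ∈ Metric.ball z₀ (ε / 2), ζ - w ≠ 0 := by
    intro ζ hζ w hw h
    rw [sub_eq_zero] at h
    subst h
    rw [Metric.mem_sphere] at hζ
    rw [Metric.mem_ball] at hw
    linarith
  have hz₀ : z₀ ∈ Metric.ball z₀ (ε / 2) := Metric.mem_ball_self (by positivity)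
  -- The quotient is the Cauchy integral of f(t, ζ) / ((ζ - z₀)(ζ - z)), which makes sense at z = z₀
  -- too. The identity is the difference of Cauchy's formulas at z and at z₀; halving ε keeps the
  -- closed disc inside s.
  refine ⟨ε / 2, by positivity, hB, fun p => (2 * Real.pi * Complex.I : ℂ)⁻¹ •
    ∮ ζ in C(z₀, ε / 2), (ζ - z₀)⁻¹ * (ζ - p.2)⁻¹ * f (p.1, ζ), ?_, ?_⟩
  · refine DifferentiableOn.fun_const_smul (differentiableOn_circleIntegral
      (K := fun (p : E × ℂ) ζ => (ζ - z₀)⁻¹ * (ζ - p.2)⁻¹ * f (p.1, ζ))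
      (Metric.isOpen_ball.prod Metric.isOpen_ball) (by positivity) ?_ ?_) (2 * Real.pi * Complex.I : ℂ)⁻¹
    · refine ContinuousOn.mul (ContinuousOn.mul ?_ ?_) ?_
      · exact ContinuousOn.inv₀ (by fun_prop) fun x hx => hne _ hx.2 _ hz₀
      · exact ContinuousOn.inv₀ (by fun_prop) fun x hx => hne _ hx.2 _ hx.1.2
      · refine hf.continuousOn.comp (f := fun x : (E × ℂ) × ℂ => (x.1.1, x.2)) (by fun_prop) ?_
        exact fun x hx => hsub _ hx.1.1 _ (Metric.sphere_subset_closedBall hx.2)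
    · intro ζ hζ
      refine DifferentiableOn.mul (DifferentiableOn.const_mul ?_ _) ?_
      · exact DifferentiableOn.inv (by fun_prop) fun p hp => hne _ hζ _ hp.2
      · refine hf.comp (f := fun x : E × ℂ => (x.1, ζ)) (by fun_prop) ?_
        exact fun x hx => hsub _ hx.1 _ (Metric.sphere_subset_closedBall hζ)
  · intro p hp
    have hd : DifferentiableOn ℂ (fun ζ => f (p.1, ζ)) (Metric.closedBall z₀ (ε / 2)) :=
      hf.comp (f := fun ζ => (p.1, ζ)) (by fun_prop) fun ζ hζ => hsub _ hp.1 _ hζ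
    have hdc := (hd.mono Metric.closure_ball_subset_closedBall).diffContOnCl
    have h1 := hdc.two_pi_i_inv_smul_circleIntegral_sub_inv_smul hp.2
    have h2 := hdc.two_pi_i_inv_smul_circleIntegral_sub_inv_smul hz₀
    have hci : ∀ w ∈ Metric.ball z₀ (ε / 2),
        CircleIntegrable (fun ζ => (ζ - w)⁻¹ • f (p.1, ζ)) z₀ (ε / 2) := fun w hw =>
      ContinuousOn.circleIntegrable (by positivity)
        ((ContinuousOn.inv₀ (by fun_prop) fun ζ hζ => hne _ hζ _ hw).smul
          (hd.continuousOn.mono Metric.sphere_subset_closedBall))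
    have h3 : (∮ ζ in C(z₀, ε / 2), (ζ - p.2)⁻¹ • f (p.1, ζ)) -
        (∮ ζ in C(z₀, ε / 2), (ζ - z₀)⁻¹ • f (p.1, ζ)) =
        (p.2 - z₀) • ∮ ζ in C(z₀, ε / 2), (ζ - z₀)⁻¹ * (ζ - p.2)⁻¹ * f (p.1, ζ) := by
      rw [← circleIntegral.integral_sub (hci _ hp.2) (hci _ hz₀), ← circleIntegral.integral_smul]
      refine circleIntegral.integral_congr (by positivity) fun ζ hζ => ?_
      have e1 := hne _ hζ _ hp.2
      have e2 := hne _ hζ _ hz₀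
      simp only [smul_eq_mul]
      field_simp
      ring
    have h4 := congrArg (fun x => (2 * Real.pi * Complex.I : ℂ)⁻¹ • x) h3
    simp only [smul_sub] at h4
    rw [h1, h2] at h4
    simp only [smul_eq_mul] at h4 ⊢
    linear_combination h4

/-- The partial derivative in the last coordinate of a holomorphic function is holomorphic. -/
theorem differentiableOn_deriv_snd [ProperSpace E] {s : Set (E × ℂ)} (hs : IsOpen s)
    {f : E × ℂ → ℂ} (hf : DifferentiableOn ℂ f s) :
    DifferentiableOn ℂ (fun p => fderiv ℂ f p (0, 1)) s := by
  intro p₀ hp₀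
  -- Division by c of f(t, z + c) - f(t, z), with (t, z) as parameters, gives a holomorphic quotient
  -- whose value at c = 0 is the derivative.
  have hs' : IsOpen {q : (E × ℂ) × ℂ | (q.1.1, q.1.2 + q.2) ∈ s} := hs.preimage (by fun_prop)
  have hf' : DifferentiableOn ℂ (fun q : (E × ℂ) × ℂ => f (q.1.1, q.1.2 + q.2))
      {q : (E × ℂ) × ℂ | (q.1.1, q.1.2 + q.2) ∈ s} :=
    hf.comp (f := fun q : (E × ℂ) × ℂ => (q.1.1, q.1.2 + q.2)) (by fun_prop) fun q hq => hq
  obtain ⟨ε, hε, hB, g, hg, hfg⟩ := exists_eq_add_mul hs' hf' (t₀ := p₀) (z₀ := 0) (by simpa)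
  have hε0 : (0 : ℂ) ∈ Metric.ball (0 : ℂ) ε := Metric.mem_ball_self hε
  have key : ∀ p ∈ Metric.ball p₀ ε, fderiv ℂ f p (0, 1) = g (p, 0) := by
    intro p hp
    have hps : p ∈ s := by simpa using hB (show (p, (0 : ℂ)) ∈ _ from ⟨hp, hε0⟩)
    have h1 : HasDerivAt (fun c : ℂ => f (p.1, p.2 + c)) (fderiv ℂ f p (0, 1)) 0 := by
      have h2 : HasDerivAt (fun c : ℂ => (p.1, p.2 + c)) ((0, 1) : E × ℂ) 0 :=
        (hasDerivAt_const _ _).prodMk (by simpa using (hasDerivAt_id (0 : ℂ)).const_add p.2)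
      refine HasFDerivAt.comp_hasDerivAt (0 : ℂ) (f := fun c : ℂ => (p.1, p.2 + c)) ?_ h2
      simpa using (hf.differentiableAt (hs.mem_nhds hps)).hasFDerivAt
    have h3 : HasDerivAt (fun c : ℂ => f (p.1, p.2) + c * g (p, c)) (g (p, 0)) 0 := by
      have hgd : DifferentiableAt ℂ (fun c : ℂ => g (p, c)) 0 := by
        refine DifferentiableAt.comp (0 : ℂ) (f := fun c : ℂ => (p, c)) ?_ (by fun_prop)
        exact hg.differentiableAt
          ((Metric.isOpen_ball.prod Metric.isOpen_ball).mem_nhds ⟨hp, hε0⟩)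
      simpa using ((hasDerivAt_id (0 : ℂ)).mul hgd.hasDerivAt).const_add (f (p.1, p.2))
    refine h1.unique (h3.congr_of_eventuallyEq ?_)
    filter_upwards [Metric.isOpen_ball.mem_nhds hε0] with c hc
    simpa using hfg (p, c) ⟨hp, hc⟩
  refine DifferentiableAt.differentiableWithinAt ?_
  have hg0 : DifferentiableAt ℂ (fun p => g (p, 0)) p₀ := by
    refine DifferentiableAt.comp p₀ (f := fun p => (p, (0 : ℂ))) ?_ (by fun_prop)
    exact hg.differentiableAt ((Metric.isOpen_ball.prod Metric.isOpen_ball).mem_nhds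
      ⟨Metric.mem_ball_self hε, hε0⟩)
  refine hg0.congr_of_eventuallyEq ?_
  filter_upwards [Metric.ball_mem_nhds p₀ hε] with p hp using key p hp

/-! ### Algebras of holomorphic functions -/

namespace Hol

variable {W W' : Opens E}

/-- The restriction to `W` of a function that is holomorphic there. -/
def ofDifferentiableOn (F : E → ℂ) (hF : DifferentiableOn ℂ F W) : Hol W :=
  ⟨fun x => F x, F, hF, fun _ => rfl⟩

open Classical in
/-- Extension by zero. -/
def extend (f : Hol W) : E → ℂ := fun x => if h : x ∈ W then f.1 ⟨x, h⟩ else 0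

theorem extend_apply (f : Hol W) {x : E} (h : x ∈ W) : (extend f) x = f.1 ⟨x, h⟩ := dif_pos h

theorem differentiableOn_extend (f : Hol W) : DifferentiableOn ℂ (extend f) W := by
  obtain ⟨F, hF, h⟩ := f.2
  exact hF.congr fun x hx => ((extend_apply f) hx).trans (h ⟨x, hx⟩)

theorem differentiableAt_extend (f : Hol W) {x : E} (h : x ∈ W) :
    DifferentiableAt ℂ (extend f) x :=
  (differentiableOn_extend f).differentiableAt (W.isOpen.mem_nhds h)

@[ext]
theorem ext_apply {f g : Hol W} (h : ∀ x : W, f.1 x = g.1 x) : f = g := Subtype.ext (funext h)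

/-- The restriction of a holomorphic function on `E × ℂ` to `E × {0}`. -/
def atZero {W' : Opens (E × ℂ)} (h : ∀ t ∈ W, (t, (0 : ℂ)) ∈ W') : Hol W' →ₐ[ℂ] Hol W where
  toFun f := ⟨fun t => f.1 ⟨(t.1, 0), h _ t.2⟩, by
    obtain ⟨F, hF, hf⟩ := f.2
    exact ⟨fun t => F (t, 0), hF.comp (f := fun t => (t, (0 : ℂ))) (by fun_prop) h,
      fun x => hf _⟩⟩
  map_one' := rfl
  map_mul' _ _ := rfl
  map_zero' := rfl
  map_add' _ _ := rfl
  commutes' _ := rfl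

theorem exists_mul_eq_one (f : Hol W) (h : ∀ x, f.1 x ≠ 0) : ∃ g : Hol W, f * g = 1 := by
  refine ⟨ofDifferentiableOn (fun x => ((extend f) x)⁻¹)
    ((differentiableOn_extend f).inv fun x hx => ?_), ?_⟩
  · rw [(extend_apply f) hx]; exact h _
  · ext x
    change f.1 x * ((extend f) x)⁻¹ = 1
    rw [(extend_apply f) x.2]; exact mul_inv_cancel₀ (h x)

/-- The open set where a holomorphic function does not vanish. -/
def support (f : Hol W) : Opens E where
  carrier := {x | (extend f) x ≠ 0} ∩ W
  is_open' := by
    rw [Set.inter_comm]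
    exact (differentiableOn_extend f).continuousOn.isOpen_inter_preimage W.isOpen
      isOpen_compl_singleton

theorem support_le (f : Hol W) : (support f) ≤ W := fun _ h => h.2

theorem mem_support (f : Hol W) {x : E} (h : x ∈ W) : x ∈ (support f) ↔ f.1 ⟨x, h⟩ ≠ 0 := by
  rw [← (extend_apply f) h]; exact and_iff_left h

/-- Dividing by the value at x moves the function into the slit plane near x, where half the
principal logarithm yields a root; c restores the value at x. -/
theorem exists_sqrt (f : Hol W) {x : E} (hx : x ∈ W) (h : f.1 ⟨x, hx⟩ ≠ 0) :
    ∃ (W' : Opens E) (i : W' ≤ W) (g : Hol W'), x ∈ W' ∧ g * g = Hol.res i f := by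
  obtain ⟨c, hc⟩ : ∃ c : ℂ, c * c = f.1 ⟨x, hx⟩ := by
    obtain ⟨c, hc⟩ := IsAlgClosed.exists_pow_nat_eq (f.1 ⟨x, hx⟩) (n := 2) (by norm_num)
    exact ⟨c, by rw [← hc, sq]⟩
  set W' : Opens E := ⟨W ∩ (fun y => (extend f) y / f.1 ⟨x, hx⟩) ⁻¹' Complex.slitPlane,
    ((differentiableOn_extend f).continuousOn.div_const _).isOpen_inter_preimage W.isOpen
      Complex.isOpen_slitPlane⟩ with hW'
  have hmem : ∀ y ∈ W', (extend f) y / f.1 ⟨x, hx⟩ ∈ Complex.slitPlane := fun y hy => hy.2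
  have hd : DifferentiableOn ℂ (fun y => (extend f) y / f.1 ⟨x, hx⟩) W' := by
    simp only [div_eq_mul_inv]
    exact ((differentiableOn_extend f).mono Set.inter_subset_left).mul_const _
  refine ⟨W', fun y hy => hy.1, ofDifferentiableOn (fun y => c * Complex.exp
    (Complex.log ((extend f) y / f.1 ⟨x, hx⟩) / 2))
    (by simpa only [div_eq_mul_inv] using ((hd.clog hmem).mul_const 2⁻¹).cexp.const_mul c), ⟨hx, ?_⟩, ?_⟩
  · change (extend f) x / f.1 ⟨x, hx⟩ ∈ Complex.slitPlane
    rw [(extend_apply f) hx, div_self h]; exact Complex.one_mem_slitPlane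
  · ext y
    change (c * Complex.exp _) * (c * Complex.exp _) = f.1 ⟨y.1, y.2.1⟩
    rw [mul_mul_mul_comm, ← Complex.exp_add, add_halves,
      Complex.exp_log (Complex.slitPlane_ne_zero (hmem y.1 y.2)), hc, (extend_apply f) y.2.1]
    exact mul_div_cancel₀ _ h

section

variable [ProperSpace E] {W W' : Opens (E × ℂ)}

/-- The derivative of a holomorphic function in the last coordinate. -/
def dz : Hol W →ₗ[ℂ] Hol W where
  toFun f := ofDifferentiableOn _ (differentiableOn_deriv_snd W.isOpen (differentiableOn_extend f))
  map_add' f g := by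
    ext x
    change fderiv ℂ (extend (f + g)) x.1 (0, 1) =
      fderiv ℂ (extend f) x.1 (0, 1) + fderiv ℂ (extend g) x.1 (0, 1)
    have : (extend (f + g)) = fun x => (extend f) x + (extend g) x := by
      ext x; by_cases h : x ∈ W <;> simp [extend, h]
    rw [this, fderiv_fun_add ((differentiableAt_extend f) x.2) ((differentiableAt_extend g) x.2)]
    rfl
  map_smul' c f := by
    ext x
    change fderiv ℂ (extend (c • f)) x.1 (0, 1) = c • fderiv ℂ (extend f) x.1 (0, 1)
    have : (extend (c • f)) = fun x => c • (extend f) x := by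
      ext x; by_cases h : x ∈ W <;> simp [extend, h]
    rw [this, fderiv_fun_const_smul ((differentiableAt_extend f) x.2)]
    rfl

theorem dz_mul (f g : Hol W) : dz (f * g) = dz f * g + f * dz g := by
  ext x
  change fderiv ℂ (extend (f * g)) x.1 (0, 1) =
    fderiv ℂ (extend f) x.1 (0, 1) * g.1 x + f.1 x * fderiv ℂ (extend g) x.1 (0, 1)
  have : (extend (f * g)) = fun x => (extend f) x * (extend g) x := by
    ext x; by_cases h : x ∈ W <;> simp [extend, h]
  rw [this, fderiv_fun_mul ((differentiableAt_extend f) x.2) ((differentiableAt_extend g) x.2)]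
  simp only [add_apply, smul_apply, smul_eq_mul,
    extend_apply _ x.2]
  ring

theorem dz_eq {f : Hol W} {F : E × ℂ → ℂ} {x : W} {c : ℂ} (h : ∀ y : W, f.1 y = F y)
    (hF : HasFDerivAt F (c • ContinuousLinearMap.snd ℂ E ℂ) x.1 ) : (dz f).1 x = c := by
  change fderiv ℂ _ x.1 _ = _
  have : (extend f) =ᶠ[𝓝 x.1] F := by
    filter_upwards [W.isOpen.mem_nhds x.2] with y hy
    rw [(extend_apply f) hy, h]
  rw [this.fderiv_eq, hF.fderiv]; simp

theorem dz_res (i : W' ≤ W) (f : Hol W) : dz (Hol.res i f) = Hol.res i (dz f) := by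
  ext x
  change fderiv ℂ _ x.1 _ = fderiv ℂ _ x.1 _
  have : (extend (Hol.res i f)) =ᶠ[𝓝 x.1] (extend f) := by
    filter_upwards [W'.isOpen.mem_nhds x.2] with y hy
    rw [extend_apply _ hy, extend_apply _ (i hy)]; rfl
  rw [this.fderiv_eq]

theorem dz_ofFst {W₀ : Opens E} (i : ∀ p ∈ W, p.1 ∈ W₀) (f : Hol W₀) :
    dz (Hol.ofFst i f) = 0 := by
  ext x
  change fderiv ℂ _ x.1 _ = 0
  have : (extend (Hol.ofFst i f)) =ᶠ[𝓝 x.1] fun p => (extend f) p.1 := by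
    filter_upwards [W.isOpen.mem_nhds x.2] with y hy
    rw [extend_apply _ hy, extend_apply _ (i y hy)]; rfl
  rw [this.fderiv_eq]
  have h : HasFDerivAt (fun p : E × ℂ => (extend f) p.1) _ x.1 :=
    ((differentiableAt_extend f) (i _ x.2)).hasFDerivAt.comp x.1 hasFDerivAt_fst
  rw [h.fderiv]; simp

theorem dz_snd (i : W ≤ ⊤) : dz (Hol.res i Hol.snd : Hol W) = 1 := by
  ext x
  refine dz_eq (F := fun p => p.2) (fun _ => rfl) ?_
  change HasFDerivAt _ ((1 : ℂ) • _) _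
  rw [one_smul]; exact hasFDerivAt_snd

/-- Every holomorphic function near a point of `E × {0}` is, up to a multiple of the last
coordinate, independent of it. -/
theorem exists_eq_ofFst_add_snd_mul (f : Hol W) {t : E} (ht : (t, (0 : ℂ)) ∈ W) :
    ∃ (W' : Opens (E × ℂ)) (i : W' ≤ W) (W₀ : Opens E) (i₀ : ∀ p ∈ W', p.1 ∈ W₀)
      (f₀ : Hol W₀) (g : Hol W'), (t, (0 : ℂ)) ∈ W' ∧
      Hol.res i f = Hol.ofFst i₀ f₀ + Hol.res le_top Hol.snd * g := by
  obtain ⟨ε, hε, hB, g, hg, hfg⟩ := exists_eq_add_mul W.isOpen (differentiableOn_extend f) ht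
  have h0 : ∀ t' ∈ Metric.ball t ε, (t', (0 : ℂ)) ∈ W := fun t' ht' =>
    hB ⟨ht', Metric.mem_ball_self hε⟩
  refine ⟨⟨_, Metric.isOpen_ball.prod Metric.isOpen_ball⟩, hB, ⟨_, Metric.isOpen_ball⟩,
    fun p hp => hp.1, atZero h0 f, ofDifferentiableOn g hg,
    ⟨Metric.mem_ball_self hε, Metric.mem_ball_self hε⟩, ?_⟩
  ext p
  have h := hfg p.1 p.2
  rw [(extend_apply f) (hB p.2), (extend_apply f) (h0 _ p.2.1), sub_zero] at h
  exact h

end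

end Hol

end Analysis

namespace SuperSpace

variable (X : SuperSpace) {U V : Opens X.space}

/-! ### Locality and gluing -/

theorem eq_of_cover {ι : Type} (U : ι → Opens X.space) {V : Opens X.space} (hU : ∀ i, U i ≤ V)
    (hc : ∀ x ∈ V, ∃ i, x ∈ U i) {a b : X.Γ V} (h : ∀ i, X.res (hU i) a = X.res (hU i) b) :
    a = b := by
  obtain ⟨c, -, hc'⟩ := X.existsUnique_gluing U V hU hc (fun i => X.res (hU i) b)
    fun i j => by rw [X.res_res, X.res_res]
  exact (hc' a h).trans (hc' b fun _ => rfl).symm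

theorem eq_of_local {a b : X.Γ V} (h : ∀ x ∈ V, ∃ (U : Opens X.space) (hU : U ≤ V),
    x ∈ U ∧ X.res hU a = X.res hU b) : a = b := by
  choose! U hU hx he using h
  exact X.eq_of_cover (fun x : V => U x.1) (fun x => hU x.1 x.2) (fun x hxV => ⟨⟨x, hxV⟩, hx x hxV⟩)
    fun x => he x.1 x.2

/-- Gluing of the solutions of a condition that restricts and has at most one solution on each open
set. The glued section agrees with every local solution, not only with those chosen for gluing, so
later proofs need not unfold the choice. -/
theorem exists_section_of_local (P : ∀ U : Opens X.space, U ≤ V → X.Γ U → Prop)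
    (hres : ∀ (U U' : Opens X.space) (h : U ≤ V) (h' : U' ≤ U) (a : X.Γ U), P U h a →
      P U' (h'.trans h) (X.res h' a))
    (huniq : ∀ (U : Opens X.space) (h : U ≤ V) (a b : X.Γ U), P U h a → P U h b → a = b)
    (hex : ∀ x ∈ V, ∃ (U : Opens X.space) (h : U ≤ V) (a : X.Γ U), x ∈ U ∧ P U h a) :
    ∃ a : X.Γ V, ∀ (U : Opens X.space) (h : U ≤ V) (b : X.Γ U), P U h b → X.res h a = b := by
  choose! U hU s hx hs using hex
  obtain ⟨a, ha, -⟩ := X.existsUnique_gluing (fun x : V => U x.1) V (fun x => hU x.1 x.2)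
    (fun x hxV => ⟨⟨x, hxV⟩, hx x hxV⟩) (fun x => s x.1) fun x y =>
      huniq _ (inf_le_left.trans (hU x.1 x.2)) _ _ (hres _ _ _ _ _ (hs x.1 x.2))
        (hres _ _ _ _ _ (hs y.1 y.2))
  refine ⟨a, fun U' h b hb => ?_⟩
  refine X.eq_of_local fun x hxU => ⟨U x ⊓ U', inf_le_right, ⟨hx x (h hxU), hxU⟩, ?_⟩
  have h1 := hres _ _ _ (inf_le_left : U x ⊓ U' ≤ U x) _ (hs x (h hxU))
  have h2 := hres _ _ _ (inf_le_right : U x ⊓ U' ≤ U') _ hb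
  rw [X.res_res, ← huniq _ _ _ _ h1 h2, ← ha ⟨x, h hxU⟩, X.res_res]

theorem subsingleton_of_eq_bot (h : ∀ x, x ∉ V) (a b : X.Γ V) : a = b :=
  X.eq_of_local fun x hx => (h x hx).elim

/-! ### Parity -/

theorem exists_parts (a : X.Γ U) : ∃ a₀ ∈ X.part U 0, ∃ a₁ ∈ X.part U 1, a = a₀ + a₁ := by
  have h : a ∈ X.part U 0 ⊔ X.part U 1 := by rw [(X.isCompl U).sup_eq_top]; trivial
  obtain ⟨a₀, h₀, a₁, h₁, rfl⟩ := Submodule.mem_sup.1 h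
  exact ⟨a₀, h₀, a₁, h₁, rfl⟩

theorem eq_zero_of_mem_of_mem {a : X.Γ U} (h₀ : a ∈ X.part U 0) (h₁ : a ∈ X.part U 1) : a = 0 :=
  Submodule.disjoint_def.1 (X.isCompl U).disjoint a h₀ h₁

/-- The grading involution: `bar a = a` for even and `bar a = -a` for odd `a`. -/
def bar : X.Γ U →ₗ[ℂ] X.Γ U :=
  2 • (X.part U 0).projection _ (X.isCompl U) - LinearMap.id

theorem bar_of_even {a : X.Γ U} (h : a ∈ X.part U 0) : X.bar a = a := by
  have := Submodule.projection_apply_left (X.isCompl U) ⟨a, h⟩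
  simp only [bar, LinearMap.sub_apply, LinearMap.smul_apply, this, LinearMap.id_apply]
  rw [two_smul]; abel

theorem bar_of_odd {a : X.Γ U} (h : a ∈ X.part U 1) : X.bar a = -a := by
  have := (Submodule.projection_apply_eq_zero_iff (X.isCompl U)).2 h
  simp only [bar, LinearMap.sub_apply, LinearMap.smul_apply, this, smul_zero,
    LinearMap.id_apply, zero_sub]

theorem bar_bar (a : X.Γ U) : X.bar (X.bar a) = a := by
  obtain ⟨a₀, h₀, a₁, h₁, rfl⟩ := X.exists_parts a
  simp [X.bar_of_even h₀, X.bar_of_odd h₁]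

theorem self_eq_zero_of_eq_neg {a : X.Γ U} (h : a = -a) : a = 0 := by
  have h2 : (2 : ℂ) • a = 0 := by rw [two_smul]; nth_rewrite 1 [h]; simp
  exact (smul_eq_zero_iff_right (by norm_num)).1 h2

theorem mem_even_iff {a : X.Γ U} : a ∈ X.part U 0 ↔ X.bar a = a := by
  refine ⟨X.bar_of_even, fun h => ?_⟩
  obtain ⟨a₀, h₀, a₁, h₁, rfl⟩ := X.exists_parts a
  rw [map_add, X.bar_of_even h₀, X.bar_of_odd h₁] at h
  rw [X.self_eq_zero_of_eq_neg (add_left_cancel h).symm, add_zero]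
  exact h₀

theorem mem_odd_iff {a : X.Γ U} : a ∈ X.part U 1 ↔ X.bar a = -a := by
  refine ⟨X.bar_of_odd, fun h => ?_⟩
  obtain ⟨a₀, h₀, a₁, h₁, rfl⟩ := X.exists_parts a
  rw [map_add, X.bar_of_even h₀, X.bar_of_odd h₁, neg_add] at h
  rw [X.self_eq_zero_of_eq_neg (add_right_cancel h), zero_add]
  exact h₁

theorem sgn_zero_left (i : ZMod 2) : sgn 0 i = 1 := by simp [sgn]
theorem sgn_zero_right (i : ZMod 2) : sgn i 0 = 1 := by simp [sgn]
theorem sgn_one_one : sgn 1 1 = -1 := by simp [sgn]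

theorem bar_eq_sgn_smul {i : ZMod 2} {a : X.Γ U} (h : a ∈ X.part U i) :
    X.bar a = sgn 1 i • a := by
  rcases zmod_cases i with rfl | rfl
  · rw [X.bar_of_even h, sgn_zero_right, one_smul]
  · rw [X.bar_of_odd h, sgn_one_one, neg_one_smul]

theorem mem_part_iff {i : ZMod 2} {a : X.Γ U} : a ∈ X.part U i ↔ X.bar a = sgn 1 i • a := by
  rcases zmod_cases i with rfl | rfl
  · rw [X.mem_even_iff, sgn_zero_right, one_smul]
  · rw [X.mem_odd_iff, sgn_one_one, neg_one_smul]

theorem bar_mul (a b : X.Γ U) : X.bar (a * b) = X.bar a * X.bar b := by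
  obtain ⟨a₀, h₀, a₁, h₁, rfl⟩ := X.exists_parts a
  obtain ⟨b₀, k₀, b₁, k₁, rfl⟩ := X.exists_parts b
  have e00 := X.mul_mem h₀ k₀
  have e01 := X.mul_mem h₀ k₁
  have e10 := X.mul_mem h₁ k₀
  have e11 := X.mul_mem h₁ k₁
  rw [add_zero] at e00 e10
  rw [zero_add] at e01
  rw [show (1 : ZMod 2) + 1 = 0 from rfl] at e11
  simp only [add_mul, mul_add, map_add, X.bar_of_even e00, X.bar_of_odd e01, X.bar_of_odd e10,
    X.bar_of_even e11, X.bar_of_even h₀, X.bar_of_even k₀, X.bar_of_odd h₁, X.bar_of_odd k₁,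
    mul_neg, neg_mul]
  abel

theorem bar_one : X.bar (1 : X.Γ U) = 1 := X.bar_of_even (X.one_mem U)

theorem bar_res (h : V ≤ U) (a : X.Γ U) : X.bar (X.res h a) = X.res h (X.bar a) := by
  obtain ⟨a₀, h₀, a₁, h₁, rfl⟩ := X.exists_parts a
  simp [X.bar_of_even h₀, X.bar_of_odd h₁, X.bar_of_even (X.res_mem h h₀),
    X.bar_of_odd (X.res_mem h h₁)]

theorem even_comm {a : X.Γ U} (h : a ∈ X.part U 0) (b : X.Γ U) : a * b = b * a := by
  obtain ⟨b₀, k₀, b₁, k₁, rfl⟩ := X.exists_parts b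
  rw [mul_add, add_mul, X.super_comm h k₀, X.super_comm h k₁]
  simp [sgn_zero_left]

theorem odd_mul {a : X.Γ U} (h : a ∈ X.part U 1) (b : X.Γ U) : a * b = X.bar b * a := by
  obtain ⟨b₀, k₀, b₁, k₁, rfl⟩ := X.exists_parts b
  rw [mul_add, map_add, add_mul, X.super_comm h k₀, X.super_comm h k₁, X.bar_of_even k₀,
    X.bar_of_odd k₁]
  simp [sgn_zero_right, sgn_one_one]

theorem odd_mul_odd {a b : X.Γ U} (h : a ∈ X.part U 1) (k : b ∈ X.part U 1) :
    a * b = -(b * a) := by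
  rw [X.odd_mul h, X.bar_of_odd k, neg_mul]

theorem odd_mul_self {a : X.Γ U} (h : a ∈ X.part U 1) : a * a = 0 :=
  X.self_eq_zero_of_eq_neg (X.odd_mul_odd h h)

theorem odd_mul_mul_self {a : X.Γ U} (h : a ∈ X.part U 1) (b : X.Γ U) : a * b * a = 0 := by
  rw [X.odd_mul h, mul_assoc, X.odd_mul_self h, mul_zero]

/-- The square of a b is (a b a) b, which vanishes because a is odd; b may be arbitrary. -/
theorem isUnit_one_sub_odd_mul_odd {a b : X.Γ U} (h : a ∈ X.part U 1) :
    IsUnit (1 - a * b) := by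
  have hn : IsNilpotent (a * b) :=
    ⟨2, by rw [sq, ← mul_assoc, X.odd_mul_mul_self h, zero_mul]⟩
  exact hn.isUnit_one_sub

/-- The grading involution fixes a, so it sends the inverse of a to an inverse of a. -/
theorem even_inv {a b : X.Γ U} (h : a ∈ X.part U 0) (hab : a * b = 1) : b ∈ X.part U 0 := by
  rw [X.mem_even_iff]
  have h1 : a * X.bar b = 1 := by
    rw [← X.bar_one, ← hab, X.bar_mul, X.bar_of_even h]
  have h2 : b * a = 1 := by rw [← X.even_comm h, hab]
  calc X.bar b = b * a * X.bar b := by rw [h2, one_mul]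
    _ = b := by rw [mul_assoc, h1, mul_one]

theorem mem_part_of_local {i : ZMod 2} {a : X.Γ V} (h : ∀ x ∈ V, ∃ (U : Opens X.space)
    (hU : U ≤ V), x ∈ U ∧ X.res hU a ∈ X.part U i) : a ∈ X.part V i := by
  rw [X.mem_part_iff]
  refine X.eq_of_local fun x hx => ?_
  obtain ⟨U, hU, hxU, ha⟩ := h x hx
  exact ⟨U, hU, hxU, by rw [← X.bar_res, map_smul, X.mem_part_iff.1 ha]⟩

theorem isUnit_res {a : X.Γ U} (h : V ≤ U) (ha : IsUnit a) : IsUnit (X.res h a) :=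
  ha.map (X.res h)

/-- The even sections. -/
def evenSubalgebra (U : Opens X.space) : Subalgebra ℂ (X.Γ U) where
  carrier := X.part U 0
  mul_mem' h k := by simpa using X.mul_mem h k
  add_mem' h k := add_mem h k
  algebraMap_mem' c := by
    rw [Algebra.algebraMap_eq_smul_one]
    exact (X.part U 0).smul_mem c (X.one_mem U)

/-- This makes commutative algebra, in particular Newton's method, applicable to even sections. -/
instance (U : Opens X.space) : CommRing (X.evenSubalgebra U) where
  mul_comm a b := Subtype.ext (X.even_comm a.2 b.1)

/-- An even section that differs by a nilpotent from an invertible square is a square. -/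
theorem exists_mul_self_eq {s a : X.Γ U} (hs : s ∈ X.part U 0) (ha : a ∈ X.part U 0)
    (hu : IsUnit a) (hn : IsNilpotent (a * a - s)) :
    ∃ b ∈ X.part U 0, b * b = s ∧ IsUnit b := by
  obtain ⟨a', ha'⟩ := hu.exists_right_inv
  set a₀ : X.evenSubalgebra U := ⟨a, ha⟩
  set s₀ : X.evenSubalgebra U := ⟨s, hs⟩
  have hua : IsUnit a₀ :=
    IsUnit.of_mul_eq_one ⟨a', X.even_inv ha ha'⟩ (Subtype.ext ha')
  -- Newton's method for the root of X² - s starting from a: the value a² - s is nilpotent and the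
  -- derivative 2a is a unit.
  let P : Polynomial (X.evenSubalgebra U) := Polynomial.X ^ 2 - Polynomial.C s₀
  have h1 : IsNilpotent (Polynomial.aeval a₀ P) := by
    obtain ⟨n, hn⟩ := hn
    refine ⟨n, Subtype.ext ?_⟩
    simpa [P, sq, a₀, s₀] using hn
  have h2 : IsUnit (Polynomial.aeval a₀ (Polynomial.derivative P)) := by
    have h3 : Polynomial.aeval a₀ (Polynomial.derivative P) = (2 : ℂ) • a₀ := by
      simp [P, two_smul, one_add_one_eq_two, two_mul]
    rw [h3]
    exact hua.smul (Units.mk0 (2 : ℂ) two_ne_zero)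
  obtain ⟨b, ⟨hb1, hb⟩, -⟩ := Polynomial.existsUnique_nilpotent_sub_and_aeval_eq_zero h1 h2
  have hbs : b * b = s₀ := by
    simpa [P, sub_eq_zero, sq] using hb
  have hub : IsUnit b := by
    have := hb1.neg.isUnit_add_left_of_commute hua (Commute.all _ _)
    rwa [neg_sub, add_sub_cancel] at this
  exact ⟨b.1, b.2, congrArg Subtype.val hbs, hub.map (X.evenSubalgebra U).subtype⟩

end SuperSpace

/-! ### Calculus of relative vector fields and forms -/

section VF

variable {X T : SuperSpace} {π : Hom X T} {U : Opens X.space}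

namespace Hom

theorem pull_bar (π : Hom X T) {V : Opens T.space} (c : T.Γ V) :
    π.pull V (T.bar c) = X.bar (π.pull V c) := by
  obtain ⟨a₀, h₀, a₁, h₁, rfl⟩ := T.exists_parts c
  simp [T.bar_of_even h₀, T.bar_of_odd h₁, X.bar_of_even (π.pull_mem h₀),
    X.bar_of_odd (π.pull_mem h₁)]

end Hom

namespace RelVF

theorem leibniz_even (ξ : RelVF π 0 U) {U' : Opens X.space} (h : U' ≤ U) (s s' : X.Γ U') :
    ξ.app U' h (s * s') = ξ.app U' h s * s' + s * ξ.app U' h s' := by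
  obtain ⟨a₀, h₀, a₁, h₁, rfl⟩ := X.exists_parts s
  rw [add_mul, map_add, ξ.leibniz h h₀, ξ.leibniz h h₁, map_add, add_mul, add_mul,
    SuperSpace.sgn_zero_left, SuperSpace.sgn_zero_left, one_smul, one_smul]
  abel

/-- The sign is carried by the involution, so s need not be homogeneous. -/
theorem leibniz_odd (ξ : RelVF π 1 U) {U' : Opens X.space} (h : U' ≤ U) (s s' : X.Γ U') :
    ξ.app U' h (s * s') = ξ.app U' h s * s' + X.bar s * ξ.app U' h s' := by
  obtain ⟨a₀, h₀, a₁, h₁, rfl⟩ := X.exists_parts s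
  rw [add_mul, map_add, ξ.leibniz h h₀, ξ.leibniz h h₁, map_add, add_mul, map_add, add_mul,
    ← smul_mul_assoc, ← smul_mul_assoc, ← X.bar_eq_sgn_smul h₀, ← X.bar_eq_sgn_smul h₁]
  abel

theorem app_one {p : ZMod 2} (ξ : RelVF π p U) {U' : Opens X.space} (h : U' ≤ U) :
    ξ.app U' h 1 = 0 := by
  have := ξ.leibniz h (X.one_mem U') 1
  rw [SuperSpace.sgn_zero_right, one_smul, mul_one, mul_one, one_mul] at this
  exact left_eq_add.1 this

theorem app_odd_mem (ξ : RelVF π 1 U) {U' : Opens X.space} (h : U' ≤ U) {s : X.Γ U'}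
    (hs : s ∈ X.part U' 1) : ξ.app U' h s ∈ X.part U' 0 := ξ.app_mem h hs

theorem app_even_mem (ξ : RelVF π 1 U) {U' : Opens X.space} (h : U' ≤ U) {s : X.Γ U'}
    (hs : s ∈ X.part U' 0) : ξ.app U' h s ∈ X.part U' 1 := by
  simpa using ξ.app_mem h hs

/-- The product of a vector field with an even function. -/
def smulEven {p : ZMod 2} (a : X.Γ U) (ha : a ∈ X.part U 0) (ξ : RelVF π p U) : RelVF π p U where
  app U' h := LinearMap.mulLeft ℂ (X.res h a) ∘ₗ ξ.app U' h
  app_res h h' s := by simp [ξ.app_res h h', X.res_res]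
  app_mem h i s hs := by
    simpa using X.mul_mem (X.res_mem h ha) (ξ.app_mem h hs)
  leibniz {U'} h i s hs s' := by
    simp only [LinearMap.comp_apply, LinearMap.mulLeft_apply, ξ.leibniz h hs, mul_add,
      mul_smul_comm, ← mul_assoc]
    rw [X.even_comm (X.res_mem h ha) s]
  app_pull h V hV f := by simp [ξ.app_pull h hV]

theorem smulEven_app {p : ZMod 2} (a : X.Γ U) (ha : a ∈ X.part U 0) (ξ : RelVF π p U)
    {U' : Opens X.space} (h : U' ≤ U) (s : X.Γ U') :
    (smulEven a ha ξ).app U' h s = X.res h a * ξ.app U' h s := rfl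

theorem IsComb.res {p a b : ZMod 2} {ξ : RelVF π p U} {f g : X.Γ U} {ζ : RelVF π a U}
    {ζ' : RelVF π b U} (H : ξ.IsComb f ζ g ζ') {U' : Opens X.space} (h : U' ≤ U) :
    (ξ.res h).IsComb (X.res h f) (ζ.res h) (X.res h g) (ζ'.res h) := by
  intro V hV s
  rw [X.res_res, X.res_res]
  exact H V (hV.trans h) s

theorem IsMul.isComb {p a : ZMod 2} {ξ : RelVF π p U} {f : X.Γ U} {ζ : RelVF π a U}
    (H : ξ.IsMul f ζ) : ξ.IsComb f ζ 0 ζ := by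
  intro V hV s
  rw [H V hV s, map_zero, zero_mul, add_zero]

end RelVF

namespace RelForm

variable {V : Opens X.space}

theorem apply_res (ω : RelForm π U) {U' U'' : Opens X.space} (h : U' ≤ U) (h' : U'' ≤ U')
    {p : ZMod 2} (ξ : RelVF π p U') :
    ω.1 ⟨U'', h'.trans h⟩ p (ξ.res h') = X.res h' (ω.1 ⟨U', h⟩ p ξ) := ω.2.1 U' U'' h h' p ξ

theorem apply_isMul (ω : RelForm π U) {U' : Opens X.space} (h : U' ≤ U) {p a : ZMod 2}
    {ξ : RelVF π p U'} {f : X.Γ U'} {ζ : RelVF π a U'} (H : ξ.IsMul f ζ) :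
    ω.1 ⟨U', h⟩ p ξ = f * ω.1 ⟨U', h⟩ a ζ := by
  rw [ω.2.2 U' h p a a ξ f 0 ζ ζ H.isComb, zero_mul, add_zero]

theorem ext_apply {ω ω' : RelForm π U} (h : ∀ (U' : Opens X.space) (hU : U' ≤ U) (p : ZMod 2)
    (ξ : RelVF π p U'), ω.1 ⟨U', hU⟩ p ξ = ω'.1 ⟨U', hU⟩ p ξ) : ω = ω' :=
  Subtype.ext (funext fun U' => funext fun p => funext fun ξ => h U'.1 U'.2 p ξ)

theorem eq_of_local {ω ω' : RelForm π U} (h : ∀ x ∈ U, ∃ (U' : Opens X.space) (h' : U' ≤ U),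
    x ∈ U' ∧ res h' ω = res h' ω') : ω = ω' := by
  refine ext_apply fun U₁ h₁ p ξ => X.eq_of_local fun x hx => ?_
  obtain ⟨U', h', hx', he⟩ := h x (h₁ hx)
  refine ⟨U' ⊓ U₁, inf_le_right, ⟨hx', hx⟩, ?_⟩
  rw [← apply_res, ← apply_res]
  exact congrFun (congrFun (congrFun (congrArg Subtype.val he) ⟨U' ⊓ U₁, inf_le_left⟩) p)
    (ξ.res inf_le_right)

theorem exists_gluing {ι : Type} (U : ι → Opens X.space) (V : Opens X.space) (hU : ∀ i, U i ≤ V)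
    (hc : ∀ x ∈ V, ∃ i, x ∈ U i) (ω : ∀ i, RelForm π (U i))
    (hω : ∀ i j, res (inf_le_left : U i ⊓ U j ≤ U i) (ω i) =
      res (inf_le_right : U i ⊓ U j ≤ U j) (ω j)) :
    ∃ ω' : RelForm π V, ∀ i, res (hU i) ω' = ω i := by
  have hωapp : ∀ (i j : ι) (V' : Opens X.space) (h : V' ≤ U i) (h' : V' ≤ U j) (p : ZMod 2)
      (ξ : RelVF π p V'), (ω i).1 ⟨V', h⟩ p ξ = (ω j).1 ⟨V', h'⟩ p ξ := fun i j V' h h' p ξ =>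
    congrFun (congrFun (congrFun (congrArg Subtype.val (hω i j)) ⟨V', le_inf h h'⟩) p) ξ
  -- The value of the glued form on a field ξ over V' is itself glued, from the values of the forms
  -- `ω i` on the restrictions of ξ.
  have key : ∀ (V' : {V' : Opens X.space // V' ≤ V}) (p : ZMod 2) (ξ : RelVF π p V'.1),
      ∃ a : X.Γ V'.1, ∀ i, X.res (inf_le_right : U i ⊓ V'.1 ≤ V'.1) a =
        (ω i).1 ⟨U i ⊓ V'.1, inf_le_left⟩ p (ξ.res inf_le_right) := by
    intro V' p ξ
    refine (X.existsUnique_gluing (fun i => U i ⊓ V'.1) V'.1 (fun i => inf_le_right)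
      (fun x hx => (hc x (V'.2 hx)).imp fun i hi => ⟨hi, hx⟩)
      (fun i => (ω i).1 ⟨U i ⊓ V'.1, inf_le_left⟩ p (ξ.res inf_le_right)) fun i j => ?_).exists
    rw [← apply_res, ← apply_res]
    exact hωapp i j _ _ _ p _
  choose val hval using key
  have hval' : ∀ (V' : Opens X.space) (h : V' ≤ V) (p : ZMod 2) (ξ : RelVF π p V') (i : ι)
      (V'' : Opens X.space) (h' : V'' ≤ V') (hi : V'' ≤ U i),
      X.res h' (val ⟨V', h⟩ p ξ) = (ω i).1 ⟨V'', hi⟩ p (ξ.res h') := by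
    intro V' h p ξ i V'' h' hi
    have := congrArg (X.res (le_inf hi h' : V'' ≤ U i ⊓ V')) (hval ⟨V', h⟩ p ξ i)
    rw [X.res_res, ← apply_res] at this
    exact this
  refine ⟨⟨val, fun V' V'' h h' p ξ => ?_, fun V' h p a b ξ f g ζ ζ' H => ?_⟩, fun i => ?_⟩
  · refine X.eq_of_cover (fun i => U i ⊓ V'') (fun i => inf_le_right)
      (fun x hx => (hc x (h (h' hx))).imp fun i hi => ⟨hi, hx⟩) fun i => ?_
    rw [hval' _ _ _ _ i _ _ inf_le_left, X.res_res, hval' _ _ _ _ i _ _ inf_le_left]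
    rfl
  · refine X.eq_of_cover (fun i => U i ⊓ V') (fun i => inf_le_right)
      (fun x hx => (hc x (h hx)).imp fun i hi => ⟨hi, hx⟩) fun i => ?_
    rw [hval' _ _ _ _ i _ _ inf_le_left, map_add, map_mul, map_mul,
      hval' _ _ _ _ i _ _ inf_le_left, hval' _ _ _ _ i _ _ inf_le_left]
    exact (ω i).2.2 _ _ _ _ _ _ _ _ _ _ (H.res _)
  · refine ext_apply fun V' h p ξ => ?_
    have := hval' V' (h.trans (hU i)) p ξ i V' le_rfl h
    rw [X.res_self] at this
    exact this

theorem mem_closed_of_local {ω : RelForm π U} (h : ∀ x ∈ U, ∃ (U' : Opens X.space) (h' : U' ≤ U),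
    x ∈ U' ∧ res h' ω ∈ closed π U') : ω ∈ closed π U := by
  intro U₁ h₁ a b ξ ζ
  refine X.eq_of_local fun x hx => ?_
  obtain ⟨U', h', hx', he⟩ := h x (h₁ hx)
  refine ⟨U' ⊓ U₁, inf_le_right, ⟨hx', hx⟩, ?_⟩
  have := he (U' ⊓ U₁) inf_le_left a b (ξ.res inf_le_right) (ζ.res inf_le_right)
  rw [map_zero, map_sub, map_sub, map_smul, ← ξ.app_res, ← ζ.app_res, ← apply_res, ← apply_res,
    ← apply_res]
  exact this

theorem hasParity_of_local {p : ZMod 2} {ω : RelForm π U} (h : ∀ x ∈ U, ∃ (U' : Opens X.space)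
    (h' : U' ≤ U), x ∈ U' ∧ (res h' ω).HasParity p) : ω.HasParity p := by
  intro U₁ h₁ a ξ
  refine X.mem_part_of_local fun x hx => ?_
  obtain ⟨U', h', hx', he⟩ := h x (h₁ hx)
  refine ⟨U' ⊓ U₁, inf_le_right, ⟨hx', hx⟩, ?_⟩
  rw [← apply_res]
  exact he (U' ⊓ U₁) inf_le_left a (ξ.res inf_le_right)

theorem HasParity.zero {p : ZMod 2} : (0 : RelForm π U).HasParity p :=
  fun _ _ _ _ => zero_mem _

theorem HasParity.res {p : ZMod 2} {ω : RelForm π U} (h : ω.HasParity p) {U' : Opens X.space}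
    (h' : U' ≤ U) : (RelForm.res h' ω).HasParity p :=
  fun U'' hU a ξ => h U'' (hU.trans h') a ξ

theorem res_d (h : V ≤ U) (x : X.Γ U) : res h (d x : RelForm π U) = d (X.res h x) := by
  refine ext_apply fun U' hU p ξ => ?_
  change ξ.app U' le_rfl (X.res _ x) = ξ.app U' le_rfl (X.res _ (X.res h x))
  rw [X.res_res]

theorem d_apply (x : X.Γ U) {U' : Opens X.space} (h : U' ≤ U) {p : ZMod 2} (ξ : RelVF π p U') :
    (d x : RelForm π U).1 ⟨U', h⟩ p ξ = ξ.app U' le_rfl (X.res h x) := rfl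

theorem d_add (x y : X.Γ U) : (d (x + y) : RelForm π U) = d x + d y := by
  refine ext_apply fun U' hU p ξ => ?_
  change ξ.app U' le_rfl _ = ξ.app U' le_rfl _ + ξ.app U' le_rfl _
  rw [map_add, map_add]

theorem d_neg (x : X.Γ U) : (d (-x) : RelForm π U) = -d x := by
  refine ext_apply fun U' hU p ξ => ?_
  change ξ.app U' le_rfl _ = -ξ.app U' le_rfl _
  rw [map_neg, map_neg]

/-- Relative fields kill functions from the base. This is why translating a coordinate by such a
function leaves its differential unchanged. -/
theorem d_pull {V : Opens T.space} (hV : U ≤ Opens.comap π.base V) (c : T.Γ V) :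
    (d (X.res hV (π.pull V c)) : RelForm π U) = 0 := by
  refine ext_apply fun U' hU p ξ => ?_
  rw [d_apply, X.res_res, ξ.app_pull]
  rfl

/-- The first two terms of the closedness condition are by definition the supercommutator applied to
x, which the third term subtracts. -/
theorem d_mem_closed (x : X.Γ U) : (d x : RelForm π U) ∈ closed π U := by
  intro U' h a b ξ ζ
  simp only [d_apply, RelVF.bracket, LinearMap.sub_apply, LinearMap.comp_apply,
    LinearMap.smul_apply, sub_self]

theorem d_hasParity {p : ZMod 2} {x : X.Γ U} (hx : x ∈ X.part U p) :
    (d x : RelForm π U).HasParity p :=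
  fun _ h _ ξ => ξ.app_mem le_rfl (X.res_mem h hx)

theorem mulRight_apply (ω : RelForm π U) {V : Opens T.space} (hV : U ≤ Opens.comap π.base V)
    (c : T.Γ V) {U' : Opens X.space} (h : U' ≤ U) {p : ZMod 2} (ξ : RelVF π p U') :
    (ω.mulRight hV c).1 ⟨U', h⟩ p ξ = ω.1 ⟨U', h⟩ p ξ * X.res (h.trans hV) (π.pull V c) := rfl

theorem mulRight_res (ω : RelForm π U) {V V' : Opens T.space} (hV : U ≤ Opens.comap π.base V)
    (h : V' ≤ V) (hV' : U ≤ Opens.comap π.base V') (c : T.Γ V) :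
    ω.mulRight hV' (T.res h c) = ω.mulRight hV c := by
  refine ext_apply fun U' hU p ξ => ?_
  rw [mulRight_apply, mulRight_apply, π.pull_res, X.res_res]

end RelForm

end VF

/-! ### Monomials in odd sections -/

section Monomials

variable {n : ℕ}

/-- The product of the `η k`, `k ∈ I`, in increasing order. -/
def oddMonomial {A : Type} [Ring A] (η : Fin n → A) (I : Finset (Fin n)) : A :=
  ((I.sort (· ≤ ·)).map η).prod

/-- Each exchange of neighbours contributes a factor -1. The scalar is chosen before the superspace
and the odd sections, so that products can be computed on tuples of coefficients alone. -/
theorem exists_prod_map_eq_of_perm {l l' : List (Fin n)} (h : l.Perm l') :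
    ∃ ε : ℂ, ∀ (X : SuperSpace) (U : Opens X.space) (η : Fin n → X.Γ U),
      (∀ k, η k ∈ X.part U 1) → (l.map η).prod = ε • (l'.map η).prod := by
  induction h with
  | nil => exact ⟨1, fun X U η _ => by simp⟩
  | cons a _ ih =>
    obtain ⟨ε, h⟩ := ih
    exact ⟨ε, fun X U η hη => by simp [h X U η hη]⟩
  | swap a b l =>
    refine ⟨-1, fun X U η hη => ?_⟩
    simp only [List.map_cons, List.prod_cons, ← mul_assoc]
    rw [X.odd_mul_odd (hη b) (hη a), neg_one_smul, neg_mul]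
  | trans _ _ ih ih' =>
    obtain ⟨ε, h⟩ := ih
    obtain ⟨ε', h'⟩ := ih'
    exact ⟨ε * ε', fun X U η hη => by rw [h X U η hη, h' X U η hη, smul_smul]⟩

theorem exists_prod_map_eq (l : List (Fin n)) :
    ∃ (ε : ℂ) (J : Finset (Fin n)), ∀ (X : SuperSpace) (U : Opens X.space) (η : Fin n → X.Γ U),
      (∀ k, η k ∈ X.part U 1) → (l.map η).prod = ε • oddMonomial η J := by
  by_cases hl : l.Nodup
  · have hp : l.Perm (l.toFinset.sort (· ≤ ·)) := by
      rw [List.perm_ext_iff_of_nodup hl (Finset.sort_nodup _ _)]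
      simp
    obtain ⟨ε, h⟩ := exists_prod_map_eq_of_perm hp
    exact ⟨ε, l.toFinset, h⟩
  · obtain ⟨a, ha⟩ := List.exists_duplicate_iff_not_nodup.2 hl
    obtain ⟨l', hl'⟩ := (List.duplicate_iff_sublist.1 ha).exists_perm_append
    obtain ⟨ε, h⟩ := exists_prod_map_eq_of_perm hl'
    -- A repeated odd factor, brought to the front, squares to zero; the index set is then
    -- irrelevant.
    refine ⟨0, ∅, fun X U η hη => ?_⟩
    rw [h X U η hη]
    simp [← mul_assoc, X.odd_mul_self (hη a)]

theorem exists_oddMonomial_mul (I J : Finset (Fin n)) :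
    ∃ (ε : ℂ) (K : Finset (Fin n)), ∀ (X : SuperSpace) (U : Opens X.space) (η : Fin n → X.Γ U),
      (∀ k, η k ∈ X.part U 1) → oddMonomial η I * oddMonomial η J = ε • oddMonomial η K := by
  obtain ⟨ε, K, h⟩ := exists_prod_map_eq (I.sort (· ≤ ·) ++ J.sort (· ≤ ·))
  refine ⟨ε, K, fun X U η hη => ?_⟩
  rw [← h X U η hη, List.map_append, List.prod_append]
  rfl

/-- The coefficient in the product of two monomials in odd variables. -/
def mulSign (I J : Finset (Fin n)) : ℂ := (exists_oddMonomial_mul I J).choose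

/-- The index set of the product of two monomials in odd variables. -/
def mulSet (I J : Finset (Fin n)) : Finset (Fin n) := (exists_oddMonomial_mul I J).choose_spec.choose

variable {X : SuperSpace} {U : Opens X.space} {η : Fin n → X.Γ U}

theorem oddMonomial_mul (hη : ∀ k, η k ∈ X.part U 1) (I J : Finset (Fin n)) :
    oddMonomial η I * oddMonomial η J = mulSign I J • oddMonomial η (mulSet I J) :=
  (exists_oddMonomial_mul I J).choose_spec.choose_spec X U η hη

theorem oddMonomial_empty : oddMonomial η ∅ = 1 := by simp [oddMonomial]

theorem bar_oddMonomial (hη : ∀ k, η k ∈ X.part U 1) (I : Finset (Fin n)) :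
    X.bar (oddMonomial η I) = (-1 : ℂ) ^ I.card • oddMonomial η I := by
  have h : ∀ l : List (Fin n), X.bar ((l.map η).prod) = (-1 : ℂ) ^ l.length • (l.map η).prod := by
    intro l
    induction l with
    | nil => simp [X.bar_one]
    | cons a l ih =>
      rw [List.map_cons, List.prod_cons, X.bar_mul, ih, X.bar_of_odd (hη a), List.length_cons,
        pow_succ, mul_neg_one, neg_smul, mul_smul_comm, neg_mul, smul_neg]
  rw [oddMonomial, h, Finset.length_sort]

theorem oddMonomial_homogeneous (hη : ∀ k, η k ∈ X.part U 1) (I : Finset (Fin n)) :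
    oddMonomial η I ∈ X.part U 0 ∨ oddMonomial η I ∈ X.part U 1 := by
  rw [X.mem_even_iff, X.mem_odd_iff, bar_oddMonomial hη]
  rcases neg_one_pow_eq_or ℂ I.card with h | h <;> rw [h] <;> simp

theorem oddMonomial_mul_mul_self (hη : ∀ k, η k ∈ X.part U 1) {I : Finset (Fin n)}
    (hI : I ≠ ∅) (b : X.Γ U) : oddMonomial η I * b * oddMonomial η I = 0 := by
  obtain ⟨a, l, hl⟩ : ∃ a l, I.sort (· ≤ ·) = a :: l := by
    cases h : I.sort (· ≤ ·) with
    | nil =>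
      refine (hI ?_).elim
      rw [← Finset.card_eq_zero, ← Finset.length_sort (· ≤ ·), h, List.length_nil]
    | cons a l => exact ⟨a, l, rfl⟩
  rw [oddMonomial, hl, List.map_cons, List.prod_cons]
  calc _ = η a * ((l.map η).prod * b) * η a * (l.map η).prod := by simp only [mul_assoc]
    _ = 0 := by rw [X.odd_mul_mul_self (hη a), zero_mul]

end Monomials

/-- The sum of the odd terms is s - u minus an even section, hence both even and odd, hence zero.
What remains is a sum of commuting sections of square zero. -/
theorem SuperSpace.isNilpotent_sub_of_sum (X : SuperSpace) {U : Opens X.space} {ι : Type}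
    {F : Finset ι} {t : ι → X.Γ U} {s u : X.Γ U} (hs : s ∈ X.part U 0) (hu : u ∈ X.part U 0)
    (h : s = u + ∑ i ∈ F, t i) (ht : ∀ i ∈ F, (t i ∈ X.part U 0 ∨ t i ∈ X.part U 1) ∧
      t i * t i = 0) : IsNilpotent (s - u) := by
  classical
  have h0 : ∑ i ∈ F with t i ∈ X.part U 0, t i ∈ X.part U 0 :=
    Submodule.sum_mem _ fun i hi => (Finset.mem_filter.1 hi).2
  have h1 : ∑ i ∈ F with t i ∉ X.part U 0, t i ∈ X.part U 1 :=
    Submodule.sum_mem _ fun i hi =>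
      (ht i (Finset.mem_filter.1 hi).1).1.resolve_left (Finset.mem_filter.1 hi).2
  have h2 : s - u - ∑ i ∈ F with t i ∈ X.part U 0, t i = ∑ i ∈ F with t i ∉ X.part U 0, t i := by
    rw [h, ← Finset.sum_filter_add_sum_filter_not F (fun i => t i ∈ X.part U 0) t]
    abel
  have h3 := X.eq_zero_of_mem_of_mem (h2 ▸ sub_mem (sub_mem hs hu) h0) h1
  rw [h3, sub_eq_zero] at h2
  rw [h2]
  exact Commute.isNilpotent_sum (fun i hi => ⟨2, by rw [sq, (ht i (Finset.mem_filter.1 hi).1).2]⟩)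
    fun i j hi _ => X.even_comm (Finset.mem_filter.1 hi).2 _

/-! ### Expansions in odd variables -/

namespace HolCoord

variable {E : Type} [NormedAddCommGroup E] [NormedSpace ℂ E] {X : SuperSpace}
  {U : Opens X.space} (C : HolCoord X E U) {n : ℕ} {η : Fin n → X.Γ U}
  {U' : Opens X.space} {h : U' ≤ U} {W : Opens E} {hW : Set.MapsTo C.fn U' W}

theorem expand_eq (η : Fin n → X.Γ U) (f : Finset (Fin n) → Hol W) : C.expand η h hW f =
    ∑ I, C.ev h hW (f I) * oddMonomial (fun k => X.res h (η k)) I := rfl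

theorem expand_add (f g : Finset (Fin n) → Hol W) :
    C.expand η h hW (f + g) = C.expand η h hW f + C.expand η h hW g := by
  simp only [expand_eq, Pi.add_apply, map_add, add_mul, Finset.sum_add_distrib]

theorem expand_smul (c : ℂ) (f : Finset (Fin n) → Hol W) :
    C.expand η h hW (c • f) = c • C.expand η h hW f := by
  simp only [expand_eq, Pi.smul_apply, map_smul, smul_mul_assoc, Finset.smul_sum]

theorem expand_zero : C.expand η h hW (0 : Finset (Fin n) → Hol W) = 0 := by
  simp [expand_eq]

theorem expand_neg (f : Finset (Fin n) → Hol W) :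
    C.expand η h hW (-f) = -C.expand η h hW f := by
  rw [← neg_one_smul ℂ, expand_smul, neg_one_smul]

theorem expand_sub (f g : Finset (Fin n) → Hol W) :
    C.expand η h hW (f - g) = C.expand η h hW f - C.expand η h hW g := by
  rw [sub_eq_add_neg, expand_add, expand_neg, sub_eq_add_neg]

theorem expand_sum {ι : Type} (s : Finset ι) (f : ι → Finset (Fin n) → Hol W) :
    C.expand η h hW (∑ i ∈ s, f i) = ∑ i ∈ s, C.expand η h hW (f i) := by
  simp only [expand_eq, Finset.sum_apply, map_sum, Finset.sum_mul]
  exact Finset.sum_comm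

theorem expand_const_mul (a : Hol W) (f : Finset (Fin n) → Hol W) :
    C.expand η h hW (fun I => a * f I) = C.ev h hW a * C.expand η h hW f := by
  simp only [expand_eq, map_mul, Finset.mul_sum, mul_assoc]

theorem expand_single (I : Finset (Fin n)) (a : Hol W) :
    C.expand η h hW (Pi.single I a) =
      C.ev h hW a * oddMonomial (fun k => X.res h (η k)) I := by
  rw [expand_eq, Finset.sum_eq_single I]
  · rw [Pi.single_eq_same]
  · intro J _ hJ
    rw [Pi.single_eq_of_ne hJ, map_zero, zero_mul]
  · simp

theorem expand_single_empty (a : Hol W) :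
    C.expand η h hW (Pi.single ∅ a) = C.ev h hW a := by
  rw [expand_single, oddMonomial_empty, mul_one]

theorem expand_one : C.expand η h hW (Pi.single ∅ (1 : Hol W)) = 1 := by
  rw [expand_single_empty, map_one]

theorem res_oddMonomial {U'' : Opens X.space} (h' : U'' ≤ U') (I : Finset (Fin n)) :
    X.res h' (oddMonomial (fun k => X.res h (η k)) I) =
      oddMonomial (fun k => X.res (h'.trans h) (η k)) I := by
  simp only [oddMonomial, map_list_prod, List.map_map]
  congr 1
  exact List.map_congr_left fun k _ => X.res_res _ _ _

theorem res_expand {U'' : Opens X.space} (h' : U'' ≤ U') {W' : Opens E} (i : W' ≤ W)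
    (hW' : Set.MapsTo C.fn U'' W') (f : Finset (Fin n) → Hol W) :
    X.res h' (C.expand η h hW f) =
      C.expand η (h'.trans h) hW' (fun I => Hol.res i (f I)) := by
  simp only [expand_eq, map_sum, map_mul, res_oddMonomial, C.ev_res h h' hW hW' i]

/-- The product of two expansions, on coefficients. -/
def mulCoeff (f g : Finset (Fin n) → Hol W) : Finset (Fin n) → Hol W :=
  ∑ I, ∑ J, Pi.single (mulSet I J) (mulSign I J • (f I * g J))

theorem expand_mulCoeff (hη : ∀ k, η k ∈ X.part U 1) (f g : Finset (Fin n) → Hol W) :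
    C.expand η h hW (mulCoeff f g) = C.expand η h hW f * C.expand η h hW g := by
  rw [mulCoeff, expand_sum, expand_eq, expand_eq, Finset.sum_mul]
  refine Finset.sum_congr rfl fun I _ => ?_
  rw [expand_sum, Finset.mul_sum]
  refine Finset.sum_congr rfl fun J _ => ?_
  have hodd : ∀ k, X.res h (η k) ∈ X.part U' 1 := fun k => X.res_mem h (hη k)
  rw [expand_single, map_smul, smul_mul_assoc, ← mul_smul_comm, ← oddMonomial_mul hodd, map_mul,
    mul_assoc, mul_assoc, ← mul_assoc (C.ev h hW (g J)), X.even_comm (C.ev_even h hW (g J)),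
    mul_assoc]

theorem bar_expand (hη : ∀ k, η k ∈ X.part U 1) (f : Finset (Fin n) → Hol W) :
    X.bar (C.expand η h hW f) = C.expand η h hW fun I => (-1 : ℂ) ^ I.card • f I := by
  simp only [expand_eq, map_sum, X.bar_mul, X.bar_of_even (C.ev_even h hW _),
    bar_oddMonomial fun k => X.res_mem h (hη k), map_smul, smul_mul_assoc, mul_smul_comm]

theorem expand_term_sq (hη : ∀ k, η k ∈ X.part U 1) {I : Finset (Fin n)} (hI : I ≠ ∅) (a : Hol W) :
    (C.ev h hW a * oddMonomial (fun k => X.res h (η k)) I) *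
      (C.ev h hW a * oddMonomial (fun k => X.res h (η k)) I) = 0 := by
  rw [mul_assoc, ← mul_assoc (oddMonomial _ _),
    oddMonomial_mul_mul_self (fun k => X.res_mem h (hη k)) hI, mul_zero]

theorem expand_term_homogeneous (hη : ∀ k, η k ∈ X.part U 1) (I : Finset (Fin n)) (a : Hol W) :
    C.ev h hW a * oddMonomial (fun k => X.res h (η k)) I ∈ X.part U' 0 ∨
      C.ev h hW a * oddMonomial (fun k => X.res h (η k)) I ∈ X.part U' 1 := by
  refine (oddMonomial_homogeneous (fun k => X.res_mem h (hη k)) I).imp (fun hI => ?_) fun hI => ?_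
  · simpa using X.mul_mem (C.ev_even h hW a) hI
  · simpa using X.mul_mem (C.ev_even h hW a) hI

/-- The part of an open set that lies over `W`. -/
def inter (h : U' ≤ U) (W : Opens E) : Opens X.space :=
  ⟨U' ∩ C.fn ⁻¹' W, (C.continuousOn.mono h).isOpen_inter_preimage U'.isOpen W.isOpen⟩

theorem inter_le (h : U' ≤ U) (W : Opens E) : C.inter h W ≤ U' := fun _ hx => hx.1

theorem mapsTo_inter (h : U' ≤ U) (W : Opens E) : Set.MapsTo C.fn (C.inter h W) W :=
  fun _ hx => hx.2

theorem isUnit_ev (f : Hol W) (hf : ∀ x, f.1 x ≠ 0) : IsUnit (C.ev h hW f) := by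
  obtain ⟨g, hg⟩ := Hol.exists_mul_eq_one f hf
  exact (IsUnit.of_mul_eq_one g hg).map (C.ev h hW)

/-- On the preimage of the set where f does not vanish, the inverse function pulls back to an
inverse. -/
theorem exists_isUnit_res_ev (f : Hol W) {x : X.space} (hx : x ∈ U')
    (hf : f.1 ⟨C.fn x, hW hx⟩ ≠ 0) :
    ∃ (U'' : Opens X.space) (h' : U'' ≤ U'), x ∈ U'' ∧ IsUnit (X.res h' (C.ev h hW f)) := by
  refine ⟨C.inter h (Hol.support f), C.inter_le _ _,
    ⟨hx, (Hol.mem_support f (hW hx)).2 hf⟩, ?_⟩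
  rw [← C.ev_res h _ hW (C.mapsTo_inter h _) (Hol.support_le f)]
  exact C.isUnit_ev _ fun x => (Hol.mem_support f (Hol.support_le f x.2)).1 x.2

end HolCoord

/-! ### Charts of the base -/

namespace SuperChart

variable {T : SuperSpace} {m n : ℕ} (c : SuperChart T m n)

/-- All terms of an expansion other than the one indexed by ∅ are nilpotent. If that coefficient
were nonzero at a point, its pullback would be both invertible and nilpotent nearby, which is
impossible in a nonzero ring. -/
theorem apply_empty_eq_zero (hT : T.IsComplex) {V : Opens T.space} (h : V ≤ c.source)
    {W : Opens (Fin m → ℂ)} (hW : Set.MapsTo c.coord.fn V W) {f : Finset (Fin n) → Hol W}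
    (hf : c.coord.expand c.odd h hW f = 0) {t : T.space} (ht : t ∈ V) :
    (f ∅).1 ⟨c.coord.fn t, hW ht⟩ = 0 := by
  classical
  by_contra hne
  obtain ⟨V', h', ht', hu⟩ := c.coord.exists_isUnit_res_ev (h := h) (f ∅) ht hne
  have : IsNilpotent (0 - c.coord.ev h hW (f ∅)) := by
    refine T.isNilpotent_sub_of_sum (F := Finset.univ.erase ∅) (t := fun I =>
      c.coord.ev h hW (f I) * oddMonomial (fun k => T.res h (c.odd k)) I) (zero_mem _)
      (c.coord.ev_even h hW _) ?_ fun I hI =>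
      ⟨c.coord.expand_term_homogeneous c.odd_mem I _,
        c.coord.expand_term_sq c.odd_mem (Finset.ne_of_mem_erase hI) _⟩
    rw [← hf, HolCoord.expand_eq, ← Finset.add_sum_erase _ _ (Finset.mem_univ ∅),
      oddMonomial_empty, mul_one]
  rw [zero_sub, isNilpotent_neg_iff] at this
  have := hT.nontrivial V' ⟨t, ht'⟩
  exact hu.not_isNilpotent (IsNilpotent.map ‹IsNilpotent _› (T.res h'))

end SuperChart

/-! ### Vector fields from local data -/

/-- The sign rule for moving an operator of parity `p` past a section. -/
def SuperSpace.twist (X : SuperSpace) {U : Opens X.space} (p : ZMod 2) : X.Γ U →ₗ[ℂ] X.Γ U :=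
  if p = 1 then X.bar else LinearMap.id

theorem SuperSpace.twist_zero (X : SuperSpace) {U : Opens X.space} (s : X.Γ U) :
    X.twist 0 s = s := rfl

theorem SuperSpace.twist_one (X : SuperSpace) {U : Opens X.space} (s : X.Γ U) :
    X.twist 1 s = X.bar s := rfl

theorem SuperSpace.twist_res (X : SuperSpace) {U V : Opens X.space} (p : ZMod 2) (h : V ≤ U)
    (s : X.Γ U) : X.twist p (X.res h s) = X.res h (X.twist p s) := by
  rcases zmod_cases p with rfl | rfl
  · rfl
  · exact X.bar_res h s

theorem SuperSpace.twist_eq_sgn_smul (X : SuperSpace) {U : Opens X.space} {p i : ZMod 2}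
    {s : X.Γ U} (hs : s ∈ X.part U i) : X.twist p s = sgn p i • s := by
  rcases zmod_cases p with rfl | rfl
  · rw [X.twist_zero, SuperSpace.sgn_zero_left, one_smul]
  · exact X.bar_eq_sgn_smul hs

theorem sgn_mul_self (i j : ZMod 2) : sgn i j * sgn i j = 1 := by
  unfold sgn; split_ifs <;> norm_num

theorem sgn_one_add (i j : ZMod 2) : sgn 1 (i + j) = sgn 1 i * sgn 1 j := by
  rcases zmod_cases i with rfl | rfl <;> rcases zmod_cases j with rfl | rfl <;>
    simp [sgn, show (1 : ZMod 2) + 1 = 0 from rfl]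

section

variable {X T : SuperSpace} {π : Hom X T}

/-- A vector field is determined by a relation between sections and their derivatives that can be
solved locally. -/
theorem RelVF.exists_of_local {p : ZMod 2} {U₀ : Opens X.space}
    (P : ∀ U : Opens X.space, U ≤ U₀ → X.Γ U → X.Γ U → Prop)
    (hres : ∀ (U U' : Opens X.space) (h : U ≤ U₀) (h' : U' ≤ U) (s a : X.Γ U), P U h s a →
      P U' (h'.trans h) (X.res h' s) (X.res h' a))
    (hzero : ∀ (U : Opens X.space) (h : U ≤ U₀) (a : X.Γ U), P U h 0 a → a = 0)
    (hex : ∀ (U : Opens X.space) (h : U ≤ U₀) (s : X.Γ U), ∀ x ∈ U, ∃ (U' : Opens X.space)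
      (h' : U' ≤ U) (a : X.Γ U'), x ∈ U' ∧ P U' (h'.trans h) (X.res h' s) a)
    (hadd : ∀ (U : Opens X.space) (h : U ≤ U₀) (s s' a a' : X.Γ U), P U h s a → P U h s' a' →
      P U h (s + s') (a + a'))
    (hsmul : ∀ (U : Opens X.space) (h : U ≤ U₀) (k : ℂ) (s a : X.Γ U), P U h s a →
      P U h (k • s) (k • a))
    (hbar : ∀ (U : Opens X.space) (h : U ≤ U₀) (s a : X.Γ U), P U h s a →
      P U h (X.bar s) (sgn 1 p • X.bar a))
    (hmul : ∀ (U : Opens X.space) (h : U ≤ U₀) (s s' a a' : X.Γ U), P U h s a → P U h s' a' →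
      P U h (s * s') (a * s' + X.twist p s * a'))
    (hpull : ∀ (U : Opens X.space) (h : U ≤ U₀) (V : Opens T.space)
      (hV : U ≤ Opens.comap π.base V) (k : T.Γ V), ∀ x ∈ U, ∃ (U' : Opens X.space)
      (h' : U' ≤ U), x ∈ U' ∧ P U' (h'.trans h) (X.res h' (X.res hV (π.pull V k))) 0) :
    ∃ ξ : RelVF π p U₀, ∀ (U : Opens X.space) (h : U ≤ U₀) (s a : X.Γ U), P U h s a →
      ξ.app U h s = a := by
  -- Additivity reduces the uniqueness of derivatives to the case of the zero section.
  have huniq : ∀ (U : Opens X.space) (h : U ≤ U₀) (s a b : X.Γ U), P U h s a → P U h s b →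
      a = b := by
    intro U h s a b ha hb
    have := hadd U h _ _ _ _ ha (hsmul U h (-1) _ _ hb)
    rw [neg_one_smul, neg_one_smul, add_neg_cancel, ← sub_eq_add_neg] at this
    exact sub_eq_zero.1 (hzero U h _ this)
  have key : ∀ (U : Opens X.space) (h : U ≤ U₀) (s : X.Γ U), ∃ a : X.Γ U,
      ∀ (U' : Opens X.space) (h' : U' ≤ U) (b : X.Γ U'), P U' (h'.trans h) (X.res h' s) b →
        X.res h' a = b := by
    intro U h s
    refine X.exists_section_of_local (fun U' h' b => P U' (h'.trans h) (X.res h' s) b) ?_ ?_ ?_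
    · intro U' U'' h' h'' a ha
      have := hres _ _ _ h'' _ _ ha
      rwa [X.res_res] at this
    · intro U' h' a b
      exact huniq _ _ _ _ _
    · exact hex U h s
  choose D hD using key
  have hD' : ∀ (U : Opens X.space) (h : U ≤ U₀) (s a : X.Γ U), P U h s a → D U h s = a := by
    intro U h s a ha
    have := hD U h s U le_rfl a (by rwa [X.res_self])
    rwa [X.res_self] at this
  have hDres : ∀ (U U' : Opens X.space) (h : U ≤ U₀) (h' : U' ≤ U) (s : X.Γ U),
      D U' (h'.trans h) (X.res h' s) = X.res h' (D U h s) := by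
    intro U U' h h' s
    refine X.eq_of_local fun x hx => ?_
    obtain ⟨U'', h'', a, hx'', ha⟩ := hex U' (h'.trans h) (X.res h' s) x hx
    refine ⟨U'', h'', hx'', ?_⟩
    rw [hD _ _ _ _ h'' a ha, X.res_res, hD U h s _ (h''.trans h') a]
    rwa [X.res_res] at ha
  have hpt : ∀ (U : Opens X.space) (h : U ≤ U₀) (s s' : X.Γ U), ∀ x ∈ U, ∃ (U' : Opens X.space)
      (h' : U' ≤ U), x ∈ U' ∧ P U' (h'.trans h) (X.res h' s) (X.res h' (D U h s)) ∧
        P U' (h'.trans h) (X.res h' s') (X.res h' (D U h s')) := by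
    intro U h s s' x hx
    obtain ⟨U₁, h₁, a, hx₁, ha⟩ := hex U h s x hx
    obtain ⟨U₂, h₂, b, hx₂, hb⟩ := hex U h s' x hx
    have ha' := hres _ _ _ (inf_le_left : U₁ ⊓ U₂ ≤ U₁) _ _ ha
    have hb' := hres _ _ _ (inf_le_right : U₁ ⊓ U₂ ≤ U₂) _ _ hb
    rw [X.res_res] at ha' hb'
    refine ⟨U₁ ⊓ U₂, inf_le_left.trans h₁, ⟨hx₁, hx₂⟩, ?_, ?_⟩
    · rwa [hD U h s _ _ _ ha']
    · rwa [hD U h s' _ (inf_le_left.trans h₁) _ hb']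
  refine ⟨⟨fun U h => ⟨⟨D U h, fun s s' => ?_⟩, fun k s => ?_⟩, fun {U U'} h h' s =>
    hDres U U' h h' s, fun {U} h i s hs => ?_, fun {U} h i s hs s' => ?_,
    fun {U} h V hV k => ?_⟩, hD'⟩
  · refine X.eq_of_local fun x hx => ?_
    obtain ⟨U', h', hx', ha, hb⟩ := hpt U h s s' x hx
    refine ⟨U', h', hx', ?_⟩
    rw [← hDres, map_add, map_add]
    exact hD' _ _ _ _ (hadd _ _ _ _ _ _ ha hb)
  · refine X.eq_of_local fun x hx => ?_
    obtain ⟨U', h', hx', ha, -⟩ := hpt U h s s x hx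
    refine ⟨U', h', hx', ?_⟩
    change X.res h' (D U h _) = X.res h' (k • D U h s)
    rw [← hDres, map_smul, map_smul]
    exact hD' _ _ _ _ (hsmul _ _ _ _ _ ha)
  · change D U h s ∈ _
    -- Homogeneity is tested with the involution: by `hbar`, it carries the derivative of s to that
    -- of bar s up to the sign of p, and bar s is a multiple of s.
    rw [X.mem_part_iff]
    refine X.eq_of_local fun x hx => ?_
    obtain ⟨U', h', hx', ha, -⟩ := hpt U h s s x hx
    refine ⟨U', h', hx', ?_⟩
    have h1 := hbar _ _ _ _ ha
    rw [X.bar_eq_sgn_smul (X.res_mem h' hs)] at h1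
    have h2 := huniq _ _ _ _ _ h1 (hsmul _ _ _ _ _ ha)
    rw [← X.bar_res, map_smul, sgn_one_add, mul_smul, ← h2, smul_smul, sgn_mul_self, one_smul]
  · change D U h (s * s') = D U h s * s' + sgn p i • (s * D U h s')
    rw [← smul_mul_assoc, ← X.twist_eq_sgn_smul hs]
    refine X.eq_of_local fun x hx => ?_
    obtain ⟨U', h', hx', ha, hb⟩ := hpt U h s s' x hx
    refine ⟨U', h', hx', ?_⟩
    rw [← hDres, map_add, map_mul, map_mul, map_mul, ← X.twist_res]
    exact hD' _ _ _ _ (hmul _ _ _ _ _ _ ha hb)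
  · change D U h _ = 0
    refine X.eq_of_local fun x hx => ?_
    obtain ⟨U', h', hx', ha⟩ := hpull U h V hV k x hx
    refine ⟨U', h', hx', ?_⟩
    rw [← hDres, map_zero]
    exact hD' _ _ _ _ ha

/-- Moving θ past F' applies the involution to F', and the term containing θ twice vanishes. -/
theorem add_mul_odd_mul_add_mul_odd {U : Opens X.space} {θ : X.Γ U} (hθ : θ ∈ X.part U 1)
    (F G F' G' : X.Γ U) :
    (F + G * θ) * (F' + G' * θ) = F * F' + (F * G' + G * X.bar F') * θ := by
  have h1 : G * θ * F' = G * X.bar F' * θ := by rw [mul_assoc, X.odd_mul hθ, ← mul_assoc]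
  have h2 : G * θ * (G' * θ) = 0 := by
    rw [mul_assoc, ← mul_assoc θ, X.odd_mul_mul_self hθ, mul_zero]
  rw [add_mul, mul_add, mul_add, h1, h2, add_zero, ← mul_assoc, add_mul, add_assoc]

end

/-! ### Relative charts -/

namespace RelChart

variable {X T : SuperSpace} {π : Hom X T} (c : RelChart π)

/-- The odd coordinates of the base, as sections on the source of a relative chart. -/
def η (k : Fin c.n) : X.Γ c.source := X.res c.source_le (π.pull _ (c.base.odd k))

theorem η_odd (k : Fin c.n) : c.η k ∈ X.part c.source 1 :=
  X.res_mem _ (π.pull_mem (c.base.odd_mem k))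

/-- Tuples of coefficients of superfunctions. -/
abbrev Coeff (W : Opens ((Fin c.m → ℂ) × ℂ)) : Type := Finset (Fin c.n) → Hol W

variable {U U' : Opens X.space} {h : U ≤ c.source} {W W' : Opens ((Fin c.m → ℂ) × ℂ)}
  {hW : Set.MapsTo c.coord.fn U W}

/-- The section with given coefficients that does not involve `θ`. -/
def basic (h : U ≤ c.source) (hW : Set.MapsTo c.coord.fn U W) (f : c.Coeff W) : X.Γ U :=
  c.coord.expand c.η h hW f

/-- The section with given coefficients. -/
def section_ (h : U ≤ c.source) (hW : Set.MapsTo c.coord.fn U W) (f g : c.Coeff W) : X.Γ U :=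
  c.basic h hW f + c.basic h hW g * X.res h c.θ

theorem exists_section_eq (h : U ≤ c.source) (s : X.Γ U) {x : X.space} (hx : x ∈ U) :
    ∃ (U' : Opens X.space) (h' : U' ≤ U) (W : Opens ((Fin c.m → ℂ) × ℂ))
      (hW : Set.MapsTo c.coord.fn U' W) (f g : c.Coeff W), x ∈ U' ∧
      X.res h' s = c.section_ (h'.trans h) hW f g :=
  c.generates U h s x hx

/-- Restriction of coefficients. -/
def resCoeff (i : W' ≤ W) (f : c.Coeff W) : c.Coeff W' := fun I => Hol.res i (f I)

theorem res_basic (h : U ≤ c.source) (hW : Set.MapsTo c.coord.fn U W) (h' : U' ≤ U) (i : W' ≤ W)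
    (hW' : Set.MapsTo c.coord.fn U' W') (f : c.Coeff W) :
    X.res h' (c.basic h hW f) = c.basic (h'.trans h) hW' (c.resCoeff i f) :=
  c.coord.res_expand h' i hW' f

theorem res_section (h : U ≤ c.source) (hW : Set.MapsTo c.coord.fn U W) (h' : U' ≤ U)
    (i : W' ≤ W) (hW' : Set.MapsTo c.coord.fn U' W') (f g : c.Coeff W) :
    X.res h' (c.section_ h hW f g) = c.section_ (h'.trans h) hW'
      (c.resCoeff i f) (c.resCoeff i g) := by
  rw [section_, map_add, map_mul, c.res_basic h hW h' i hW', c.res_basic h hW h' i hW', X.res_res,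
    section_]

theorem pull_expand (h : U ≤ c.source) {V : Opens T.space} (hV : V ≤ c.base.source)
    (hUV : U ≤ Opens.comap π.base V) {W₀ : Opens (Fin c.m → ℂ)}
    (hW₀ : Set.MapsTo c.base.coord.fn V W₀) (hW : Set.MapsTo c.coord.fn U W)
    (i : ∀ p ∈ W, p.1 ∈ W₀) (f : Finset (Fin c.n) → Hol W₀) :
    X.res hUV (π.pull V (c.base.coord.expand c.base.odd hV hW₀ f)) =
      c.basic h hW fun I => Hol.ofFst i (f I) := by
  simp only [basic, HolCoord.expand_eq, map_sum, map_mul]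
  refine Finset.sum_congr rfl fun I _ => ?_
  rw [c.ev_fst U h V hV hUV W₀ hW₀ W hW i (f I)]
  congr 1
  simp only [oddMonomial, map_list_prod, List.map_map]
  congr 1
  refine List.map_congr_left fun k _ => ?_
  simp only [Function.comp_apply, η, X.res_res, π.pull_res]

theorem basic_eq_zero_of_rel (h : U ≤ c.source) {V : Opens T.space} (hV : V ≤ c.base.source)
    (hUV : U ≤ Opens.comap π.base V) {W₀ : Opens (Fin c.m → ℂ)}
    (hW₀ : Set.MapsTo c.base.coord.fn V W₀) (hW : Set.MapsTo c.coord.fn U W)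
    (i : ∀ p ∈ W, p.1 ∈ W₀) {k : ℕ} {ρ : Fin k → Finset (Fin c.n) → Hol W₀}
    (hρ : ∀ l, c.base.coord.expand c.base.odd hV hW₀ (ρ l) = 0) {f : c.Coeff W}
    {a : Fin k → Hol W} (hf : ∀ I, f I = ∑ l, a l * Hol.ofFst i (ρ l I)) :
    c.basic h hW f = 0 := by
  have : f = ∑ l, fun I => a l * Hol.ofFst i (ρ l I) := by
    ext1 I; rw [hf, Finset.sum_apply]
  rw [this, basic, HolCoord.expand_sum]
  refine Finset.sum_eq_zero fun l _ => ?_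
  rw [HolCoord.expand_const_mul]
  have h1 := c.pull_expand h hV hUV hW₀ hW i (ρ l)
  rw [hρ, map_zero, map_zero] at h1
  change _ * c.basic h hW _ = 0
  rw [← h1, mul_zero]

/-- Local form of the relations among superfunctions on a relative chart. -/
theorem exists_rel {f g : c.Coeff W} (H : c.section_ h hW f g = 0) {x : X.space} (hx : x ∈ U) :
    ∃ (U' : Opens X.space) (_ : U' ≤ U) (W' : Opens ((Fin c.m → ℂ) × ℂ)) (i : W' ≤ W)
      (_ : Set.MapsTo c.coord.fn U' W') (V : Opens T.space) (hV : V ≤ c.base.source)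
      (_ : U' ≤ Opens.comap π.base V)
      (W₀ : Opens (Fin c.m → ℂ)) (hW₀ : Set.MapsTo c.base.coord.fn V W₀)
      (i₀ : ∀ p ∈ W', p.1 ∈ W₀) (k : ℕ) (ρ : Fin k → Finset (Fin c.n) → Hol W₀)
      (a b : Fin k → Hol W'), x ∈ U' ∧
      (∀ l, c.base.coord.expand c.base.odd hV hW₀ (ρ l) = 0) ∧
      ∀ I, Hol.res i (f I) = ∑ l, a l * Hol.ofFst i₀ (ρ l I) ∧
        Hol.res i (g I) = ∑ l, b l * Hol.ofFst i₀ (ρ l I) := by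
  obtain ⟨W', i, V, hV, W₀, hW₀, i₀, k, ρ, a, b, hxW, hxV, hρ, hI⟩ :=
    c.kernel_eq U h W hW f g H x hx
  exact ⟨c.coord.inter h W' ⊓ Opens.comap π.base V, inf_le_left.trans (c.coord.inter_le _ _), W',
    i, fun y hy => hy.1.2, V, hV, inf_le_right, W₀, hW₀, i₀, k, ρ, a, b, ⟨⟨hx, hxW⟩, hxV⟩, hρ, hI⟩

/-- Relations on a relative chart are combinations of relations of the base with holomorphic
coefficients. An operator linear over functions of the base acts on these coefficients only and so
preserves relations. With the identity this separates the two components of f + g θ; with ∂/∂z it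
makes the even coordinate field well defined. -/
theorem basic_apply_eq_zero (Φ : ∀ W : Opens ((Fin c.m → ℂ) × ℂ), Hol W →ₗ[ℂ] Hol W)
    (hres : ∀ (W W' : Opens ((Fin c.m → ℂ) × ℂ)) (i : W' ≤ W) (f : Hol W),
      Φ W' (Hol.res i f) = Hol.res i (Φ W f))
    (hfst : ∀ (W : Opens ((Fin c.m → ℂ) × ℂ)) (W₀ : Opens (Fin c.m → ℂ))
      (i : ∀ p ∈ W, p.1 ∈ W₀) (a : Hol W) (ρ : Hol W₀),
      Φ W (a * Hol.ofFst i ρ) = Φ W a * Hol.ofFst i ρ)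
    {f g : c.Coeff W} (H : c.section_ h hW f g = 0) :
    (c.basic h hW fun I => Φ W (f I)) = 0 ∧ (c.basic h hW fun I => Φ W (g I)) = 0 := by
  constructor
  · refine X.eq_of_local fun x hx => ?_
    obtain ⟨U', h', W', i, hW', V, hV, hUV, W₀, hW₀, i₀, k, ρ, a, b, hx', hρ, hI⟩ :=
      c.exists_rel H hx
    refine ⟨U', h', hx', ?_⟩
    rw [c.res_basic h hW h' i hW', map_zero]
    refine c.basic_eq_zero_of_rel _ hV hUV hW₀ hW' i₀ hρ (a := fun l => Φ W' (a l)) fun I => ?_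
    change Hol.res i (Φ W (f I)) = _
    simp only [← hres, (hI I).1, map_sum, hfst]
  · refine X.eq_of_local fun x hx => ?_
    obtain ⟨U', h', W', i, hW', V, hV, hUV, W₀, hW₀, i₀, k, ρ, a, b, hx', hρ, hI⟩ :=
      c.exists_rel H hx
    refine ⟨U', h', hx', ?_⟩
    rw [c.res_basic h hW h' i hW', map_zero]
    refine c.basic_eq_zero_of_rel _ hV hUV hW₀ hW' i₀ hρ (a := fun l => Φ W' (b l)) fun I => ?_
    change Hol.res i (Φ W (g I)) = _
    simp only [← hres, (hI I).2, map_sum, hfst]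

theorem basic_eq_zero {f g : c.Coeff W} (H : c.section_ h hW f g = 0) :
    c.basic h hW f = 0 ∧ c.basic h hW g = 0 :=
  c.basic_apply_eq_zero (fun _ => LinearMap.id) (fun _ _ _ _ => rfl) (fun _ _ _ _ _ => rfl) H

theorem basic_dz_eq_zero {f g : c.Coeff W} (H : c.section_ h hW f g = 0) :
    (c.basic h hW fun I => Hol.dz (f I)) = 0 ∧ (c.basic h hW fun I => Hol.dz (g I)) = 0 :=
  c.basic_apply_eq_zero (fun _ => Hol.dz) (fun _ _ i f => Hol.dz_res i f)
    (fun W W₀ i a ρ => by rw [Hol.dz_mul, Hol.dz_ofFst, mul_zero, add_zero]) H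

/-- At a point of the source the relations of the base have vanishing ∅-coefficient, hence so has
every combination of them. Thus the numerical value of a section at a point is well defined. -/
theorem apply_empty_eq_zero (hT : T.IsComplex) {f g : c.Coeff W}
    (H : c.section_ h hW f g = 0) {x : X.space} (hx : x ∈ U) :
    (f ∅).1 ⟨c.coord.fn x, hW hx⟩ = 0 := by
  obtain ⟨U', h', W', i, hW', V, hV, hUV, W₀, hW₀, i₀, k, ρ, a, b, hx', hρ, hI⟩ :=
    c.exists_rel H hx
  have h1 := congrFun (congrArg Subtype.val (hI ∅).1) ⟨c.coord.fn x, hW' hx'⟩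
  refine h1.trans ?_
  rw [AddSubmonoidClass.coe_finsetSum, Finset.sum_apply]
  refine Finset.sum_eq_zero fun l _ => ?_
  have h2 := c.base.apply_empty_eq_zero hT hV hW₀ (hρ l) (hUV hx')
  have h3 : (Hol.ofFst i₀ (ρ l ∅)).1 ⟨c.coord.fn x, hW' hx'⟩ = 0 := by
    rw [← h2]
    exact congrArg (ρ l ∅).1 (Subtype.ext (c.fst_eq x (h (h' hx'))))
  change (a l).1 _ * (Hol.ofFst i₀ (ρ l ∅)).1 _ = 0
  rw [h3, mul_zero]

theorem basic_add (f g : c.Coeff W) :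
    c.basic h hW (f + g) = c.basic h hW f + c.basic h hW g := c.coord.expand_add f g

theorem basic_smul (k : ℂ) (f : c.Coeff W) : c.basic h hW (k • f) = k • c.basic h hW f :=
  c.coord.expand_smul k f

theorem basic_mul (f g : c.Coeff W) :
    c.basic h hW (HolCoord.mulCoeff f g) = c.basic h hW f * c.basic h hW g :=
  c.coord.expand_mulCoeff c.η_odd f g

/-- The coefficients of the image of a section under the grading involution. -/
def barCoeff (f : c.Coeff W) : c.Coeff W := fun I => (-1 : ℂ) ^ I.card • f I

theorem bar_basic (f : c.Coeff W) : X.bar (c.basic h hW f) = c.basic h hW (c.barCoeff f) :=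
  c.coord.bar_expand c.η_odd f

theorem section_add (f g f' g' : c.Coeff W) :
    c.section_ h hW (f + f') (g + g') = c.section_ h hW f g + c.section_ h hW f' g' := by
  simp only [section_, basic_add, add_mul]; abel

theorem section_smul (k : ℂ) (f g : c.Coeff W) :
    c.section_ h hW (k • f) (k • g) = k • c.section_ h hW f g := by
  simp only [section_, basic_smul, smul_mul_assoc, smul_add]

theorem bar_section (f g : c.Coeff W) : X.bar (c.section_ h hW f g) =
    c.section_ h hW (c.barCoeff f) ((-1 : ℂ) • c.barCoeff g) := by
  rw [section_, map_add, X.bar_mul, X.bar_of_odd (X.res_mem h c.θ_odd), bar_basic, bar_basic,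
    section_, basic_smul, neg_one_smul, neg_mul, mul_neg]

theorem section_mul (f g f' g' : c.Coeff W) :
    c.section_ h hW f g * c.section_ h hW f' g' =
      c.section_ h hW (HolCoord.mulCoeff f f')
        (HolCoord.mulCoeff f g' + HolCoord.mulCoeff g (c.barCoeff f')) := by
  rw [section_, section_, add_mul_odd_mul_add_mul_odd (X.res_mem h c.θ_odd), section_, basic_add,
    basic_mul, basic_mul, basic_mul, bar_basic]

/-- The derivative of superfunctions in the even relative coordinate, on coefficients. -/
def dzCoeff (f : c.Coeff W) : c.Coeff W := fun I => Hol.dz (f I)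

theorem dzCoeff_mulCoeff (f g : c.Coeff W) : c.dzCoeff (HolCoord.mulCoeff f g) =
    HolCoord.mulCoeff (c.dzCoeff f) g + HolCoord.mulCoeff f (c.dzCoeff g) := by
  have hs : ∀ (I J : Finset (Fin c.n)) (a : Hol W),
      Hol.dz ((Pi.single I a : c.Coeff W) J) = (Pi.single I (Hol.dz a) : c.Coeff W) J := by
    intro I J a
    by_cases hIJ : J = I
    · subst hIJ; rw [Pi.single_eq_same, Pi.single_eq_same]
    · rw [Pi.single_eq_of_ne hIJ, Pi.single_eq_of_ne hIJ, map_zero]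
  ext1 K
  simp only [dzCoeff, HolCoord.mulCoeff, Finset.sum_apply, map_sum, hs, Pi.add_apply, map_smul,
    Hol.dz_mul, smul_add, Pi.single_add, Finset.sum_add_distrib]

theorem dzCoeff_barCoeff (f : c.Coeff W) : c.dzCoeff (c.barCoeff f) = c.barCoeff (c.dzCoeff f) := by
  ext1 I; simp only [dzCoeff, barCoeff, map_smul]

theorem dzCoeff_resCoeff (i : W' ≤ W) (f : c.Coeff W) :
    c.dzCoeff (c.resCoeff i f) = c.resCoeff i (c.dzCoeff f) := by
  ext1 I; exact Hol.dz_res i (f I)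

theorem dzCoeff_add (f g : c.Coeff W) : c.dzCoeff (f + g) = c.dzCoeff f + c.dzCoeff g := by
  ext1 I; simp only [dzCoeff, Pi.add_apply, map_add]

theorem dzCoeff_smul (k : ℂ) (f : c.Coeff W) : c.dzCoeff (k • f) = k • c.dzCoeff f := by
  ext1 I; simp only [dzCoeff, Pi.smul_apply, map_smul]

theorem section_eq_of_res (i : W' ≤ W) (hW' : Set.MapsTo c.coord.fn U W') (f g : c.Coeff W) :
    c.section_ h hW f g = c.section_ h hW' (c.resCoeff i f) (c.resCoeff i g) := by
  have := c.res_section h hW le_rfl i hW' f g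
  rwa [X.res_self] at this

theorem basic_eq_of_res (i : W' ≤ W) (hW' : Set.MapsTo c.coord.fn U W') (f : c.Coeff W) :
    c.basic h hW f = c.basic h hW' (c.resCoeff i f) := by
  have := c.res_basic h hW le_rfl i hW' f
  rwa [X.res_self] at this

/-- Functions on the base do not involve the relative coordinates. -/
theorem exists_pull_eq_basic (h : U ≤ c.source) {V : Opens T.space}
    (hV : U ≤ Opens.comap π.base V) (k : T.Γ V) {x : X.space} (hx : x ∈ U) :
    ∃ (U' : Opens X.space) (h' : U' ≤ U) (W : Opens ((Fin c.m → ℂ) × ℂ))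
      (hW : Set.MapsTo c.coord.fn U' W) (W₀ : Opens (Fin c.m → ℂ)) (i : ∀ p ∈ W, p.1 ∈ W₀)
      (f : Finset (Fin c.n) → Hol W₀), x ∈ U' ∧
      X.res h' (X.res hV (π.pull V k)) = c.basic (h'.trans h) hW fun I => Hol.ofFst i (f I) := by
  obtain ⟨V', h', W₀, hW₀, f, hxV, hf⟩ := c.base.generates (V ⊓ c.base.source) inf_le_right
    (T.res inf_le_left k) (π.base x) ⟨hV hx, c.source_le (h hx)⟩
  have hi : ∀ p ∈ (Opens.comap ⟨Prod.fst, continuous_fst⟩ W₀ : Opens ((Fin c.m → ℂ) × ℂ)),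
    p.1 ∈ W₀ := fun p hp => hp
  have hW : Set.MapsTo c.coord.fn (U ⊓ Opens.comap π.base V' : Opens X.space)
      (Opens.comap ⟨Prod.fst, continuous_fst⟩ W₀ : Opens ((Fin c.m → ℂ) × ℂ)) := by
    intro y hy
    change (c.coord.fn y).1 ∈ W₀
    rw [c.fst_eq y (h hy.1)]
    exact hW₀ hy.2
  refine ⟨U ⊓ Opens.comap π.base V', inf_le_left, _, hW, W₀, hi, f, ⟨hx, hxV⟩, ?_⟩
  rw [← c.pull_expand (inf_le_left.trans h) (h'.trans inf_le_right) inf_le_right hW₀ hW hi f, ← hf,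
    T.res_res, π.pull_res, X.res_res, X.res_res]

/-- The vector field `∂_θ` of a relative chart. -/
theorem exists_dθ : ∃ ξ : RelVF π 1 c.source, ∀ (U : Opens X.space) (h : U ≤ c.source)
    (W : Opens ((Fin c.m → ℂ) × ℂ)) (hW : Set.MapsTo c.coord.fn U W) (f g : c.Coeff W),
    ξ.app U h (c.section_ h hW f g) = X.bar (c.basic h hW g) := by
  -- The derivative of f + g θ is bar g and not g, because the odd operator has to pass g before it
  -- reaches θ.
  refine Exists.imp (fun ξ hξ U h W hW f g => hξ U h _ _ ⟨W, hW, f, g, rfl, rfl⟩)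
    (RelVF.exists_of_local (π := π) (p := 1) (U₀ := c.source)
    (fun U h s a => ∃ (W : Opens ((Fin c.m → ℂ) × ℂ)) (hW : Set.MapsTo c.coord.fn U W)
      (f g : c.Coeff W), s = c.section_ h hW f g ∧ a = X.bar (c.basic h hW g))
    ?_ ?_ ?_ ?_ ?_ ?_ ?_ ?_)
  · rintro U U' h h' s a ⟨W, hW, f, g, rfl, rfl⟩
    have hW' : Set.MapsTo c.coord.fn U' W := fun y hy => hW (h' hy)
    exact ⟨W, hW', _, _, c.res_section h hW h' le_rfl hW' f g, by
      rw [← X.bar_res, c.res_basic h hW h' le_rfl hW']⟩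
  · rintro U h a ⟨W, hW, f, g, h0, rfl⟩
    rw [(c.basic_eq_zero h0.symm).2, map_zero]
  · intro U h s x hx
    obtain ⟨U', h', W, hW, f, g, hx', he⟩ := c.exists_section_eq h s hx
    exact ⟨U', h', _, hx', W, hW, f, g, he, rfl⟩
  · rintro U h s s' a a' ⟨W, hW, f, g, rfl, rfl⟩ ⟨W', hW', f', g', rfl, rfl⟩
    have hi : Set.MapsTo c.coord.fn U (W ⊓ W' : Opens _) := fun y hy => ⟨hW hy, hW' hy⟩
    refine ⟨W ⊓ W', hi, c.resCoeff inf_le_left f + c.resCoeff inf_le_right f',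
      c.resCoeff inf_le_left g + c.resCoeff inf_le_right g', ?_, ?_⟩
    · rw [c.section_eq_of_res inf_le_left hi f g, c.section_eq_of_res inf_le_right hi f' g',
        ← section_add]
    · rw [c.basic_eq_of_res inf_le_left hi g, c.basic_eq_of_res inf_le_right hi g', ← map_add,
        ← basic_add]
  · rintro U h k s a ⟨W, hW, f, g, rfl, rfl⟩
    exact ⟨W, hW, k • f, k • g, by rw [section_smul], by rw [basic_smul, map_smul]⟩
  · rintro U h s a ⟨W, hW, f, g, rfl, rfl⟩
    refine ⟨W, hW, _, _, c.bar_section f g, ?_⟩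
    rw [basic_smul, SuperSpace.sgn_one_one, map_smul, bar_basic]
  · rintro U h s s' a a' ⟨W, hW, f, g, rfl, rfl⟩ ⟨W', hW', f', g', rfl, rfl⟩
    have hi : Set.MapsTo c.coord.fn U (W ⊓ W' : Opens _) := fun y hy => ⟨hW hy, hW' hy⟩
    rw [c.section_eq_of_res inf_le_left hi f g, c.section_eq_of_res inf_le_right hi f' g',
      c.basic_eq_of_res inf_le_left hi g, c.basic_eq_of_res inf_le_right hi g']
    refine ⟨W ⊓ W', hi, _, _, c.section_mul _ _ _ _, ?_⟩
    simp only [X.twist_one, section_, basic_add, basic_mul, map_add, X.bar_mul,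
      ← bar_basic, X.bar_bar]
    rw [add_mul, mul_add, X.bar_of_odd (X.res_mem h c.θ_odd), mul_neg, neg_mul,
      mul_assoc _ (X.res h c.θ), X.odd_mul (X.res_mem h c.θ_odd), X.bar_bar]
    abel
  · intro U h V hV k x hx
    obtain ⟨U', h', W, hW, W₀, i, f, hx', he⟩ := c.exists_pull_eq_basic h hV k hx
    refine ⟨U', h', hx', W, hW, fun I => Hol.ofFst i (f I), 0, ?_, ?_⟩
    · rw [section_, he, basic, basic, HolCoord.expand_zero, zero_mul, add_zero]
    · rw [basic, HolCoord.expand_zero, map_zero]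

/-- The vector field `∂_z` of a relative chart. -/
theorem exists_dz : ∃ ξ : RelVF π 0 c.source, ∀ (U : Opens X.space) (h : U ≤ c.source)
    (W : Opens ((Fin c.m → ℂ) × ℂ)) (hW : Set.MapsTo c.coord.fn U W) (f g : c.Coeff W),
    ξ.app U h (c.section_ h hW f g) = c.section_ h hW (c.dzCoeff f) (c.dzCoeff g) := by
  refine Exists.imp (fun ξ hξ U h W hW f g => hξ U h _ _ ⟨W, hW, f, g, rfl, rfl⟩)
    (RelVF.exists_of_local (π := π) (p := 0) (U₀ := c.source)
    (fun U h s a => ∃ (W : Opens ((Fin c.m → ℂ) × ℂ)) (hW : Set.MapsTo c.coord.fn U W)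
      (f g : c.Coeff W), s = c.section_ h hW f g ∧
        a = c.section_ h hW (c.dzCoeff f) (c.dzCoeff g))
    ?_ ?_ ?_ ?_ ?_ ?_ ?_ ?_)
  · rintro U U' h h' s a ⟨W, hW, f, g, rfl, rfl⟩
    have hW' : Set.MapsTo c.coord.fn U' W := fun y hy => hW (h' hy)
    exact ⟨W, hW', _, _, c.res_section h hW h' le_rfl hW' f g,
      c.res_section h hW h' le_rfl hW' _ _⟩
  · rintro U h a ⟨W, hW, f, g, h0, rfl⟩
    have h1 := c.basic_dz_eq_zero h0.symm
    change c.basic h hW _ + c.basic h hW _ * _ = 0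
    have h2 : c.basic h hW (c.dzCoeff f) = 0 := h1.1
    have h3 : c.basic h hW (c.dzCoeff g) = 0 := h1.2
    rw [h2, h3, zero_mul, add_zero]
  · intro U h s x hx
    obtain ⟨U', h', W, hW, f, g, hx', he⟩ := c.exists_section_eq h s hx
    exact ⟨U', h', _, hx', W, hW, f, g, he, rfl⟩
  · rintro U h s s' a a' ⟨W, hW, f, g, rfl, rfl⟩ ⟨W', hW', f', g', rfl, rfl⟩
    have hi : Set.MapsTo c.coord.fn U (W ⊓ W' : Opens _) := fun y hy => ⟨hW hy, hW' hy⟩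
    refine ⟨W ⊓ W', hi, c.resCoeff inf_le_left f + c.resCoeff inf_le_right f',
      c.resCoeff inf_le_left g + c.resCoeff inf_le_right g', ?_, ?_⟩
    · rw [c.section_eq_of_res inf_le_left hi f g, c.section_eq_of_res inf_le_right hi f' g',
        ← section_add]
    · rw [c.section_eq_of_res inf_le_left hi (c.dzCoeff f), c.section_eq_of_res inf_le_right hi
        (c.dzCoeff f'), ← section_add]
      simp only [dzCoeff_add, dzCoeff_resCoeff]
  · rintro U h k s a ⟨W, hW, f, g, rfl, rfl⟩
    exact ⟨W, hW, k • f, k • g, by rw [section_smul], by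
      rw [dzCoeff_smul, dzCoeff_smul, section_smul]⟩
  · rintro U h s a ⟨W, hW, f, g, rfl, rfl⟩
    refine ⟨W, hW, _, _, c.bar_section f g, ?_⟩
    rw [SuperSpace.sgn_zero_right, one_smul, bar_section, dzCoeff_smul, dzCoeff_barCoeff,
      dzCoeff_barCoeff]
  · rintro U h s s' a a' ⟨W, hW, f, g, rfl, rfl⟩ ⟨W', hW', f', g', rfl, rfl⟩
    have hi : Set.MapsTo c.coord.fn U (W ⊓ W' : Opens _) := fun y hy => ⟨hW hy, hW' hy⟩
    rw [c.section_eq_of_res inf_le_left hi f g, c.section_eq_of_res inf_le_right hi f' g',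
      c.section_eq_of_res inf_le_left hi (c.dzCoeff f), c.section_eq_of_res inf_le_right hi
        (c.dzCoeff f')]
    refine ⟨W ⊓ W', hi, _, _, c.section_mul _ _ _ _, ?_⟩
    rw [X.twist_zero, section_mul, section_mul, ← section_add]
    simp only [dzCoeff_add, dzCoeff_mulCoeff, dzCoeff_barCoeff, dzCoeff_resCoeff]
    congr 1
    abel
  · intro U h V hV k x hx
    obtain ⟨U', h', W, hW, W₀, i, f, hx', he⟩ := c.exists_pull_eq_basic h hV k hx
    refine ⟨U', h', hx', W, hW, fun I => Hol.ofFst i (f I), 0, ?_, ?_⟩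
    · rw [section_, he, basic, basic, HolCoord.expand_zero, zero_mul, add_zero]
    · have h1 : c.dzCoeff (fun I => Hol.ofFst i (f I)) = 0 := by
        ext1 I; exact Hol.dz_ofFst i (f I)
      have h2 : c.dzCoeff (0 : c.Coeff W) = 0 := by
        ext1 I; exact map_zero _
      rw [h1, h2, section_, basic, HolCoord.expand_zero, zero_mul, add_zero]

/-- The vector field `∂_θ` of a relative chart. -/
def dθ : RelVF π 1 c.source := c.exists_dθ.choose

/-- The vector field `∂_z` of a relative chart. -/
def dz : RelVF π 0 c.source := c.exists_dz.choose

theorem dθ_section (h : U ≤ c.source) (hW : Set.MapsTo c.coord.fn U W) (f g : c.Coeff W) :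
    c.dθ.app U h (c.section_ h hW f g) = X.bar (c.basic h hW g) :=
  c.exists_dθ.choose_spec U h W hW f g

theorem dz_section (h : U ≤ c.source) (hW : Set.MapsTo c.coord.fn U W) (f g : c.Coeff W) :
    c.dz.app U h (c.section_ h hW f g) = c.section_ h hW (c.dzCoeff f) (c.dzCoeff g) :=
  c.exists_dz.choose_spec U h W hW f g

theorem basic_zero : c.basic h hW 0 = 0 := c.coord.expand_zero

theorem basic_single (a : Hol W) : c.basic h hW (Pi.single ∅ a) = c.coord.ev h hW a :=
  c.coord.expand_single_empty a

theorem dzCoeff_single (a : Hol W) :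
    c.dzCoeff (Pi.single ∅ a) = (Pi.single ∅ (Hol.dz a) : c.Coeff W) := by
  ext1 I
  by_cases hI : I = ∅
  · subst hI; simp only [dzCoeff, Pi.single_eq_same]
  · simp only [dzCoeff, Pi.single_eq_of_ne hI, map_zero]

theorem dzCoeff_zero : c.dzCoeff (0 : c.Coeff W) = 0 := by
  ext1 I; exact map_zero _

theorem ev_eq_section (a : Hol W) :
    c.coord.ev h hW a = c.section_ h hW (Pi.single ∅ a) 0 := by
  rw [section_, basic_zero, basic_single, zero_mul, add_zero]

theorem res_θ_eq_section (h : U ≤ c.source) (hW : Set.MapsTo c.coord.fn U W) :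
    X.res h c.θ = c.section_ h hW 0 (Pi.single ∅ 1) := by
  rw [section_, basic_zero, basic_single, map_one, one_mul, zero_add]

theorem mapsTo_top (U : Opens X.space) : Set.MapsTo c.coord.fn U
    ((⊤ : Opens ((Fin c.m → ℂ) × ℂ)) : Set ((Fin c.m → ℂ) × ℂ)) := fun _ _ => trivial

theorem res_z (h : U ≤ c.source) (hW : Set.MapsTo c.coord.fn U W) :
    X.res h c.z = c.coord.ev h hW (Hol.res le_top Hol.snd) :=
  (c.coord.ev_res le_rfl h (c.mapsTo_top _) hW le_top Hol.snd).symm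

theorem z_even : c.z ∈ X.part c.source 0 := c.coord.ev_even _ _ _

theorem dθ_θ : c.dθ.app _ le_rfl c.θ = 1 := by
  have h := c.res_θ_eq_section le_rfl (c.mapsTo_top _)
  rw [X.res_self] at h
  rw [h, dθ_section, basic_single, map_one, X.bar_one]

theorem dz_θ : c.dz.app _ le_rfl c.θ = 0 := by
  have h := c.res_θ_eq_section le_rfl (c.mapsTo_top _)
  rw [X.res_self] at h
  rw [h, dz_section, dzCoeff_zero, dzCoeff_single, section_, basic_zero, basic_single]
  have : Hol.dz (1 : Hol (⊤ : Opens ((Fin c.m → ℂ) × ℂ))) = 0 :=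
    Hol.dz_ofFst (W₀ := ⊤) (fun _ _ => trivial) 1
  rw [this, map_zero, zero_mul, add_zero]

theorem z_eq_section : c.z = c.section_ le_rfl (c.mapsTo_top _)
    (Pi.single ∅ Hol.snd) 0 := by
  rw [← ev_eq_section]; rfl

theorem dθ_z : c.dθ.app _ le_rfl c.z = 0 := by
  rw [z_eq_section, dθ_section, basic_zero, map_zero]

theorem dz_z : c.dz.app _ le_rfl c.z = 1 := by
  rw [z_eq_section, dz_section, dzCoeff_zero, dzCoeff_single, section_, basic_zero, basic_single,
    zero_mul, add_zero]
  have : Hol.dz (Hol.snd : Hol (⊤ : Opens ((Fin c.m → ℂ) × ℂ))) = 1 := Hol.dz_snd le_rfl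
  rw [this, map_one]

theorem app_res_eq {p : ZMod 2} {U₀ : Opens X.space} (ξ : RelVF π p U₀) (h : U ≤ U₀)
    (s : X.Γ U₀) : ξ.app U h (X.res h s) = X.res h (ξ.app U₀ le_rfl s) := ξ.app_res le_rfl h s

/-! ### Even sections near a point -/

/-- All terms of the local expansion except the holomorphic function indexed by ∅ contain an odd
factor, so each of them is homogeneous of square zero. -/
theorem exists_isNilpotent_sub_ev (h : U ≤ c.source) {s : X.Γ U} (hs : s ∈ X.part U 0)
    {x : X.space} (hx : x ∈ U) :
    ∃ (U' : Opens X.space) (h' : U' ≤ U) (W : Opens ((Fin c.m → ℂ) × ℂ))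
      (hW : Set.MapsTo c.coord.fn U' W) (f : Hol W), x ∈ U' ∧
      IsNilpotent (X.res h' s - c.coord.ev (h'.trans h) hW f) := by
  classical
  obtain ⟨U', h', W, hW, f, g, hx', he⟩ := c.exists_section_eq h s hx
  refine ⟨U', h', W, hW, f ∅, hx', ?_⟩
  set η := fun k => X.res (h'.trans h) (c.η k)
  refine X.isNilpotent_sub_of_sum (ι := Finset (Fin c.n) ⊕ Finset (Fin c.n))
    (F := (Finset.univ.erase ∅).disjSum Finset.univ)
    (t := Sum.elim (fun I => c.coord.ev (h'.trans h) hW (f I) * oddMonomial η I)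
      fun I => c.coord.ev (h'.trans h) hW (g I) * oddMonomial η I * X.res (h'.trans h) c.θ)
    (X.res_mem h' hs) (c.coord.ev_even _ hW _) ?_ ?_
  · rw [he, Finset.sum_disjSum]
    simp only [Sum.elim_inl, Sum.elim_inr]
    rw [← add_assoc, section_, basic, basic, HolCoord.expand_eq, HolCoord.expand_eq,
      ← Finset.sum_mul, ← Finset.add_sum_erase _ _ (Finset.mem_univ ∅), oddMonomial_empty, mul_one]
  · rintro (I | I) hI
    · refine ⟨c.coord.expand_term_homogeneous c.η_odd I _, c.coord.expand_term_sq c.η_odd ?_ _⟩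
      simpa using hI
    · have hθ := X.res_mem (h'.trans h) c.θ_odd
      refine ⟨?_, ?_⟩
      · simp only [Sum.elim_inr]
        rcases c.coord.expand_term_homogeneous (h := h'.trans h) (hW := hW) c.η_odd I (g I)
          with h0 | h1
        · right; simpa using X.mul_mem h0 hθ
        · left; exact X.mul_mem h1 hθ
      · simp only [Sum.elim_inr]
        rw [mul_assoc _ (X.res _ c.θ), ← mul_assoc (X.res _ c.θ), X.odd_mul_mul_self hθ, mul_zero]

theorem isUnit_of_isNilpotent_sub {s u : X.Γ U} (hu : IsUnit u) (hue : u ∈ X.part U 0)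
    (hn : IsNilpotent (s - u)) : IsUnit s := by
  have := hn.isUnit_add_left_of_commute hu (X.even_comm hue _).symm
  rwa [add_sub_cancel] at this

/-- The even sections at a point form a local ring. -/
theorem exists_isUnit_or_isUnit_one_sub (h : U ≤ c.source) {s : X.Γ U} (hs : s ∈ X.part U 0)
    {x : X.space} (hx : x ∈ U) : ∃ (U' : Opens X.space) (h' : U' ≤ U), x ∈ U' ∧
      (IsUnit (X.res h' s) ∨ IsUnit (1 - X.res h' s)) := by
  obtain ⟨U₁, h₁, W, hW, f, hx₁, hn⟩ := c.exists_isNilpotent_sub_ev h hs hx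
  -- Up to nilpotents the section is the holomorphic function f; if f vanishes at x then 1 - f does
  -- not.
  by_cases hf : f.1 ⟨c.coord.fn x, hW hx₁⟩ = 0
  · have hf' : (1 - f).1 ⟨c.coord.fn x, hW hx₁⟩ ≠ 0 := by
      change 1 - f.1 _ ≠ 0
      rw [hf, sub_zero]; exact one_ne_zero
    obtain ⟨U₂, h₂, hx₂, hu⟩ := c.coord.exists_isUnit_res_ev (h := h₁.trans h) (1 - f) hx₁ hf'
    refine ⟨U₂, h₂.trans h₁, hx₂, Or.inr ?_⟩
    refine isUnit_of_isNilpotent_sub hu (X.res_mem h₂ (c.coord.ev_even _ _ _)) ?_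
    have h3 := (hn.map (X.res h₂)).neg
    rw [map_sub, map_one, map_sub, map_one]
    rw [map_sub, X.res_res] at h3
    convert h3 using 1
    abel
  · obtain ⟨U₂, h₂, hx₂, hu⟩ := c.coord.exists_isUnit_res_ev (h := h₁.trans h) f hx₁ hf
    refine ⟨U₂, h₂.trans h₁, hx₂, Or.inl ?_⟩
    refine isUnit_of_isNilpotent_sub hu (X.res_mem h₂ (c.coord.ev_even _ _ _)) ?_
    have h3 := hn.map (X.res h₂)
    rwa [map_sub, X.res_res] at h3

/-- Expand the inverse a of the pullback of f: the ∅-coefficient of the relation f a - 1 = 0,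
evaluated at x, would read -1 = 0 if f vanished there. -/
theorem apply_ne_zero_of_isUnit_ev (hT : T.IsComplex) {f : Hol W}
    (hu : IsUnit (c.coord.ev h hW f)) {x : X.space} (hx : x ∈ U) :
    f.1 ⟨c.coord.fn x, hW hx⟩ ≠ 0 := by
  intro h0
  obtain ⟨a, ha⟩ := hu.exists_right_inv
  obtain ⟨U', h', W', hW', f', g', hx', he⟩ := c.exists_section_eq h a hx
  have hi : Set.MapsTo c.coord.fn U' (W ⊓ W' : Opens _) := fun y hy => ⟨hW (h' hy), hW' hy⟩
  rw [c.section_eq_of_res inf_le_right hi] at he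
  set f₁ : Hol (W ⊓ W') := Hol.res inf_le_left f with hf₁
  set a₁ := c.resCoeff (inf_le_right : W ⊓ W' ≤ W') f'
  set b₁ := c.resCoeff (inf_le_right : W ⊓ W' ≤ W') g'
  have h1 : c.section_ (h'.trans h) hi ((fun I => f₁ * a₁ I) - Pi.single ∅ 1)
      (fun I => f₁ * b₁ I) = 0 := by
    have h2 := congrArg (X.res h') ha
    rw [map_mul, he, map_one, ← c.coord.ev_res h h' hW hi inf_le_left f] at h2
    rw [section_, basic, basic, HolCoord.expand_sub, HolCoord.expand_const_mul,
      HolCoord.expand_const_mul, HolCoord.expand_one, ← h2, section_, mul_add, ← mul_assoc]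
    simp only [basic]
    abel
  have h3 := c.apply_empty_eq_zero hT h1 hx'
  rw [Pi.sub_apply, Pi.single_eq_same] at h3
  change f.1 ⟨c.coord.fn x, _⟩ * _ - 1 = (0 : ℂ) at h3
  rw [h0, zero_mul, zero_sub] at h3
  exact one_ne_zero (neg_eq_zero.1 h3)

/-- The holomorphic function underlying s does not vanish and has a root near the point; since it
differs from s by a nilpotent, Newton's method corrects this root to one of s. -/
theorem exists_sqrt (hT : T.IsComplex) (h : U ≤ c.source) {s : X.Γ U} (hs : s ∈ X.part U 0)
    (hu : IsUnit s) {x : X.space} (hx : x ∈ U) :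
    ∃ (U' : Opens X.space) (h' : U' ≤ U) (b : X.Γ U'), x ∈ U' ∧ b ∈ X.part U' 0 ∧
      b * b = X.res h' s ∧ IsUnit b := by
  obtain ⟨U₁, h₁, W, hW, f, hx₁, hn⟩ := c.exists_isNilpotent_sub_ev h hs hx
  have hue : IsUnit (c.coord.ev (h₁.trans h) hW f) := by
    refine isUnit_of_isNilpotent_sub (X.isUnit_res h₁ hu) (X.res_mem h₁ hs) ?_
    rw [← isNilpotent_neg_iff, neg_sub]
    exact hn
  have hf := c.apply_ne_zero_of_isUnit_ev hT hue hx₁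
  obtain ⟨W', i, g, hxW, hg⟩ := Hol.exists_sqrt f (hW hx₁) hf
  set U₂ := c.coord.inter (h₁.trans h) W'
  have h₂ : U₂ ≤ U₁ := c.coord.inter_le _ _
  have hW₂ : Set.MapsTo c.coord.fn U₂ W' := c.coord.mapsTo_inter _ _
  have hsq : c.coord.ev (h₂.trans (h₁.trans h)) hW₂ g * c.coord.ev (h₂.trans (h₁.trans h)) hW₂ g =
      X.res h₂ (c.coord.ev (h₁.trans h) hW f) := by
    rw [← map_mul, hg, c.coord.ev_res (h₁.trans h) h₂ hW hW₂ i f]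
  have hug : IsUnit (c.coord.ev (h₂.trans (h₁.trans h)) hW₂ g) := by
    have := X.isUnit_res h₂ hue
    rw [← hsq] at this
    exact ((Commute.refl _).isUnit_mul_iff.1 this).1
  obtain ⟨b, hb, hbs, hbu⟩ := X.exists_mul_self_eq (s := X.res (h₂.trans h₁) s)
    (X.res_mem _ hs) (c.coord.ev_even _ hW₂ g) hug (by
      rw [hsq, ← isNilpotent_neg_iff, neg_sub]
      have := hn.map (X.res h₂)
      rwa [map_sub, X.res_res] at this)
  exact ⟨U₂, h₂.trans h₁, b, ⟨hx₁, hxW⟩, hb, hbs, hbu⟩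

end RelChart

theorem Hol.exists_eq_ofFst_add_snd_mul_of_finite {E : Type} [NormedAddCommGroup E]
    [NormedSpace ℂ E] [ProperSpace E] {W : Opens (E × ℂ)} {ι : Type} [Finite ι] (f : ι → Hol W)
    {t : E} (ht : (t, (0 : ℂ)) ∈ W) :
    ∃ (W' : Opens (E × ℂ)) (i : W' ≤ W) (W₀ : Opens E) (i₀ : ∀ p ∈ W', p.1 ∈ W₀)
      (f₀ : ι → Hol W₀) (g : ι → Hol W'), (t, (0 : ℂ)) ∈ W' ∧
      ∀ k, Hol.res i (f k) = Hol.ofFst i₀ (f₀ k) + Hol.res le_top Hol.snd * g k := by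
  choose W' i W₀ i₀ f₀ g hm he using fun k => Hol.exists_eq_ofFst_add_snd_mul (f k) ht
  set W₁ : Opens (E × ℂ) := ⟨W ∩ ⋂ k, W' k, W.isOpen.inter
    (isOpen_iInter_of_finite fun k => (W' k).isOpen)⟩
  set W₂ : Opens E := ⟨⋂ k, W₀ k, isOpen_iInter_of_finite fun k => (W₀ k).isOpen⟩
  have hW₁ : ∀ k, W₁ ≤ W' k := fun k p hp => Set.mem_iInter.1 hp.2 k
  have hW₂ : ∀ k, W₂ ≤ W₀ k := fun k p hp => Set.mem_iInter.1 hp k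
  refine ⟨W₁, fun p hp => hp.1, W₂, fun p hp => Set.mem_iInter.2 fun k => i₀ k p (hW₁ k hp),
    fun k => Hol.res (hW₂ k) (f₀ k), fun k => Hol.res (hW₁ k) (g k),
    ⟨ht, Set.mem_iInter.2 hm⟩, fun k => ?_⟩
  exact congrArg (Hol.res (hW₁ k)) (he k)

namespace Hom

variable {X T : SuperSpace} (π : Hom X T)

/-- Pullback of functions on the base to an open set lying over their domain. -/
def pullTo {V : Opens T.space} {U : Opens X.space} (h : U ≤ Opens.comap π.base V) :
    T.Γ V →ₐ[ℂ] X.Γ U :=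
  (X.res h).comp (π.pull V)

theorem res_pullTo {V : Opens T.space} {U U' : Opens X.space} (h : U ≤ Opens.comap π.base V)
    (h' : U' ≤ U) (a : T.Γ V) : X.res h' (π.pullTo h a) = π.pullTo (h'.trans h) a :=
  X.res_res _ _ _

theorem pullTo_res {V V' : Opens T.space} {U : Opens X.space} (k : V' ≤ V)
    (h : U ≤ Opens.comap π.base V') (a : T.Γ V) :
    π.pullTo h (T.res k a) = π.pullTo (h.trans (Opens.comap_mono _ k)) a := by
  change X.res h (π.pull V' (T.res k a)) = _
  rw [π.pull_res, X.res_res]; rfl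

theorem pullTo_mem {V : Opens T.space} {U : Opens X.space} (h : U ≤ Opens.comap π.base V)
    {i : ZMod 2} {a : T.Γ V} (ha : a ∈ T.part V i) : π.pullTo h a ∈ X.part U i :=
  X.res_mem _ (π.pull_mem ha)

theorem bar_pullTo {V : Opens T.space} {U : Opens X.space} (h : U ≤ Opens.comap π.base V)
    (a : T.Γ V) : X.bar (π.pullTo h a) = π.pullTo h (T.bar a) := by
  change X.bar (X.res h (π.pull V a)) = _
  rw [X.bar_res, ← π.pull_bar]; rfl

end Hom

/-! ### The Ramond divisor in relative coordinates -/

namespace SRSFamily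

variable {T : SuperSpace} {r : ℕ} (F : SRSFamily T r)

/-- Pullback of functions on the base to the Ramond divisor. -/
def pullR {V : Opens T.space} {W : Opens F.R.space} (h : W ≤ F.above V) : T.Γ V →ₐ[ℂ] F.R.Γ W :=
  F.q.pullTo h

theorem res_pullR {V : Opens T.space} {W W' : Opens F.R.space} (h : W ≤ F.above V)
    (h' : W' ≤ W) (a : T.Γ V) : F.R.res h' (F.pullR h a) = F.pullR (h'.trans h) a :=
  F.q.res_pullTo _ _ _

theorem pullR_res {V V' : Opens T.space} {W : Opens F.R.space} (k : V' ≤ V)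
    (h : W ≤ F.above V') (a : T.Γ V) :
    F.pullR h (T.res k a) = F.pullR (h.trans (F.above_mono k)) a :=
  F.q.pullTo_res _ _ _

theorem pullR_mem {V : Opens T.space} {W : Opens F.R.space} (h : W ≤ F.above V)
    {i : ZMod 2} {a : T.Γ V} (ha : a ∈ T.part V i) : F.pullR h a ∈ F.R.part W i :=
  F.q.pullTo_mem h ha

theorem bar_pullR {V : Opens T.space} {W : Opens F.R.space} (h : W ≤ F.above V)
    (a : T.Γ V) : F.R.bar (F.pullR h a) = F.pullR h (T.bar a) :=
  F.q.bar_pullTo h a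

theorem comap_le_above {V : Opens T.space} {U : Opens F.X.space}
    (h : U ≤ Opens.comap F.π.base V) : Opens.comap F.j.base U ≤ F.above V :=
  Opens.comap_mono F.j.base h

theorem j_pull_pullTo {V : Opens T.space} {U : Opens F.X.space}
    (h : U ≤ Opens.comap F.π.base V) (a : T.Γ V) :
    F.j.pull U (F.π.pullTo h a) = F.pullR (F.comap_le_above h) a :=
  (F.j.pull_res h _).trans (F.R.res_res _ _ _).symm

variable {F} {c : RelChart F.π} (hc : IsCutOutBy F.j c.source c.z)
include hc

theorem pull_z_mul {U : Opens F.X.space} (h : U ≤ c.source) (s : F.X.Γ U) :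
    F.j.pull U (F.X.res h c.z * s) = 0 :=
  (hc U h _).2 fun _ hx => ⟨U, le_rfl, s, hx, F.X.res_self _ _⟩

/-- If the value of z at a point of R were nonzero, z would be invertible nearby, while its
restriction to R is zero and the structure sheaf of R vanishes on no nonempty open set. -/
theorem coord_snd_eq_zero {y : F.R.space} (hy : F.j.base y ∈ c.source) :
    (c.coord.fn (F.j.base y)).2 = 0 := by
  by_contra hne
  obtain ⟨U, h, hyU, hu⟩ := c.coord.exists_isUnit_res_ev (h := le_rfl) (hW := c.mapsTo_top _)
    Hol.snd hy hne
  have h1 := pull_z_mul hc h 1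
  rw [mul_one] at h1
  have h2 : IsUnit (F.j.pull U (F.X.res h c.z)) := hu.map (F.j.pull U)
  have := F.R_nontrivial (Opens.comap F.j.base U) ⟨y, hyU⟩
  rw [h1] at h2
  exact not_isUnit_zero h2

/-- Off the closed image of R every section restricts to R as a section over the empty set, that is,
as zero. In particular z divides 1 there and cannot take the value 0. -/
theorem exists_base_eq (hT : T.IsComplex) {x : F.X.space} (hx : x ∈ c.source)
    (h0 : (c.coord.fn x).2 = 0) : ∃ y, F.j.base y = x := by
  by_contra hne
  set U : Opens F.X.space := ⟨(c.source : Set F.X.space) ∩ (Set.range F.j.base)ᶜ,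
    c.source.isOpen.inter F.closedSubspace.isClosedEmbedding.isClosed_range.isOpen_compl⟩
  have hU : U ≤ c.source := fun y hy => hy.1
  obtain ⟨U', h', a, hx', he⟩ := (hc U hU 1).1 (F.R.subsingleton_of_eq_bot
    (V := Opens.comap F.j.base U)
    (fun y (hy : F.j.base y ∈ U) => hy.2 ⟨y, rfl⟩) _ _) x ⟨hx, hne⟩
  rw [map_one] at he
  have hu : IsUnit (F.X.res (h'.trans hU) c.z) := by
    have h1 := F.X.even_comm (F.X.res_mem (h'.trans hU) c.z_even) a
    exact ⟨⟨_, a, he.symm, by rw [← h1, ← he]⟩, rfl⟩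
  rw [c.res_z _ (c.mapsTo_top _)] at hu
  exact c.apply_ne_zero_of_isUnit_ev hT hu hx' h0

omit hc in
theorem exists_isOpen_base_eq (W : Opens F.R.space) :
    ∃ U : Opens F.X.space, Opens.comap F.j.base U = W := by
  obtain ⟨U, hU, h⟩ := F.closedSubspace.isClosedEmbedding.isInducing.isOpen_iff.1 W.isOpen
  exact ⟨⟨U, hU⟩, Opens.ext h⟩

/-- This is the openness of R → T: the image of a neighbourhood in X is open in T × ℂ, and its
points with second coordinate zero come from R. -/
theorem exists_forall_mem_of_divisor (hT : T.IsComplex) {y : F.R.space}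
    (hy : F.j.base y ∈ c.source) {W : Opens F.R.space} (hyW : y ∈ W) :
    ∃ V : Opens T.space, F.q.base y ∈ V ∧ ∀ t ∈ V, ∃ y' ∈ W, F.q.base y' = t := by
  obtain ⟨U, rfl⟩ := exists_isOpen_base_eq (F := F) W
  have hO := c.isOpenEmbedding.isOpenMap {x : c.source | x.1 ∈ U}
    (U.isOpen.preimage continuous_subtype_val)
  refine ⟨⟨{t | (t, (0 : ℂ)) ∈ _}, hO.preimage (by fun_prop : Continuous fun t => (t, (0 : ℂ)))⟩,
    ⟨⟨F.j.base y, hy⟩, hyW, Prod.ext rfl (coord_snd_eq_zero hc hy)⟩, ?_⟩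
  rintro t ⟨x, hxU, hx⟩
  obtain ⟨y', hy'⟩ := exists_base_eq hc hT x.2 (congrArg Prod.snd hx)
  refine ⟨y', ?_, ?_⟩
  · change F.j.base y' ∈ U
    rw [hy']; exact hxU
  · change F.π.base (F.j.base y') = t
    rw [hy']; exact congrArg Prod.fst hx

omit hc in
theorem exists_forall_mem (hT : T.IsComplex) {y : F.R.space} {W : Opens F.R.space} (hyW : y ∈ W) :
    ∃ V : Opens T.space, F.q.base y ∈ V ∧ ∀ t ∈ V, ∃ y' ∈ W, F.q.base y' = t := by
  obtain ⟨c, hy, hc⟩ := F.divisor y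
  exact exists_forall_mem_of_divisor hc hT hy hyW

omit hc in
/-- Neighbourhoods of the punctures in one fibre contain the punctures in the nearby fibres. -/
theorem exists_forall_mem_label (hT : T.IsComplex) {t : T.space} {y : Fin (2 * r) → F.R.space}
    (hy : ∀ i, F.q.base (y i) = t ∧ F.label (y i) = i) (W : Fin (2 * r) → Opens F.R.space)
    (hW : ∀ i, y i ∈ W i) :
    ∃ V : Opens T.space, t ∈ V ∧ ∀ y' ∈ F.above V, y' ∈ W (F.label y') := by
  have key : ∀ i, ∃ V : Opens T.space, t ∈ V ∧
      ∀ y', F.q.base y' ∈ V → F.label y' = i → y' ∈ W i := by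
    intro i
    obtain ⟨V, hV, H⟩ := exists_forall_mem hT
      (W := W i ⊓ ⟨F.label ⁻¹' {i}, F.label_locallyConstant.isOpen_fiber i⟩)
      (y := y i) ⟨hW i, (hy i).2⟩
    rw [(hy i).1] at hV
    refine ⟨V, hV, fun y' hy' hl => ?_⟩
    obtain ⟨y'', ⟨hy₁, hy₂⟩, he⟩ := H _ hy'
    -- The point found in the neighbourhood is the given one, as a fibre has a single puncture of
    -- label i.
    rwa [(F.label_bijective (F.q.base y') i).unique ⟨rfl, hl⟩ ⟨he, hy₂⟩]
  choose V hV H using key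
  exact ⟨⟨⋂ i, V i, isOpen_iInter_of_finite fun i => (V i).isOpen⟩, Set.mem_iInter.2 hV,
    fun y' hy' => H _ y' (Set.mem_iInter.1 hy' _) rfl⟩

omit hc in
theorem exists_punctures (t : T.space) :
    ∃ y : Fin (2 * r) → F.R.space, ∀ i, F.q.base (y i) = t ∧ F.label (y i) = i :=
  ⟨fun i => (F.label_bijective t i).choose, fun i => (F.label_bijective t i).choose_spec.1⟩

theorem coord_fn_eq {y : F.R.space} (hy : F.j.base y ∈ c.source) :
    c.coord.fn (F.j.base y) = (c.base.coord.fn (F.q.base y), 0) :=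
  Prod.ext (c.fst_eq _ hy) (coord_snd_eq_zero hc hy)

/-- Near the Ramond divisor every section is `a + b θ` modulo `z`, with `a` and `b` from the
base. -/
theorem exists_eq_add_mul_add_z_mul {y : F.R.space} {U : Opens F.X.space} (h : U ≤ c.source)
    (s : F.X.Γ U) (hy : F.j.base y ∈ U) :
    ∃ (U' : Opens F.X.space) (h' : U' ≤ U) (V : Opens T.space)
      (hV : U' ≤ Opens.comap F.π.base V) (a b : T.Γ V) (s' : F.X.Γ U'), F.j.base y ∈ U' ∧
      F.X.res h' s = F.π.pullTo hV a + F.π.pullTo hV b * F.X.res (h'.trans h) c.θ + F.X.res (h'.trans h) c.z * s' := by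
  obtain ⟨U₁, h₁, W, hW, f, g, hy₁, he⟩ := c.exists_section_eq h s hy
  have hfn := coord_fn_eq hc (h hy)
  have hm : (c.base.coord.fn (F.q.base y), (0 : ℂ)) ∈ W := by
    rw [← hfn]; exact hW hy₁
  -- All coefficients of both components are divided by z on a common neighbourhood; their values at
  -- z = 0 are functions of the base coordinates alone.
  obtain ⟨W', i, W₀, i₀, f₀, g₀, hm', hI⟩ := Hol.exists_eq_ofFst_add_snd_mul_of_finite
    (Sum.elim f g) hm
  set V := c.base.coord.inter le_rfl W₀
  have hVs : V ≤ c.base.source := c.base.coord.inter_le _ _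
  have hVW : Set.MapsTo c.base.coord.fn V W₀ := c.base.coord.mapsTo_inter _ _
  set U₂ : Opens F.X.space := c.coord.inter (h₁.trans h) W' ⊓ Opens.comap F.π.base V
  have h₂ : U₂ ≤ U₁ := inf_le_left.trans (c.coord.inter_le _ _)
  have hW₂ : Set.MapsTo c.coord.fn U₂ W' := fun x hx => hx.1.2
  have hV₂ : U₂ ≤ Opens.comap F.π.base V := inf_le_right
  have h₃ := h₂.trans (h₁.trans h)
  have key : ∀ k : Finset (Fin c.n) → Finset (Fin c.n) ⊕ Finset (Fin c.n),
      c.basic h₃ hW₂ (fun I => Hol.res i (Sum.elim f g (k I))) =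
      F.X.res hV₂ (F.π.pull V (c.base.coord.expand c.base.odd hVs hVW fun I => f₀ (k I))) +
      F.X.res h₃ c.z * c.basic h₃ hW₂ fun I => g₀ (k I) := by
    intro k
    rw [c.pull_expand h₃ hVs hV₂ hVW hW₂ i₀, c.res_z h₃ hW₂]
    have : (fun I => Hol.res i (Sum.elim f g (k I))) = (fun I => Hol.ofFst i₀ (f₀ (k I))) +
        (fun I => Hol.res le_top Hol.snd * g₀ (k I)) := funext fun I => hI (k I)
    rw [this, c.basic_add]
    congr 1
    exact c.coord.expand_const_mul _ _
  refine ⟨U₂, h₂.trans h₁, V, hV₂, c.base.coord.expand c.base.odd hVs hVW fun I => f₀ (Sum.inl I),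
    c.base.coord.expand c.base.odd hVs hVW fun I => f₀ (Sum.inr I), c.basic h₃ hW₂ (fun I => g₀ (Sum.inl I)) +
    c.basic h₃ hW₂ (fun I => g₀ (Sum.inr I)) * F.X.res h₃ c.θ, ⟨⟨hy₁, ?_⟩, ?_⟩, ?_⟩
  · change c.coord.fn _ ∈ W'
    rw [hfn]; exact hm'
  · refine ⟨c.source_le (h hy), ?_⟩
    exact i₀ _ hm'
  · rw [← F.X.res_res h₁ h₂, he, c.res_section _ _ h₂ i hW₂]
    have k1 := key Sum.inl
    have k2 := key Sum.inr
    simp only [Sum.elim_inl, Sum.elim_inr] at k1 k2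
    change c.basic h₃ hW₂ (fun I => Hol.res i (f I)) +
      c.basic h₃ hW₂ (fun I => Hol.res i (g I)) * _ = _
    rw [k1, k2, add_mul, mul_add, ← mul_assoc]
    exact add_add_add_comm _ _ _ _

/-- Sections of the Ramond divisor are locally `a + b x`, with `a` and `b` from the base. -/
theorem exists_eq_add_mul {y : F.R.space} (hyc : F.j.base y ∈ c.source) {W : Opens F.R.space}
    (s : F.R.Γ W) (hy : y ∈ W) :
    ∃ (W' : Opens F.R.space) (h' : W' ≤ W) (hs : W' ≤ Opens.comap F.j.base c.source)
      (V : Opens T.space) (hV : W' ≤ F.above V) (a b : T.Γ V), y ∈ W' ∧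
      F.R.res h' s = F.pullR hV a + F.pullR hV b * F.R.res hs (F.j.pull _ c.θ) := by
  obtain ⟨U, h, a, hyU, ha⟩ := F.closedSubspace.surjective W s y hy
  obtain ⟨U', h', V, hV, a', b', s', hyU', he⟩ := exists_eq_add_mul_add_z_mul hc
    (U := U ⊓ c.source) inf_le_right (F.X.res inf_le_left a) ⟨hyU, hyc⟩
  have hU'W : Opens.comap F.j.base U' ≤ W :=
    (Opens.comap_mono F.j.base (h'.trans inf_le_left)).trans h
  refine ⟨Opens.comap F.j.base U', hU'W, Opens.comap_mono _ (h'.trans inf_le_right), V,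
    Opens.comap_mono F.j.base hV, a', b', hyU', ?_⟩
  rw [F.X.res_res] at he
  have h1 := congrArg (F.j.pull U') he
  rw [map_add, pull_z_mul hc, add_zero, map_add, map_mul, j_pull_pullTo, j_pull_pullTo, F.j.pull_res,
    F.j.pull_res, ha, F.R.res_res] at h1
  exact h1

/-- Along the Ramond divisor `a + b x`, with `a` and `b` from the base, determines `a` and `b`. -/
theorem exists_res_eq_zero {y : F.R.space} {W : Opens F.R.space} (hy : y ∈ W)
    (hs : W ≤ Opens.comap F.j.base c.source) {V : Opens T.space} (hV : W ≤ F.above V)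
    {a b : T.Γ V} (H : F.pullR hV a + F.pullR hV b * F.R.res hs (F.j.pull _ c.θ) = 0) :
    ∃ (V' : Opens T.space) (h : V' ≤ V), F.q.base y ∈ V' ∧ T.res h a = 0 ∧ T.res h b = 0 := by
  obtain ⟨U, rfl⟩ := exists_isOpen_base_eq (F := F) W
  have hyc : F.j.base y ∈ c.source := hs hy
  set U₁ : Opens F.X.space := U ⊓ c.source ⊓ Opens.comap F.π.base V
  have hU₁ : U₁ ≤ c.source := inf_le_left.trans inf_le_right
  have hU₁V : U₁ ≤ Opens.comap F.π.base V := inf_le_right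
  have hzero : F.j.pull U₁ (F.π.pullTo hU₁V a + F.π.pullTo hU₁V b * F.X.res hU₁ c.θ) = 0 := by
    have h1 := congrArg (F.R.res (Opens.comap_mono F.j.base
      (inf_le_left.trans inf_le_left : U₁ ≤ U))) H
    rw [map_add, map_mul, map_zero, res_pullR, res_pullR, F.R.res_res] at h1
    rw [map_add, map_mul, j_pull_pullTo, j_pull_pullTo, F.j.pull_res]
    exact h1
  -- Lift to X: there a + b θ = z s'. Expanding s', a and b turns this into a relation among
  -- superfunctions with coefficients α - z f and β - z g.
  obtain ⟨U₂, h₂, s', hy₂, hs'⟩ := (hc U₁ hU₁ _).1 hzero _ ⟨⟨hy, hyc⟩, hV hy⟩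
  obtain ⟨U₃, h₃, W₃, hW₃, f, g, hy₃, he⟩ := c.exists_section_eq (h₂.trans hU₁) s' hy₂
  obtain ⟨V₁, k₁, W₁, hVW₁, α, ht₁, hα⟩ := c.base.generates (V ⊓ c.base.source) inf_le_right
    (T.res inf_le_left a) (F.q.base y) ⟨hV hy, c.source_le hyc⟩
  obtain ⟨V₂, k₂, W₂, hVW₂, β, ht₂, hβ⟩ := c.base.generates (V ⊓ c.base.source) inf_le_right
    (T.res inf_le_left b) (F.q.base y) ⟨hV hy, c.source_le hyc⟩
  rw [T.res_res] at hα hβ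
  set U₄ : Opens F.X.space := U₃ ⊓ Opens.comap F.π.base (V₁ ⊓ V₂)
  have h₄ : U₄ ≤ c.source := inf_le_left.trans (h₃.trans (h₂.trans hU₁))
  set p₀ : C((Fin c.m → ℂ) × ℂ, Fin c.m → ℂ) := ⟨Prod.fst, continuous_fst⟩
  set W₄ : Opens ((Fin c.m → ℂ) × ℂ) := W₃ ⊓ Opens.comap p₀ (W₁ ⊓ W₂)
  have hW₄ : Set.MapsTo c.coord.fn U₄ W₄ := by
    intro x hx
    refine ⟨hW₃ hx.1, ?_⟩
    change (c.coord.fn x).1 ∈ W₁ ⊓ W₂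
    rw [c.fst_eq x (h₄ hx)]
    exact ⟨hVW₁ hx.2.1, hVW₂ hx.2.2⟩
  have i₁ : ∀ p ∈ W₄, p.1 ∈ W₁ := fun p hp => hp.2.1
  have i₂ : ∀ p ∈ W₄, p.1 ∈ W₂ := fun p hp => hp.2.2
  have hker : c.section_ h₄ hW₄
      (fun I => Hol.ofFst i₁ (α I) - Hol.res le_top Hol.snd * Hol.res inf_le_left (f I))
      (fun I => Hol.ofFst i₂ (β I) - Hol.res le_top Hol.snd * Hol.res inf_le_left (g I)) = 0 := by
    have e1 : c.basic h₄ hW₄ (fun I => Hol.ofFst i₁ (α I)) =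
        F.π.pullTo (inf_le_left.trans (h₃.trans (h₂.trans hU₁V))) a := by
      rw [← c.pull_expand h₄ (k₁.trans inf_le_right)
        (inf_le_right.trans (Opens.comap_mono _ inf_le_left)) hVW₁ hW₄ i₁, ← hα, F.π.pull_res,
        F.X.res_res]
      rfl
    have e2 : c.basic h₄ hW₄ (fun I => Hol.ofFst i₂ (β I)) =
        F.π.pullTo (inf_le_left.trans (h₃.trans (h₂.trans hU₁V))) b := by
      rw [← c.pull_expand h₄ (k₂.trans inf_le_right)
        (inf_le_right.trans (Opens.comap_mono _ inf_le_right)) hVW₂ hW₄ i₂, ← hβ, F.π.pull_res,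
        F.X.res_res]
      rfl
    have e3 : ∀ f : c.Coeff W₃, c.basic h₄ hW₄
        (fun I => Hol.res le_top Hol.snd * Hol.res inf_le_left (f I)) =
        F.X.res h₄ c.z * c.basic h₄ hW₄ (c.resCoeff inf_le_left f) := by
      intro f
      rw [c.res_z h₄ hW₄]
      exact c.coord.expand_const_mul _ _
    have e4 := congrArg (F.X.res (inf_le_left.trans h₃ : U₄ ≤ U₂)) hs'
    have e5 := congrArg (F.X.res (inf_le_left : U₄ ≤ U₃)) he
    rw [F.X.res_res, c.res_section _ _ _ inf_le_left hW₄] at e5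
    rw [map_mul, e5] at e4
    simp only [map_add, map_mul, F.X.res_res, F.π.res_pullTo] at e4
    change c.basic h₄ hW₄ ((fun I => Hol.ofFst i₁ (α I)) - fun I => _) +
      c.basic h₄ hW₄ ((fun I => Hol.ofFst i₂ (β I)) - fun I => _) * _ = 0
    rw [RelChart.basic, RelChart.basic, HolCoord.expand_sub, HolCoord.expand_sub]
    change c.basic h₄ hW₄ _ - c.basic h₄ hW₄ _ + (c.basic h₄ hW₄ _ - c.basic h₄ hW₄ _) * _ = 0
    rw [e1, e2, e3, e3]
    have e6 : ∀ A B C D Z θ : F.X.Γ U₄, A + B * θ = Z * (C + D * θ) →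
        A - Z * C + (B - Z * D) * θ = 0 := by
      intro A B C D Z θ h
      rw [mul_add, ← mul_assoc] at h
      rw [sub_mul, sub_add_sub_comm, h, sub_self]
    exact e6 _ _ _ _ _ _ e4
  have hfn := coord_fn_eq hc hyc
  -- The coefficients α - z f and β - z g are combinations of relations of the base. Setting z = 0
  -- leaves α and β as such combinations with coefficients on the base, so a and b vanish near the
  -- point.
  obtain ⟨U₅, h₅, W₅, i₅, hW₅, V₅, hV₅, hUV₅, W₀, hW₀, i₀, k, ρ, A, B, hy₅, hρ, hI⟩ :=
    c.exists_rel hker (x := F.j.base y) ⟨hy₃, ht₁, ht₂⟩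
  set z₀ : C(Fin c.m → ℂ, (Fin c.m → ℂ) × ℂ) := ⟨fun t => (t, 0), by fun_prop⟩
  set W₆ : Opens (Fin c.m → ℂ) := Opens.comap z₀ W₅
  have hz : ∀ t ∈ W₆, (t, (0 : ℂ)) ∈ W₅ := fun t ht => ht
  have j₁ : W₆ ≤ W₁ := fun t ht => i₁ _ (i₅ ht)
  have j₂ : W₆ ≤ W₂ := fun t ht => i₂ _ (i₅ ht)
  have j₀ : W₆ ≤ W₀ := fun t ht => i₀ _ ht
  set V₆ := c.base.coord.inter (U' := V₁ ⊓ V₂ ⊓ V₅) (inf_le_right.trans hV₅) W₆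
  have hV₆ : V₆ ≤ V₁ ⊓ V₂ ⊓ V₅ := c.base.coord.inter_le _ _
  have hVs : V₆ ≤ c.base.source := hV₆.trans (inf_le_right.trans hV₅)
  have hVW : Set.MapsTo c.base.coord.fn V₆ W₆ := c.base.coord.mapsTo_inter _ _
  have hexp : ∀ (γ : Finset (Fin c.n) → Hol W₆) (A : Fin k → Hol W₆),
      (∀ I, γ I = ∑ l, A l * Hol.res j₀ (ρ l I)) →
      c.base.coord.expand c.base.odd hVs hVW γ = 0 := by
    intro γ A hγ
    have : γ = ∑ l, fun I => A l * Hol.res j₀ (ρ l I) := by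
      ext1 I; rw [hγ, Finset.sum_apply]
    rw [this, HolCoord.expand_sum]
    refine Finset.sum_eq_zero fun l _ => ?_
    rw [HolCoord.expand_const_mul, ← c.base.coord.res_expand (h := hV₅) (hW := hW₀)
      (hV₆.trans inf_le_right) j₀ hVW (ρ l), hρ, map_zero, mul_zero]
  have hat : ∀ (I : Finset (Fin c.n)) (C : Fin k → Hol W₅), Hol.atZero hz
      (∑ l, C l * Hol.ofFst i₀ (ρ l I)) = ∑ l, Hol.atZero hz (C l) * Hol.res j₀ (ρ l I) := by
    intro I C
    rw [map_sum]
    refine Finset.sum_congr rfl fun l _ => ?_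
    rw [map_mul]; rfl
  refine ⟨V₆, hV₆.trans (inf_le_left.trans (inf_le_left.trans (k₁.trans inf_le_left))),
    ⟨⟨⟨ht₁, ht₂⟩, hUV₅ hy₅⟩, ?_⟩, ?_, ?_⟩
  · change (c.base.coord.fn (F.q.base y), (0 : ℂ)) ∈ W₅
    rw [← hfn]; exact hW₅ hy₅
  · have e1 := congrArg (T.res (hV₆.trans (inf_le_left.trans inf_le_left))) hα
    rw [T.res_res, c.base.coord.res_expand _ j₁ hVW] at e1
    rw [e1]
    refine hexp _ (fun l => Hol.atZero hz (A l)) fun I => ?_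
    rw [← hat, ← (hI I).1]
    ext t
    change _ = (α I).1 _ - (0 : ℂ) * _
    rw [zero_mul, sub_zero]; rfl
  · have e1 := congrArg (T.res (hV₆.trans (inf_le_left.trans inf_le_right))) hβ
    rw [T.res_res, c.base.coord.res_expand _ j₂ hVW] at e1
    rw [e1]
    refine hexp _ (fun l => Hol.atZero hz (B l)) fun I => ?_
    rw [← hat, ← (hI I).2]
    ext t
    change _ = (β I).1 _ - (0 : ℂ) * _
    rw [zero_mul, sub_zero]; rfl

end SRSFamily

/-! ### Functions and vector fields on the Ramond divisor -/

namespace SRSFamily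

variable {T : SuperSpace} {r : ℕ} {F : SRSFamily T r}

/-- The restriction to the Ramond divisor of the odd coordinate of a relative chart. -/
def oddCoord (c : RelChart F.π) : F.R.Γ (Opens.comap F.j.base c.source) := F.j.pull _ c.θ

theorem oddCoord_mem (c : RelChart F.π) : oddCoord c ∈ F.R.part _ 1 := F.j.pull_mem c.θ_odd

theorem j_pull_res_θ (c : RelChart F.π) {U : Opens F.X.space} (h : U ≤ c.source) :
    F.j.pull U (F.X.res h c.θ) = F.R.res (Opens.comap_mono F.j.base h) (oddCoord c) :=
  F.j.pull_res h _

variable {c : RelChart F.π}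

theorem j_pull_res_eq {U U' : Opens F.X.space} (i : U ≤ c.source) (h : U' ≤ U)
    {V V' : Opens T.space} (hV : U ≤ Opens.comap F.π.base V) (k : V' ≤ V)
    (hV' : U' ≤ Opens.comap F.π.base V') {s : F.X.Γ U} {a b : T.Γ V}
    (H : F.j.pull U s = F.pullR (F.comap_le_above hV) a + F.pullR (F.comap_le_above hV) b *
      F.R.res (Opens.comap_mono F.j.base i) (oddCoord c)) :
    F.j.pull U' (F.X.res h s) = F.pullR (F.comap_le_above hV') (T.res k a) +
      F.pullR (F.comap_le_above hV') (T.res k b) *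
        F.R.res (Opens.comap_mono F.j.base (h.trans i)) (oddCoord c) := by
  rw [F.j.pull_res h, H, map_add, map_mul, res_pullR, res_pullR, F.R.res_res, pullR_res, pullR_res]

/-- Applying ∂_z to z s = 0 gives s = -z ∂_z s, a multiple of z. So a factor z may be cancelled if
only restrictions to R matter. -/
theorem res_eq_zero_of_mul_z (hc : IsCutOutBy F.j c.source c.z) {U : Opens F.X.space}
    (h : U ≤ c.source) {s : F.X.Γ U} (hs : F.X.res h c.z * s = 0) : F.j.pull U s = 0 := by
  have h1 := c.dz.leibniz_even h (F.X.res h c.z) s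
  rw [hs, map_zero, RelChart.app_res_eq, c.dz_z, map_one, one_mul] at h1
  have h2 : s = F.X.res h c.z * -(c.dz.app U h s) := by
    rw [mul_neg]; exact eq_neg_of_add_eq_zero_left h1.symm
  rw [h2, pull_z_mul hc]

theorem exists_res_eq {y : F.R.space} (hc : IsCutOutBy F.j c.source c.z) {W : Opens F.R.space}
    (hy : y ∈ W) (hs : W ≤ Opens.comap F.j.base c.source) {V : Opens T.space}
    (hV : W ≤ F.above V) {a b a' b' : T.Γ V}
    (H : F.pullR hV a + F.pullR hV b * F.R.res hs (oddCoord c) =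
      F.pullR hV a' + F.pullR hV b' * F.R.res hs (oddCoord c)) :
    ∃ (V' : Opens T.space) (h : V' ≤ V), F.q.base y ∈ V' ∧ T.res h a = T.res h a' ∧
      T.res h b = T.res h b' := by
  obtain ⟨V', h, hy', h1, h2⟩ := exists_res_eq_zero hc hy hs hV (a := a - a') (b := b - b') (by
    rw [map_sub, map_sub, sub_mul, sub_add_sub_comm]
    exact sub_eq_zero.2 H)
  rw [map_sub, sub_eq_zero] at h1 h2
  exact ⟨V', h, hy', h1, h2⟩

theorem pullR_eq_zero (hc : IsCutOutBy F.j c.source c.z) {W : Opens F.R.space}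
    (hs : W ≤ Opens.comap F.j.base c.source) {V : Opens T.space}
    (hV : W ≤ F.above V) {a b : T.Γ V}
    (H : F.pullR hV a + F.pullR hV b * F.R.res hs (oddCoord c) = 0) :
    F.pullR hV a = 0 ∧ F.pullR hV b = 0 := by
  have key : ∀ y ∈ W, ∃ (W' : Opens F.R.space) (h : W' ≤ W), y ∈ W' ∧
      F.pullR (h.trans hV) a = 0 ∧ F.pullR (h.trans hV) b = 0 := by
    intro y hy
    obtain ⟨V', h, hy', h1, h2⟩ := exists_res_eq_zero hc hy hs hV H
    refine ⟨W ⊓ F.above V', inf_le_left, ⟨hy, hy'⟩, ?_, ?_⟩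
    · have := F.pullR_res h (inf_le_right : W ⊓ F.above V' ≤ _) a
      rwa [h1, map_zero, eq_comm] at this
    · have := F.pullR_res h (inf_le_right : W ⊓ F.above V' ≤ _) b
      rwa [h2, map_zero, eq_comm] at this
  constructor
  · refine F.R.eq_of_local fun y hy => ?_
    obtain ⟨W', h, hy', h1, h2⟩ := key y hy
    exact ⟨W', h, hy', by rw [res_pullR, h1, map_zero]⟩
  · refine F.R.eq_of_local fun y hy => ?_
    obtain ⟨W', h, hy', h1, h2⟩ := key y hy
    exact ⟨W', h, hy', by rw [res_pullR, h2, map_zero]⟩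

/-- Functions on R are locally a + b x, and b is determined as a function on R, so differentiation
in x is well defined; the signs are those of differentiation in θ. -/
theorem exists_dx (hc : IsCutOutBy F.j c.source c.z) :
    ∃ ξ : RelVF F.q 1 (Opens.comap F.j.base c.source), ∀ (W : Opens F.R.space)
      (h : W ≤ Opens.comap F.j.base c.source) (V : Opens T.space) (hV : W ≤ F.above V)
      (a b : T.Γ V), ξ.app W h (F.pullR hV a + F.pullR hV b * F.R.res h (oddCoord c)) =
        F.R.bar (F.pullR hV b) := by
  have hθ : ∀ {W : Opens F.R.space} (h : W ≤ Opens.comap F.j.base c.source),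
      F.R.res h (oddCoord c) ∈ F.R.part W 1 := fun h => F.R.res_mem h (oddCoord_mem c)
  refine Exists.imp (fun ξ hξ W h V hV a b => hξ W h _ _ ⟨V, hV, a, b, rfl, rfl⟩)
    (RelVF.exists_of_local (π := F.q) (p := 1) (U₀ := Opens.comap F.j.base c.source)
    (fun W h s d => ∃ (V : Opens T.space) (hV : W ≤ F.above V) (a b : T.Γ V),
      s = F.pullR hV a + F.pullR hV b * F.R.res h (oddCoord c) ∧ d = F.R.bar (F.pullR hV b))
    ?_ ?_ ?_ ?_ ?_ ?_ ?_ ?_)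
  · rintro W W' h h' s d ⟨V, hV, a, b, rfl, rfl⟩
    exact ⟨V, h'.trans hV, a, b, by rw [map_add, map_mul, res_pullR, res_pullR, F.R.res_res],
      by rw [← F.R.bar_res, res_pullR]⟩
  · rintro W h d ⟨V, hV, a, b, h0, rfl⟩
    rw [(pullR_eq_zero hc h hV h0.symm).2, map_zero]
  · intro W h s y hy
    obtain ⟨W', h', hs, V, hV, a, b, hy', he⟩ := exists_eq_add_mul hc (h hy) s hy
    exact ⟨W', h', _, hy', V, hV, a, b, he, rfl⟩
  · rintro W h s s' d d' ⟨V, hV, a, b, rfl, rfl⟩ ⟨V', hV', a', b', rfl, rfl⟩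
    have hi : W ≤ F.above (V ⊓ V') := fun y hy => ⟨hV hy, hV' hy⟩
    refine ⟨V ⊓ V', hi, T.res inf_le_left a + T.res inf_le_right a',
      T.res inf_le_left b + T.res inf_le_right b', ?_, ?_⟩
    · rw [map_add, map_add, pullR_res, pullR_res, pullR_res, pullR_res, add_mul]
      exact add_add_add_comm _ _ _ _
    · rw [map_add, pullR_res, pullR_res, map_add]
  · rintro W h k s d ⟨V, hV, a, b, rfl, rfl⟩
    exact ⟨V, hV, k • a, k • b, by rw [map_smul, map_smul, smul_add, smul_mul_assoc],
      by rw [map_smul, map_smul]⟩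
  · rintro W h s d ⟨V, hV, a, b, rfl, rfl⟩
    refine ⟨V, hV, T.bar a, -T.bar b, ?_, ?_⟩
    · rw [map_add, F.R.bar_mul, F.R.bar_of_odd (hθ h), bar_pullR, bar_pullR, map_neg, neg_mul,
        mul_neg]
    · rw [SuperSpace.sgn_one_one, bar_pullR, map_neg, map_neg, neg_one_smul]
  · rintro W h s s' d d' ⟨V, hV, a, b, rfl, rfl⟩ ⟨V', hV', a', b', rfl, rfl⟩
    have hi : W ≤ F.above (V ⊓ V') := fun y hy => ⟨hV hy, hV' hy⟩
    refine ⟨V ⊓ V', hi, T.res inf_le_left a * T.res inf_le_right a',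
      T.res inf_le_left a * T.res inf_le_right b' +
        T.res inf_le_left b * T.bar (T.res inf_le_right a'), ?_, ?_⟩
    · simp only [map_add, map_mul, ← bar_pullR, pullR_res]
      exact add_mul_odd_mul_add_mul_odd (hθ h) _ _ _ _
    · simp only [map_add, map_mul, ← bar_pullR, pullR_res, F.R.twist_one, F.R.bar_mul,
        F.R.bar_bar]
      rw [add_mul, mul_add, F.R.bar_of_odd (hθ h), mul_neg, neg_mul,
        mul_assoc _ (F.R.res h (oddCoord c)), F.R.odd_mul (hθ h), F.R.bar_bar]
      abel
  · intro W h V hV k y hy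
    refine ⟨W, le_rfl, hy, V, hV, k, 0, ?_, ?_⟩
    · rw [map_zero, zero_mul, add_zero, F.R.res_self]; rfl
    · rw [map_zero, map_zero]

/-- The vector field `∂_x` on the Ramond divisor. -/
def dx (hc : IsCutOutBy F.j c.source c.z) : RelVF F.q 1 (Opens.comap F.j.base c.source) :=
  (exists_dx hc).choose

theorem dx_app (hc : IsCutOutBy F.j c.source c.z) {W : Opens F.R.space}
    (h : W ≤ Opens.comap F.j.base c.source) {V : Opens T.space} (hV : W ≤ F.above V)
    (a b : T.Γ V) : (dx hc).app W h (F.pullR hV a + F.pullR hV b * F.R.res h (oddCoord c)) =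
      F.R.bar (F.pullR hV b) :=
  (exists_dx hc).choose_spec W h V hV a b

theorem dx_oddCoord (hc : IsCutOutBy F.j c.source c.z) {W : Opens F.R.space}
    (h : W ≤ Opens.comap F.j.base c.source) : (dx hc).app W h (F.R.res h (oddCoord c)) = 1 := by
  have := dx_app hc h (V := ⊤) (fun _ _ => trivial) 0 1
  rwa [map_zero, map_one, zero_add, one_mul, F.R.bar_one] at this

theorem app_pullR {p : ZMod 2} {W₀ W : Opens F.R.space} (ξ : RelVF F.q p W₀) (h : W ≤ W₀)
    {V : Opens T.space} (hV : W ≤ F.above V) (a : T.Γ V) : ξ.app W h (F.pullR hV a) = 0 :=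
  ξ.app_pull h hV a

/-- With the coefficient moved to the right, the same formula holds for fields of both parities. -/
theorem app_pullR_mul {p : ZMod 2} {W₀ W : Opens F.R.space} (ξ : RelVF F.q p W₀) (h : W ≤ W₀)
    {V : Opens T.space} (hV : W ≤ F.above V) (b : T.Γ V) {x : F.R.Γ W} (hx : x ∈ F.R.part W 1) :
    ξ.app W h (F.pullR hV b * x) = ξ.app W h x * F.R.bar (F.pullR hV b) := by
  have hm := ξ.app_mem h hx
  rcases zmod_cases p with rfl | rfl
  · rw [ξ.leibniz_even, app_pullR, zero_mul, zero_add, F.R.odd_mul hm, F.R.bar_bar]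
  · rw [ξ.leibniz_odd, app_pullR, zero_mul, zero_add, F.R.even_comm hm]

/-- Every vector field on the Ramond divisor is a multiple of `∂_x`. -/
theorem isMul_dx (hc : IsCutOutBy F.j c.source c.z) {p : ZMod 2} {W : Opens F.R.space}
    (h : W ≤ Opens.comap F.j.base c.source) (ξ : RelVF F.q p W) :
    ξ.IsMul (ξ.app W le_rfl (F.R.res h (oddCoord c))) ((dx hc).res h) := by
  intro W' h' s
  refine F.R.eq_of_local fun y hy => ?_
  obtain ⟨W'', h'', hs, V, hV, a, b, hy', he⟩ := exists_eq_add_mul hc (h (h' hy)) s hy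
  refine ⟨W'', h'', hy', ?_⟩
  change _ = F.R.res h'' (_ * (dx hc).app W' (h'.trans h) s)
  rw [map_mul, F.R.res_res, ← (dx hc).app_res, ← ξ.app_res, ← ξ.app_res]
  change _ = _ + _ * F.R.res hs (oddCoord c) at he
  rw [he, dx_app, map_add, app_pullR, zero_add,
    app_pullR_mul _ _ _ _ (F.R.res_mem hs (oddCoord_mem c)), F.R.res_res]

end SRSFamily

/-- The quotient is replaced by its component of parity i, which is harmless because z is even; the
component is an average over the involution. -/
theorem SuperSpace.exists_mem_eq_mul (X : SuperSpace) {U : Opens X.space} {i : ZMod 2}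
    {z s a : X.Γ U} (hz : z ∈ X.part U 0) (hs : s ∈ X.part U i) (h : s = z * a) :
    ∃ a' ∈ X.part U i, s = z * a' := by
  have h1 : z * X.bar a = sgn 1 i • s := by
    rw [← X.bar_eq_sgn_smul hs, h, X.bar_mul, X.bar_of_even hz]
  refine ⟨(2⁻¹ : ℂ) • (a + sgn 1 i • X.bar a), ?_, ?_⟩
  · rw [X.mem_part_iff, map_smul, map_add, map_smul, X.bar_bar, smul_comm, smul_add (sgn 1 i),
      smul_smul, sgn_mul_self, one_smul, add_comm]
  · rw [mul_smul_comm, mul_add, mul_smul_comm, h1, ← h, smul_smul, sgn_mul_self, one_smul,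
      ← two_smul ℂ s, smul_smul]
    norm_num

/-- The compatibility of two superconformal systems on R, sorted into a part without x and a part
with x, so that coefficients can be compared. Here G₀ + G₁ x stands for the quotient of the even
coordinates and A + B x for the second odd coordinate. -/
theorem SuperSpace.relation_of_sub_eq_zero (X : SuperSpace) {U : Opens X.space}
    {x G₀ G₁ A B : X.Γ U} (hx : x ∈ X.part U 1) (hG₀ : G₀ ∈ X.part U 0) (hA : A ∈ X.part U 1)
    (hB : B ∈ X.part U 0)
    (H : x * (G₀ + G₁ * x) + -G₁ - B * ((G₀ + G₁ * x) * (A + B * x)) = 0) :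
    -G₁ + G₀ * x = G₀ * A * B + (G₀ * B - G₁ * A) * B * x := by
  rw [add_mul_odd_mul_add_mul_odd hx, X.bar_of_odd hA, mul_add, ← mul_assoc,
    X.odd_mul_mul_self hx, add_zero, ← X.even_comm hG₀, X.even_comm hB, add_mul,
    mul_assoc _ x B, ← X.even_comm hB x, ← mul_assoc, mul_neg, ← sub_eq_add_neg (G₀ * B),
    sub_eq_zero, add_comm] at H
  exact H

/-! ### Comparison of superconformal coordinates -/

namespace SRSFamily

variable {T : SuperSpace} {r : ℕ} {F : SRSFamily T r}

namespace SCChart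

variable (C : F.SCChart)

theorem v_res_θ {U : Opens F.X.space} (h : U ≤ C.chart.source) :
    C.v.app U h (F.X.res h C.chart.θ) = 1 := by
  rw [RelChart.app_res_eq, C.v_θ, map_one]

theorem v_res_z {U : Opens F.X.space} (h : U ≤ C.chart.source) :
    C.v.app U h (F.X.res h C.chart.z) = F.X.res h C.chart.z * F.X.res h C.chart.θ := by
  rw [RelChart.app_res_eq, C.v_z, map_mul]

/-- The restrictions to the Ramond divisor of a section and of its derivative along the
distribution. -/
theorem exists_pull_eq {y : F.R.space} {U : Opens F.X.space} (h : U ≤ C.chart.source)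
    {i : ZMod 2} {s : F.X.Γ U} (hs : s ∈ F.X.part U i) (hy : F.j.base y ∈ U) :
    ∃ (U' : Opens F.X.space) (h' : U' ≤ U) (V : Opens T.space)
      (hV : U' ≤ Opens.comap F.π.base V) (a b : T.Γ V), F.j.base y ∈ U' ∧
      a ∈ T.part V i ∧ b ∈ T.part V (1 + i) ∧
      F.j.pull U' (F.X.res h' s) = F.pullR (F.comap_le_above hV) a +
        F.pullR (F.comap_le_above hV) b *
          F.R.res (Opens.comap_mono F.j.base (h'.trans h)) (oddCoord C.chart) ∧
      F.j.pull U' (C.v.app U' (h'.trans h) (F.X.res h' s)) =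
        F.pullR (F.comap_le_above hV) (T.bar b) := by
  obtain ⟨U₁, h₁, V, hV, a, b, s', hy₁, he⟩ := exists_eq_add_mul_add_z_mul C.divisor h s hy
  have k1 : F.j.pull U₁ (F.X.res h₁ s) = F.pullR (F.comap_le_above hV) a +
        F.pullR (F.comap_le_above hV) b *
          F.R.res (Opens.comap_mono F.j.base (h₁.trans h)) (oddCoord C.chart) := by
    rw [he, map_add, pull_z_mul C.divisor, add_zero, map_add, map_mul, j_pull_pullTo,
      j_pull_pullTo, j_pull_res_θ]
  -- The field sends a + b θ + z s' to bar b + z (θ s' + v s'), since v z = z θ; the multiple of z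
  -- disappears on R.
  have k2 : F.j.pull U₁ (C.v.app U₁ (h₁.trans h) (F.X.res h₁ s)) =
        F.pullR (F.comap_le_above hV) (T.bar b) := by
    have e1 : C.v.app U₁ (h₁.trans h) (F.π.pullTo hV a) = 0 := C.v.app_pull _ _ _
    have e2 : C.v.app U₁ (h₁.trans h) (F.π.pullTo hV b) = 0 := C.v.app_pull _ _ _
    rw [he, map_add (C.v.app _ _), map_add (C.v.app _ _), e1, zero_add, C.v.leibniz_odd, e2, zero_mul, zero_add, v_res_θ,
      mul_one, C.v.leibniz_odd, v_res_z, mul_assoc,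
      F.X.bar_of_even (F.X.res_mem _ C.chart.z_even), ← mul_add, map_add,
      pull_z_mul C.divisor, add_zero, F.π.bar_pullTo, j_pull_pullTo]
  -- The involution gives a second expansion of the same restriction, up to the sign of its parity;
  -- uniqueness of the coefficients near y then fixes the parities of a and b.
  have k3 := congrArg F.R.bar k1
  rw [← F.j.pull_bar, F.X.bar_eq_sgn_smul (F.X.res_mem h₁ hs), map_smul, k1, map_add, F.R.bar_mul,
    F.R.bar_of_odd (F.R.res_mem _ (oddCoord_mem _)), bar_pullR, bar_pullR, smul_add,
    ← smul_mul_assoc, ← map_smul, ← map_smul, mul_neg, ← neg_mul, ← map_neg] at k3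
  obtain ⟨V', h', hyV, ha, hb⟩ := exists_res_eq C.divisor (y := y) hy₁ _ _ k3
  set U₂ := U₁ ⊓ Opens.comap F.π.base V'
  have h₂ : U₂ ≤ U₁ := inf_le_left
  have hV₂ : U₂ ≤ Opens.comap F.π.base V' := inf_le_right
  refine ⟨U₂, h₂.trans h₁, V', hV₂, T.res h' a, T.res h' b, ⟨hy₁, hyV⟩, ?_, ?_, ?_, ?_⟩
  · rw [T.mem_part_iff, T.bar_res, ← ha, map_smul]
  · rw [T.mem_part_iff, T.bar_res, sgn_one_add, SuperSpace.sgn_one_one, mul_smul, neg_one_smul,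
      ← map_smul, hb, map_neg, neg_neg]
  · have := congrArg (F.R.res (Opens.comap_mono F.j.base h₂)) k1
    rw [← F.j.pull_res h₂, F.X.res_res, map_add, map_mul, res_pullR, res_pullR, F.R.res_res] at this
    rw [this, pullR_res, pullR_res]
  · have := congrArg (F.R.res (Opens.comap_mono F.j.base h₂)) k2
    rw [← F.j.pull_res h₂, ← C.v.app_res, F.X.res_res, res_pullR] at this
    rw [this, T.bar_res, pullR_res]

/-- Both fields generate the distribution, so v' = f v. Evaluation on θ' gives f v(θ') = 1 and
evaluation on z' gives f v(z') = z' θ'; eliminate f. -/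
theorem v_app_z (C' : F.SCChart) {U : Opens F.X.space} (h : U ≤ C.chart.source)
    (h' : U ≤ C'.chart.source) :
    C.v.app U h (F.X.res h' C'.chart.z) =
      C.v.app U h (F.X.res h' C'.chart.θ) * (F.X.res h' C'.chart.z * F.X.res h' C'.chart.θ) := by
  have hD : C'.v.res h' ∈ F.D 1 U := (C'.generates 1 U h' _).2 ⟨1, fun _ _ _ => by
    rw [map_one, one_mul]⟩
  obtain ⟨f, hf⟩ := (C.generates 1 U h _).1 hD
  have h1 := hf U le_rfl (F.X.res h' C'.chart.θ)
  have h2 := hf U le_rfl (F.X.res h' C'.chart.z)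
  change C'.v.app U h' _ = _ * C.v.app U h _ at h1 h2
  rw [v_res_θ, F.X.res_self] at h1
  rw [v_res_z, F.X.res_self] at h2
  rw [h2, ← mul_assoc, F.X.even_comm (C.v.app_odd_mem h (F.X.res_mem h' C'.chart.θ_odd)), ← h1,
    one_mul]

/-- The function z' vanishes on R, whose ideal is generated by z. -/
theorem exists_z_eq (C' : F.SCChart) {y : F.R.space} {U : Opens F.X.space}
    (h : U ≤ C.chart.source) (h' : U ≤ C'.chart.source) (hy : F.j.base y ∈ U) :
    ∃ (U' : Opens F.X.space) (i : U' ≤ U) (g : F.X.Γ U'), F.j.base y ∈ U' ∧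
      g ∈ F.X.part U' 0 ∧
      F.X.res (i.trans h') C'.chart.z = F.X.res (i.trans h) C.chart.z * g := by
  have h1 := pull_z_mul C'.divisor h' 1
  rw [mul_one] at h1
  obtain ⟨U', i, g, hy', hg⟩ := (C.divisor U h _).1 h1 _ hy
  rw [F.X.res_res] at hg
  obtain ⟨g', hg', he⟩ := F.X.exists_mem_eq_mul (F.X.res_mem (i.trans h) C.chart.z_even)
    (F.X.res_mem (i.trans h') C'.chart.z_even) hg
  exact ⟨U', i, g', hy', hg', he⟩

end SCChart

/-- As a is odd, a² = 0, so the first relation gives g₁ a = 0; the second becomes g₀ = g₀ b², and g₀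
is invertible. -/
theorem mul_self_eq_one_of_relations {V : Opens T.space} {a b g₀ g₁ k : T.Γ V}
    (ha : a ∈ T.part V 1) (hb : b ∈ T.part V 0) (hg₀ : g₀ ∈ T.part V 0)
    (h₁ : -g₁ = g₀ * a * b) (h₂ : g₀ = (g₀ * b - g₁ * a) * b) (h₃ : g₀ * k = 1) : b * b = 1 := by
  have e1 : g₁ * a = 0 := by
    rw [← neg_eq_zero, ← neg_mul, h₁, mul_assoc, T.even_comm hb, ← mul_assoc, mul_assoc g₀ a a,
      T.odd_mul_self ha, mul_zero, zero_mul]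
  rw [e1, sub_zero, mul_assoc] at h₂
  have e2 : k * g₀ = 1 := by rw [← T.even_comm hg₀, h₃]
  rw [← one_mul (b * b), ← e2, mul_assoc, ← h₂]

/-- A square root of one on the base is locally `1` or `-1`. -/
theorem exists_pullTo_eq_or {c : RelChart F.π} {x : F.X.space} {U : Opens F.X.space}
    (h : U ≤ c.source) {V : Opens T.space} (hV : U ≤ Opens.comap F.π.base V) {b : T.Γ V}
    (hb : b ∈ T.part V 0) (hbb : b * b = 1) (hx : x ∈ U) :
    ∃ (U' : Opens F.X.space) (h' : U' ≤ U), x ∈ U' ∧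
      (F.π.pullTo (h'.trans hV) b = 1 ∨ F.π.pullTo (h'.trans hV) b = -1) := by
  -- The sections e and 1 - e are half of 1 + b and of 1 - b, whose product is zero. One of them is
  -- a unit near x, and then the other vanishes.
  set e : T.Γ V := (2⁻¹ : ℂ) • (1 + b)
  have he : e ∈ T.part V 0 := Submodule.smul_mem _ _ (Submodule.add_mem _ (T.one_mem V) hb)
  have hne : (1 + b) * (1 - b) = 0 := by
    rw [mul_sub, add_mul, add_mul, hbb]; simp [add_comm]
  have h1e : 1 - e = (2⁻¹ : ℂ) • (1 - b) := by
    have : (1 : T.Γ V) = (2⁻¹ : ℂ) • (1 + 1) := by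
      rw [← two_smul ℂ (1 : T.Γ V), smul_smul]; norm_num
    change 1 - (2⁻¹ : ℂ) • (1 + b) = _
    nth_rewrite 1 [this]
    rw [← smul_sub]; congr 1; abel
  obtain ⟨U', h', hx', hu | hu⟩ := c.exists_isUnit_or_isUnit_one_sub h (F.π.pullTo_mem hV he) hx
  · refine ⟨U', h', hx', Or.inl ?_⟩
    rw [F.π.res_pullTo] at hu
    have h0 : F.π.pullTo (h'.trans hV) e * F.π.pullTo (h'.trans hV) (1 - b) = 0 := by
      rw [← map_mul, smul_mul_assoc, hne, smul_zero, map_zero]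
    have := (hu.mul_right_eq_zero).1 h0
    rw [map_sub, map_one, sub_eq_zero] at this
    exact this.symm
  · refine ⟨U', h', hx', Or.inr ?_⟩
    rw [F.π.res_pullTo, ← map_one (F.π.pullTo (h'.trans hV)), ← map_sub, h1e] at hu
    have h0 : F.π.pullTo (h'.trans hV) (1 + b) *
        F.π.pullTo (h'.trans hV) ((2⁻¹ : ℂ) • (1 - b)) = 0 := by
      rw [← map_mul, mul_smul_comm, hne, smul_zero, map_zero]
    have := (hu.mul_left_eq_zero).1 h0
    rw [map_add, map_one] at this
    exact (neg_eq_of_add_eq_zero_right this).symm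

/-- Superconformal coordinates on the Ramond divisor are unique up to sign and translation. -/
theorem SCChart.exists_oddCoord_eq (C C' : F.SCChart) {y : F.R.space}
    (hy : F.j.base y ∈ C.chart.source) (hy' : F.j.base y ∈ C'.chart.source) :
    ∃ (W : Opens F.R.space) (h : W ≤ Opens.comap F.j.base C.chart.source)
      (h' : W ≤ Opens.comap F.j.base C'.chart.source) (V : Opens T.space) (hV : W ≤ F.above V)
      (a : T.Γ V), y ∈ W ∧
      (F.R.res h' (oddCoord C'.chart) = F.pullR hV a + F.R.res h (oddCoord C.chart) ∨
        F.R.res h' (oddCoord C'.chart) = F.pullR hV a - F.R.res h (oddCoord C.chart)) := by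
  obtain ⟨U₁, h₁, g, hy₁, hg, hzg⟩ := C.exists_z_eq C' (U := C.chart.source ⊓ C'.chart.source)
    inf_le_left inf_le_right ⟨hy, hy'⟩
  obtain ⟨U₂, h₂, g', hy₂, hg', hzg'⟩ := C'.exists_z_eq C (h₁.trans inf_le_right)
    (h₁.trans inf_le_left) hy₁
  have i : U₂ ≤ C.chart.source := (h₂.trans h₁).trans inf_le_left
  have i' : U₂ ≤ C'.chart.source := (h₂.trans h₁).trans inf_le_right
  have hzg₂ := congrArg (F.X.res h₂) hzg
  rw [map_mul, F.X.res_res, F.X.res_res] at hzg₂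
  set γ := F.X.res h₂ g
  have hγ : γ ∈ F.X.part U₂ 0 := F.X.res_mem h₂ hg
  clear_value γ
  have hθ' := F.X.res_mem i' C'.chart.θ_odd
  -- the relation between the two coordinate systems on `X`
  have rel : F.j.pull U₂ (F.X.res i C.chart.θ * γ + C.v.app U₂ i γ -
      C.v.app U₂ i (F.X.res i' C'.chart.θ) * (γ * F.X.res i' C'.chart.θ)) = 0 := by
    refine res_eq_zero_of_mul_z C.divisor i ?_
    -- Substituting z' = z γ, both sides of v(z') = v(θ') z' θ' acquire the factor z, which is
    -- cancelled on R.
    have k1 := C.v_app_z C' i i'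
    rw [hzg₂, C.v.leibniz_odd, C.v_res_z,
      F.X.bar_of_even (F.X.res_mem i C.chart.z_even)] at k1
    rw [mul_sub, mul_add, ← mul_assoc, k1, sub_eq_zero, mul_assoc (F.X.res _ C.chart.z) γ,
      ← mul_assoc (C.v.app _ _ _), ← F.X.even_comm (F.X.res_mem i C.chart.z_even), mul_assoc]
  -- From z' = z γ and z = z' g' one gets z (1 - γ g') = 0, so the quotient γ is invertible on R.
  have unit : F.j.pull U₂ (1 - γ * g') = 0 := by
    refine res_eq_zero_of_mul_z C.divisor i ?_
    rw [mul_sub, ← mul_assoc, ← hzg₂, ← hzg', mul_one, sub_self]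
  -- On R write θ' = a + b x, γ = g₀ + g₁ x and g' = k₀ + k₁ x. The derivatives along v restrict to
  -- b for θ' and to -g₁ for γ, by parity.
  obtain ⟨U₃, h₃, V₃, hV₃, a, b, hy₃, ha, hb, e₁, e₂⟩ := C.exists_pull_eq i hθ' hy₂
  obtain ⟨U₄, h₄, V₄, hV₄, g₀, g₁, hy₄, hg₀, hg₁, e₃, e₄⟩ := C.exists_pull_eq (h₃.trans i)
    (F.X.res_mem h₃ hγ) hy₃
  obtain ⟨U₅, h₅, V₅, hV₅, k₀, k₁, hy₅, hk₀, hk₁, e₅, -⟩ := C.exists_pull_eq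
    ((h₄.trans h₃).trans i) (F.X.res_mem (h₄.trans h₃) hg') hy₄
  have i₅ : U₅ ≤ U₂ := h₅.trans (h₄.trans h₃)
  set V : Opens T.space := V₃ ⊓ V₄ ⊓ V₅
  have k₃ : V ≤ V₃ := inf_le_left.trans inf_le_left
  have k₄ : V ≤ V₄ := inf_le_left.trans inf_le_right
  have k₅ : V ≤ V₅ := inf_le_right
  have hV : U₅ ≤ Opens.comap F.π.base V := fun x hx =>
    ⟨⟨hV₃ (h₄ (h₅ hx)), hV₄ (h₅ hx)⟩, hV₅ hx⟩
  have f₁ := j_pull_res_eq (h₃.trans i) (h₅.trans h₄) hV₃ k₃ hV e₁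
  have f₃ := j_pull_res_eq (h₄.trans (h₃.trans i)) h₅ hV₄ k₄ hV e₃
  have f₅ := j_pull_res_eq (i₅.trans i) le_rfl hV₅ k₅ hV e₅
  have f₂ := congrArg (F.R.res (Opens.comap_mono F.j.base (h₅.trans h₄))) e₂
  have f₄ := congrArg (F.R.res (Opens.comap_mono F.j.base h₅)) e₄
  rw [← F.j.pull_res (h₅.trans h₄), ← C.v.app_res, F.X.res_res, res_pullR] at f₂
  rw [← F.j.pull_res h₅, ← C.v.app_res, F.X.res_res, F.X.res_res, res_pullR] at f₄
  rw [F.X.res_res] at f₁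
  rw [F.X.res_res, F.X.res_res] at f₃
  rw [F.X.res_self, F.X.res_res] at f₅
  have f₂' := F.pullR_res k₃ (F.comap_le_above hV) (T.bar b)
  have f₄' := F.pullR_res k₄ (F.comap_le_above hV) (T.bar g₁)
  rw [T.bar_of_even hb] at f₂ f₂'
  rw [T.bar_of_odd hg₁] at f₄ f₄'
  rw [← f₂'] at f₂
  rw [← f₄'] at f₄
  have rel' := congrArg (F.R.res (Opens.comap_mono F.j.base i₅)) rel
  have unit' := congrArg (F.R.res (Opens.comap_mono F.j.base i₅)) unit
  rw [← F.j.pull_res i₅, map_zero] at rel' unit'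
  rw [map_sub, map_add, map_mul, map_mul, map_mul, map_sub, map_add, map_mul, map_mul, map_mul,
    ← C.v.app_res, ← C.v.app_res, F.X.res_res i i₅, f₁, f₂, f₃, f₄, j_pull_res_θ] at rel'
  rw [map_sub, map_mul, map_one, map_sub, map_mul, map_one, f₃, f₅] at unit'
  have mb : T.res k₃ b ∈ T.part V 0 := T.res_mem k₃ hb
  have ma := T.res_mem k₃ ha
  have mg := T.res_mem k₄ hg₀
  have mx : F.R.res (Opens.comap_mono F.j.base (i₅.trans i)) (oddCoord C.chart) ∈
    F.R.part _ 1 := F.R.res_mem _ (oddCoord_mem _)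
  rw [map_neg, map_neg] at rel'
  have rel₁ := F.R.relation_of_sub_eq_zero mx (F.pullR_mem (F.comap_le_above hV) mg)
    (F.pullR_mem (F.comap_le_above hV) ma) (F.pullR_mem (F.comap_le_above hV) mb) rel'
  simp only [← map_mul, ← map_sub, ← map_neg] at rel₁
  rw [sub_eq_zero, add_mul_odd_mul_add_mul_odd mx, bar_pullR, ← map_mul, ← map_mul, ← map_mul,
    ← map_add] at unit'
  -- Coefficients of 1 and x: -g₁ = g₀ a b and g₀ = (g₀ b - g₁ a) b near y, while invertibility of γ
  -- yields g₀ k₀ = 1. These force b² = 1.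
  obtain ⟨V₆, h₆, hy₆, q₁, q₂⟩ := exists_res_eq C.divisor (y := y) hy₅ _ _ rel₁
  obtain ⟨V₇, h₇, hy₇, q₃, -⟩ := exists_res_eq C.divisor (y := y) hy₅
    (Opens.comap_mono F.j.base (i₅.trans i)) (F.comap_le_above hV) (a := 1) (b := 0)
    (((by rw [map_one, map_zero, zero_mul, add_zero]) : _ = (1 : F.R.Γ _)).trans unit')
  set V' := V₆ ⊓ V₇
  have q₁' := congrArg (T.res (inf_le_left : V' ≤ V₆)) q₁
  have q₂' := congrArg (T.res (inf_le_left : V' ≤ V₆)) q₂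
  have q₃' := congrArg (T.res (inf_le_right : V' ≤ V₇)) q₃
  simp only [map_mul, map_sub, map_neg, map_one, T.res_res] at q₁' q₂' q₃'
  have hbb := mul_self_eq_one_of_relations (T.res_mem _ ha) (T.res_mem _ hb) (T.res_mem _ hg₀)
    q₁' q₂' q₃'.symm
  set j₃ : V' ≤ V₃ := inf_le_left.trans (h₆.trans k₃)
  set U₆ : Opens F.X.space := U₅ ⊓ Opens.comap F.π.base V'
  obtain ⟨U₇, l₇, hy₈, hpm⟩ := exists_pullTo_eq_or (c := C.chart) (U := U₆)
    (x := F.j.base y) (inf_le_left.trans (i₅.trans i)) inf_le_right (T.res_mem j₃ hb) hbb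
    ⟨hy₅, hy₆, hy₇⟩
  have hV₇ : U₇ ≤ Opens.comap F.π.base V' := l₇.trans inf_le_right
  have i₇ : U₇ ≤ U₂ := l₇.trans (inf_le_left.trans i₅)
  have f₇ := j_pull_res_eq (h₃.trans i) (l₇.trans (inf_le_left.trans (h₅.trans h₄))) hV₃ j₃ hV₇ e₁
  rw [F.X.res_res, F.X.res_res, j_pull_res_θ, ← j_pull_pullTo _ hV₇ (T.res j₃ b)] at f₇
  refine ⟨Opens.comap F.j.base U₇, Opens.comap_mono _ (i₇.trans i), Opens.comap_mono _
    (i₇.trans i'), V', F.comap_le_above hV₇, T.res j₃ a, hy₈, hpm.imp (fun hp => ?_) fun hp => ?_⟩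
  · rw [f₇, hp, map_one, one_mul]
  · rw [f₇, hp, map_neg, map_one, neg_one_mul, sub_eq_add_neg]

end SRSFamily

/-- Restriction of even coordinates to a smaller open set. -/
def HolCoord.restrict {X : SuperSpace} {E : Type} [NormedAddCommGroup E] [NormedSpace ℂ E]
    {U U' : Opens X.space} (C : HolCoord X E U) (h : U' ≤ U) : HolCoord X E U' where
  fn := C.fn
  continuousOn := C.continuousOn.mono h
  ev k _ hW := C.ev (k.trans h) hW
  ev_even k _ hW f := C.ev_even (k.trans h) hW f
  ev_res k k' _ _ hW hW' i f := C.ev_res (k.trans h) k' hW hW' i f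

/-! ### Restriction of charts and change of the odd coordinate -/

namespace RelChart

variable {X T : SuperSpace} {π : Hom X T} (c : RelChart π)

theorem expand_restrict {U U' : Opens X.space} (h : U ≤ c.source) (h' : U' ≤ U)
    {W : Opens ((Fin c.m → ℂ) × ℂ)} (hW : Set.MapsTo c.coord.fn U' W) (f : c.Coeff W) :
    (c.coord.restrict h).expand (fun k => X.res (h.trans c.source_le) (π.pull _ (c.base.odd k)))
      h' hW f = c.basic (h'.trans h) hW f := by
  simp only [HolCoord.expand, basic, η, X.res_res]
  rfl

/-- Restriction of a relative chart to a smaller open set. -/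
def restrict {U : Opens X.space} (h : U ≤ c.source) : RelChart π where
  m := c.m
  n := c.n
  base := c.base
  source := U
  source_le := h.trans c.source_le
  coord := c.coord.restrict h
  θ := X.res h c.θ
  θ_odd := X.res_mem h c.θ_odd
  fst_eq x hx := c.fst_eq x (h hx)
  ev_fst U' h' := c.ev_fst U' (h'.trans h)
  isOpenEmbedding := c.isOpenEmbedding.comp (Opens.isOpenEmbedding_of_le h)
  generates U' h' s x hx := by
    obtain ⟨U₁, h₁, W, hW, f, g, hx₁, he⟩ := c.generates U' (h'.trans h) s x hx
    refine ⟨U₁, h₁, W, hW, f, g, hx₁, he.trans ?_⟩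
    rw [expand_restrict, expand_restrict, X.res_res]; rfl
  kernel_eq U' h' W hW f g H x hx := by
    refine c.kernel_eq U' (h'.trans h) W hW f g ?_ x hx
    exact (congrArg₂ (· + ·) (c.expand_restrict h h' hW f).symm (congrArg₂ (· * ·)
      (c.expand_restrict h h' hW g).symm (X.res_res _ _ _).symm)).trans H

theorem restrict_z {U : Opens X.space} (h : U ≤ c.source) : (c.restrict h).z = X.res h c.z :=
  c.res_z h (c.mapsTo_top U) |>.symm

variable {U U' : Opens X.space} {h : U ≤ c.source} {W W' : Opens ((Fin c.m → ℂ) × ℂ)}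
  {hW : Set.MapsTo c.coord.fn U W}

theorem dθ_basic (f : c.Coeff W) : c.dθ.app U h (c.basic h hW f) = 0 := by
  have := c.dθ_section h hW f 0
  rwa [section_, basic_zero, zero_mul, add_zero, map_zero] at this

theorem dθ_dθ (h : U ≤ c.source) (s : X.Γ U) : c.dθ.app U h (c.dθ.app U h s) = 0 := by
  refine X.eq_of_local fun x hx => ?_
  obtain ⟨U', h', W, hW, f, g, hx', he⟩ := c.exists_section_eq h s hx
  refine ⟨U', h', hx', ?_⟩
  rw [← c.dθ.app_res, ← c.dθ.app_res, he, dθ_section, bar_basic, dθ_basic, map_zero]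

/-- The fields of the two charts are chosen separately, but both are determined by the same formula
on sections f + g θ. -/
theorem restrict_dθ_app {U₀ : Opens X.space} (h₀ : U₀ ≤ c.source) (h : U ≤ U₀) (s : X.Γ U) :
    (c.restrict h₀).dθ.app U h s = c.dθ.app U (h.trans h₀) s := by
  refine X.eq_of_local fun x hx => ?_
  obtain ⟨U', h', W, hW, f, g, hx', he⟩ := c.exists_section_eq (h.trans h₀) s hx
  refine ⟨U', h', hx', ?_⟩
  have hb : ∀ f : c.Coeff W, (c.restrict h₀).basic (h'.trans h) hW f =
      c.basic ((h'.trans h).trans h₀) hW f := fun f => c.expand_restrict h₀ (h'.trans h) hW f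
  have hs : c.section_ ((h'.trans h).trans h₀) hW f g =
      (c.restrict h₀).section_ (h'.trans h) hW f g := by
    refine congrArg₂ (· + ·) (hb f).symm (congrArg₂ (· * ·) (hb g).symm ?_)
    exact (X.res_res _ _ _).symm
  refine ((c.restrict h₀).dθ.app_res h h' s).symm.trans ?_
  rw [← c.dθ.app_res, he, dθ_section, hs]
  exact ((c.restrict h₀).dθ_section (h'.trans h) hW f g).trans (congrArg X.bar (hb g))

/-- The kernel of ∂_θ consists of the sections not involving θ, since ∂_θ(f + g θ) = bar g. -/
theorem exists_basic_eq (h : U ≤ c.source) {s : X.Γ U} (hs : c.dθ.app U h s = 0) {x : X.space}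
    (hx : x ∈ U) : ∃ (U' : Opens X.space) (h' : U' ≤ U) (W : Opens ((Fin c.m → ℂ) × ℂ))
      (hW : Set.MapsTo c.coord.fn U' W) (f : c.Coeff W), x ∈ U' ∧
      X.res h' s = c.basic (h'.trans h) hW f := by
  obtain ⟨U', h', W, hW, f, g, hx', he⟩ := c.exists_section_eq h s hx
  refine ⟨U', h', W, hW, f, hx', ?_⟩
  have h1 := congrArg (c.dθ.app U' (h'.trans h)) he
  rw [c.dθ.app_res h, hs, map_zero, dθ_section] at h1
  have h2 := congrArg X.bar h1
  rw [map_zero, X.bar_bar] at h2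
  rw [he, section_, ← h2, zero_mul, add_zero]

/-- Change of the odd coordinate of a relative chart. -/
def changeθ (θ' : X.Γ c.source) (hθ : θ' ∈ X.part c.source 1)
    (hu : IsUnit (c.dθ.app _ le_rfl θ')) : RelChart π where
  m := c.m
  n := c.n
  base := c.base
  source := c.source
  source_le := c.source_le
  coord := c.coord
  θ := θ'
  θ_odd := hθ
  fst_eq := c.fst_eq
  ev_fst := c.ev_fst
  isOpenEmbedding := c.isOpenEmbedding
  generates U h s x hx := by
    -- D is invertible and killed by ∂_θ, and so is its inverse u. For g' = bar(∂_θ s · u) both g'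
    -- and s - g' θ' are killed by ∂_θ, hence do not involve θ; this is the expansion of s in the
    -- new coordinate.
    set D := c.dθ.app U h (X.res h θ')
    have hDu : IsUnit D := by
      change IsUnit (c.dθ.app U h (X.res h θ'))
      rw [app_res_eq]; exact X.isUnit_res h hu
    have hDe : D ∈ X.part U 0 := c.dθ.app_odd_mem h (X.res_mem h hθ)
    have hDD : c.dθ.app U h D = 0 := c.dθ_dθ h _
    obtain ⟨u, hDu⟩ := hDu.exists_right_inv
    have hue := X.even_inv hDe hDu
    have hdu : c.dθ.app U h u = 0 := by
      have h1 := c.dθ.leibniz_odd h D u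
      rw [hDu, RelVF.app_one, hDD, zero_mul, zero_add, X.bar_of_even hDe] at h1
      rw [← one_mul (c.dθ.app U h u), ← hDu, X.even_comm hDe, mul_assoc, ← h1, mul_zero]
    set g' := X.bar (c.dθ.app U h s * u)
    have hbd : ∀ t : X.Γ U, c.dθ.app U h t = 0 → c.dθ.app U h (X.bar t) = 0 := by
      intro t ht
      obtain ⟨t₀, h₀, t₁, h₁, rfl⟩ := X.exists_parts t
      rw [map_add] at ht
      have e := X.eq_zero_of_mem_of_mem (c.dθ.app_odd_mem h h₁) (by
        rw [eq_neg_of_add_eq_zero_right ht]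
        exact Submodule.neg_mem _ (c.dθ.app_even_mem h h₀))
      rw [map_add, X.bar_of_even h₀, X.bar_of_odd h₁, map_add, map_neg, e]
      rw [e, add_zero] at ht
      rw [ht, neg_zero, add_zero]
    have hg' : c.dθ.app U h g' = 0 := by
      refine hbd _ ?_
      rw [c.dθ.leibniz_odd, hdu, c.dθ_dθ, mul_zero, zero_mul, add_zero]
    have hf' : c.dθ.app U h (s - g' * X.res h θ') = 0 := by
      rw [map_sub, c.dθ.leibniz_odd, hg', zero_mul, zero_add, X.bar_bar, mul_assoc,
        X.even_comm hue, hDu, mul_one, sub_self]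
    obtain ⟨U₁, h₁, W₁, hW₁, f₁, hx₁, e₁⟩ := c.exists_basic_eq h hf' hx
    obtain ⟨U₂, h₂, W₂, hW₂, g₂, hx₂, e₂⟩ := c.exists_basic_eq (h₁.trans h)
      (s := X.res h₁ g') (by rw [c.dθ.app_res h, hg', map_zero]) hx₁
    have hi : Set.MapsTo c.coord.fn U₂ (W₁ ⊓ W₂ : Opens _) := fun y hy => ⟨hW₁ (h₂ hy), hW₂ hy⟩
    refine ⟨U₂, h₂.trans h₁, W₁ ⊓ W₂, hi, c.resCoeff inf_le_left f₁, c.resCoeff inf_le_right g₂,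
      hx₂, ?_⟩
    change _ = c.basic _ _ _ + c.basic _ _ _ * _
    have e₃ := congrArg (X.res h₂) e₁
    rw [X.res_res, c.res_basic _ _ h₂ inf_le_left hi, map_sub, map_mul, ← X.res_res h₁ h₂ g', e₂,
      X.res_res, c.basic_eq_of_res inf_le_right hi g₂] at e₃
    rw [← e₃, sub_add_cancel]
  kernel_eq U h W hW f g H x hx := by
    refine c.kernel_eq U h W hW f g ?_ x hx
    change c.basic h hW f + c.basic h hW g * X.res h θ' = 0 at H
    change c.basic h hW f + c.basic h hW g * X.res h c.θ = 0
    -- Applying ∂_θ to f + g θ' = 0 leaves bar g times the unit ∂_θ θ', so g and then f vanish as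
    -- sections, and the relation holds with θ as well.
    have h1 := congrArg (c.dθ.app U h) H
    rw [map_add, dθ_basic, zero_add, c.dθ.leibniz_odd, dθ_basic, zero_mul, zero_add, map_zero,
      app_res_eq] at h1
    have h2 := ((X.isUnit_res h hu).mul_left_eq_zero).1 h1
    have h3 := congrArg X.bar h2
    rw [X.bar_bar, map_zero] at h3
    rw [h3, zero_mul, add_zero] at H
    rw [H, h3, zero_mul, add_zero]

end RelChart

theorem IsCutOutBy.restrict {R X : SuperSpace} {j : Hom R X} {U U' : Opens X.space} {h : X.Γ U}
    (H : IsCutOutBy j U h) (k : U' ≤ U) : IsCutOutBy j U' (X.res k h) := by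
  intro U'' i s
  rw [H U'' (i.trans k) s]
  simp only [X.res_res]

theorem IsCutOutBy.mul_isUnit {R X : SuperSpace} {j : Hom R X} {U : Opens X.space} {h n : X.Γ U}
    (H : IsCutOutBy j U h) (hn : IsUnit n) : IsCutOutBy j U (h * n) := by
  obtain ⟨n, rfl⟩ := hn
  intro U' i s
  rw [H U' i s]
  refine forall₂_congr fun x hx => ⟨?_, ?_⟩
  · rintro ⟨U'', i', a, hx', he⟩
    refine ⟨U'', i', X.res (i'.trans i) ↑n⁻¹ * a, hx', ?_⟩
    rw [he, map_mul, mul_assoc, ← mul_assoc (X.res _ (n : X.Γ U)), ← map_mul, Units.mul_inv, map_one,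
      one_mul]
  · rintro ⟨U'', i', a, hx', he⟩
    exact ⟨U'', i', X.res (i'.trans i) n * a, hx', by rw [he, map_mul, mul_assoc]⟩

/-! ### Frames of the relative tangent sheaf -/

section Frames

variable {X T : SuperSpace} {π : Hom X T} {U : Opens X.space}

theorem RelVF.app_bar {p : ZMod 2} (ξ : RelVF π p U) {U' : Opens X.space} (h : U' ≤ U)
    (s : X.Γ U') : ξ.app U' h (X.bar s) = sgn 1 p • X.bar (ξ.app U' h s) := by
  have key : ∀ i, ∀ s ∈ X.part U' i, ξ.app U' h (X.bar s) = sgn 1 p • X.bar (ξ.app U' h s) := by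
    intro i s hs
    rw [X.bar_eq_sgn_smul hs, X.bar_eq_sgn_smul (ξ.app_mem h hs), map_smul, smul_smul,
      sgn_one_add, ← mul_assoc, sgn_mul_self, one_mul]
  obtain ⟨s₀, h₀, s₁, h₁, rfl⟩ := X.exists_parts s
  rw [map_add, map_add, key _ _ h₀, key _ _ h₁, map_add, map_add, smul_add]

/-- Conjugating the expansion of ξ by the grading involution gives another expansion of ξ, and
expansions in a frame are unique. -/
theorem IsFrame.mem_part {w : RelVF π 0 U} {v : RelVF π 1 U} (hf : IsFrame w v) {p : ZMod 2}
    {ξ : RelVF π p U} {f g : X.Γ U} (H : ξ.IsComb f w g v) :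
    f ∈ X.part U p ∧ g ∈ X.part U (1 + p) := by
  have H' : ξ.IsComb (sgn 1 p • X.bar f) w (sgn 1 (1 + p) • X.bar g) v := by
    intro U' h s
    have h1 := congrArg X.bar (H U' h (X.bar s))
    rw [ξ.app_bar, w.app_bar, v.app_bar, SuperSpace.sgn_one_one, SuperSpace.sgn_zero_right,
      map_smul, X.bar_bar, map_add, X.bar_mul, X.bar_mul, one_smul, X.bar_bar, map_smul,
      X.bar_bar] at h1
    have h2 := congrArg (sgn 1 p • ·) h1
    simp only [smul_smul, sgn_mul_self, one_smul] at h2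
    rw [h2, map_smul, map_smul, sgn_one_add, SuperSpace.sgn_one_one, X.bar_res, X.bar_res,
      smul_add, smul_mul_assoc, smul_mul_assoc, mul_smul_comm, smul_smul, mul_comm]
  have := (hf p U le_rfl ξ).unique (y₁ := (f, g)) (y₂ := (_, _)) H H'
  rw [Prod.mk.injEq] at this
  rw [X.mem_part_iff, X.mem_part_iff]
  constructor
  · nth_rewrite 2 [this.1]
    rw [smul_smul, sgn_mul_self, one_smul]
  · nth_rewrite 2 [this.2]
    rw [smul_smul, sgn_mul_self, one_smul]

theorem IsFrame.res {w : RelVF π 0 U} {v : RelVF π 1 U} (hf : IsFrame w v) {U' : Opens X.space}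
    (h : U' ≤ U) : IsFrame (w.res h) (v.res h) :=
  fun p U'' h' ξ => hf p U'' (h'.trans h) ξ

theorem SuperSpace.isUnit_of_mul_even (X : SuperSpace) {U : Opens X.space} {a b : X.Γ U}
    (ha : a ∈ X.part U 0) (h : IsUnit (a * b)) : IsUnit a ∧ IsUnit b :=
  Commute.isUnit_mul_iff (X.even_comm ha b) |>.1 h

/-- A frame of the relative tangent sheaf in terms of the coordinate vector fields. -/
theorem RelChart.exists_of_isFrame (c : RelChart π) {w : RelVF π 0 c.source}
    {v : RelVF π 1 c.source} (hf : IsFrame w v) :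
    IsUnit (v.app _ le_rfl c.θ) ∧
      v.IsComb (v.app _ le_rfl c.z) c.dz (v.app _ le_rfl c.θ) c.dθ ∧
      ∃ e e' : X.Γ c.source, e ∈ X.part c.source 0 ∧ IsUnit e ∧ w.IsComb e c.dz e' v := by
  obtain ⟨⟨p, q⟩, hpq, -⟩ := hf 0 _ le_rfl c.dz
  obtain ⟨⟨p', q'⟩, hpq', -⟩ := hf 1 _ le_rfl c.dθ
  change c.dz.IsComb p w q v at hpq
  change c.dθ.IsComb p' w q' v at hpq'
  obtain ⟨mp, mq⟩ := hf.mem_part hpq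
  obtain ⟨mp', mq'⟩ := hf.mem_part hpq'
  have h1 := hpq _ le_rfl c.z
  have h2 := hpq' _ le_rfl c.θ
  rw [c.dz_z, X.res_self, X.res_self] at h1
  rw [c.dθ_θ, X.res_self, X.res_self] at h2
  -- With ∂_z = p w + q v, evaluation on z gives p w(z) = 1 - q v(z), where q is odd. In the same
  -- way ∂_θ = p' w + q' v on θ shows that q' and v(θ) are units.
  have up : IsUnit p := by
    refine (X.isUnit_of_mul_even mp (b := w.app _ le_rfl c.z) ?_).1
    rw [← sub_eq_of_eq_add h1]
    exact X.isUnit_one_sub_odd_mul_odd mq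
  obtain ⟨uq', uv⟩ := X.isUnit_of_mul_even (a := q') (b := v.app _ le_rfl c.θ) mq' (by
    rw [← sub_eq_of_eq_add' h2]
    exact X.isUnit_one_sub_odd_mul_odd mp')
  obtain ⟨e, he⟩ := up.exists_left_inv
  obtain ⟨d, hd⟩ := uq'.exists_left_inv
  have me : e ∈ X.part c.source 0 := X.even_inv mp (by rw [X.even_comm mp, he])
  have md : d ∈ X.part c.source 0 := X.even_inv mq' (by rw [X.even_comm mq', hd])
  have hw : w.IsComb e c.dz (-(e * q)) v := by
    intro U' h s
    rw [hpq U' h s, mul_add, ← mul_assoc, ← map_mul, he, map_one, one_mul, ← mul_assoc, map_neg,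
      map_mul, neg_mul, add_neg_cancel_right]
  -- Inserting w = e ∂_z - e q v into the expansion of ∂_θ and multiplying by d gives (1 - d p' e q)
  -- v = d ∂_θ - d p' e ∂_z; d p' is odd, so the factor on the left is invertible.
  obtain ⟨n, hn⟩ := (X.isUnit_one_sub_odd_mul_odd (a := d * p') (b := e * q)
    (by simpa using X.mul_mem md mp')).exists_left_inv
  have hv : v.IsComb (-(n * d * p' * e)) c.dz (n * d) c.dθ := by
    intro U' h s
    have k1 : X.res h n * ((1 - X.res h d * X.res h p' * (X.res h e * X.res h q)) *
        v.app U' h s) = v.app U' h s := by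
      have := congrArg (X.res h) hn
      simp only [map_mul, map_sub, map_one] at this
      rw [← mul_assoc, this, one_mul]
    have k2 : X.res h d * X.res h q' = 1 := by rw [← map_mul, hd, map_one]
    rw [hpq' U' h s, hw U' h s]
    simp only [map_mul, map_neg]
    have k3 : X.res h (n * d) * (X.res h p' * (X.res h e * c.dz.app U' h s +
        -(X.res h e * X.res h q) * v.app U' h s) + X.res h q' * v.app U' h s) =
        X.res h n * X.res h d * X.res h p' * X.res h e * c.dz.app U' h s +
        X.res h n * ((X.res h d * X.res h q' - X.res h d * X.res h p' *
          (X.res h e * X.res h q)) * v.app U' h s) := by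
      rw [map_mul]; noncomm_ring
    rw [map_mul] at k3
    rw [k3, k2, k1, neg_mul, neg_add_cancel_left]
  have hz := hv _ le_rfl c.z
  have hθ := hv _ le_rfl c.θ
  rw [c.dz_z, c.dθ_z, X.res_self, mul_one, mul_zero, add_zero] at hz
  rw [c.dz_θ, c.dθ_θ, X.res_self, X.res_self, mul_one, mul_zero, zero_add] at hθ
  refine ⟨uv, ?_, e, -(e * q), me, ?_, hw⟩
  · rw [hz, hθ]; exact hv
  · exact ⟨⟨e, p, he, by rw [X.even_comm mp, he]⟩, rfl⟩

end Frames

/-! ### Existence of superconformal coordinates -/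

namespace SRSFamily

variable {T : SuperSpace} {r : ℕ} {F : SRSFamily T r}

/-- The distribution is generated by `v` on an open set. -/
def IsGenerator (F : SRSFamily T r) {U : Opens F.X.space} (v : RelVF F.π 1 U) : Prop :=
  ∀ (p : ZMod 2) (U' : Opens F.X.space) (i : U' ≤ U) (ξ : RelVF F.π p U'),
    ξ ∈ F.D p U' ↔ ∃ f : F.X.Γ U', ξ.IsMul f (v.res i)

theorem IsGenerator.res {U U' : Opens F.X.space} {v : RelVF F.π 1 U} (hv : F.IsGenerator v)
    (h : U' ≤ U) : F.IsGenerator (v.res h) :=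
  fun p U'' i ξ => hv p U'' (i.trans h) ξ

theorem IsGenerator.smulEven {U : Opens F.X.space} {v : RelVF F.π 1 U} (hv : F.IsGenerator v)
    {a : F.X.Γ U} (ha : a ∈ F.X.part U 0) (hu : IsUnit a) : F.IsGenerator (v.smulEven a ha) := by
  obtain ⟨b, hb⟩ := hu.exists_left_inv
  intro p U' i ξ
  rw [hv p U' i ξ]
  constructor
  · rintro ⟨f, hf⟩
    refine ⟨f * F.X.res i b, fun U'' h s => ?_⟩
    change _ = _ * (v.smulEven a ha).app U'' (h.trans i) s
    rw [RelVF.smulEven_app, map_mul, mul_assoc, ← mul_assoc (F.X.res h (F.X.res i b)),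
      F.X.res_res, ← map_mul, hb, map_one, one_mul]
    exact hf U'' h s
  · rintro ⟨f, hf⟩
    refine ⟨f * F.X.res i a, fun U'' h s => ?_⟩
    have := hf U'' h s
    change _ = _ * (v.smulEven a ha).app U'' (h.trans i) s at this
    rw [this, RelVF.smulEven_app, map_mul, mul_assoc, F.X.res_res]
    rfl

/-- Divide v by the unit v(θ). As [v, v] = 2 v², the square of the new field v₁ is a combination H
∂_z + κ v, with H the product of h and a unit. Applied to θ it gives 0 = v₁(1) = κ v(θ), so κ = 0.
-/
theorem exists_normalized {c : RelChart F.π} {w : RelVF F.π 0 c.source}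
    {v : RelVF F.π 1 c.source} (hf : IsFrame w v) (hv : F.IsGenerator v) {h k : F.X.Γ c.source}
    (hh : IsCutOutBy F.j c.source h) (hb : (v.bracket v).IsComb (2 * h) w k v) :
    ∃ (v₁ : RelVF F.π 1 c.source) (H : F.X.Γ c.source), F.IsGenerator v₁ ∧
      v₁.app _ le_rfl c.θ = 1 ∧ v₁.IsComb (v₁.app _ le_rfl c.z) c.dz 1 c.dθ ∧
      (∀ (U' : Opens F.X.space) (h' : U' ≤ c.source) (s : F.X.Γ U'),
        v₁.app U' h' (v₁.app U' h' s) = F.X.res h' H * c.dz.app U' h' s) ∧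
      IsCutOutBy F.j c.source H := by
  obtain ⟨uv, hvc, e, e', me, ue, hw⟩ := c.exists_of_isFrame hf
  have mv : v.app _ le_rfl c.θ ∈ F.X.part _ 0 := v.app_odd_mem le_rfl c.θ_odd
  obtain ⟨u, hu⟩ := uv.exists_left_inv
  have mu : u ∈ F.X.part _ 0 := F.X.even_inv mv (by rw [F.X.even_comm mv, hu])
  have uu : IsUnit u := ⟨⟨u, _, hu, by rw [F.X.even_comm mv, hu]⟩, rfl⟩
  set v₁ := v.smulEven u mu
  have happ : ∀ (U' : Opens F.X.space) (h' : U' ≤ c.source) (s : F.X.Γ U'),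
    v₁.app U' h' s = F.X.res h' u * v.app U' h' s := fun U' h' s => v.smulEven_app u mu h' s
  have hθ : v₁.app _ le_rfl c.θ = 1 := by rw [happ, F.X.res_self, hu]
  have hvv : ∀ (U' : Opens F.X.space) (h' : U' ≤ c.source) (s : F.X.Γ U'),
      v.app U' h' (v.app U' h' s) = F.X.res h' (h * e) * c.dz.app U' h' s +
        F.X.res h' (h * e' + (2⁻¹ : ℂ) • k) * v.app U' h' s := by
    intro U' h' s
    have h1 := hb U' h' s
    change v.app U' h' (v.app U' h' s) - sgn 1 1 • v.app U' h' (v.app U' h' s) = _ at h1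
    rw [SuperSpace.sgn_one_one, neg_one_smul, sub_neg_eq_add, hw U' h' s, ← two_smul ℂ] at h1
    have h2 := congrArg ((2⁻¹ : ℂ) • ·) h1
    simp only [smul_smul] at h2
    rw [inv_mul_cancel₀ two_ne_zero, one_smul] at h2
    rw [h2]
    have h3 : (2 : F.X.Γ c.source) * h = (2 : ℂ) • h := by rw [two_smul, two_mul]
    rw [h3, map_smul, smul_mul_assoc, smul_add, smul_smul, inv_mul_cancel₀ two_ne_zero, one_smul]
    simp only [map_mul, map_add, map_smul, mul_add, add_mul, mul_assoc, smul_mul_assoc, add_assoc]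
  set H := h * (e * (u * u))
  set κ := u * v.app _ le_rfl u + u * u * (h * e' + (2⁻¹ : ℂ) • k)
  have hcomm : ∀ {U' : Opens F.X.space} (h' : U' ≤ c.source) (s : F.X.Γ U'),
    F.X.res h' u * s = s * F.X.res h' u := fun h' s => F.X.even_comm (F.X.res_mem h' mu) s
  have hsq : ∀ (U' : Opens F.X.space) (h' : U' ≤ c.source) (s : F.X.Γ U'),
      v₁.app U' h' (v₁.app U' h' s) = F.X.res h' H * c.dz.app U' h' s +
        F.X.res h' κ * v.app U' h' s := by
    intro U' h' s
    rw [happ, happ, v.leibniz_odd, hvv, F.X.bar_of_even (F.X.res_mem h' mu), RelChart.app_res_eq]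
    have k1 : F.X.res h' H = F.X.res h' u * (F.X.res h' u * F.X.res h' (h * e)) := by
      rw [hcomm h', hcomm h']
      simp only [H, map_mul, mul_assoc]
    rw [k1]
    simp only [κ, map_add, map_mul, mul_add, add_mul, mul_assoc, map_smul]
    abel
  have hκ : κ = 0 := by
    have h1 := hsq _ le_rfl c.θ
    rw [hθ, v₁.app_one, c.dz_θ, mul_zero, zero_add, F.X.res_self] at h1
    exact (uv.mul_left_eq_zero).1 h1.symm
  refine ⟨v₁, H, hv.smulEven mu uu, hθ, fun U' h' s => ?_, fun U' h' s => ?_,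
    hh.mul_isUnit (ue.mul (uu.mul uu))⟩
  · rw [happ, happ, hvc U' h' s, mul_add, ← mul_assoc, ← mul_assoc, ← map_mul, ← map_mul, hu,
      map_one, one_mul, F.X.res_self]
  · rw [hsq, hκ, map_zero, zero_mul, add_zero]

/-- Put β = v(z); then H = v(β) and v(H) = v²(β) = H ∂_z β. Near R, z = H b, so β = v(H b) is a
multiple of H and therefore of z: β = z γ. Then H = v(z γ) = z v(γ) because γ² = 0, and z = H b
gives z (1 - v(γ) b) = 0. Since z is nonzero near R, the local ring property makes v(γ) a unit. -/
theorem exists_γ {c : RelChart F.π} (hc : IsCutOutBy F.j c.source c.z)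
    {v : RelVF F.π 1 c.source} {H : F.X.Γ c.source}
    (hsq : ∀ (U' : Opens F.X.space) (h' : U' ≤ c.source) (s : F.X.Γ U'),
        v.app U' h' (v.app U' h' s) = F.X.res h' H * c.dz.app U' h' s)
    (hH : IsCutOutBy F.j c.source H) {y : F.R.space} (hy : F.j.base y ∈ c.source) :
    ∃ (U : Opens F.X.space) (h : U ≤ c.source) (γ : F.X.Γ U), F.j.base y ∈ U ∧
      γ ∈ F.X.part U 1 ∧ F.X.res h (v.app _ le_rfl c.z) = F.X.res h c.z * γ ∧
      IsUnit (v.app U h γ) := by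
  have hHe : H = v.app _ le_rfl (v.app _ le_rfl c.z) := by
    rw [hsq, F.X.res_self, c.dz_z, mul_one]
  have mβ : v.app _ le_rfl c.z ∈ F.X.part _ 1 := v.app_even_mem le_rfl c.z_even
  have mH : H ∈ F.X.part _ 0 := by rw [hHe]; exact v.app_odd_mem le_rfl mβ
  have hvH : v.app _ le_rfl H = H * c.dz.app _ le_rfl (v.app _ le_rfl c.z) := by
    conv_lhs => rw [hHe]
    rw [hsq, F.X.res_self]
  have hz0 : F.j.pull c.source c.z = 0 := by
    have := pull_z_mul hc le_rfl 1
    rwa [mul_one, F.X.res_self] at this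
  obtain ⟨U₁, h₁, b, hy₁, hb⟩ := (hH _ le_rfl c.z).1 hz0 _ hy
  obtain ⟨b, mb, hb⟩ := F.X.exists_mem_eq_mul (F.X.res_mem h₁ mH) (F.X.res_mem h₁ c.z_even) hb
  have hβ : F.X.res h₁ (v.app _ le_rfl c.z) = F.X.res h₁ H *
      (F.X.res h₁ (c.dz.app _ le_rfl (v.app _ le_rfl c.z)) * b + v.app U₁ h₁ b) := by
    rw [← v.app_res, hb, v.leibniz_odd, F.X.bar_of_even (F.X.res_mem h₁ mH), RelChart.app_res_eq,
      hvH, map_mul, mul_add, mul_assoc]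
  obtain ⟨U₂, h₂, γ, hy₂, hγ⟩ := (hc U₁ h₁ _).1 ((hH U₁ h₁ _).2 fun x hx =>
    ⟨U₁, le_rfl, _, hx, (F.X.res_self _ _).trans hβ⟩) _ hy₁
  rw [F.X.res_res] at hγ
  obtain ⟨γ, mγ, hγ⟩ := F.X.exists_mem_eq_mul (F.X.res_mem (h₂.trans h₁) c.z_even)
    (F.X.res_mem (h₂.trans h₁) mβ) hγ
  have hHz : F.X.res (h₂.trans h₁) H = F.X.res (h₂.trans h₁) c.z * v.app U₂ (h₂.trans h₁) γ := by
    rw [hHe, ← v.app_res le_rfl, hγ, v.leibniz_odd, RelChart.app_res_eq, hγ, mul_assoc,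
      F.X.odd_mul_self mγ, mul_zero, zero_add, F.X.bar_of_even (F.X.res_mem _ c.z_even)]
  have hz : F.X.res (h₂.trans h₁) c.z * (1 - v.app U₂ (h₂.trans h₁) γ * F.X.res h₂ b) = 0 := by
    have := congrArg (F.X.res h₂) hb
    rw [map_mul, F.X.res_res, F.X.res_res, hHz, mul_assoc] at this
    rw [mul_sub, mul_one, ← this, sub_self]
  have mvγ : v.app U₂ (h₂.trans h₁) γ ∈ F.X.part U₂ 0 := v.app_odd_mem _ mγ
  have mprod : v.app U₂ (h₂.trans h₁) γ * F.X.res h₂ b ∈ F.X.part U₂ 0 :=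
    F.X.mul_mem mvγ (F.X.res_mem h₂ mb)
  obtain ⟨U₃, h₃, hy₃, hu | hu⟩ := c.exists_isUnit_or_isUnit_one_sub (h₂.trans h₁) mprod hy₂
  · refine ⟨U₃, h₃.trans (h₂.trans h₁), F.X.res h₃ γ, hy₃, F.X.res_mem h₃ mγ, ?_, ?_⟩
    · rw [← F.X.res_res (h₂.trans h₁) h₃, hγ, map_mul, F.X.res_res]
    · rw [v.app_res]
      rw [map_mul] at hu
      exact (F.X.isUnit_of_mul_even (F.X.res_mem h₃ mvγ) hu).1
  -- If 1 - v(γ) b were a unit, z would vanish near the point, against ∂_z z = 1.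
  · exfalso
    have h0 := congrArg (F.X.res h₃) hz
    rw [map_mul, map_zero, map_sub, map_one] at h0
    have h1 := (hu.mul_left_eq_zero).1 h0
    rw [F.X.res_res] at h1
    have h2 := RelChart.app_res_eq c.dz (h₃.trans (h₂.trans h₁)) c.z
    rw [h1, map_zero, c.dz_z, map_one] at h2
    have h3 := congrArg (F.j.pull U₃) h2
    rw [map_zero, map_one] at h3
    have := F.R_nontrivial (Opens.comap F.j.base U₃) ⟨y, hy₃⟩
    exact zero_ne_one h3

/-- Superconformal coordinates from a generator of the distribution in normal form. -/
theorem exists_SCChart_of_normal {c : RelChart F.π} (hc : IsCutOutBy F.j c.source c.z)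
    {v : RelVF F.π 1 c.source} (hv : F.IsGenerator v)
    {w : RelVF F.π 0 c.source}
    (hcomb : v.IsComb (v.app _ le_rfl c.z) w 1 c.dθ) {γ μ : F.X.Γ c.source}
    (mγ : γ ∈ F.X.part _ 1) (hγ : v.app _ le_rfl c.z = c.z * γ) (mμ : μ ∈ F.X.part _ 0)
    (uμ : IsUnit μ) (hμ : μ * μ = v.app _ le_rfl γ) :
    ∃ C : F.SCChart, C.chart.source = c.source := by
  obtain ⟨ν, hν⟩ := uμ.exists_right_inv
  have mν := F.X.even_inv mμ hν
  set θ' := γ * ν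
  have mθ : θ' ∈ F.X.part _ 1 := by simpa using F.X.mul_mem mγ mν
  -- The coordinate θ' = γ ν, with ν = μ⁻¹, is a solution of θ' v(θ') = γ: one has v(θ') = μ - γ
  -- v(ν), and γ² = 0. So σ = v(θ')⁻¹ turns v into a field with σ v(θ') = 1 and σ v(z) = z θ'.
  set ρ := v.app _ le_rfl θ' with hρdef
  have mρ : ρ ∈ F.X.part _ 0 := v.app_odd_mem le_rfl mθ
  have hρ : ρ = μ - γ * v.app _ le_rfl ν := by
    rw [hρdef, v.leibniz_odd, F.X.bar_of_odd mγ, ← hμ, mul_assoc, hν, mul_one, neg_mul,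
      sub_eq_add_neg]
  have hνρ : ν * ρ = 1 - γ * (ν * v.app _ le_rfl ν) := by
    rw [hρ, mul_sub, ← F.X.even_comm mμ, hν, ← mul_assoc, F.X.even_comm mν γ, mul_assoc]
  have uρ : IsUnit ρ := (F.X.isUnit_of_mul_even mν (by
    rw [hνρ]; exact F.X.isUnit_one_sub_odd_mul_odd mγ)).2
  have hθρ : θ' * ρ = γ := by
    rw [mul_assoc, hνρ, mul_sub, mul_one, ← mul_assoc, F.X.odd_mul_self mγ, zero_mul, sub_zero]
  have hdθ : c.dθ.app _ le_rfl θ' = ρ - γ * (c.z * w.app _ le_rfl θ') := by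
    have h1 := hcomb _ le_rfl θ'
    rw [map_one, one_mul, F.X.res_self, hγ, F.X.even_comm c.z_even, mul_assoc] at h1
    exact (sub_eq_of_eq_add' h1).symm
  obtain ⟨σ, hσ⟩ := uρ.exists_left_inv
  have mσ : σ ∈ F.X.part _ 0 := F.X.even_inv mρ (by rw [F.X.even_comm mρ, hσ])
  -- Admissibility of the new odd coordinate: ∂_θ θ' differs from the unit ρ by a multiple of the
  -- odd γ.
  have udθ : IsUnit (c.dθ.app _ le_rfl θ') := by
    refine (F.X.isUnit_of_mul_even mσ ?_).2
    rw [hdθ, mul_sub, hσ, ← mul_assoc]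
    exact F.X.isUnit_one_sub_odd_mul_odd (by simpa using F.X.mul_mem mσ mγ)
  have uσ : IsUnit σ := ⟨⟨σ, ρ, hσ, by rw [F.X.even_comm mρ, hσ]⟩, rfl⟩
  refine ⟨⟨c.changeθ θ' mθ udθ, hc, v.smulEven σ mσ, ?_, ?_, hv.smulEven mσ uσ⟩, rfl⟩
  · change F.X.res le_rfl σ * v.app _ le_rfl θ' = 1
    rw [F.X.res_self]; exact hσ
  · change F.X.res le_rfl σ * v.app _ le_rfl c.z = c.z * θ'
    rw [F.X.res_self, hγ, ← hθρ, F.X.even_comm mσ, mul_assoc, mul_assoc, F.X.even_comm mρ, hσ,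
      mul_one]

/-- The source is shrunk until v(z) is divisible by z with odd quotient γ and v(γ) has an invertible
root; the normal form of v survives the restriction. -/
theorem exists_SCChart_of_generator (hT : T.IsComplex) {c : RelChart F.π}
    (hc : IsCutOutBy F.j c.source c.z) {v : RelVF F.π 1 c.source} (hv : F.IsGenerator v)
    (hcomb : v.IsComb (v.app _ le_rfl c.z) c.dz 1 c.dθ) {H : F.X.Γ c.source}
    (hsq : ∀ (U' : Opens F.X.space) (h' : U' ≤ c.source) (s : F.X.Γ U'),
        v.app U' h' (v.app U' h' s) = F.X.res h' H * c.dz.app U' h' s)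
    (hH : IsCutOutBy F.j c.source H) {y : F.R.space} (hy : F.j.base y ∈ c.source) :
    ∃ C : F.SCChart, F.j.base y ∈ C.chart.source := by
  obtain ⟨U₁, h₁, γ, hy₁, mγ, hγ, uγ⟩ := exists_γ hc hsq hH hy
  obtain ⟨U, h, μ, hyU, mμ, hμ, uμ⟩ := c.exists_sqrt hT h₁ (v.app_odd_mem h₁ mγ) uγ hy₁
  have l : U ≤ c.source := h.trans h₁
  have hz : (c.restrict l).z = F.X.res l c.z := c.restrict_z l
  have hvz : (v.res l).app U le_rfl (c.restrict l).z = F.X.res l (v.app _ le_rfl c.z) := by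
    rw [hz]; exact v.app_res le_rfl l c.z
  obtain ⟨C, hC⟩ := exists_SCChart_of_normal (c := c.restrict l) (v := v.res l)
    (w := c.dz.res l) (γ := F.X.res h γ) (μ := μ) (by rw [hz]; exact hc.restrict l) (hv.res l)
    (by
      intro U' h' s
      refine (hcomb U' (h'.trans l) s).trans (congrArg₂ (· + ·) (congrArg₂ (· * ·) ?_ rfl)
        (congrArg₂ (· * ·) ?_ (c.restrict_dθ_app l h' s).symm))
      · exact (F.X.res_res l h' _).symm.trans (congrArg (F.X.res h') hvz.symm)
      · rw [map_one]; exact (map_one (F.X.res h')).symm)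
    (F.X.res_mem h mγ) (by
      refine hvz.trans ?_
      rw [← F.X.res_res h₁ h, hγ, map_mul, F.X.res_res, hz]; rfl) mμ uμ
    (hμ.trans (v.app_res h₁ h γ).symm)
  refine ⟨C, ?_⟩
  rw [hC]; exact hyU

/-- Superconformal coordinates exist near the Ramond divisor. -/
theorem exists_SCChart (hT : T.IsComplex) (y : F.R.space) :
    ∃ C : F.SCChart, F.j.base y ∈ C.chart.source := by
  obtain ⟨c₀, hy₀, hc₀⟩ := F.divisor y
  obtain ⟨U, w, v, h, k, hyU, hf, hD, hh, hb⟩ := F.D_superconformal (F.j.base y)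
  have l₀ : c₀.source ⊓ U ≤ c₀.source := inf_le_left
  have l : c₀.source ⊓ U ≤ U := inf_le_right
  have hc : IsCutOutBy F.j (c₀.restrict l₀).source (c₀.restrict l₀).z := by
    rw [c₀.restrict_z]; exact hc₀.restrict l₀
  have hbr := hb.res l
  rw [map_mul, map_ofNat] at hbr
  obtain ⟨v₁, H, hv₁, hθ, hcomb, hsq, hH⟩ := exists_normalized (c := c₀.restrict l₀)
    (w := w.res l) (v := v.res l) (h := F.X.res l h) (k := F.X.res l k) (hf.res l)
    (IsGenerator.res (F := F) hD l) (hh.restrict l) hbr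
  exact exists_SCChart_of_generator hT hc hv₁ hcomb hsq hH ⟨hy₀, hyU⟩

end SRSFamily

namespace SRSFamily

variable {T : SuperSpace} {r : ℕ} {F : SRSFamily T r}

/-! ### Closed forms on the Ramond divisor -/

/-- Multiplication of forms on the Ramond divisor by functions on the base. -/
def mulR {V : Opens T.space} {W : Opens F.R.space} (hV : W ≤ F.above V) :
    RelForm F.q W →+ T.Γ V →+ RelForm F.q W :=
  AddMonoidHom.mk' (fun ω => AddMonoidHom.mk' (fun a => ω.mulRight hV a) fun a b => by
      ext U' p ξ
      simp [RelForm.mulRight, mul_add]) fun ω ω' => by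
    ext c U' p ξ
    simp [RelForm.mulRight, add_mul]

section mulR

variable {V V' : Opens T.space} {W W' : Opens F.R.space}

theorem mulR_apply (hV : W ≤ F.above V) (ω : RelForm F.q W) (a : T.Γ V) {p : ZMod 2}
    (h : W' ≤ W) (ξ : RelVF F.q p W') :
    (mulR hV ω a).1 ⟨W', h⟩ p ξ = ω.1 ⟨W', h⟩ p ξ * F.pullR (h.trans hV) a := rfl

theorem res_mulR (hV : W ≤ F.above V) (h : W' ≤ W) (ω : RelForm F.q W) (a : T.Γ V) :
    RelForm.res h (mulR hV ω a) = mulR (h.trans hV) (RelForm.res h ω) a := rfl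

theorem mulR_res (k : V' ≤ V) (hV : W ≤ F.above V') (ω : RelForm F.q W) (a : T.Γ V) :
    mulR hV ω (T.res k a) = mulR (hV.trans (F.above_mono k)) ω a :=
  RelForm.mulRight_res ω (hV.trans (F.above_mono k)) k hV a

theorem mulR_mul (hV : W ≤ F.above V) (ω : RelForm F.q W) (a b : T.Γ V) :
    mulR hV (mulR hV ω a) b = mulR hV ω (a * b) := by
  refine RelForm.ext_apply fun W' h p ξ => ?_
  rw [mulR_apply, mulR_apply, mulR_apply, map_mul, mul_assoc]

theorem mulR_one (hV : W ≤ F.above V) (ω : RelForm F.q W) : mulR hV ω 1 = ω := by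
  refine RelForm.ext_apply fun W' h p ξ => ?_
  rw [mulR_apply, map_one, mul_one]

theorem mulR_intCast (hV : W ≤ F.above V) (ω : RelForm F.q W) (n : ℤ) :
    mulR hV ω (n : T.Γ V) = n • ω := by
  rw [← zsmul_one, map_zsmul, mulR_one]

theorem resZ_mulZ (h : V' ≤ V) (ω : F.Z V) (a : T.Γ V) :
    F.resZ h (F.mulZ ω a) = F.mulZ (F.resZ h ω) (T.res h a) :=
  Subtype.ext (mulR_res h le_rfl (RelForm.res (F.above_mono h) ω.1) a).symm

theorem resZ_resZ {V'' : Opens T.space} (h : V' ≤ V) (h' : V'' ≤ V') (ω : F.Z V) :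
    F.resZ h' (F.resZ h ω) = F.resZ (h'.trans h) ω := rfl

theorem mulZ_mul (ω : F.Z V) (a b : T.Γ V) : F.mulZ (F.mulZ ω a) b = F.mulZ ω (a * b) :=
  Subtype.ext (mulR_mul le_rfl ω.1 a b)

theorem mulZ_one (ω : F.Z V) : F.mulZ ω 1 = ω := Subtype.ext (mulR_one le_rfl ω.1)

end mulR

namespace SCChart

/-- The domain of the coordinate on the Ramond divisor. -/
def dom (C : F.SCChart) : Opens F.R.space := Opens.comap F.j.base C.chart.source

/-- The superconformal coordinate on the Ramond divisor. -/
def x (C : F.SCChart) : F.R.Γ C.dom := oddCoord C.chart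

theorem x_mem (C : F.SCChart) : C.x ∈ F.R.part C.dom 1 := oddCoord_mem _

/-- The superconformal differential. -/
def form (C : F.SCChart) : RelForm F.q C.dom := RelForm.d C.x

theorem isSCDiff_form (C : F.SCChart) {W : Opens F.R.space} (h : W ≤ C.dom) :
    F.IsSCDiff W (RelForm.res h C.form) :=
  fun _ hy => ⟨W, le_rfl, F.R.res h C.x, hy, ⟨C, h, rfl⟩, RelForm.res_d h C.x⟩

end SCChart

theorem exists_isSCDiff_eq {W : Opens F.R.space} {γ : RelForm F.q W} (hγ : F.IsSCDiff W γ)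
    {y : F.R.space} (hy : y ∈ W) : ∃ (W' : Opens F.R.space) (h : W' ≤ W) (C : F.SCChart)
      (hs : W' ≤ C.dom), y ∈ W' ∧ RelForm.res h γ = RelForm.res hs C.form := by
  obtain ⟨W', h, x, hy', ⟨C, hs, rfl⟩, he⟩ := hγ y hy
  exact ⟨W', h, C, hs, hy', he.trans (RelForm.res_d hs C.x).symm⟩

/-- Near `y`, the form `ω` is the product of the differential of a superconformal coordinate with
the function `a` on the base. -/
def HasCoeff (C : F.SCChart) {W : Opens F.R.space} (ω : RelForm F.q W) (y : F.R.space)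
    {V : Opens T.space} (a : T.Γ V) : Prop :=
  ∃ (W' : Opens F.R.space) (h : W' ≤ W) (hs : W' ≤ C.dom) (hV : W' ≤ F.above V), y ∈ W' ∧
    RelForm.res h ω = mulR hV (RelForm.res hs C.form) a

namespace HasCoeff

variable {C : F.SCChart} {W : Opens F.R.space} {ω ω' : RelForm F.q W} {y : F.R.space}
  {V : Opens T.space} {a a' : T.Γ V}

theorem add (h : HasCoeff C ω y a) (h' : HasCoeff C ω' y a') :
    HasCoeff C (ω + ω') y (a + a') := by
  obtain ⟨W₁, h₁, hs₁, hV₁, hy₁, e₁⟩ := h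
  obtain ⟨W₂, h₂, hs₂, hV₂, hy₂, e₂⟩ := h'
  refine ⟨W₁ ⊓ W₂, inf_le_left.trans h₁, inf_le_left.trans hs₁, inf_le_left.trans hV₁,
    ⟨hy₁, hy₂⟩, ?_⟩
  rw [map_add, map_add]
  exact congrArg₂ (· + ·) (congrArg (RelForm.res inf_le_left) e₁)
    (congrArg (RelForm.res inf_le_right) e₂)

theorem zero (hC : y ∈ C.dom) (hy : y ∈ W) (hV : y ∈ F.above V) :
    HasCoeff C (0 : RelForm F.q W) y (0 : T.Γ V) :=
  ⟨W ⊓ C.dom ⊓ F.above V, inf_le_left.trans inf_le_left, inf_le_left.trans inf_le_right,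
    inf_le_right, ⟨⟨hy, hC⟩, hV⟩, by rw [map_zero, map_zero]⟩

theorem neg (h : HasCoeff C ω y a) : HasCoeff C (-ω) y (-a) := by
  obtain ⟨W₁, h₁, hs₁, hV₁, hy₁, e₁⟩ := h
  exact ⟨W₁, h₁, hs₁, hV₁, hy₁, by rw [map_neg, e₁, map_neg]⟩

theorem sum {ι : Type} (s : Finset ι) {ω : ι → RelForm F.q W} {a : ι → T.Γ V} (hC : y ∈ C.dom)
    (hy : y ∈ W) (hV : y ∈ F.above V) (h : ∀ i ∈ s, HasCoeff C (ω i) y (a i)) :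
    HasCoeff C (∑ i ∈ s, ω i) y (∑ i ∈ s, a i) := by
  classical
  induction s using Finset.induction_on with
  | empty => exact zero hC hy hV
  | insert i s hi ih =>
    rw [Finset.sum_insert hi, Finset.sum_insert hi]
    exact (h i (Finset.mem_insert_self i s)).add
      (ih fun k hk => h k (Finset.mem_insert_of_mem hk))

theorem mul (h : HasCoeff C ω y a) (hV : W ≤ F.above V) (b : T.Γ V) :
    HasCoeff C (mulR hV ω b) y (a * b) := by
  obtain ⟨W₁, h₁, hs₁, hV₁, hy₁, e₁⟩ := h
  exact ⟨W₁, h₁, hs₁, hV₁, hy₁, by rw [res_mulR, e₁, mulR_mul]⟩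

theorem res (h : HasCoeff C ω y a) {W' : Opens F.R.space} (h' : W' ≤ W) (hy : y ∈ W') :
    HasCoeff C (RelForm.res h' ω) y a := by
  obtain ⟨W₁, h₁, hs₁, hV₁, hy₁, e₁⟩ := h
  exact ⟨W₁ ⊓ W', inf_le_right, inf_le_left.trans hs₁, inf_le_left.trans hV₁, ⟨hy₁, hy⟩,
    congrArg (RelForm.res inf_le_left) e₁⟩

theorem of_res {W' : Opens F.R.space} {h' : W' ≤ W} (h : HasCoeff C (RelForm.res h' ω) y a) :
    HasCoeff C ω y a := by
  obtain ⟨W₁, h₁, hs₁, hV₁, hy₁, e₁⟩ := h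
  exact ⟨W₁, h₁.trans h', hs₁, hV₁, hy₁, e₁⟩

theorem res_base (h : HasCoeff C ω y a) {V' : Opens T.space} (k : V' ≤ V)
    (hy : y ∈ F.above V') : HasCoeff C ω y (T.res k a) := by
  obtain ⟨W₁, h₁, hs₁, hV₁, hy₁, e₁⟩ := h
  refine ⟨W₁ ⊓ F.above V', inf_le_left.trans h₁, inf_le_left.trans hs₁, inf_le_right, ⟨hy₁, hy⟩, ?_⟩
  rw [mulR_res]
  exact congrArg (RelForm.res inf_le_left) e₁

theorem mem (h : HasCoeff C ω y a) : y ∈ W ∧ y ∈ C.dom ∧ y ∈ F.above V := by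
  obtain ⟨W₁, h₁, hs₁, hV₁, hy₁, e₁⟩ := h
  exact ⟨h₁ hy₁, hs₁ hy₁, hV₁ hy₁⟩

theorem exists_res_eq (h : HasCoeff C ω y a) (h' : HasCoeff C ω' y a) :
    ∃ (W' : Opens F.R.space) (k : W' ≤ W), y ∈ W' ∧ RelForm.res k ω = RelForm.res k ω' := by
  obtain ⟨W₁, h₁, hs₁, hV₁, hy₁, e₁⟩ := h
  obtain ⟨W₂, h₂, hs₂, hV₂, hy₂, e₂⟩ := h'
  refine ⟨W₁ ⊓ W₂, inf_le_left.trans h₁, ⟨hy₁, hy₂⟩, ?_⟩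
  exact (congrArg (RelForm.res (inf_le_left : W₁ ⊓ W₂ ≤ W₁)) e₁).trans
    (congrArg (RelForm.res (inf_le_right : W₁ ⊓ W₂ ≤ W₂)) e₂).symm

end HasCoeff

/-- The coefficient of a form is recovered by pairing with ∂_x, because ∂_x x = 1. -/
theorem form_apply_dx (C : F.SCChart) {W : Opens F.R.space} (h : W ≤ C.dom) {V : Opens T.space}
    (hV : W ≤ F.above V) (a : T.Γ V) :
    (mulR hV (RelForm.res h C.form) a).1 ⟨W, le_rfl⟩ 1 ((dx C.divisor).res h) =
      F.pullR hV a := by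
  rw [mulR_apply]
  change (dx C.divisor).app W h (F.R.res _ C.x) * _ = _
  exact (congrArg (· * _) (dx_oddCoord C.divisor h)).trans (one_mul _)

theorem exists_res_eq_of_pullR (C : F.SCChart) {y : F.R.space} {W : Opens F.R.space} (hy : y ∈ W)
    (h : W ≤ C.dom) {V : Opens T.space} (hV : W ≤ F.above V) {a b : T.Γ V}
    (H : F.pullR hV a = F.pullR hV b) : ∃ (V' : Opens T.space) (h : V' ≤ V), F.q.base y ∈ V' ∧
      T.res h a = T.res h b := by
  obtain ⟨V', k, hy', e, -⟩ := exists_res_eq C.divisor hy h hV (a := a) (b := 0) (a' := b)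
    (b' := 0) (by rw [H])
  exact ⟨V', k, hy', e⟩

theorem HasCoeff.unique {C : F.SCChart} {W W' : Opens F.R.space} {ω : RelForm F.q W}
    {ω' : RelForm F.q W'} {y : F.R.space} {V : Opens T.space} {a a' : T.Γ V}
    (h : HasCoeff C ω y a) (h' : HasCoeff C ω' y a') (hω : RelForm.res inf_le_left ω =
      (RelForm.res inf_le_right ω' : RelForm F.q (W ⊓ W'))) :
    ∃ (V' : Opens T.space) (k : V' ≤ V), F.q.base y ∈ V' ∧ T.res k a = T.res k a' := by
  obtain ⟨W₁, h₁, hs₁, hV₁, hy₁, e₁⟩ := h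
  obtain ⟨W₂, h₂, hs₂, hV₂, hy₂, e₂⟩ := h'
  have e : mulR (inf_le_left.trans hV₁) (RelForm.res (inf_le_left.trans hs₁) C.form) a =
      (mulR (inf_le_left.trans hV₁) (RelForm.res (inf_le_left.trans hs₁) C.form) a' :
        RelForm F.q (W₁ ⊓ W₂)) :=
    ((congrArg (RelForm.res (inf_le_left : W₁ ⊓ W₂ ≤ W₁)) e₁).symm.trans
      (congrArg (RelForm.res (inf_le_inf h₁ h₂)) hω)).trans
      (congrArg (RelForm.res (inf_le_right : W₁ ⊓ W₂ ≤ W₂)) e₂)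
  refine exists_res_eq_of_pullR C (W := W₁ ⊓ W₂) ⟨hy₁, hy₂⟩ (inf_le_left.trans hs₁)
    (inf_le_left.trans hV₁) ?_
  rw [← form_apply_dx C (inf_le_left.trans hs₁), ← form_apply_dx C (inf_le_left.trans hs₁), e]

/-- Closed forms are locally multiples of superconformal differentials by functions on the
base. -/
theorem exists_hasCoeff (C : F.SCChart) {y : F.R.space} (hC : y ∈ C.dom) {W : Opens F.R.space}
    {ω : RelForm F.q W} (hω : ω ∈ RelForm.closed F.q W) (hy : y ∈ W) :
    ∃ (V : Opens T.space) (a : T.Γ V), HasCoeff C ω y a := by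
  have l : W ⊓ C.dom ≤ C.dom := inf_le_right
  have l' : W ⊓ C.dom ≤ W := inf_le_left
  set ξ := (dx C.divisor).res l
  set s := ω.1 ⟨W ⊓ C.dom, l'⟩ 1 ξ
  obtain ⟨W', h', hs, V, hV, a, b, hy', he⟩ := exists_eq_add_mul C.divisor hC s ⟨hy, hC⟩
  -- Closedness on the pair (∂_x, ∂_x): as ∂_x² = 0 the supercommutator vanishes, and the sign rule
  -- leaves 2 ∂_x s = 0.
  have hds : ξ.app _ le_rfl s = 0 := by
    have h1 := hω _ l' 1 1 ξ ξ
    rw [SuperSpace.sgn_one_one, neg_one_smul, sub_neg_eq_add,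
      ω.apply_isMul l' (f := 0) (ζ := ξ) (ξ := ξ.bracket ξ), zero_mul, sub_zero,
      ← two_smul ℂ] at h1
    · exact (smul_eq_zero_iff_right two_ne_zero).1 h1
    · intro W₁ h₁ t
      change (dx C.divisor).app W₁ (h₁.trans l) ((dx C.divisor).app W₁ (h₁.trans l) t) -
        sgn 1 1 • (dx C.divisor).app W₁ (h₁.trans l) ((dx C.divisor).app W₁ (h₁.trans l) t) = _
      have h0 : (dx C.divisor).app W₁ (h₁.trans l) ((dx C.divisor).app W₁ (h₁.trans l) t) = 0 := by
        refine F.R.eq_of_local fun y' hy' => ?_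
        obtain ⟨W₂, h₂, hs₂, V₂, hV₂, a₂, b₂, hy₂, he₂⟩ := exists_eq_add_mul C.divisor
          (l (h₁ hy')) t hy'
        refine ⟨W₂, h₂, hy₂, ?_⟩
        change _ = _ + _ * F.R.res hs₂ (oddCoord _) at he₂
        rw [← (dx C.divisor).app_res, ← (dx C.divisor).app_res, he₂, dx_app, bar_pullR, app_pullR,
          map_zero]
      rw [h0, smul_zero, sub_zero, map_zero, zero_mul]
  have hb : F.pullR hV b = 0 := by
    have h1 := (dx C.divisor).app_res l h' s
    change _ = F.R.res h' (ξ.app _ le_rfl s) at h1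
    change _ = _ + _ * F.R.res hs (oddCoord _) at he
    rw [hds, map_zero, he, dx_app] at h1
    rw [← F.R.bar_bar (F.pullR hV b), h1, map_zero]
  rw [hb, zero_mul, add_zero] at he
  -- Every field is a multiple of ∂_x, so ω is determined by s, and s is now the function a from the
  -- base.
  refine ⟨V, a, W', h'.trans l', hs, hV, hy', RelForm.ext_apply fun W₁ h₁ p ζ => ?_⟩
  have h2 := ω.apply_isMul (h₁.trans (h'.trans l')) (isMul_dx C.divisor (h₁.trans hs) ζ)
  have h3 := ω.apply_res l' (h₁.trans h') ξ
  refine h2.trans ?_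
  rw [mulR_apply]
  refine congrArg₂ (· * ·) rfl ?_
  refine h3.trans ?_
  rw [← F.R.res_res h' h₁, ← res_pullR F hV h₁, ← he]

end SRSFamily

/-! ### Closed forms near a fibre -/

namespace SRSFamily

variable {T : SuperSpace} {r : ℕ} {F : SRSFamily T r}

/-- Superconformal differentials are unique up to sign. -/
theorem SCChart.exists_form_eq (C C' : F.SCChart) {y : F.R.space} (hy : y ∈ C.dom)
    (hy' : y ∈ C'.dom) : ∃ ε : ℤ, ε * ε = 1 ∧ ∃ (W : Opens F.R.space) (h : W ≤ C.dom)
      (h' : W ≤ C'.dom), y ∈ W ∧ RelForm.res h' C'.form = ε • RelForm.res h C.form := by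
  obtain ⟨W, h, h', V, hV, a, hyW, he⟩ := C.exists_oddCoord_eq C' hy hy'
  -- In x' = a ± x the function a is from the base and has no relative differential.
  have hd : (RelForm.d (F.pullR hV a) : RelForm F.q W) = 0 := RelForm.d_pull hV a
  have e₁ : RelForm.res (show W ≤ C'.dom from h') C'.form =
    (RelForm.d (F.R.res (show W ≤ C'.dom from h') C'.x) : RelForm F.q W) := RelForm.res_d _ _
  have e₂ : RelForm.res (show W ≤ C.dom from h) C.form =
    (RelForm.d (F.R.res (show W ≤ C.dom from h) C.x) : RelForm F.q W) := RelForm.res_d _ _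
  rcases he with he | he
  · refine ⟨1, by norm_num, W, h, h', hyW, ?_⟩
    rw [one_smul, e₁, e₂]
    refine (congrArg RelForm.d he).trans ?_
    rw [RelForm.d_add, hd, zero_add]
    rfl
  · refine ⟨-1, by norm_num, W, h, h', hyW, ?_⟩
    rw [neg_one_smul, e₁, e₂]
    refine (congrArg RelForm.d he).trans ?_
    rw [sub_eq_add_neg, RelForm.d_add, hd, zero_add, RelForm.d_neg]
    rfl

/-- The sign depends on the charts and the point but not on the form, so that two forms change by
the same sign and the product of their coefficients does not change. -/
theorem SCChart.exists_sign (C C' : F.SCChart) {y : F.R.space} (hy : y ∈ C.dom)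
    (hy' : y ∈ C'.dom) : ∃ ε : ℤ, ε * ε = 1 ∧ ∀ {W : Opens F.R.space} {ω : RelForm F.q W}
      {V : Opens T.space} {a : T.Γ V}, HasCoeff C' ω y a → HasCoeff C ω y ((ε : T.Γ V) * a) := by
  obtain ⟨ε, hε, W₀, h₀, h₀', hy₀, e₀⟩ := C.exists_form_eq C' hy hy'
  refine ⟨ε, hε, ?_⟩
  rintro W ω V a ⟨W₁, h₁, hs₁, hV₁, hy₁, e₁⟩
  refine ⟨W₀ ⊓ W₁, inf_le_right.trans h₁, inf_le_left.trans h₀, inf_le_right.trans hV₁, ⟨hy₀, hy₁⟩,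
    ?_⟩
  have e₂ := congrArg (RelForm.res (inf_le_right : W₀ ⊓ W₁ ≤ W₁)) e₁
  have e₃ := congrArg (RelForm.res (inf_le_left : W₀ ⊓ W₁ ≤ W₀)) e₀
  rw [← mulR_mul, mulR_intCast]
  rw [map_zsmul] at e₃
  exact e₂.trans (congrArg (fun γ => mulR _ γ a) e₃)

/-- A closed form is determined near a fibre by its germs at the punctures. -/
theorem exists_resZ_eq (hT : T.IsComplex) {V : Opens T.space} {t : T.space} (ht : t ∈ V)
    {ω ω' : F.Z V} (H : ∀ y, F.q.base y = t → ∃ (W : Opens F.R.space) (h : W ≤ F.above V),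
      y ∈ W ∧ RelForm.res h ω.1 = RelForm.res h ω'.1) :
    ∃ (V' : Opens T.space) (h : V' ≤ V), t ∈ V' ∧ F.resZ h ω = F.resZ h ω' := by
  obtain ⟨y, hy⟩ := F.exists_punctures t
  choose W hW hyW he using fun i => H (y i) (hy i).1
  obtain ⟨V₁, ht₁, hV₁⟩ := exists_forall_mem_label hT hy W hyW
  refine ⟨V ⊓ V₁, inf_le_left, ⟨ht, ht₁⟩, Subtype.ext (RelForm.eq_of_local fun y' hy' => ?_)⟩
  refine ⟨W (F.label y') ⊓ F.above (V ⊓ V₁), inf_le_right, ⟨hV₁ y' hy'.2, hy'⟩, ?_⟩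
  exact congrArg (RelForm.res (inf_le_left : W (F.label y') ⊓ F.above (V ⊓ V₁) ≤ _))
    (he (F.label y'))

theorem eqZ_of_local {V : Opens T.space} {ω ω' : F.Z V} (H : ∀ t ∈ V, ∃ (V' : Opens T.space)
    (h : V' ≤ V), t ∈ V' ∧ F.resZ h ω = F.resZ h ω') : ω = ω' := by
  refine Subtype.ext (RelForm.eq_of_local fun y hy => ?_)
  obtain ⟨V', h, ht, he⟩ := H _ hy
  exact ⟨F.above V', F.above_mono h, ht, congrArg Subtype.val he⟩

theorem isSheaf_Z (F : SRSFamily T r) : IsSheaf (fun V => F.Z V) (fun h ω => F.resZ h ω) := by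
  intro ι U V hU hcov s hs
  obtain ⟨ω, hω⟩ := RelForm.exists_gluing (fun i => F.above (U i)) (F.above V)
    (fun i => F.above_mono (hU i)) (fun y hy => hcov _ hy) (fun i => (s i).1)
    fun i j => congrArg Subtype.val (hs i j)
  have hcl : ω ∈ RelForm.closed F.q (F.above V) := by
    refine RelForm.mem_closed_of_local fun y hy => ?_
    obtain ⟨i, hi⟩ := hcov _ hy
    refine ⟨F.above (U i), F.above_mono (hU i), hi, ?_⟩
    rw [hω i]; exact (s i).2
  refine ⟨⟨ω, hcl⟩, fun i => Subtype.ext (hω i), fun ω' hω' => eqZ_of_local fun t ht => ?_⟩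
  obtain ⟨i, hi⟩ := hcov t ht
  exact ⟨U i, hU i, hi, (hω' i).trans (Subtype.ext (hω i)).symm⟩

theorem isSheaf_Lam (F : SRSFamily T r) :
    IsSheaf (fun V => F.Lam V) (fun h ω => F.resLam h ω) := by
  intro ι U V hU hcov s hs
  obtain ⟨ω, hω, huniq⟩ := isSheaf_Z F U V hU hcov (fun i => (s i).1)
    fun i j => congrArg Subtype.val (hs i j)
  have hmem : ω ∈ F.Lam V := by
    intro y hy
    obtain ⟨i, hi⟩ := hcov _ hy
    obtain ⟨W, h, hyW, hW⟩ := (s i).2 y hi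
    refine ⟨W, h.trans (F.above_mono (hU i)), hyW, ?_⟩
    have := congrArg (fun ω : F.Z (U i) => RelForm.res h ω.1) (hω i)
    exact this ▸ hW
  exact ⟨⟨ω, hmem⟩, fun i => Subtype.ext (hω i), fun ω' hω' => Subtype.ext
    (huniq ω'.1 fun i => congrArg Subtype.val (hω' i))⟩

/-- The component of the Ramond divisor with a given label. -/
def component (F : SRSFamily T r) (i : Fin (2 * r)) : Opens F.R.space :=
  ⟨F.label ⁻¹' {i}, F.label_locallyConstant.isOpen_fiber i⟩

theorem mem_component {y : F.R.space} {i : Fin (2 * r)} : y ∈ F.component i ↔ F.label y = i :=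
  Iff.rfl

/-- Extension by zero of a closed form on one component. -/
theorem exists_extension {V : Opens T.space} (i : Fin (2 * r))
    (γ : RelForm F.q (F.above V ⊓ F.component i)) (hγ : γ ∈ RelForm.closed F.q _) :
    ∃ ω : F.Z V, RelForm.res inf_le_left ω.1 = γ ∧ ∀ k, k ≠ i →
      (RelForm.res inf_le_left ω.1 : RelForm F.q (F.above V ⊓ F.component k)) = 0 := by
  classical
  set s : ∀ k, RelForm F.q (F.above V ⊓ F.component k) := fun k =>
    if h : k = i then RelForm.res (by rw [h]) γ else 0
  have hs : s i = γ := dif_pos rfl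
  have hs' : ∀ k, k ≠ i → s k = 0 := fun k hk => dif_neg hk
  obtain ⟨ω, hω⟩ := RelForm.exists_gluing (fun k => F.above V ⊓ F.component k) (F.above V)
    (fun k => inf_le_left) (fun y hy => ⟨F.label y, hy, rfl⟩) s fun k l => by
      by_cases hkl : k = l
      · subst hkl; rfl
      -- Components with different labels are disjoint, so there is nothing to compare.
      · refine RelForm.eq_of_local fun y hy => (hkl ?_).elim
        exact (mem_component.1 hy.1.2).symm.trans (mem_component.1 hy.2.2)
  refine ⟨⟨ω, RelForm.mem_closed_of_local fun y hy =>
    ⟨F.above V ⊓ F.component (F.label y), inf_le_left, ⟨hy, rfl⟩, ?_⟩⟩, (hω i).trans hs,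
    fun k hk => (hω k).trans (hs' k hk)⟩
  rw [hω]
  by_cases hk : F.label y = i
  · change (if h : F.label y = i then RelForm.res (by rw [h]) γ else 0) ∈ _
    rw [dif_pos hk]
    exact RelForm.res_closed _ hγ
  · rw [hs' _ hk]; exact zero_mem _

/-! ### Superconformal frames -/

/-- Sections `e i` that are superconformal differentials along the `i`-th puncture and vanish along
the other punctures. -/
def IsSCFrame {V : Opens T.space} (e : Fin (2 * r) → F.Z V) : Prop :=
  ∀ y ∈ F.above V, ∃ C : F.SCChart, y ∈ C.dom ∧
    ∀ k, HasCoeff C (e k).1 y (if k = F.label y then 1 else 0 : T.Γ V)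

theorem IsSCFrame.res {V V' : Opens T.space} {e : Fin (2 * r) → F.Z V} (he : F.IsSCFrame e)
    (h : V' ≤ V) : F.IsSCFrame fun k => F.resZ h (e k) := by
  intro y hy
  obtain ⟨C, hC, H⟩ := he y (F.above_mono h hy)
  refine ⟨C, hC, fun k => ?_⟩
  have := ((H k).res (F.above_mono h) hy).res_base h hy
  rwa [apply_ite (T.res h), map_one, map_zero] at this

theorem isSCFrame_of_res {V : Opens T.space} {e : Fin (2 * r) → F.Z V}
    (H : ∀ y ∈ F.above V, ∃ (W : Opens F.R.space) (h : W ≤ F.above V) (C : F.SCChart)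
      (hs : W ≤ C.dom), y ∈ W ∧ RelForm.res h (e (F.label y)).1 = RelForm.res hs C.form)
    (H' : ∀ k l, l ≠ k →
      (RelForm.res inf_le_left (e k).1 : RelForm F.q (F.above V ⊓ F.component l)) = 0) :
    F.IsSCFrame e := by
  intro y hy
  obtain ⟨W, h, C, hs, hyW, he⟩ := H y hy
  refine ⟨C, hs hyW, fun k => ?_⟩
  split_ifs with hk
  · subst hk
    exact ⟨W, h, hs, h, hyW, by rw [mulR_one, he]⟩
  · refine HasCoeff.of_res (h' := (inf_le_left : F.above V ⊓ F.component (F.label y) ≤ _)) ?_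
    rw [H' k _ (Ne.symm hk)]
    exact HasCoeff.zero (hs hyW) ⟨hy, rfl⟩ hy

/-- Take superconformal coordinates at the punctures of the fibre over t. By openness of R → T their
domains contain the whole components over a neighbourhood of t, and their differentials are extended
by zero. -/
theorem exists_isSCFrame (hT : T.IsComplex) (t : T.space) :
    ∃ (V : Opens T.space) (e : Fin (2 * r) → F.Z V), t ∈ V ∧ F.IsSCFrame e := by
  obtain ⟨y, hy⟩ := F.exists_punctures t
  choose C hC using fun i => exists_SCChart hT (y i)
  obtain ⟨V, ht, hV⟩ := exists_forall_mem_label hT hy (fun i => (C i).dom) hC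
  have hle : ∀ i, F.above V ⊓ F.component i ≤ (C i).dom := by
    intro i y' hy'
    have := hV y' hy'.1
    rwa [mem_component.1 hy'.2] at this
  choose e he he' using fun i => exists_extension (V := V) i (RelForm.res (hle i) (C i).form)
    (RelForm.res_closed _ (RelForm.d_mem_closed _))
  refine ⟨V, e, ht, isSCFrame_of_res (fun y' hy' => ?_) he'⟩
  exact ⟨F.above V ⊓ F.component (F.label y'), inf_le_left, C (F.label y'), hle _, ⟨hy', rfl⟩,
    he _⟩

/-- Near y only the member of the frame with the label of y contributes. -/
theorem IsSCFrame.hasCoeff_sum {V V' : Opens T.space} {e : Fin (2 * r) → F.Z V}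
    {C : F.SCChart} {y : F.R.space} (hC : ∀ k, HasCoeff C (e k).1 y
      (if k = F.label y then 1 else 0 : T.Γ V)) (h : V' ≤ V) (hy : y ∈ F.above V')
    (c : Fin (2 * r) → T.Γ V') :
    HasCoeff C (∑ k, F.mulZ (F.resZ h (e k)) (c k)).1 y (c (F.label y)) := by
  have key : ∀ k, HasCoeff C (F.mulZ (F.resZ h (e k)) (c k)).1 y
      ((if k = F.label y then 1 else 0) * c k) := by
    intro k
    have := (((hC k).res (F.above_mono h) hy).res_base h hy).mul le_rfl (c k)
    rwa [apply_ite (T.res h), map_one, map_zero] at this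
  have := HasCoeff.sum Finset.univ (hC (F.label y)).mem.2.1 hy hy fun k _ => key k
  rw [AddSubgroup.val_finsetSum]
  simpa using this

/-- Being a basis is a local property. -/
theorem isBasis_of_local {V₀ : Opens T.space} {e : Fin (2 * r) → F.Z V₀}
    (huniq : ∀ (V : Opens T.space) (h : V ≤ V₀) (c c' : Fin (2 * r) → T.Γ V),
      ∑ i, F.mulZ (F.resZ h (e i)) (c i) = ∑ i, F.mulZ (F.resZ h (e i)) (c' i) →
      ∀ t ∈ V, ∃ (V' : Opens T.space) (h' : V' ≤ V), t ∈ V' ∧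
        ∀ i, T.res h' (c i) = T.res h' (c' i))
    (hex : ∀ (V : Opens T.space) (h : V ≤ V₀) (ω : F.Z V), ∀ t ∈ V, ∃ (V' : Opens T.space)
      (h' : V' ≤ V) (c : Fin (2 * r) → T.Γ V'), t ∈ V' ∧
      F.resZ h' ω = ∑ i, F.mulZ (F.resZ (h'.trans h) (e i)) (c i)) : F.IsBasis e := by
  have huniq' : ∀ (V : Opens T.space) (h : V ≤ V₀) (c c' : Fin (2 * r) → T.Γ V),
      ∑ i, F.mulZ (F.resZ h (e i)) (c i) = ∑ i, F.mulZ (F.resZ h (e i)) (c' i) → c = c' := by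
    intro V h c c' H
    ext i
    refine T.eq_of_local fun t ht => ?_
    obtain ⟨V', h', ht', he⟩ := huniq V h c c' H t ht
    exact ⟨V', h', ht', he i⟩
  have hres : ∀ (V V' : Opens T.space) (h : V ≤ V₀) (h' : V' ≤ V) (c : Fin (2 * r) → T.Γ V),
      F.resZ h' (∑ i, F.mulZ (F.resZ h (e i)) (c i)) =
        ∑ i, F.mulZ (F.resZ (h'.trans h) (e i)) (T.res h' (c i)) := by
    intro V V' h h' c
    rw [map_sum]
    exact Finset.sum_congr rfl fun i _ => resZ_mulZ _ _ _
  intro V h ω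
  -- Each coefficient is glued separately, as the section that agrees with the i-th coefficient of
  -- every local expansion.
  have key : ∀ i, ∃ a : T.Γ V, ∀ (V' : Opens T.space) (h' : V' ≤ V) (b : T.Γ V'),
      (∃ c : Fin (2 * r) → T.Γ V', F.resZ h' ω =
        ∑ k, F.mulZ (F.resZ (h'.trans h) (e k)) (c k) ∧ b = c i) → T.res h' a = b := by
    intro i
    refine T.exists_section_of_local (fun V' h' b => ∃ c : Fin (2 * r) → T.Γ V', F.resZ h' ω =
        ∑ k, F.mulZ (F.resZ (h'.trans h) (e k)) (c k) ∧ b = c i) ?_ ?_ ?_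
    · rintro V₁ V₂ h₁ h₂ a ⟨c, hc, rfl⟩
      refine ⟨fun k => T.res h₂ (c k), ?_, rfl⟩
      rw [← resZ_resZ h₁ h₂, hc, hres]
    · rintro V₁ h₁ a b ⟨c, hc, rfl⟩ ⟨c', hc', rfl⟩
      rw [huniq' _ _ c c' (hc.symm.trans hc')]
    · intro t ht
      obtain ⟨V', h', c, ht', hc⟩ := hex V h ω t ht
      exact ⟨V', h', c i, ht', c, hc, rfl⟩
  choose a ha using key
  refine ⟨a, eqZ_of_local fun t ht => ?_, fun c hc => ?_⟩
  · obtain ⟨V', h', c, ht', hc⟩ := hex V h ω t ht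
    refine ⟨V', h', ht', ?_⟩
    rw [hres, hc]
    exact Finset.sum_congr rfl fun i _ => by rw [ha i V' h' (c i) ⟨c, hc, rfl⟩]
  · ext i
    have := ha i V le_rfl (c i) ⟨c, hc, rfl⟩
    rw [← this, T.res_self]

/-- The coefficients are read off from the germs at the punctures of a fibre, whence local
uniqueness. Conversely a closed form is dx · a at each puncture, and the combination with these
coefficients has the same germs along the fibre, hence agrees with it near the fibre. -/
theorem IsSCFrame.isBasis (hT : T.IsComplex) {V₀ : Opens T.space} {e : Fin (2 * r) → F.Z V₀}
    (he : F.IsSCFrame e) : F.IsBasis e := by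
  refine isBasis_of_local ?_ ?_
  · intro V h c c' H t ht
    obtain ⟨y, hy⟩ := F.exists_punctures t
    have hyV : ∀ i, y i ∈ F.above V := fun i => by
      change F.q.base (y i) ∈ V
      rw [(hy i).1]; exact ht
    have key : ∀ i, ∃ (V' : Opens T.space) (h' : V' ≤ V), t ∈ V' ∧
        T.res h' (c i) = T.res h' (c' i) := by
      intro i
      obtain ⟨C, -, hC⟩ := he (y i) (F.above_mono h (hyV i))
      have h1 := hasCoeff_sum hC h (hyV i) c
      have h2 := hasCoeff_sum hC h (hyV i) c'
      obtain ⟨V', h', ht', e'⟩ := h1.unique h2 (by rw [H])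
      rw [(hy i).1] at ht'
      rw [(hy i).2] at e'
      exact ⟨V', h', ht', e'⟩
    choose V' h' ht' e' using key
    refine ⟨V ⊓ ⟨⋂ i, V' i, isOpen_iInter_of_finite fun i => (V' i).isOpen⟩, inf_le_left,
      ⟨ht, Set.mem_iInter.2 ht'⟩, fun i => ?_⟩
    have hle : V ⊓ ⟨⋂ i, V' i, isOpen_iInter_of_finite fun i => (V' i).isOpen⟩ ≤ V' i :=
      fun x hx => Set.mem_iInter.1 hx.2 i
    have := congrArg (T.res hle) (e' i)
    rwa [T.res_res, T.res_res] at this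
  · intro V h ω t ht
    obtain ⟨y, hy⟩ := F.exists_punctures t
    have hyV : ∀ i, y i ∈ F.above V := fun i => by
      change F.q.base (y i) ∈ V
      rw [(hy i).1]; exact ht
    choose C hCd hC using fun i => he (y i) (F.above_mono h (hyV i))
    choose V' a ha using fun i => exists_hasCoeff (C i) (hCd i) ω.2 (hyV i)
    have htV' : ∀ i, t ∈ V' i := fun i => by
      have := (ha i).mem.2.2
      change F.q.base (y i) ∈ V' i at this
      rwa [(hy i).1] at this
    set V₁ : Opens T.space := V ⊓ ⟨⋂ i, V' i, isOpen_iInter_of_finite fun i => (V' i).isOpen⟩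
    have h₁ : V₁ ≤ V := inf_le_left
    have hle : ∀ i, V₁ ≤ V' i := fun i x hx => Set.mem_iInter.1 hx.2 i
    have ht₁ : t ∈ V₁ := ⟨ht, Set.mem_iInter.2 htV'⟩
    have hy₁ : ∀ i, y i ∈ F.above V₁ := fun i => by
      change F.q.base (y i) ∈ V₁
      rw [(hy i).1]; exact ht₁
    obtain ⟨V₂, h₂, ht₂, e₂⟩ := exists_resZ_eq hT ht₁ (ω := F.resZ h₁ ω)
      (ω' := ∑ i, F.mulZ (F.resZ (h₁.trans h) (e i)) (T.res (hle i) (a i))) (by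
      intro y' hy'
      have hyy : y' = y (F.label y') :=
        (F.label_bijective t (F.label y')).unique ⟨hy', rfl⟩ (hy _)
      rw [hyy]
      set i := F.label y'
      have k1 := ((ha i).res (F.above_mono h₁) (hy₁ i)).res_base (hle i) (hy₁ i)
      have k2 := hasCoeff_sum (hC i) (h₁.trans h) (hy₁ i) fun i => T.res (hle i) (a i)
      rw [(hy i).2] at k2
      exact k1.exists_res_eq k2)
    refine ⟨V₂, h₂.trans h₁, fun i => T.res h₂ (T.res (hle i) (a i)), ht₂, ?_⟩
    refine e₂.trans ?_
    rw [map_sum]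
    exact Finset.sum_congr rfl fun i _ => resZ_mulZ _ _ _

theorem IsSCFrame.hasParity {V : Opens T.space} {e : Fin (2 * r) → F.Z V} (he : F.IsSCFrame e)
    (i : Fin (2 * r)) : (e i).1.HasParity 1 := by
  refine RelForm.hasParity_of_local fun y hy => ?_
  obtain ⟨C, -, hC⟩ := he y hy
  obtain ⟨W, h, hs, hV, hyW, H⟩ := hC i
  refine ⟨W, h, hyW, ?_⟩
  rw [H]
  split_ifs
  · rw [mulR_one]
    exact (RelForm.d_hasParity C.x_mem).res hs
  · rw [map_zero]; exact RelForm.HasParity.zero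

theorem isVectorBundle (hT : T.IsComplex) (F : SRSFamily T r) : F.IsVectorBundle := by
  refine ⟨isSheaf_Z F, fun t => ?_⟩
  obtain ⟨V, e, ht, he⟩ := exists_isSCFrame (F := F) hT t
  exact ⟨V, e, ht, he.hasParity, he.isBasis hT⟩

end SRSFamily

/-! ### Locally constant integral functions -/

namespace SuperSpace

variable {T : SuperSpace} {V V' : Opens T.space}

theorem IsComplex.intCast_injective (hT : T.IsComplex) {t : T.space} (ht : t ∈ V) {m n : ℤ}
    (h : (m : T.Γ V) = n) : m = n := by
  have := hT.nontrivial V ⟨t, ht⟩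
  have h1 : algebraMap ℂ (T.Γ V) m = algebraMap ℂ (T.Γ V) n := by simpa using h
  exact_mod_cast (algebraMap ℂ (T.Γ V)).injective h1

theorem exists_eq_apply {α : Type} (n : LocallyConstant V α) {t : T.space} (ht : t ∈ V) :
    ∃ (V' : Opens T.space) (h : V' ≤ V), t ∈ V' ∧
      ∀ (t' : T.space) (ht' : t' ∈ V'), n ⟨t', h ht'⟩ = n ⟨t, ht⟩ := by
  refine ⟨⟨Subtype.val '' (n ⁻¹' {n ⟨t, ht⟩}), V.isOpen.isOpenEmbedding_subtypeVal.isOpenMap _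
    (n.isLocallyConstant.isOpen_fiber _)⟩, ?_, ⟨⟨t, ht⟩, rfl, rfl⟩, ?_⟩
  · rintro _ ⟨x, -, rfl⟩; exact x.2
  · rintro _ ⟨x, hx, rfl⟩; exact hx

theorem exists_ofLC (n : LocallyConstant V ℤ) : ∃ s : T.Γ V, ∀ (V' : Opens T.space) (h : V' ≤ V)
    (k : ℤ), (∀ (t : T.space) (ht : t ∈ V'), n ⟨t, h ht⟩ = k) → T.res h s = k := by
  refine Exists.imp (fun s hs V' h k hk => hs V' h k ⟨k, hk, rfl⟩) (T.exists_section_of_local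
    (fun V' h a => ∃ k : ℤ, (∀ (t : T.space) (ht : t ∈ V'), n ⟨t, h ht⟩ = k) ∧ a = k) ?_ ?_ ?_)
  · rintro V₁ V₂ h₁ h₂ a ⟨k, hk, rfl⟩
    exact ⟨k, fun t ht => hk t (h₂ ht), map_intCast _ _⟩
  · rintro V₁ h₁ a b ⟨k, hk, rfl⟩ ⟨l, hl, rfl⟩
    -- On the empty set the function is equal to every integer; working at points avoids this case.
    refine T.eq_of_local fun t ht => ?_
    rw [(hk t ht).symm.trans (hl t ht)]
    exact ⟨V₁, le_rfl, ht, rfl⟩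
  · intro t ht
    obtain ⟨V₁, h₁, ht₁, hn⟩ := exists_eq_apply n ht
    exact ⟨V₁, h₁, _, ht₁, _, hn, rfl⟩

theorem eq_of_forall_const {s s' : T.Γ V} (n : LocallyConstant V ℤ)
    (hs : ∀ (V' : Opens T.space) (h : V' ≤ V) (k : ℤ),
      (∀ (t : T.space) (ht : t ∈ V'), n ⟨t, h ht⟩ = k) → T.res h s = k)
    (hs' : ∀ (V' : Opens T.space) (h : V' ≤ V) (k : ℤ),
      (∀ (t : T.space) (ht : t ∈ V'), n ⟨t, h ht⟩ = k) → T.res h s' = k) : s = s' := by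
  refine T.eq_of_local fun t ht => ?_
  obtain ⟨V₁, h₁, ht₁, hn⟩ := exists_eq_apply n ht
  exact ⟨V₁, h₁, ht₁, (hs V₁ h₁ _ hn).trans (hs' V₁ h₁ _ hn).symm⟩

/-- The inclusion of the constant sheaf `ℤ` in the structure sheaf. -/
def ofLC : LocallyConstant V ℤ →+* T.Γ V where
  toFun n := (exists_ofLC n).choose
  map_one' := eq_of_forall_const 1 (exists_ofLC 1).choose_spec fun V' h k hk => by
    refine T.eq_of_local fun t ht => ⟨V', le_rfl, ht, ?_⟩
    rw [← hk t ht, map_one, LocallyConstant.one_apply, Int.cast_one]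
  map_zero' := eq_of_forall_const 0 (exists_ofLC 0).choose_spec fun V' h k hk => by
    refine T.eq_of_local fun t ht => ⟨V', le_rfl, ht, ?_⟩
    rw [← hk t ht, map_zero, LocallyConstant.zero_apply, Int.cast_zero]
  map_add' m n := by
    refine T.eq_of_local fun t ht => ?_
    obtain ⟨V₁, h₁, ht₁, hm⟩ := exists_eq_apply m ht
    obtain ⟨V₂, h₂, ht₂, hn⟩ := exists_eq_apply n ht
    refine ⟨V₁ ⊓ V₂, inf_le_left.trans h₁, ⟨ht₁, ht₂⟩, ?_⟩
    rw [map_add, (exists_ofLC (m + n)).choose_spec _ _ (m ⟨t, ht⟩ + n ⟨t, ht⟩),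
      (exists_ofLC m).choose_spec _ _ (m ⟨t, ht⟩), (exists_ofLC n).choose_spec _ _ (n ⟨t, ht⟩),
      Int.cast_add]
    · exact fun t' ht' => hn t' ht'.2
    · exact fun t' ht' => hm t' ht'.1
    · exact fun t' ht' => congrArg₂ (· + ·) (hm t' ht'.1) (hn t' ht'.2)
  map_mul' m n := by
    refine T.eq_of_local fun t ht => ?_
    obtain ⟨V₁, h₁, ht₁, hm⟩ := exists_eq_apply m ht
    obtain ⟨V₂, h₂, ht₂, hn⟩ := exists_eq_apply n ht
    refine ⟨V₁ ⊓ V₂, inf_le_left.trans h₁, ⟨ht₁, ht₂⟩, ?_⟩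
    rw [map_mul, (exists_ofLC (m * n)).choose_spec _ _ (m ⟨t, ht⟩ * n ⟨t, ht⟩),
      (exists_ofLC m).choose_spec _ _ (m ⟨t, ht⟩), (exists_ofLC n).choose_spec _ _ (n ⟨t, ht⟩),
      Int.cast_mul]
    · exact fun t' ht' => hn t' ht'.2
    · exact fun t' ht' => hm t' ht'.1
    · exact fun t' ht' => congrArg₂ (· * ·) (hm t' ht'.1) (hn t' ht'.2)

theorem res_ofLC_of_const (n : LocallyConstant V ℤ) (h : V' ≤ V) (k : ℤ)
    (hk : ∀ (t : T.space) (ht : t ∈ V'), n ⟨t, h ht⟩ = k) : T.res h (ofLC n) = k :=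
  (exists_ofLC n).choose_spec V' h k hk

theorem exists_res_ofLC (n : LocallyConstant V ℤ) {t : T.space} (ht : t ∈ V) :
    ∃ (V' : Opens T.space) (h : V' ≤ V), t ∈ V' ∧ T.res h (ofLC n) = (n ⟨t, ht⟩ : ℤ) := by
  obtain ⟨V₁, h₁, ht₁, hn⟩ := exists_eq_apply n ht
  exact ⟨V₁, h₁, ht₁, res_ofLC_of_const n h₁ _ hn⟩

theorem ofLC_const (k : ℤ) : (ofLC (LocallyConstant.const V k) : T.Γ V) = k := by
  have := res_ofLC_of_const (T := T) (LocallyConstant.const V k) le_rfl k fun _ _ => rfl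
  rwa [T.res_self] at this

/-- The restriction of locally constant functions. -/
abbrev _root_.LocallyConstant.resOpens {α : Type} (h : V' ≤ V) (n : LocallyConstant V α) :
    LocallyConstant V' α := n.comap ⟨Set.inclusion h, continuous_inclusion h⟩

theorem res_ofLC (n : LocallyConstant V ℤ) (h : V' ≤ V) :
    T.res h (ofLC n) = ofLC (n.resOpens h) := by
  refine eq_of_forall_const (n.resOpens h) (fun V₁ h₁ k hk => ?_) fun V₁ h₁ k hk =>
    res_ofLC_of_const _ h₁ k hk
  rw [T.res_res]
  exact res_ofLC_of_const n (h₁.trans h) k hk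

theorem IsComplex.apply_eq (hT : T.IsComplex) {n : LocallyConstant V ℤ} {h : V' ≤ V} {k : ℤ}
    (hk : T.res h (ofLC n) = (k : T.Γ V')) {t : T.space} (ht : t ∈ V') : n ⟨t, h ht⟩ = k := by
  obtain ⟨V₁, h₁, ht₁, hn⟩ := exists_res_ofLC n (h ht)
  refine hT.intCast_injective (V := V₁ ⊓ V') (t := t) ⟨ht₁, ht⟩ ?_
  have e₁ := congrArg (T.res (inf_le_left : V₁ ⊓ V' ≤ V₁)) hn
  have e₂ := congrArg (T.res (inf_le_right : V₁ ⊓ V' ≤ V')) hk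
  rw [T.res_res, map_intCast] at e₁ e₂
  exact e₁.symm.trans e₂

theorem IsComplex.ofLC_injective (hT : T.IsComplex) :
    Function.Injective (ofLC : LocallyConstant V ℤ → T.Γ V) := by
  intro m n h
  ext t
  obtain ⟨V₁, h₁, ht₁, hn⟩ := exists_res_ofLC n t.2
  exact hT.apply_eq (h := h₁) (by rw [h, hn]) ht₁

/-- Integers embed in the sections over nonempty open sets, so the local integral values agree on
overlaps and form a locally constant function. -/
theorem IsComplex.exists_ofLC_eq (hT : T.IsComplex) {s : T.Γ V} (hs : ∀ t ∈ V,
    ∃ (V' : Opens T.space) (h : V' ≤ V) (k : ℤ), t ∈ V' ∧ T.res h s = (k : T.Γ V')) :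
    ∃ n : LocallyConstant V ℤ, ofLC n = s := by
  choose! V' h k ht hk using hs
  have hloc : ∀ t ∈ V, ∀ t' ∈ V' t ⊓ V, k t' = k t := by
    intro t htV t' ht'
    refine hT.intCast_injective (V := V' t ⊓ V' t') (t := t') ⟨ht'.1, ht t' ht'.2⟩ ?_
    have e₁ := congrArg (T.res (inf_le_left : V' t ⊓ V' t' ≤ V' t)) (hk t htV)
    have e₂ := congrArg (T.res (inf_le_right : V' t ⊓ V' t' ≤ V' t')) (hk t' ht'.2)
    rw [T.res_res, map_intCast] at e₁ e₂
    exact e₂.symm.trans e₁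
  have hlc : IsLocallyConstant fun t : V => k t.1 := by
    rw [IsLocallyConstant.iff_exists_open]
    intro t
    exact ⟨Subtype.val ⁻¹' (V' t.1 : Set T.space), (V' t.1).isOpen.preimage continuous_subtype_val,
      ht t.1 t.2, fun t' ht' => hloc t.1 t.2 t'.1 ⟨ht', t'.2⟩⟩
  refine ⟨⟨_, hlc⟩, T.eq_of_local fun t htV => ⟨V' t, h t htV, ht t htV, ?_⟩⟩
  rw [hk t htV]
  exact res_ofLC_of_const _ _ _ fun t' ht' => hloc t htV t' ⟨ht', h t htV ht'⟩

end SuperSpace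

namespace SRSFamily

open SuperSpace

variable {T : SuperSpace} {r : ℕ} {F : SRSFamily T r} {V₀ V V' : Opens T.space}
  {e : Fin (2 * r) → F.Z V₀}

/-! ### Coefficients -/

/-- The combination of the forms `e i` with coefficients `c i`. -/
def comb (e : Fin (2 * r) → F.Z V₀) (h : V ≤ V₀) (c : Fin (2 * r) → T.Γ V) : F.Z V :=
  ∑ i, F.mulZ (F.resZ h (e i)) (c i)

theorem resZ_comb (h : V ≤ V₀) (h' : V' ≤ V) (c : Fin (2 * r) → T.Γ V) :
    F.resZ h' (comb e h c) = comb e (h'.trans h) fun i => T.res h' (c i) := by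
  rw [comb, map_sum]
  exact Finset.sum_congr rfl fun i _ => resZ_mulZ _ _ _

theorem comb_add (h : V ≤ V₀) (c c' : Fin (2 * r) → T.Γ V) :
    comb e h (c + c') = comb e h c + comb e h c' := by
  rw [comb, comb, comb, ← Finset.sum_add_distrib]
  exact Finset.sum_congr rfl fun i _ => map_add _ _ _

theorem mulZ_comb (h : V ≤ V₀) (c : Fin (2 * r) → T.Γ V) (a : T.Γ V) :
    F.mulZ (comb e h c) a = comb e h fun i => c i * a := by
  rw [comb, map_sum, AddMonoidHom.finsetSum_apply]
  exact Finset.sum_congr rfl fun i _ => mulZ_mul _ _ _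

theorem comb_single (h : V ≤ V₀) (i : Fin (2 * r)) (a : T.Γ V) :
    comb e h (Pi.single i a) = F.mulZ (F.resZ h (e i)) a := by
  rw [comb, Finset.sum_eq_single i, Pi.single_eq_same]
  · intro k _ hk
    rw [Pi.single_eq_of_ne hk, map_zero]
  · exact fun hi => (hi (Finset.mem_univ i)).elim

namespace IsBasis

variable (hb : F.IsBasis e)

/-- The coefficients of a closed form with respect to a basis. -/
def coef (h : V ≤ V₀) (ω : F.Z V) : Fin (2 * r) → T.Γ V := (hb V h ω).choose

theorem comb_coef (h : V ≤ V₀) (ω : F.Z V) : comb e h (hb.coef h ω) = ω :=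
  (hb V h ω).choose_spec.1.symm

theorem coef_comb (h : V ≤ V₀) (c : Fin (2 * r) → T.Γ V) : hb.coef h (comb e h c) = c :=
  (hb V h (comb e h c)).unique (hb.comb_coef h _).symm rfl

theorem coef_add (h : V ≤ V₀) (ω ω' : F.Z V) :
    hb.coef h (ω + ω') = hb.coef h ω + hb.coef h ω' := by
  conv_lhs => rw [← hb.comb_coef h ω, ← hb.comb_coef h ω', ← comb_add, hb.coef_comb]

theorem coef_mulZ (h : V ≤ V₀) (ω : F.Z V) (a : T.Γ V) :
    hb.coef h (F.mulZ ω a) = fun i => hb.coef h ω i * a := by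
  conv_lhs => rw [← hb.comb_coef h ω, mulZ_comb, hb.coef_comb]

theorem coef_resZ (h : V ≤ V₀) (h' : V' ≤ V) (ω : F.Z V) :
    hb.coef (h'.trans h) (F.resZ h' ω) = fun i => T.res h' (hb.coef h ω i) := by
  conv_lhs => rw [← hb.comb_coef h ω, resZ_comb, hb.coef_comb]

end IsBasis

/-- The coefficients in a superconformal frame are the coefficients of the germs. -/
theorem IsBasis.hasCoeff (hb : F.IsBasis e) {C : F.SCChart} {y : F.R.space}
    (hC : ∀ k, HasCoeff C (e k).1 y (if k = F.label y then 1 else 0 : T.Γ V₀)) (h : V ≤ V₀)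
    (hy : y ∈ F.above V) (ω : F.Z V) : HasCoeff C ω.1 y (hb.coef h ω (F.label y)) := by
  have := IsSCFrame.hasCoeff_sum hC h hy (hb.coef h ω)
  rwa [← comb, hb.comb_coef] at this

/-! ### The lattice -/

/-- Near y the form γ is the differential of another superconformal coordinate, hence equal to ±
that of the given one. -/
theorem IsSCDiff.exists_hasCoeff {W : Opens F.R.space} {γ : RelForm F.q W}
    (hγ : F.IsSCDiff W γ) {y : F.R.space} (hy : y ∈ W) {C : F.SCChart} (hC : y ∈ C.dom)
    (hV : y ∈ F.above V) : ∃ ε : ℤ, ε * ε = 1 ∧ HasCoeff C γ y (ε : T.Γ V) := by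
  obtain ⟨W', h, C', hs, hy', he⟩ := exists_isSCDiff_eq hγ hy
  obtain ⟨ε, hε1, hε⟩ := C.exists_sign C' hC (hs hy')
  have h1 : HasCoeff C' γ y (1 : T.Γ V) := by
    refine ⟨W' ⊓ F.above V, inf_le_left.trans h, inf_le_left.trans hs, inf_le_right,
      ⟨hy', hV⟩, ?_⟩
    rw [mulR_one]
    exact congrArg (RelForm.res inf_le_left) he
  have h2 := hε h1
  rw [mul_one] at h2
  exact ⟨ε, hε1, h2⟩

theorem exists_hasCoeff_intCast {W : Opens F.R.space} {α : RelForm F.q W}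
    (hα : α ∈ AddSubgroup.closure {γ | F.IsSCDiff W γ}) {y : F.R.space} (hy : y ∈ W)
    {C : F.SCChart} (hC : y ∈ C.dom) (hV : y ∈ F.above V) :
    ∃ k : ℤ, HasCoeff C α y (k : T.Γ V) := by
  induction hα using AddSubgroup.closure_induction with
  | mem γ hγ =>
    obtain ⟨ε, -, hε⟩ := IsSCDiff.exists_hasCoeff hγ hy hC hV
    exact ⟨ε, hε⟩
  | zero => exact ⟨0, by rw [Int.cast_zero]; exact HasCoeff.zero hC hy hV⟩
  | add a b _ _ ha hb =>
    obtain ⟨k, hk⟩ := ha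
    obtain ⟨l, hl⟩ := hb
    exact ⟨k + l, by rw [Int.cast_add]; exact hk.add hl⟩
  | neg a _ ha =>
    obtain ⟨k, hk⟩ := ha
    exact ⟨-k, by rw [Int.cast_neg]; exact hk.neg⟩

theorem exists_hasCoeff_of_mem_Lam (l : F.Lam V) {y : F.R.space} (hy : y ∈ F.above V)
    {C : F.SCChart} (hC : y ∈ C.dom) : ∃ k : ℤ, HasCoeff C l.1.1 y (k : T.Γ V) := by
  obtain ⟨W, h, hyW, hW⟩ := l.2 y hy
  obtain ⟨k, hk⟩ := exists_hasCoeff_intCast hW hyW hC hy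
  exact ⟨k, hk.of_res⟩

theorem mem_Lam_of_hasCoeff {ω : F.Z V} (H : ∀ y ∈ F.above V, ∃ (C : F.SCChart)
    (V' : Opens T.space) (k : ℤ), HasCoeff C ω.1 y (k : T.Γ V')) : ω ∈ F.Lam V := by
  intro y hy
  obtain ⟨C, V', k, W, h, hs, hV, hyW, he⟩ := H y hy
  refine ⟨W, h, hyW, ?_⟩
  rw [he, mulR_intCast]
  exact AddSubgroup.zsmul_mem _ (AddSubgroup.subset_closure (C.isSCDiff_form hs)) k

theorem hasParity_of_mem_Lam (hT : T.IsComplex) (l : F.Lam V) : l.1.1.HasParity 1 := by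
  refine RelForm.hasParity_of_local fun y hy => ?_
  obtain ⟨C, hC⟩ := exists_SCChart hT y
  obtain ⟨k, W, h, hs, hV, hyW, he⟩ := exists_hasCoeff_of_mem_Lam l hy (C := C) hC
  refine ⟨W, h, hyW, ?_⟩
  rw [he, mulR_intCast]
  intro U' hU a ξ
  exact zsmul_mem ((RelForm.d_hasParity C.x_mem).res hs U' hU a ξ) k

namespace IsSCFrame

variable (he : F.IsSCFrame e)

include he

theorem exists_coef_eq_of_hasCoeff (hb : F.IsBasis e) (h : V ≤ V₀) {ω : F.Z V} {y : F.R.space}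
    (hy : y ∈ F.above V) : ∃ C : F.SCChart, y ∈ C.dom ∧
      HasCoeff C (F.resZ h (e (F.label y))).1 y (1 : T.Γ V) ∧ ∀ a : T.Γ V, HasCoeff C ω.1 y a →
        ∃ (V' : Opens T.space) (k : V' ≤ V), F.q.base y ∈ V' ∧
          T.res k (hb.coef h ω (F.label y)) = T.res k a := by
  obtain ⟨C, hC, H⟩ := he y (F.above_mono h hy)
  refine ⟨C, hC, ?_, fun a ha => (hb.hasCoeff H h hy ω).unique ha rfl⟩
  have := ((H (F.label y)).res (F.above_mono h) hy).res_base h hy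
  rwa [if_pos rfl, map_one] at this

/-- The i-th coefficient is the coefficient of the germ at the i-th puncture, which is an integer
for sections of the lattice, since superconformal differentials have coefficient ±1. -/
theorem exists_ofLC_eq_coef (hT : T.IsComplex) (hb : F.IsBasis e) (h : V ≤ V₀) (l : F.Lam V)
    (i : Fin (2 * r)) : ∃ n : LocallyConstant V ℤ, ofLC n = hb.coef h l.1 i := by
  refine hT.exists_ofLC_eq fun t ht => ?_
  obtain ⟨y, hy⟩ := F.exists_punctures t
  have hyV : y i ∈ F.above V := by
    change F.q.base (y i) ∈ V
    rw [(hy i).1]; exact ht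
  obtain ⟨C, hC, -, H⟩ := he.exists_coef_eq_of_hasCoeff hb h (ω := l.1) hyV
  obtain ⟨k, hk⟩ := exists_hasCoeff_of_mem_Lam l hyV hC
  obtain ⟨V', h', ht', e'⟩ := H _ hk
  rw [(hy i).1] at ht'
  rw [(hy i).2, map_intCast] at e'
  exact ⟨V', h', k, ht', e'⟩

theorem comb_ofLC_mem (h : V ≤ V₀) (n : Fin (2 * r) → LocallyConstant V ℤ) :
    comb e h (fun i => ofLC (n i)) ∈ F.Lam V := by
  refine mem_Lam_of_hasCoeff fun y hy => ?_
  obtain ⟨C, hC, H⟩ := he y (F.above_mono h hy)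
  obtain ⟨V', h', ht', hk⟩ := exists_res_ofLC (n (F.label y)) (t := F.q.base y) hy
  refine ⟨C, V', n (F.label y) ⟨F.q.base y, hy⟩, ?_⟩
  have := (hasCoeff_sum H h hy fun i => ofLC (n i)).res_base h' ht'
  rw [hk] at this
  exact this

end IsSCFrame

end SRSFamily

namespace SRSFamily

open SuperSpace

variable {T : SuperSpace} {r : ℕ} {F : SRSFamily T r} {V₀ V₁ V V' : Opens T.space}
  {e f : Fin (2 * r) → F.Z V₀}

/-! ### Trivializations -/

/-- The integral combinations of a superconformal frame. -/
def IsSCFrame.hom (he : F.IsSCFrame e) (h : V ≤ V₀) :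
    LocallyConstant V (Fin (2 * r) → ℤ) →+ F.Lam V :=
  AddMonoidHom.mk' (fun n => ⟨comb e h fun i => ofLC (n.flip i), he.comb_ofLC_mem h n.flip⟩)
    fun m n => Subtype.ext <| by
      refine Eq.trans ?_ (comb_add h _ _)
      refine congrArg (comb e h) (funext fun i => ?_)
      exact map_add ofLC (m.flip i) (n.flip i)

/-- Injectivity is uniqueness of coefficients together with the embedding of the constant sheaf ℤ in
𝒪_T; surjectivity is integrality of the coefficients of lattice sections. -/
theorem IsSCFrame.bijective_hom (he : F.IsSCFrame e) (hT : T.IsComplex) (h : V ≤ V₀) :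
    Function.Bijective (he.hom h) := by
  have hb := he.isBasis hT
  constructor
  · intro m n hmn
    have h1 : comb e h (fun i => ofLC (m.flip i)) = comb e h fun i => ofLC (n.flip i) :=
      congrArg Subtype.val hmn
    have h2 := congrArg (hb.coef h) h1
    rw [hb.coef_comb, hb.coef_comb] at h2
    ext t i
    exact DFunLike.congr_fun (hT.ofLC_injective (congrFun h2 i)) t
  · intro l
    choose n hn using he.exists_ofLC_eq_coef hT hb h l
    refine ⟨LocallyConstant.unflip n, Subtype.ext ?_⟩
    refine Eq.trans ?_ (hb.comb_coef h l.1)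
    refine congrArg (comb e h) (funext fun i => ?_)
    rw [LocallyConstant.flip_unflip]
    exact hn i

/-- The trivialization of the lattice given by a superconformal frame. -/
def IsSCFrame.triv (he : F.IsSCFrame e) (hT : T.IsComplex) : F.Trivialization V₀ where
  equiv V h := AddEquiv.ofBijective (he.hom h) (he.bijective_hom hT h)
  equiv_res h h' n := Subtype.ext <| by
    refine (resZ_comb h h' _).trans ?_
    exact congrArg (comb e (h'.trans h)) (funext fun i => res_ofLC (n.flip i) h')

theorem IsSCFrame.coe_triv_equiv (he : F.IsSCFrame e) (hT : T.IsComplex) (h : V ≤ V₀)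
    (n : LocallyConstant V (Fin (2 * r) → ℤ)) :
    ((he.triv hT).equiv V h n).1 = comb e h fun i => ofLC (n.flip i) := rfl

theorem IsSCFrame.triv_frame (he : F.IsSCFrame e) (hT : T.IsComplex) (i : Fin (2 * r)) :
    ((he.triv hT).frame i).1 = e i := by
  refine Eq.trans ?_ ((comb_single (e := e) le_rfl i 1).trans (mulZ_one (e i)))
  refine congrArg (comb e le_rfl) (funext fun k => ?_)
  refine (ofLC_const ((Pi.single i 1 : Fin (2 * r) → ℤ) k)).trans ?_
  rcases eq_or_ne k i with rfl | hk
  · rw [Pi.single_eq_same, Pi.single_eq_same, Int.cast_one]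
  · rw [Pi.single_eq_of_ne hk, Pi.single_eq_of_ne hk, Int.cast_zero]

theorem isLocalSystem (hT : T.IsComplex) (F : SRSFamily T r) : F.IsLocalSystem := by
  refine ⟨isSheaf_Lam F, fun t => ?_, fun V ω => hasParity_of_mem_Lam hT ω⟩
  obtain ⟨V, e, ht, he⟩ := exists_isSCFrame (F := F) hT t
  exact ⟨V, ht, ⟨he.triv hT⟩⟩

namespace Trivialization

theorem equiv_const (s : F.Trivialization V₀) (h : V ≤ V₀) (m : Fin (2 * r) → ℤ) :
    s.equiv V h (LocallyConstant.const V m) = ∑ i, m i • F.resLam h (s.frame i) := by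
  have h1 : LocallyConstant.const V m =
      ∑ i, m i • LocallyConstant.const V (Pi.single i 1 : Fin (2 * r) → ℤ) := by
    have h2 : m = ∑ i, m i • (Pi.single i 1 : Fin (2 * r) → ℤ) := by
      ext k
      simp [Finset.sum_apply, Pi.single_apply]
    have h3 := congrArg (LocallyConstant.constAddMonoidHom (X := V)) h2
    rw [map_sum] at h3
    refine h3.trans (Finset.sum_congr rfl fun i _ => ?_)
    rw [map_zsmul]
    rfl
  rw [h1, map_sum]
  refine Finset.sum_congr rfl fun i _ => ?_
  rw [map_zsmul]
  exact congrArg (m i • ·)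
    (s.equiv_res le_rfl h (LocallyConstant.const V₀ (Pi.single i 1))).symm

theorem exists_res_eq (s : F.Trivialization V₀) (h : V ≤ V₀) (l : F.Lam V) {t : T.space}
    (ht : t ∈ V) : ∃ (V' : Opens T.space) (h' : V' ≤ V) (m : Fin (2 * r) → ℤ), t ∈ V' ∧
      F.resLam h' l = ∑ i, m i • F.resLam (h'.trans h) (s.frame i) := by
  obtain ⟨n, rfl⟩ := (s.equiv V h).surjective l
  obtain ⟨V', h', ht', hn⟩ := exists_eq_apply n ht
  refine ⟨V', h', n ⟨t, ht⟩, ht', ?_⟩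
  rw [← s.equiv_const, s.equiv_res]
  congr 1
  ext t' : 1
  exact hn t'.1 t'.2

theorem eq_of_sum_eq (s : F.Trivialization V₀) (h : V ≤ V₀) {t : T.space} (ht : t ∈ V)
    {m n : Fin (2 * r) → ℤ} (H : ∑ i, m i • F.resLam h (s.frame i) =
      ∑ i, n i • F.resLam h (s.frame i)) : m = n := by
  rw [← s.equiv_const, ← s.equiv_const] at H
  exact DFunLike.congr_fun ((s.equiv V h).injective H) ⟨t, ht⟩

theorem exists_matrix (s : F.Trivialization V₀) (s' : F.Trivialization V₁) {t : T.space}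
    (ht : t ∈ V₀) (ht' : t ∈ V₁) : ∃ (V : Opens T.space) (h : V ≤ V₀) (h' : V ≤ V₁)
      (M : Matrix (Fin (2 * r)) (Fin (2 * r)) ℤ), t ∈ V ∧ ∀ i,
        F.resLam h (s.frame i) = ∑ k, M i k • F.resLam h' (s'.frame k) := by
  have key : ∀ i, ∃ (V' : Opens T.space) (h' : V' ≤ V₀ ⊓ V₁) (m : Fin (2 * r) → ℤ), t ∈ V' ∧
      F.resLam h' (F.resLam inf_le_left (s.frame i)) =
        ∑ k, m k • F.resLam (h'.trans inf_le_right) (s'.frame k) := fun i =>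
    s'.exists_res_eq inf_le_right (F.resLam inf_le_left (s.frame i)) ⟨ht, ht'⟩
  choose V' h' M hV' hM using key
  refine ⟨(Finset.univ.inf V') ⊓ (V₀ ⊓ V₁), inf_le_right.trans inf_le_left,
    inf_le_right.trans inf_le_right, M, ⟨?_, ht, ht'⟩, fun i => ?_⟩
  · rw [Opens.coe_finset_inf]
    simpa using hV'
  · have hi : (Finset.univ.inf V') ⊓ (V₀ ⊓ V₁) ≤ V' i :=
      inf_le_left.trans (Finset.inf_le (Finset.mem_univ i))
    have := congrArg (F.resLam hi) (hM i)
    rw [map_sum] at this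
    refine this.trans (Finset.sum_congr rfl fun k _ => ?_)
    rw [map_zsmul]
    rfl

end Trivialization

theorem comb_zsmul (M : Matrix (Fin (2 * r)) (Fin (2 * r)) ℤ)
    (hM : ∀ i, f i = ∑ k, M i k • e k) (h : V ≤ V₀) (c : Fin (2 * r) → T.Γ V) :
    comb f h c = comb e h fun k => ∑ i, M i k • c i := by
  have h1 : ∀ i, F.mulZ (F.resZ h (f i)) (c i) =
      ∑ k, F.mulZ (F.resZ h (e k)) (M i k • c i) := by
    intro i
    rw [hM i, map_sum, map_sum, AddMonoidHom.finsetSum_apply]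
    refine Finset.sum_congr rfl fun k _ => ?_
    rw [map_zsmul, map_zsmul, map_zsmul]
    rfl
  rw [comb, comb, Finset.sum_congr rfl fun i _ => h1 i, Finset.sum_comm]
  exact Finset.sum_congr rfl fun k _ => (map_sum _ _ _).symm

/-- Expressing e through f already gives existence of coefficients; uniqueness needs only the one
identity M N = 1, since coefficients transform by the transposed matrices. -/
theorem IsBasis.of_matrix (hb : F.IsBasis e) {M N : Matrix (Fin (2 * r)) (Fin (2 * r)) ℤ}
    (hM : ∀ i, f i = ∑ k, M i k • e k) (hN : ∀ i, e i = ∑ k, N i k • f k) (hMN : M * N = 1) :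
    F.IsBasis f := by
  intro V h ω
  refine ⟨fun k => ∑ i, N i k • hb.coef h ω i, ?_, fun c hc => ?_⟩
  · exact ((comb_zsmul N hN h _).symm.trans (hb.comb_coef h ω)).symm
  · have hc' : ω = comb f h c := hc
    rw [comb_zsmul M hM] at hc'
    ext i
    rw [hc', hb.coef_comb]
    have h1 : ∀ k, N k i • ∑ j, M j k • c j = ∑ j, (M j k * N k i) • c j := by
      intro k
      rw [Finset.smul_sum]
      refine Finset.sum_congr rfl fun j _ => ?_
      rw [smul_smul, mul_comm]
    rw [Finset.sum_congr rfl fun k _ => h1 k, Finset.sum_comm]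
    have h2 : ∀ j, ∑ k, (M j k * N k i) • c j = (1 : Matrix (Fin (2 * r)) (Fin (2 * r)) ℤ) j i • c j
        := by
      intro j
      rw [← hMN, Matrix.mul_apply, Finset.sum_smul]
    rw [Finset.sum_congr rfl fun j _ => h2 j, Finset.sum_eq_single i]
    · rw [Matrix.one_apply_eq, one_smul]
    · intro j _ hj
      rw [Matrix.one_apply_ne hj, zero_smul]
    · exact fun hi => (hi (Finset.mem_univ i)).elim

theorem isBasis_of_forall_res (H : ∀ t ∈ V₀, ∃ (V : Opens T.space) (h : V ≤ V₀), t ∈ V ∧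
    F.IsBasis fun i => F.resZ h (e i)) : F.IsBasis e := by
  refine isBasis_of_local ?_ ?_
  · intro V h c c' hc t ht
    obtain ⟨V₁, h₁, ht₁, hb⟩ := H t (h ht)
    refine ⟨V ⊓ V₁, inf_le_left, ⟨ht, ht₁⟩, fun i => ?_⟩
    have h2 := congrArg (F.resZ (inf_le_left : V ⊓ V₁ ≤ V)) hc
    rw [← comb, ← comb, resZ_comb, resZ_comb] at h2
    exact (congrFun ((hb (V ⊓ V₁) inf_le_right _).unique h2 rfl) i).symm
  · intro V h ω t ht
    obtain ⟨V₁, h₁, ht₁, hb⟩ := H t (h ht)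
    obtain ⟨c, hc, -⟩ := hb (V ⊓ V₁) inf_le_right (F.resZ inf_le_left ω)
    exact ⟨V ⊓ V₁, inf_le_left, c, ⟨ht, ht₁⟩, hc⟩

theorem IsBasis.resZ (hb : F.IsBasis e) (h : V ≤ V₀) : F.IsBasis fun i => F.resZ h (e i) :=
  fun V' h' ω => hb V' (h'.trans h) ω

/-- The trivialization is arbitrary. Locally its frame and a superconformal frame are integral
combinations of each other, and the two matrices are inverse to each other because lattice
coordinates are unique; so the basis property carries over. -/
theorem Trivialization.isBasis (hT : T.IsComplex) (s : F.Trivialization V₀) :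
    F.IsBasis fun i => (s.frame i).1 := by
  refine isBasis_of_forall_res fun t ht => ?_
  obtain ⟨V₁, e, ht₁, he⟩ := exists_isSCFrame (F := F) hT t
  obtain ⟨V, h, h', M, hV, hM⟩ := s.exists_matrix (he.triv hT) ht ht₁
  obtain ⟨V', k', k, N, hV', hN⟩ := (he.triv hT).exists_matrix s ht₁ ht
  have l : V ⊓ V' ≤ V := inf_le_left
  have l' : V ⊓ V' ≤ V' := inf_le_right
  have hM' : ∀ i, F.resLam (l.trans h) (s.frame i) =
      ∑ k, M i k • F.resLam (l.trans h') ((he.triv hT).frame k) := by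
    intro i
    have := congrArg (F.resLam l) (hM i)
    simp only [map_sum, map_zsmul] at this
    exact this
  have hN' : ∀ i, F.resLam (l.trans h') ((he.triv hT).frame i) =
      ∑ k, N i k • F.resLam (l.trans h) (s.frame k) := by
    intro i
    have := congrArg (F.resLam l') (hN i)
    simp only [map_sum, map_zsmul] at this
    exact this
  have hMN : M * N = 1 := by
    ext i j
    refine congrFun (s.eq_of_sum_eq (l.trans h) (t := t) ⟨hV, hV'⟩
      (m := (M * N) i) (n := (1 : Matrix (Fin (2 * r)) (Fin (2 * r)) ℤ) i) ?_) j
    rw [Finset.sum_eq_single (s := Finset.univ) (f := fun j => (1 : Matrix _ _ ℤ) i j • _) i,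
      Matrix.one_apply_eq, one_smul, hM' i]
    · rw [Finset.sum_congr rfl fun k _ => congrArg (M i k • ·) (hN' k)]
      simp only [Finset.smul_sum, smul_smul]
      rw [Finset.sum_comm]
      refine Finset.sum_congr rfl fun j _ => ?_
      rw [Matrix.mul_apply, Finset.sum_smul]
    · intro j _ hj
      rw [Matrix.one_apply_ne hj.symm, zero_smul]
    · exact fun hi => (hi (Finset.mem_univ i)).elim
  refine ⟨V ⊓ V', l.trans h, ⟨hV, hV'⟩, ?_⟩
  refine IsBasis.of_matrix (e := fun i => F.resZ (l.trans h') (e i)) ((he.isBasis hT).resZ _)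
    (M := M) (N := N) (fun i => ?_) (fun i => ?_) hMN
  · have := congrArg Subtype.val (hM' i)
    rw [AddSubgroup.val_finsetSum] at this
    refine this.trans (Finset.sum_congr rfl fun k _ => ?_)
    rw [← he.triv_frame hT k]
    rfl
  · have := congrArg Subtype.val (hN' i)
    rw [AddSubgroup.val_finsetSum] at this
    rw [← he.triv_frame hT i]
    exact this

theorem tensorMap_sum (s : Fin (2 * r) → F.Lam V₀) (h : V ≤ V₀) (c : Fin (2 * r) → T.Γ V) :
    F.tensorMap V (∑ i, F.resLam h (s i) ⊗ₜ c i) = comb (fun i => (s i).1) h c := by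
  rw [map_sum]
  rfl

/-- Over a connected set locally constant functions are constant, so lattice sections are integral
combinations of the frame and the integers can be moved to the second factor. This is where
connectedness enters. -/
theorem Trivialization.exists_tensor_eq (s : F.Trivialization V₀) (h : V ≤ V₀)
    (hV : IsConnected (V : Set T.space)) (x : F.Lam V ⊗[ℤ] T.Γ V) :
    ∃ c : Fin (2 * r) → T.Γ V, x = ∑ i, F.resLam h (s.frame i) ⊗ₜ c i := by
  induction x using TensorProduct.induction_on with
  | zero => exact ⟨0, by simp⟩
  | tmul l c =>
    obtain ⟨n, rfl⟩ := (s.equiv V h).surjective l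
    have : PreconnectedSpace V := Subtype.preconnectedSpace hV.isPreconnected
    obtain ⟨m, rfl⟩ := n.exists_eq_const
    refine ⟨fun i => m i • c, ?_⟩
    rw [s.equiv_const, TensorProduct.sum_tmul]
    exact Finset.sum_congr rfl fun i _ => TensorProduct.smul_tmul _ _ _
  | add x y hx hy =>
    obtain ⟨c, rfl⟩ := hx
    obtain ⟨c', rfl⟩ := hy
    refine ⟨c + c', ?_⟩
    rw [← Finset.sum_add_distrib]
    exact Finset.sum_congr rfl fun i _ => (TensorProduct.tmul_add _ _ _).symm

theorem isAssociated (hT : T.IsComplex) (F : SRSFamily T r) : F.IsAssociated := by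
  refine fun V₀ s => ⟨fun V h hV => ⟨fun x x' hx => ?_, fun ω => ?_⟩, s.isBasis hT⟩
  · obtain ⟨c, rfl⟩ := s.exists_tensor_eq h hV x
    obtain ⟨c', rfl⟩ := s.exists_tensor_eq h hV x'
    rw [tensorMap_sum, tensorMap_sum] at hx
    have hc := congrArg ((s.isBasis hT).coef h) hx
    rw [(s.isBasis hT).coef_comb, (s.isBasis hT).coef_comb] at hc
    rw [hc]
  · exact ⟨_, (tensorMap_sum s.frame h _).trans ((s.isBasis hT).comb_coef h ω)⟩

end SRSFamily

namespace SRSFamily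

open SuperSpace

variable {T : SuperSpace} {r : ℕ} {F : SRSFamily T r} {V₀ V₁ V V' : Opens T.space}
  {e : Fin (2 * r) → F.Z V₀} {e' : Fin (2 * r) → F.Z V₁}

/-! ### The pairing of closed forms -/

/-- The standard form in the coefficients with respect to a basis. -/
def IsBasis.pairing (hb : F.IsBasis e) (h : V ≤ V₀) (ω ω' : F.Z V) : T.Γ V :=
  ∑ i, hb.coef h ω i * hb.coef h ω' i

theorem IsBasis.pairing_resZ (hb : F.IsBasis e) (h : V ≤ V₀) (h' : V' ≤ V) (ω ω' : F.Z V) :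
    hb.pairing (h'.trans h) (F.resZ h' ω) (F.resZ h' ω') = T.res h' (hb.pairing h ω ω') := by
  simp only [pairing, hb.coef_resZ h h', map_sum, map_mul]

/-- Two superconformal frames differ by signs. -/
theorem IsSCFrame.exists_sign_coef (he : F.IsSCFrame e) (hb : F.IsBasis e) (he' : F.IsSCFrame e')
    (hb' : F.IsBasis e') (h : V ≤ V₀) (h' : V ≤ V₁) {t : T.space} (ht : t ∈ V)
    (i : Fin (2 * r)) : ∃ ε : ℤ, ε * ε = 1 ∧ ∀ ω : F.Z V, ∃ (V' : Opens T.space) (k : V' ≤ V),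
      t ∈ V' ∧ T.res k (hb.coef h ω i) = (ε : T.Γ V') * T.res k (hb'.coef h' ω i) := by
  obtain ⟨y, hy⟩ := F.exists_punctures t
  obtain ⟨hyt, hyi⟩ := hy i
  have hyV : y i ∈ F.above V := by
    change F.q.base (y i) ∈ V
    rwa [hyt]
  obtain ⟨C, hC, H⟩ := he (y i) (F.above_mono h hyV)
  obtain ⟨C', hC', H'⟩ := he' (y i) (F.above_mono h' hyV)
  obtain ⟨ε, hε, hs⟩ := C.exists_sign C' hC hC'
  refine ⟨ε, hε, fun ω => ?_⟩
  obtain ⟨V', k, hk, E⟩ :=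
    (hb.hasCoeff H h hyV ω).unique (hs (hb'.hasCoeff H' h' hyV ω)) rfl
  rw [hyt] at hk
  rw [hyi, map_mul, map_intCast] at E
  exact ⟨V', k, hk, E⟩

/-- Near a point the i-th coefficients of both forms change by the same sign ε, and ε² = 1. -/
theorem IsSCFrame.pairing_eq (he : F.IsSCFrame e) (hb : F.IsBasis e) (he' : F.IsSCFrame e')
    (hb' : F.IsBasis e') (h : V ≤ V₀) (h' : V ≤ V₁) (ω ω' : F.Z V) :
    hb.pairing h ω ω' = hb'.pairing h' ω ω' := by
  refine Finset.sum_congr rfl fun i _ => T.eq_of_local fun t ht => ?_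
  obtain ⟨ε, hε, H⟩ := he.exists_sign_coef hb he' hb' h h' ht i
  obtain ⟨W, k, hW, E⟩ := H ω
  obtain ⟨W', k', hW', E'⟩ := H ω'
  refine ⟨W ⊓ W', inf_le_left.trans k, ⟨hW, hW'⟩, ?_⟩
  have E₁ := congrArg (T.res (inf_le_left : W ⊓ W' ≤ W)) E
  have E₂ := congrArg (T.res (inf_le_right : W ⊓ W' ≤ W')) E'
  rw [map_mul, map_intCast, T.res_res, T.res_res] at E₁ E₂
  rw [map_mul, map_mul, E₁, E₂, Int.cast_comm, mul_assoc, ← mul_assoc (ε : T.Γ (W ⊓ W')),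
    ← Int.cast_mul, hε, Int.cast_one, one_mul]

/-- The coefficient is the pairing of ω with the odd field ∂_x, which shifts the parity by one. It
is a function on the base, and its parity there is detected on R. -/
theorem IsSCFrame.coef_mem (he : F.IsSCFrame e) (hb : F.IsBasis e) (h : V ≤ V₀) {ω : F.Z V}
    {p : ZMod 2} (hp : ω.1.HasParity p) (i : Fin (2 * r)) :
    hb.coef h ω i ∈ T.part V (p + 1) := by
  rw [T.mem_part_iff]
  refine T.eq_of_local fun t ht => ?_
  obtain ⟨y, hy⟩ := F.exists_punctures t
  obtain ⟨hyt, hyi⟩ := hy i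
  have hyV : y i ∈ F.above V := by
    change F.q.base (y i) ∈ V
    rwa [hyt]
  obtain ⟨C, hC, H⟩ := he (y i) (F.above_mono h hyV)
  obtain ⟨W, k, hs, hV, hyW, E⟩ := hb.hasCoeff H h hyV ω
  have h1 := hp W k 1 ((dx C.divisor).res hs)
  have h2 : ω.1.1 ⟨W, k⟩ 1 ((dx C.divisor).res hs) = F.pullR hV (hb.coef h ω i) := by
    rw [← form_apply_dx C hs hV, ← hyi, ← E]
    rfl
  rw [h2, F.R.mem_part_iff, bar_pullR, ← map_smul, add_comm] at h1
  obtain ⟨V', l, hV', E'⟩ := exists_res_eq_of_pullR C hyW hs hV h1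
  rw [hyt] at hV'
  exact ⟨V', l, hV', E'⟩

/-- The expressions ∑ aᵢ bᵢ in all superconformal frames agree on overlaps and glue, so no global
frame is needed. -/
theorem exists_formPairing (hT : T.IsComplex) (ω ω' : F.Z V) : ∃ s : T.Γ V,
    ∀ (V' : Opens T.space) (h : V' ≤ V) (b : T.Γ V'),
      (∃ (V₀ : Opens T.space) (e : Fin (2 * r) → F.Z V₀) (hb : F.IsBasis e) (k : V' ≤ V₀),
        F.IsSCFrame e ∧ b = hb.pairing k (F.resZ h ω) (F.resZ h ω')) → T.res h s = b := by
  refine T.exists_section_of_local (fun V' h b => ∃ (V₀ : Opens T.space)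
    (e : Fin (2 * r) → F.Z V₀) (hb : F.IsBasis e) (k : V' ≤ V₀),
      F.IsSCFrame e ∧ b = hb.pairing k (F.resZ h ω) (F.resZ h ω')) ?_ ?_ ?_
  · rintro V₁ V₂ h₁ h₂ a ⟨V₀, e, hb, k, he, rfl⟩
    exact ⟨V₀, e, hb, h₂.trans k, he, (hb.pairing_resZ k h₂ _ _).symm⟩
  · rintro V₁ h₁ a b ⟨V₀, e, hb, k, he, rfl⟩ ⟨V₀', e', hb', k', he', rfl⟩
    exact he.pairing_eq hb he' hb' k k' _ _
  · intro t ht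
    obtain ⟨V₀, e, ht₀, he⟩ := exists_isSCFrame (F := F) hT t
    exact ⟨V ⊓ V₀, inf_le_left, _, ⟨ht, ht₀⟩, V₀, e, he.isBasis hT, inf_le_right, he, rfl⟩

/-- The value of the pairing of closed forms. -/
def pairZ (hT : T.IsComplex) (ω ω' : F.Z V) : T.Γ V := (exists_formPairing hT ω ω').choose

theorem IsSCFrame.res_pairZ (he : F.IsSCFrame e) (hT : T.IsComplex) (h : V' ≤ V) (k : V' ≤ V₀)
    (ω ω' : F.Z V) : T.res h (pairZ hT ω ω') =
      (he.isBasis hT).pairing k (F.resZ h ω) (F.resZ h ω') :=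
  (exists_formPairing hT ω ω').choose_spec V' h _ ⟨V₀, e, he.isBasis hT, k, he, rfl⟩

theorem IsSCFrame.pairZ_eq (he : F.IsSCFrame e) (hT : T.IsComplex) (h : V ≤ V₀) (ω ω' : F.Z V) :
    pairZ hT ω ω' = (he.isBasis hT).pairing h ω ω' := by
  have := he.res_pairZ hT le_rfl h ω ω'
  rwa [T.res_self] at this

theorem pairZ_resZ (hT : T.IsComplex) (h : V' ≤ V) (ω ω' : F.Z V) :
    pairZ hT (F.resZ h ω) (F.resZ h ω') = T.res h (pairZ hT ω ω') := by
  refine T.eq_of_local fun t ht => ?_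
  obtain ⟨V₀, e, ht₀, he⟩ := exists_isSCFrame (F := F) hT t
  refine ⟨V' ⊓ V₀, inf_le_left, ⟨ht, ht₀⟩, ?_⟩
  rw [he.res_pairZ hT inf_le_left inf_le_right, T.res_res,
    he.res_pairZ hT (inf_le_left.trans h) inf_le_right]
  rfl

/-- The pairing of closed forms can be computed in superconformal frames. -/
theorem eq_of_forall_isSCFrame (hT : T.IsComplex) (F : SRSFamily T r) {a b : T.Γ V}
    (H : ∀ (V' : Opens T.space) (h : V' ≤ V) (e : Fin (2 * r) → F.Z V'), F.IsSCFrame e →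
      T.res h a = T.res h b) : a = b := by
  refine T.eq_of_local fun t ht => ?_
  obtain ⟨V₀, e, ht₀, he⟩ := exists_isSCFrame (F := F) hT t
  exact ⟨V ⊓ V₀, inf_le_left, ⟨ht, ht₀⟩, H _ _ _ (he.res inf_le_right)⟩

theorem pairZ_add_left (hT : T.IsComplex) (ω₁ ω₂ ω' : F.Z V) :
    pairZ hT (ω₁ + ω₂) ω' = pairZ hT ω₁ ω' + pairZ hT ω₂ ω' := by
  refine eq_of_forall_isSCFrame hT F fun V' h e he => ?_
  rw [map_add, he.res_pairZ hT h le_rfl, he.res_pairZ hT h le_rfl, he.res_pairZ hT h le_rfl,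
    map_add]
  simp only [IsBasis.pairing, IsBasis.coef_add, Pi.add_apply, add_mul, Finset.sum_add_distrib]

theorem pairZ_add_right (hT : T.IsComplex) (ω ω₁ ω₂ : F.Z V) :
    pairZ hT ω (ω₁ + ω₂) = pairZ hT ω ω₁ + pairZ hT ω ω₂ := by
  refine eq_of_forall_isSCFrame hT F fun V' h e he => ?_
  rw [map_add, he.res_pairZ hT h le_rfl, he.res_pairZ hT h le_rfl, he.res_pairZ hT h le_rfl,
    map_add]
  simp only [IsBasis.pairing, IsBasis.coef_add, Pi.add_apply, mul_add, Finset.sum_add_distrib]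

theorem pairZ_mulZ_right (hT : T.IsComplex) (ω ω' : F.Z V) (c : T.Γ V) :
    pairZ hT ω (F.mulZ ω' c) = pairZ hT ω ω' * c := by
  refine eq_of_forall_isSCFrame hT F fun V' h e he => ?_
  rw [map_mul, he.res_pairZ hT h le_rfl, he.res_pairZ hT h le_rfl, resZ_mulZ]
  simp only [IsBasis.pairing, IsBasis.coef_mulZ, Finset.sum_mul, mul_assoc]

theorem HasParity.resZ {ω : F.Z V} {p : ZMod 2} (hp : ω.1.HasParity p) (h : V' ≤ V) :
    (F.resZ h ω).1.HasParity p :=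
  RelForm.HasParity.res hp (F.above_mono h)

theorem pairZ_mulZ_left (hT : T.IsComplex) (ω ω' : F.Z V) {p k : ZMod 2} {c : T.Γ V}
    (hp : ω'.1.HasParity p) (hc : c ∈ T.part V k) :
    pairZ hT (F.mulZ ω c) ω' = sgn k (p + 1) • (pairZ hT ω ω' * c) := by
  refine eq_of_forall_isSCFrame hT F fun V' h e he => ?_
  rw [map_smul, map_mul, he.res_pairZ hT h le_rfl, he.res_pairZ hT h le_rfl, resZ_mulZ]
  simp only [IsBasis.pairing, IsBasis.coef_mulZ, Finset.sum_mul, mul_assoc, Finset.smul_sum]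
  refine Finset.sum_congr rfl fun i _ => ?_
  -- The function c is moved past the i-th coefficient of ω', which has parity p + 1; this is the
  -- source of the sign.
  rw [T.super_comm (T.res_mem h hc) (he.coef_mem (he.isBasis hT) le_rfl (HasParity.resZ hp h) i),
    mul_smul_comm]

theorem pairZ_symm (hT : T.IsComplex) (ω ω' : F.Z V) {p p' : ZMod 2} (hp : ω.1.HasParity p)
    (hp' : ω'.1.HasParity p') :
    pairZ hT ω' ω = sgn (p + 1) (p' + 1) • pairZ hT ω ω' := by
  refine eq_of_forall_isSCFrame hT F fun V' h e he => ?_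
  rw [map_smul, he.res_pairZ hT h le_rfl, he.res_pairZ hT h le_rfl]
  simp only [IsBasis.pairing, Finset.smul_sum]
  refine Finset.sum_congr rfl fun i _ => ?_
  have h1 := he.coef_mem (he.isBasis hT) le_rfl (HasParity.resZ hp h) i
  have h2 := he.coef_mem (he.isBasis hT) le_rfl (HasParity.resZ hp' h) i
  rw [T.super_comm h1 h2, smul_smul]
  have h3 : sgn (p + 1) (p' + 1) * sgn (p + 1) (p' + 1) = 1 := by
    unfold sgn
    split_ifs <;> norm_num
  rw [h3, one_smul]

/-- The pairing of closed forms. -/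
def formPairing (hT : T.IsComplex) (F : SRSFamily T r) : F.FormPairing where
  form _ := AddMonoidHom.mk' (fun ω => AddMonoidHom.mk' (pairZ hT ω) (pairZ_add_right hT ω))
    fun ω₁ ω₂ => AddMonoidHom.ext fun ω' => pairZ_add_left hT ω₁ ω₂ ω'
  form_res h ω ω' := pairZ_resZ hT h ω ω'

theorem isBilinear_formPairing (hT : T.IsComplex) (F : SRSFamily T r) :
    (formPairing hT F).IsBilinear :=
  ⟨fun _ ω ω' c => pairZ_mulZ_right hT ω ω' c, fun _ ω ω' _ _ _ hp hc =>
    pairZ_mulZ_left hT ω ω' hp hc⟩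

theorem isSymmetric_formPairing (hT : T.IsComplex) (F : SRSFamily T r) :
    (formPairing hT F).IsSymmetric :=
  fun _ ω ω' _ _ hp hp' => pairZ_symm hT ω ω' hp hp'

end SRSFamily

namespace SRSFamily

open SuperSpace

variable {T : SuperSpace} {r : ℕ} {F : SRSFamily T r} {V₀ V V' : Opens T.space}
  {e : Fin (2 * r) → F.Z V₀}

/-! ### The pairing of the lattice -/

theorem IsSCFrame.pairZ_triv (he : F.IsSCFrame e) (hT : T.IsComplex) (h : V ≤ V₀)
    (m n : LocallyConstant V (Fin (2 * r) → ℤ)) :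
    pairZ hT ((he.triv hT).equiv V h m).1 ((he.triv hT).equiv V h n).1 =
      ofLC (∑ i, m.flip i * n.flip i) := by
  rw [he.pairZ_eq hT h, he.coe_triv_equiv, he.coe_triv_equiv, IsBasis.pairing, map_sum]
  exact Finset.sum_congr rfl fun i _ => by rw [IsBasis.coef_comb, IsBasis.coef_comb, map_mul]

/-- In a superconformal frame the coefficients of both sections are locally constant integers, and
so is the sum of their products. -/
theorem exists_ofLC_eq_pairZ (hT : T.IsComplex) (l l' : F.Lam V) :
    ∃ n : LocallyConstant V ℤ, ofLC n = pairZ hT l.1 l'.1 := by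
  refine hT.exists_ofLC_eq fun t ht => ?_
  obtain ⟨V₀, e, ht₀, he⟩ := exists_isSCFrame (F := F) hT t
  have h : V ⊓ V₀ ≤ V := inf_le_left
  have h' : V ⊓ V₀ ≤ V₀ := inf_le_right
  obtain ⟨m, hm⟩ := ((he.triv hT).equiv _ h').surjective (F.resLam h l)
  obtain ⟨n, hn⟩ := ((he.triv hT).equiv _ h').surjective (F.resLam h l')
  have H := he.pairZ_triv hT h' m n
  rw [hm, hn] at H
  obtain ⟨V', k, ht', E⟩ := exists_res_ofLC (∑ i, m.flip i * n.flip i) (t := t) ⟨ht, ht₀⟩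
  refine ⟨V', k.trans h, (∑ i, m.flip i * n.flip i) ⟨t, ht, ht₀⟩, ht', ?_⟩
  rw [← E, ← H, ← T.res_res h k]
  exact congrArg (T.res k) (pairZ_resZ hT h l.1 l'.1).symm

/-- The value of the pairing of the lattice. -/
def pairLam (hT : T.IsComplex) (l l' : F.Lam V) : LocallyConstant V ℤ :=
  (exists_ofLC_eq_pairZ hT l l').choose

theorem ofLC_pairLam (hT : T.IsComplex) (l l' : F.Lam V) :
    ofLC (pairLam hT l l') = pairZ hT l.1 l'.1 :=
  (exists_ofLC_eq_pairZ hT l l').choose_spec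

theorem pairLam_add_left (hT : T.IsComplex) (l₁ l₂ l' : F.Lam V) :
    pairLam hT (l₁ + l₂) l' = pairLam hT l₁ l' + pairLam hT l₂ l' :=
  hT.ofLC_injective <| by
    rw [map_add, ofLC_pairLam, ofLC_pairLam, ofLC_pairLam, AddSubgroup.coe_add, pairZ_add_left]

theorem pairLam_add_right (hT : T.IsComplex) (l l₁ l₂ : F.Lam V) :
    pairLam hT l (l₁ + l₂) = pairLam hT l l₁ + pairLam hT l l₂ :=
  hT.ofLC_injective <| by
    rw [map_add, ofLC_pairLam, ofLC_pairLam, ofLC_pairLam, AddSubgroup.coe_add, pairZ_add_right]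

theorem pairLam_resLam (hT : T.IsComplex) (h : V' ≤ V) (l l' : F.Lam V) :
    pairLam hT (F.resLam h l) (F.resLam h l') = (pairLam hT l l').resOpens h :=
  hT.ofLC_injective <| by
    rw [← res_ofLC, ofLC_pairLam, ofLC_pairLam]
    exact pairZ_resZ hT h l.1 l'.1

/-- The pairing of the lattice. -/
def latticePairing (hT : T.IsComplex) (F : SRSFamily T r) : F.LatticePairing where
  form _ := AddMonoidHom.mk' (fun l => AddMonoidHom.mk' (pairLam hT l) (pairLam_add_right hT l))
    fun l₁ l₂ => AddMonoidHom.ext fun l' => pairLam_add_left hT l₁ l₂ l'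
  form_res h l l' := pairLam_resLam hT h l l'

theorem latticePairing_form (hT : T.IsComplex) (l l' : F.Lam V) :
    (latticePairing hT F).form V l l' = pairLam hT l l' := rfl

theorem IsSCFrame.isIsometry (he : F.IsSCFrame e) (hT : T.IsComplex) :
    (latticePairing hT F).IsIsometry (he.triv hT) := by
  intro V h a b t
  have h1 : pairLam hT ((he.triv hT).equiv V h a) ((he.triv hT).equiv V h b) =
      ∑ i, a.flip i * b.flip i :=
    hT.ofLC_injective ((ofLC_pairLam hT _ _).trans (he.pairZ_triv hT h a b))
  rw [latticePairing_form, h1, ← LocallyConstant.coeFnAddMonoidHom_apply, map_sum,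
    Finset.sum_apply]
  rfl

/-- The coordinates of a section of the lattice are its coefficients at the punctures. -/
theorem IsSCFrame.exists_apply_eq (he : F.IsSCFrame e) (hT : T.IsComplex) (h : V ≤ V₀)
    {y : F.R.space} (hy : y ∈ F.above V) : ∃ C : F.SCChart, y ∈ C.dom ∧
      ∀ (n : LocallyConstant V (Fin (2 * r) → ℤ)) (k : ℤ),
        HasCoeff C ((he.triv hT).equiv V h n).1.1 y (k : T.Γ V) →
          n ⟨F.q.base y, hy⟩ (F.label y) = k := by
  obtain ⟨C, hC, H⟩ := he y (F.above_mono h hy)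
  refine ⟨C, hC, fun n k hk => ?_⟩
  obtain ⟨V', k', hV', E⟩ := (hasCoeff_sum H h hy fun i => ofLC (n.flip i)).unique hk rfl
  rw [map_intCast] at E
  exact hT.apply_eq E hV'

/-- At the i-th puncture γᵢ is ε times the differential of the frame, so the coordinates of the two
sections are ε aᵢ and ε bᵢ with the same ε, and their product is aᵢ bᵢ. -/
theorem isStandard_latticePairing (hT : T.IsComplex) (F : SRSFamily T r) :
    (latticePairing hT F).IsStandard := by
  intro V l l' t y hy W hW γ a b H
  obtain ⟨V₀, e, ht₀, he⟩ := exists_isSCFrame (F := F) hT t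
  have h : V ⊓ V₀ ≤ V := inf_le_left
  have h' : V ⊓ V₀ ≤ V₀ := inf_le_right
  have ht : t.1 ∈ V ⊓ V₀ := ⟨t.2, ht₀⟩
  obtain ⟨m, hm⟩ := ((he.triv hT).equiv _ h').surjective (F.resLam h l)
  obtain ⟨n, hn⟩ := ((he.triv hT).equiv _ h').surjective (F.resLam h l')
  have h1 := he.isIsometry hT (V ⊓ V₀) h' m n ⟨t, ht⟩
  rw [hm, hn, (latticePairing hT F).form_res h] at h1
  refine Eq.trans h1 (Finset.sum_congr rfl fun i _ => ?_)
  obtain ⟨hyt, hyi⟩ := hy i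
  obtain ⟨hyW, hγ, hl, hl'⟩ := H i
  have hyV : y i ∈ F.above (V ⊓ V₀) := by
    change F.q.base (y i) ∈ V ⊓ V₀
    rwa [hyt]
  obtain ⟨C, hC, hval⟩ := he.exists_apply_eq hT h' hyV
  obtain ⟨ε, hε, hc⟩ := IsSCDiff.exists_hasCoeff hγ hyW hC (V := V) (F.above_mono h hyV)
  have key : ∀ (l : F.Lam V) (c : ℤ), RelForm.res (hW i) l.1.1 = c • γ i →
      ∀ n, (he.triv hT).equiv _ h' n = F.resLam h l → n ⟨t, ht⟩ i = ε * c := by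
    intro l c hlc n hn
    have h2 := hc.mul (hW i) (c : T.Γ V)
    rw [mulR_intCast, ← hlc, ← Int.cast_mul] at h2
    have h3 := (h2.of_res.res (F.above_mono h) hyV).res_base h hyV
    rw [map_intCast] at h3
    have h4 := hval n (ε * c) (by rw [hn]; exact h3)
    have h5 : (⟨t, ht⟩ : ↥(V ⊓ V₀)) = ⟨F.q.base (y i), hyV⟩ := Subtype.ext hyt.symm
    rw [← h4, hyi, h5]
  rw [key l (a i) hl m hm, key l' (b i) hl' n hn, mul_mul_mul_comm, hε, one_mul]

/-- Any two lattice sections can be written near the punctures of any fibre with the same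
superconformal differentials. So the defining property of the pairing prescribes all its values, and
both uniqueness and symmetry follow from it. -/
theorem exists_standard_data (hT : T.IsComplex) (l l' : F.Lam V) (t : V) :
    ∃ (y : Fin (2 * r) → F.R.space) (W : Fin (2 * r) → Opens F.R.space)
      (hW : ∀ i, W i ≤ F.above V) (γ : ∀ i, RelForm F.q (W i)) (a b : Fin (2 * r) → ℤ),
      (∀ i, F.q.base (y i) = t ∧ F.label (y i) = i) ∧
      ∀ i, y i ∈ W i ∧ F.IsSCDiff (W i) (γ i) ∧
        RelForm.res (hW i) l.1.1 = a i • γ i ∧ RelForm.res (hW i) l'.1.1 = b i • γ i := by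
  obtain ⟨y, hy⟩ := F.exists_punctures t.1
  have key : ∀ i, ∃ (W : Opens F.R.space) (hW : W ≤ F.above V) (γ : RelForm F.q W) (a b : ℤ),
      y i ∈ W ∧ F.IsSCDiff W γ ∧
        RelForm.res hW l.1.1 = a • γ ∧ RelForm.res hW l'.1.1 = b • γ := by
    intro i
    have hyV : y i ∈ F.above V := by
      change F.q.base (y i) ∈ V
      rw [(hy i).1]
      exact t.2
    obtain ⟨C, hC⟩ := exists_SCChart hT (y i)
    obtain ⟨a, W₁, h₁, hs₁, hV₁, hy₁, e₁⟩ := exists_hasCoeff_of_mem_Lam l hyV (C := C) hC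
    obtain ⟨b, W₂, h₂, hs₂, hV₂, hy₂, e₂⟩ := exists_hasCoeff_of_mem_Lam l' hyV (C := C) hC
    rw [mulR_intCast] at e₁ e₂
    refine ⟨W₁ ⊓ W₂, inf_le_left.trans h₁, RelForm.res (inf_le_left.trans hs₁) C.form, a, b,
      ⟨hy₁, hy₂⟩, C.isSCDiff_form _, ?_, ?_⟩
    · have := congrArg (RelForm.res (inf_le_left : W₁ ⊓ W₂ ≤ W₁)) e₁
      rw [map_zsmul] at this
      exact this
    · have := congrArg (RelForm.res (inf_le_right : W₁ ⊓ W₂ ≤ W₂)) e₂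
      rw [map_zsmul] at this
      exact this
  choose W hW γ a b H using key
  exact ⟨y, W, hW, γ, a, b, hy, H⟩

theorem LatticePairing.IsStandard.unique (hT : T.IsComplex) {J J' : F.LatticePairing}
    (hJ : J.IsStandard) (hJ' : J'.IsStandard) : J' = J := by
  refine LatticePairing.ext (funext fun V => AddMonoidHom.ext fun l => AddMonoidHom.ext fun l' =>
    LocallyConstant.ext fun t => ?_)
  obtain ⟨y, W, hW, γ, a, b, hy, H⟩ := exists_standard_data hT l l' t
  rw [hJ V l l' t y hy W hW γ a b H, hJ' V l l' t y hy W hW γ a b H]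

theorem LatticePairing.IsStandard.isSymmetric (hT : T.IsComplex) {J : F.LatticePairing}
    (hJ : J.IsStandard) : J.IsSymmetric := by
  intro V l l'
  ext t
  obtain ⟨y, W, hW, γ, a, b, hy, H⟩ := exists_standard_data hT l l' t
  rw [hJ V l l' t y hy W hW γ a b H, hJ V l' l t y hy W hW γ b a fun i =>
    ⟨(H i).1, (H i).2.1, (H i).2.2.2, (H i).2.2.1⟩]
  exact Finset.sum_congr rfl fun i _ => mul_comm _ _

/-- Locally, pairing with the i-th basis vector returns the i-th coordinate. -/
theorem isNondegenerate_latticePairing (hT : T.IsComplex) (F : SRSFamily T r) :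
    (latticePairing hT F).IsNondegenerate := by
  intro V l H
  refine Subtype.ext (eqZ_of_local fun t ht => ?_)
  obtain ⟨V₀, e, ht₀, he⟩ := exists_isSCFrame (F := F) hT t
  have h : V ⊓ V₀ ≤ V := inf_le_left
  have h' : V ⊓ V₀ ≤ V₀ := inf_le_right
  obtain ⟨n, hn⟩ := ((he.triv hT).equiv _ h').surjective (F.resLam h l)
  have h0 : n = 0 := by
    ext t' i
    have h1 := he.isIsometry hT (V ⊓ V₀) h' n (LocallyConstant.const _ (Pi.single i 1)) t'
    rw [hn, H (V ⊓ V₀) h] at h1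
    simpa [Pi.single_apply] using h1.symm
  refine ⟨V ⊓ V₀, h, ⟨ht, ht₀⟩, ?_⟩
  rw [h0, map_zero] at hn
  exact congrArg Subtype.val hn.symm

/-! ### The extension of the pairing of the lattice -/

/-- Lattice sections are odd forms and so count as even in the sign convention; no sign arises and c
need not be homogeneous. -/
theorem pairZ_mulZ_left_of_mem_Lam (hT : T.IsComplex) (ω : F.Z V) (l : F.Lam V) (c : T.Γ V) :
    pairZ hT (F.mulZ ω c) l.1 = pairZ hT ω l.1 * c := by
  obtain ⟨c₀, h₀, c₁, h₁, rfl⟩ := T.exists_parts c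
  have hl := hasParity_of_mem_Lam hT l
  have h2 : (1 : ZMod 2) + 1 = 0 := rfl
  rw [map_add, pairZ_add_left, pairZ_mulZ_left hT ω l.1 hl h₀, pairZ_mulZ_left hT ω l.1 hl h₁, h2,
    sgn_zero_right, sgn_zero_right, one_smul, one_smul, mul_add]

theorem extends_formPairing (hT : T.IsComplex) (F : SRSFamily T r) :
    (formPairing hT F).Extends (latticePairing hT F) := by
  intro V l l' n hn a b
  have h1 : pairLam hT l l' = LocallyConstant.const V n := LocallyConstant.ext hn
  have h2 := ofLC_pairLam hT l l'
  rw [h1, ofLC_const] at h2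
  change pairZ hT (F.mulZ l.1 a) (F.mulZ l'.1 b) = _
  rw [pairZ_mulZ_right, pairZ_mulZ_left_of_mem_Lam, ← h2, mul_assoc, zsmul_eq_mul]

/-- Locally every closed form is a combination of frame vectors, which lie in the lattice and have
constant pairings 0 or 1; biadditivity then determines all values. -/
theorem FormPairing.Extends.unique (hT : T.IsComplex) {K K' : F.FormPairing}
    (hK : K.Extends (latticePairing hT F)) (hK' : K'.Extends (latticePairing hT F)) : K' = K := by
  refine FormPairing.ext (funext fun V => AddMonoidHom.ext fun ω => AddMonoidHom.ext fun ω' =>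
    eq_of_forall_isSCFrame hT F fun V' h e he => ?_)
  rw [← K'.form_res, ← K.form_res]
  generalize F.resZ h ω = α
  generalize F.resZ h ω' = β
  rw [← (he.isBasis hT).comb_coef le_rfl α, ← (he.isBasis hT).comb_coef le_rfl β, comb, comb]
  simp only [map_sum, AddMonoidHom.finsetSum_apply]
  refine Finset.sum_congr rfl fun i _ => Finset.sum_congr rfl fun k _ => ?_
  have key : ∀ t : V', (latticePairing hT F).form V' ((he.triv hT).frame k)
      ((he.triv hT).frame i) t = if i = k then 1 else 0 := by
    intro t
    refine (he.isIsometry hT V' le_rfl _ _ t).trans ?_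
    simp [Pi.single_apply]
  have hf : ∀ j, F.resZ le_rfl (e j) = ((he.triv hT).frame j).1 := fun j =>
    (he.triv_frame hT j).symm
  rw [hf, hf, hK V' _ _ _ key, hK' V' _ _ _ key]

/-! ### Orientations -/

theorem le_above_top (W : Opens F.R.space) : W ≤ F.above ⊤ := fun _ _ => trivial

/-- Coordinates of the orientation differ by functions from the base, so their differentials agree
on overlaps and glue to one form on all of R. -/
theorem Orientation.exists_form (σ : F.Orientation) : ∃ ω : RelForm F.q (F.above ⊤),
    ∀ (W : Opens F.R.space), ∀ x ∈ σ.coords W,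
      RelForm.res (le_above_top W) ω = RelForm.d x := by
  have hov : ∀ i j : (Σ W : Opens F.R.space, σ.coords W),
      RelForm.res (inf_le_left : i.1 ⊓ j.1 ≤ i.1) (RelForm.d i.2.1 : RelForm F.q i.1) =
        RelForm.res (inf_le_right : i.1 ⊓ j.1 ≤ j.1) (RelForm.d j.2.1) := by
    rintro ⟨W, x, hx⟩ ⟨W', x', hx'⟩
    refine RelForm.eq_of_local fun y hy => ?_
    obtain ⟨W'', h, h', V, hV, τ, hy', -, E⟩ := σ.translation W W' x hx x' hx' y hy
    refine ⟨W'', le_inf h h', hy', ?_⟩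
    refine (RelForm.res_d h x).trans (Eq.trans ?_ (RelForm.res_d h' x').symm)
    have h0 : (RelForm.d (F.R.res hV (F.q.pull V τ)) : RelForm F.q W'') = 0 :=
      RelForm.d_pull hV τ
    rw [E, RelForm.d_add, h0, add_zero]
  obtain ⟨ω, hω⟩ := RelForm.exists_gluing
    (fun i : (Σ W : Opens F.R.space, σ.coords W) => i.1) (F.above ⊤) (fun i => le_above_top i.1)
    (fun y _ => by
      obtain ⟨W, hy, x, hx⟩ := σ.covers y
      exact ⟨⟨W, x, hx⟩, hy⟩) (fun i => RelForm.d i.2.1) hov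
  exact ⟨ω, fun W x hx => hω ⟨W, x, hx⟩⟩

theorem exists_isAdapted (hT : T.IsComplex) (σ : F.Orientation) :
    ∃ e : F.Trivialization ⊤, e.IsAdapted σ ∧ (latticePairing hT F).IsIsometry e := by
  obtain ⟨ω, hω⟩ := σ.exists_form
  have hcl : ω ∈ RelForm.closed F.q (F.above ⊤) := by
    refine RelForm.mem_closed_of_local fun y hy => ?_
    obtain ⟨W, hyW, x, hx⟩ := σ.covers y
    exact ⟨W, le_above_top W, hyW, by rw [hω W x hx]; exact RelForm.d_mem_closed x⟩
  -- The frame consists of the restrictions of the global form ω to the components, each extended by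
  -- zero.
  choose e he he' using fun i => exists_extension (F := F) (V := ⊤) i
    (RelForm.res inf_le_left ω) (RelForm.res_closed _ hcl)
  have hres : ∀ i (W : Opens F.R.space), (∀ y ∈ W, F.label y = i) →
      RelForm.res (le_above_top W) (e i).1 = RelForm.res (le_above_top W) ω := fun i W hW =>
    congrArg (RelForm.res (le_inf (le_above_top W) hW : W ≤ F.above ⊤ ⊓ F.component i)) (he i)
  have hfr : F.IsSCFrame e := by
    refine isSCFrame_of_res (fun y hy => ?_) he'
    obtain ⟨W, hyW, x, hx⟩ := σ.covers y
    obtain ⟨C, hs, rfl⟩ := σ.isSCCoord W x hx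
    refine ⟨W ⊓ F.component (F.label y), le_above_top _, C, inf_le_left.trans hs, ⟨hyW, rfl⟩, ?_⟩
    refine (hres _ (W ⊓ F.component (F.label y)) fun y' hy' => hy'.2).trans ?_
    refine (congrArg (RelForm.res (inf_le_left : W ⊓ F.component (F.label y) ≤ W))
      (hω W _ hx)).trans ?_
    exact congrArg (RelForm.res (inf_le_left : W ⊓ F.component (F.label y) ≤ W))
      (RelForm.res_d hs C.x).symm
  refine ⟨hfr.triv hT, fun i i' W hW x hx => ?_, hfr.isIsometry hT⟩
  rw [hfr.triv_frame]
  split_ifs with hi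
  · subst hi
    exact (hres i W hW).trans (hω W x hx)
  · exact congrArg (RelForm.res (le_inf (le_above_top W) hW : W ≤ F.above ⊤ ⊓ F.component i'))
      (he' i i' (Ne.symm hi))

end SRSFamily

end SuperGeom

end

/-! ### Assembly of the theorem -/

theorem mainTheorem7 (T : SuperGeom.SuperSpace) (hT : T.IsComplex) (r : ℕ)
    (F : SuperGeom.SRSFamily T r) :
    F.IsVectorBundle ∧ F.IsLocalSystem ∧ F.IsAssociated ∧
    ∃ J : F.LatticePairing,
      (J.IsStandard ∧ ∀ J' : F.LatticePairing, J'.IsStandard → J' = J) ∧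
      J.IsSymmetric ∧ J.IsNondegenerate ∧
      (∀ t : T.space, ∃ (V₀ : TopologicalSpace.Opens T.space) (e : F.Trivialization V₀),
        t ∈ V₀ ∧ J.IsIsometry e) ∧
      (∃ K : F.FormPairing, (K.Extends J ∧ ∀ K' : F.FormPairing, K'.Extends J → K' = K) ∧
        K.IsBilinear ∧ K.IsSymmetric) ∧
      ∀ σ : F.Orientation, ∃ e : F.Trivialization ⊤, e.IsAdapted σ ∧ J.IsIsometry e := by
  refine ⟨F.isVectorBundle hT, F.isLocalSystem hT, F.isAssociated hT, F.latticePairing hT, ?_⟩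
  have hstd := F.isStandard_latticePairing hT
  refine ⟨⟨hstd, fun J' hJ' => hstd.unique hT hJ'⟩, hstd.isSymmetric hT,
    F.isNondegenerate_latticePairing hT, fun t => ?_, ⟨F.formPairing hT,
      ⟨F.extends_formPairing hT, fun K' hK' => (F.extends_formPairing hT).unique hT hK'⟩,
      F.isBilinear_formPairing hT, F.isSymmetric_formPairing hT⟩, fun σ =>
      SuperGeom.SRSFamily.exists_isAdapted hT σ⟩
  obtain ⟨V₀, e, ht, he⟩ := SuperGeom.SRSFamily.exists_isSCFrame (F := F) hT t
  exact ⟨V₀, he.triv hT, ht, he.isIsometry hT⟩
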